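/- Let $n\ge 2$ be an even integer, let $\Lambda\subset S^n$ be a finite set of $k\ge 0$ points and let $\Omega=S^n\setminus\Lambda$. Let $g=e^{2u}g_{S^n}$, with $u\in C^\infty(\Omega)$, be a metric on $\Omega$ conformal to the round metric. Denote by $R_g$ its scalar curvature, by $dv_g$ its volume measure, and by $Q_g$ its $Q$-curvature (of order $n$), that is, $Q_g=e^{-nw}(-\Delta)^{n/2}w$ in any local coordinates in which $g=e^{2w}|dx|^2$, where $\Delta=\sum_i\partial_i^2$ is the flat Laplacian. Assume that (A1) $(\Omega,g)$ is complete; (A2) $R_g\ge 0$ near the ends, i.e. outside some compact subset of $\Omega$; (A3) $\int_\Omega |Q_g|\,dv_g<\infty$. Then $$C_n\int_\Omega Q_g\,dv_g\le 2-k,\qquad\text{where } C_n=\frac{1}{((n-2)!!)^2\,|S^{n-1}|},$$ $|S^{n-1}|$ is the volume of the unit sphere in $\mathbb R^n$, and $0!!=1$. -/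

import Mathlib

open Set MeasureTheory Filter Topology
open scoped Manifold ContDiff ENNReal Nat Laplacian

/-! ### Riemannian metrics in coordinates -/

section Coordinates

variable {n : ℕ}

/-- The partial derivative `∂_i f` of a real function on `ℝⁿ`. -/
noncomputable def partialD (i : Fin n) (f : EuclideanSpace ℝ (Fin n) → ℝ)
    (y : EuclideanSpace ℝ (Fin n)) : ℝ :=
  fderiv ℝ f y (EuclideanSpace.single i 1)

/-- The Christoffel symbols `Γ^k_{ij} = ½ g^{kl} (∂_i g_{jl} + ∂_j g_{il} - ∂_l g_{ij})` of a
metric with component functions `G`. -/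
noncomputable def christoffel (G : EuclideanSpace ℝ (Fin n) → Matrix (Fin n) (Fin n) ℝ)
    (k i j : Fin n) (y : EuclideanSpace ℝ (Fin n)) : ℝ :=
  (1 / 2) * ∑ l, (G y)⁻¹ k l * (partialD i (fun z => G z j l) y +
    partialD j (fun z => G z i l) y - partialD l (fun z => G z i j) y)

/-- The Ricci tensor
`R_{ij} = ∂_l Γ^l_{ij} - ∂_j Γ^l_{il} + Γ^l_{lp} Γ^p_{ij} - Γ^l_{jp} Γ^p_{il}`. -/
noncomputable def ricci (G : EuclideanSpace ℝ (Fin n) → Matrix (Fin n) (Fin n) ℝ)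
    (i j : Fin n) (y : EuclideanSpace ℝ (Fin n)) : ℝ :=
  ∑ l, (partialD l (christoffel G l i j) y - partialD j (christoffel G l i l) y +
    ∑ p, (christoffel G l l p y * christoffel G p i j y -
      christoffel G l j p y * christoffel G p i l y))

/-- The scalar curvature `R = g^{ij} R_{ij}` of a metric with component functions `G`. -/
noncomputable def scalarCurvatureCoord
    (G : EuclideanSpace ℝ (Fin n) → Matrix (Fin n) (Fin n) ℝ)
    (y : EuclideanSpace ℝ (Fin n)) : ℝ :=
  ∑ i, ∑ j, (G y)⁻¹ i j * ricci G i j y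

/-- The `Q`-curvature `Q_n = e^{-nw} (-Δ)^{n/2} w` of the metric `e^{2w} |dx|²` on (an open subset
of) `ℝⁿ`, for even `n`; here `Δ = ∑ ∂_i²` is the flat Laplacian. -/
noncomputable def qCurvatureFlat (w : EuclideanSpace ℝ (Fin n) → ℝ)
    (y : EuclideanSpace ℝ (Fin n)) : ℝ :=
  Real.exp (-(n * w y)) *
    ((fun f : EuclideanSpace ℝ (Fin n) → ℝ => fun z => -(Δ f z))^[n / 2] w) y

end Coordinates

/-! ### Conformal metrics `e^{2u} g_{S^n}` on the round sphere -/

/-- The unit sphere `Sⁿ` in `ℝⁿ⁺¹`. -/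
abbrev USphere (n : ℕ) : Type := Metric.sphere (0 : EuclideanSpace ℝ (Fin (n + 1))) 1

theorem finrank_euclidean_succ (n : ℕ) :
    Fact (Module.finrank ℝ (EuclideanSpace ℝ (Fin (n + 1))) = n + 1) :=
  ⟨finrank_euclideanSpace_fin⟩

/-- Stereographic projection of `Sⁿ` from the pole `v` onto `ℝⁿ` (a chart on `Sⁿ ∖ {v}`). -/
noncomputable def stereoChart (n : ℕ) (v : USphere n) :
    OpenPartialHomeomorph (USphere n) (EuclideanSpace ℝ (Fin n)) :=
  haveI := finrank_euclidean_succ n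
  stereographic' n v

/-- The inverse of stereographic projection, as a map into the ambient space `ℝⁿ⁺¹`. -/
noncomputable def stereoParam (n : ℕ) (v : USphere n) (y : EuclideanSpace ℝ (Fin n)) :
    EuclideanSpace ℝ (Fin (n + 1)) :=
  ((stereoChart n v).symm y : EuclideanSpace ℝ (Fin (n + 1)))

/-- The components, in the stereographic coordinates with pole `v`, of the conformal metric
`e^{2u} g_{S^n}`, where `g_{S^n}` is the metric induced by the ambient inner product. -/
noncomputable def metricCoord (n : ℕ) (u : USphere n → ℝ) (v : USphere n)
    (y : EuclideanSpace ℝ (Fin n)) : Matrix (Fin n) (Fin n) ℝ :=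
  Matrix.of fun i j => Real.exp (2 * u ((stereoChart n v).symm y)) *
    inner ℝ (fderiv ℝ (stereoParam n v) y (EuclideanSpace.single i 1))
      (fderiv ℝ (stereoParam n v) y (EuclideanSpace.single j 1))

/-- The conformal factor `w` with respect to the flat metric: in the stereographic coordinates with
pole `v`, the metric `e^{2u} g_{S^n}` equals `e^{2w} |dx|²` (see `metricCoord_eq`). -/
noncomputable def flatFactor (n : ℕ) (u : USphere n → ℝ) (v : USphere n)
    (y : EuclideanSpace ℝ (Fin n)) : ℝ :=
  u ((stereoChart n v).symm y) + Real.log (4 / (‖y‖ ^ 2 + 4))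

/-- The north pole of `Sⁿ`. -/
noncomputable def northPole (n : ℕ) : USphere n :=
  ⟨EuclideanSpace.single (Fin.last n) 1, by simp⟩

open Classical in
/-- The pole of the stereographic chart used around `x`: the north pole, except at the north pole
itself, where the south pole is used. -/
noncomputable def chartPole (n : ℕ) (x : USphere n) : USphere n :=
  if x = northPole n then -northPole n else northPole n

/-- The scalar curvature of `e^{2u} g_{S^n}` at the point `x`. -/
noncomputable def scalarCurvature (n : ℕ) (u : USphere n → ℝ) (x : USphere n) : ℝ :=
  scalarCurvatureCoord (metricCoord n u (chartPole n x)) (stereoChart n (chartPole n x) x)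

/-- The `Q`-curvature of the locally conformally flat metric `e^{2u} g_{S^n}` at `x`, computed in
conformally flat coordinates around `x`. -/
noncomputable def qCurvature (n : ℕ) (u : USphere n → ℝ) (x : USphere n) : ℝ :=
  qCurvatureFlat (flatFactor n u (chartPole n x)) (stereoChart n (chartPole n x) x)

/-- The Riemannian volume measure of `e^{2u} g_{S^n}`: in the stereographic chart from the north
pole, which covers all of `Sⁿ` except for one point (a null set), it is `√(det g) dy`. -/
noncomputable def volumeMeasure (n : ℕ) (u : USphere n → ℝ) : Measure (USphere n) :=
  Measure.map (stereoChart n (northPole n)).symm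
    ((volume : Measure (EuclideanSpace ℝ (Fin n))).withDensity
      fun y => ENNReal.ofReal (Real.sqrt (metricCoord n u (northPole n) y).det))

/-- The length of the curve `γ : [0,1] → Sⁿ` with respect to `e^{2u} g_{S^n}`. -/
noncomputable def curveLength (n : ℕ) (u : USphere n → ℝ) (γ : ℝ → USphere n) : ℝ≥0∞ :=
  ∫⁻ t in Ioo (0 : ℝ) 1, ENNReal.ofReal (Real.exp (u (γ t)) *
    ‖deriv (fun s => (γ s : EuclideanSpace ℝ (Fin (n + 1)))) t‖)

/-- `γ` restricts to a `C¹` curve `[0,1] → Ω` from `x` to `y`. -/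
def IsC1Curve (n : ℕ) (Ω : Set (USphere n)) (x y : USphere n) (γ : ℝ → USphere n) : Prop :=
  ContDiffOn ℝ 1 (fun s => (γ s : EuclideanSpace ℝ (Fin (n + 1)))) (Icc 0 1) ∧
    (∀ t ∈ Icc (0 : ℝ) 1, γ t ∈ Ω) ∧ γ 0 = x ∧ γ 1 = y

/-- The Riemannian distance on `(Ω, e^{2u} g_{S^n})`. -/
noncomputable def metricDist (n : ℕ) (u : USphere n → ℝ) (Ω : Set (USphere n))
    (x y : USphere n) : ℝ≥0∞ :=
  ⨅ (γ : ℝ → USphere n) (_ : IsC1Curve n Ω x y γ), curveLength n u γ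

/-- The Riemannian manifold `(Ω, e^{2u} g_{S^n})` is complete: every sequence in `Ω` that is Cauchy
for the Riemannian distance converges, for the Riemannian distance, to a point of `Ω`. -/
def IsCompleteMetric (n : ℕ) (u : USphere n → ℝ) (Ω : Set (USphere n)) : Prop :=
  ∀ x : ℕ → USphere n, (∀ i, x i ∈ Ω) →
    (∀ ε : ℝ≥0∞, 0 < ε → ∃ N, ∀ i ≥ N, ∀ j ≥ N, metricDist n u Ω (x i) (x j) < ε) →
    ∃ p ∈ Ω, Tendsto (fun i => metricDist n u Ω (x i) p) atTop (𝓝 0)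

/-- The constant `C_n = 1 / (((n-2)!!)² |S^{n-1}|)`, with `|S^{n-1}|` the surface measure of the
unit sphere of `ℝⁿ` (used for even `n ≥ 2`). -/
noncomputable def gaussBonnetConst (n : ℕ) : ℝ :=
  1 / ((((n - 2)‼ : ℕ) : ℝ) ^ 2 *
    ((volume : Measure (EuclideanSpace ℝ (Fin n))).toSphere).real univ)

theorem metricCoord_eq (n : ℕ) (u : USphere n → ℝ) (v : USphere n)
    (y : EuclideanSpace ℝ (Fin n)) :
    metricCoord n u v y = Real.exp (2 * flatFactor n u v y) • (1 : Matrix (Fin n) (Fin n) ℝ) := by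
  have := finrank_euclidean_succ n
  obtain ⟨L, hL, hv⟩ : ∃ L : EuclideanSpace ℝ (Fin n) →ₗᵢ[ℝ] EuclideanSpace ℝ (Fin (n + 1)),
      (∀ z, stereoParam n v z = (‖z‖ ^ 2 + 4)⁻¹ • ((4 : ℝ) • L z + (‖z‖ ^ 2 - 4) • v.val)) ∧
      ∀ z, inner ℝ (L z) v.val = 0 := by
    let U : (ℝ ∙ (v : EuclideanSpace ℝ (Fin (n + 1))))ᗮ ≃ₗᵢ[ℝ] EuclideanSpace ℝ (Fin n) :=
        (OrthonormalBasis.fromOrthogonalSpanSingleton n (ne_zero_of_mem_unit_sphere v)).repr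
    refine ⟨(Submodule.subtypeₗᵢ _).comp U.symm.toLinearIsometry, ?_, ?_⟩
    · intro z
      have h := stereographic'_symm_apply (n := n) v z
      have hz : ‖((U.symm z : (ℝ ∙ (v : EuclideanSpace ℝ (Fin (n + 1))))ᗮ) :
          EuclideanSpace ℝ (Fin (n + 1)))‖ = ‖z‖ := by
        exact (Submodule.coe_norm _).symm.trans (U.symm.norm_map z)
      simp only at h
      change ((stereographic' n v).symm z : EuclideanSpace ℝ (Fin (n + 1))) = _
      rw [h, smul_add]
      change (‖((U.symm z : (ℝ ∙ (v : EuclideanSpace ℝ (Fin (n + 1))))ᗮ) :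
          EuclideanSpace ℝ (Fin (n + 1)))‖ ^ 2 + 4)⁻¹ • _ + (‖((U.symm z :
          (ℝ ∙ (v : EuclideanSpace ℝ (Fin (n + 1))))ᗮ) :
          EuclideanSpace ℝ (Fin (n + 1)))‖ ^ 2 + 4)⁻¹ • (‖((U.symm z :
          (ℝ ∙ (v : EuclideanSpace ℝ (Fin (n + 1))))ᗮ) :
          EuclideanSpace ℝ (Fin (n + 1)))‖ ^ 2 - 4) • _ = _
      rw [hz]
      rfl
    · intro z
      have := (U.symm z).2
      rw [Submodule.mem_orthogonal_singleton_iff_inner_left] at this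
      exact this
  have hpos : (0 : ℝ) < ‖y‖ ^ 2 + 4 := by positivity
  have hvv : inner ℝ v.val v.val = (1 : ℝ) := by
    rw [real_inner_self_eq_norm_sq, norm_eq_of_mem_sphere v]; norm_num
  have hfun : stereoParam n v =
      fun z => (‖z‖ ^ 2 + 4)⁻¹ • ((4 : ℝ) • L z + (‖z‖ ^ 2 - 4) • v.val) := funext hL
  have hsq : HasFDerivAt (fun z : EuclideanSpace ℝ (Fin n) => ‖z‖ ^ 2) (2 • innerSL ℝ y) y :=
    (hasStrictFDerivAt_norm_sq y).hasFDerivAt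
  have hinv := (hasDerivAt_inv hpos.ne').comp_hasFDerivAt y (hsq.add_const 4)
  have hnum := ((L.toContinuousLinearMap.hasFDerivAt (x := y)).const_smul (4 : ℝ)).add
    ((hsq.sub_const 4).smul_const v.val)
  have hd := hinv.smul hnum
  have key : ∀ a : EuclideanSpace ℝ (Fin n), fderiv ℝ (stereoParam n v) y a =
      (4 * (‖y‖ ^ 2 + 4)⁻¹) • L a - (8 * inner ℝ y a * ((‖y‖ ^ 2 + 4)⁻¹) ^ 2) • L y
        + (16 * inner ℝ y a * ((‖y‖ ^ 2 + 4)⁻¹) ^ 2) • v.val := by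
    intro a
    rw [hfun]
    erw [hd.fderiv]
    simp [smul_add, smul_smul]
    have e : (‖y‖ ^ 2 + 4)⁻¹ * (‖y‖ ^ 2 + 4) = 1 := inv_mul_cancel₀ hpos.ne'
    have hp := hpos.ne'
    match_scalars <;> field_simp <;> ring
  ext i j
  have hexp : Real.exp (2 * flatFactor n u v y) =
      Real.exp (2 * u ((stereoChart n v).symm y)) * (4 * (‖y‖ ^ 2 + 4)⁻¹) ^ 2 := by
    have h4 : (0 : ℝ) < 4 / (‖y‖ ^ 2 + 4) := by positivity
    rw [flatFactor, mul_add, Real.exp_add, two_mul (Real.log _), Real.exp_add, Real.exp_log h4]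
    ring
  have hv' : ∀ z, inner ℝ v.val (L z) = (0 : ℝ) := fun z => by rw [real_inner_comm]; exact hv z
  simp only [metricCoord, Matrix.of_apply, Matrix.smul_apply, smul_eq_mul, hexp, mul_assoc]
  congr 1
  rw [key, key]
  simp only [inner_add_left, inner_add_right, inner_sub_left, inner_sub_right, inner_smul_left,
    inner_smul_right, hv, hv', hvv, L.inner_map_map, Matrix.one_apply]
  have hyy : inner ℝ y y = ‖y‖ ^ 2 := real_inner_self_eq_norm_sq y
  have hc : inner ℝ (EuclideanSpace.single i (1 : ℝ)) y = inner ℝ y (EuclideanSpace.single i 1) :=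
    real_inner_comm _ _
  have hij : inner ℝ (EuclideanSpace.single i (1 : ℝ)) (EuclideanSpace.single j 1) =
      if i = j then (1 : ℝ) else 0 := by
    simp [EuclideanSpace.inner_single_left]
  rw [hyy, hc, hij]
  simp only [conj_trivial]
  have hp := hpos.ne'
  split_ifs <;> field_simp <;> ring

/-! Stereographic projection from the north pole turns the metric into `e^{2W} |dx|²` on `ℝⁿ` minus
finitely many points. The volume density `e^{nW}` cancels the factor `e^{-nW}` in the `Q`-curvature,
so the total `Q`-curvature is `∫ (-Δ)^{n/2} W dx` (`integrableOn_qCurvature_iff_and_integral_eq`).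
Only the punctures and infinity matter for its value: testing against cutoffs that vanish near all
of them and tend to 1 expresses it as a sum of fluxes, one for each puncture and one for infinity
(`integral_negLap_iterate_eq_sum_flux`). Measured in units of `((n-2)!!)² |S^{n-1}|`, the flux is at
most `-1` at a finite puncture, at most `1` at infinity if the north pole is removed, and at most
`2` there if the metric is smooth across the north pole. In both cases the bounds add up to `2 - k`.

The flux is a growth rate. Put `t = log |x|`, with `ε = 1` for the end at infinity, `ε = -1` for a
finite puncture, and `s = ε t → ∞` along the end. On radial functions `(-Δ)^{n/2}` is `± e^{-nt}`
times a constant-coefficient operator in `t`, and `e^{-nt}` cancels the Jacobian `e^{nt}`. In this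
critical dimension the polynomial of the operator has a double root at 0, with second-order
coefficient `± ((n-2)!!)²` (`polyharmonicPoly_eq`). A cutoff that decreases linearly in `s` over a
length `L`, with rounded corners, is therefore mapped to two fixed bump kernels sitting at the
corners, divided by `L`. Hence the flux is `-((n-2)!!)²` times the limit of (integral of `w` over
the unit sphere of directions at radius `e^{εs}`) divided by `s`, provided these integrals oscillate
boundedly over unit intervals (`tendsto_cutoffPairing_add`, `exists_tendsto_cutoffPairing`). The
limit exists because the `Q`-curvature is absolutely integrable.

The oscillation bound uses the sign of the scalar curvature, which says `2 Δw + (n-2) |∇w|² ≤ 0`.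
For `n > 2`, averaging over spheres and Cauchy-Schwarz give a Riccati inequality `z' ≤ κ (1 - z²)`
for the normalized derivative of the spherical mean. A function satisfying it on a whole half line
is bounded, and the spherical energies are integrable against `ds/s²`
(`sphereInt_radialD_bound_of_two_lt`). For `n = 2`, integrability of `Δw` is enough
(`sphereInt_radialD_bound_two`).

Completeness gives the bound on the flux: the spherical mean of `w` cannot have asymptotic slope
below `-ε` in `s`. Suppose it did. For `n > 2`, a Poincaré inequality on spheres and the weighted
energy bound produce a ray along which `w` differs from its mean by `o(s)`; that ray has finite
length (`end_growth_of_two_lt`). For `n = 2` the gradient term is absent. Instead Caccioppoli's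
inequality is applied to `v = e^{φ(log |x|) - w}`, with test functions built from the Riemannian
distance to the end. Their gradient is at most about `e^w`, which cancels the `e^{-w}` in `v` and
makes the right side bounded, while the left side diverges by convexity of the exponential
(`end_growth_two`). There completeness enters as the statement that an end is infinitely far away
(`IsCompleteMetric.iSup_endDist_eq_top`). -/

/-! ### Iterated flat Laplacians: locality, integration by parts, functions of `log ‖x‖` -/

section Calculus

variable {n : ℕ}

theorem contDiffAt_partialD {f : EuclideanSpace ℝ (Fin n) → ℝ} {y : EuclideanSpace ℝ (Fin n)}
    {k l : WithTop ℕ∞} (h : ContDiffAt ℝ k f y) (hkl : l + 1 ≤ k) (i : Fin n) :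
    ContDiffAt ℝ l (partialD i f) y :=
  (h.fderiv_right hkl).clm_apply contDiffAt_const

theorem laplacian_eq_sum_partialD {f : EuclideanSpace ℝ (Fin n) → ℝ}
    {y : EuclideanSpace ℝ (Fin n)} (h : ContDiffAt ℝ 2 f y) :
    Δ f y = ∑ i, partialD i (partialD i f) y := by
  rw [InnerProductSpace.laplacian_eq_iteratedFDeriv_orthonormalBasis f
    (EuclideanSpace.basisFun (Fin n) ℝ)]
  refine Finset.sum_congr rfl fun i _ => ?_
  have hd : DifferentiableAt ℝ (fderiv ℝ f) y :=
    (h.fderiv_right (m := 1) (by norm_num)).differentiableAt (by norm_num)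
  have h1 : HasFDerivAt (partialD i f)
      ((fderiv ℝ (fderiv ℝ f) y).flip (EuclideanSpace.single i 1)) y := by
    have h2 := hd.hasFDerivAt.clm_apply (hasFDerivAt_const (EuclideanSpace.single i (1 : ℝ)) y)
    refine h2.congr_fderiv ?_
    ext v
    simp
  rw [iteratedFDeriv_two_apply, partialD, h1.fderiv]
  simp

theorem sum_sq_partialD (f : EuclideanSpace ℝ (Fin n) → ℝ) (y : EuclideanSpace ℝ (Fin n)) :
    ∑ i, partialD i f y ^ 2 = ‖fderiv ℝ f y‖ ^ 2 := by
  have h := (InnerProductSpace.toDual ℝ (EuclideanSpace ℝ (Fin n))).symm.norm_map (fderiv ℝ f y)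
  rw [← h, EuclideanSpace.norm_sq_eq]
  refine Finset.sum_congr rfl fun i _ => ?_
  have : inner ℝ ((InnerProductSpace.toDual ℝ (EuclideanSpace ℝ (Fin n))).symm (fderiv ℝ f y))
      (EuclideanSpace.single i 1) = fderiv ℝ f y (EuclideanSpace.single i 1) :=
    InnerProductSpace.toDual_symm_apply
  rw [partialD, ← this, EuclideanSpace.inner_single_right]
  simp

theorem two_le_infty : (2 : WithTop ℕ∞) ≤ (∞ : WithTop ℕ∞) := by
  have : ((2 : ℕ∞) : WithTop ℕ∞) ≤ ((⊤ : ℕ∞) : WithTop ℕ∞) := WithTop.coe_le_coe.2 le_top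
  exact this

theorem infty_add_one_le : (∞ : WithTop ℕ∞) + 1 ≤ (∞ : WithTop ℕ∞) := by
  exact_mod_cast (le_top : (⊤ : ℕ∞) + 1 ≤ ⊤)

theorem contDiffAt_laplacian {f : EuclideanSpace ℝ (Fin n) → ℝ} {y : EuclideanSpace ℝ (Fin n)}
    (h : ContDiffAt ℝ ∞ f y) : ContDiffAt ℝ ∞ (Δ f) y := by
  have h1 : Δ f =ᶠ[𝓝 y] fun z => ∑ i, partialD i (partialD i f) z := by
    have h2 : ContDiffAt ℝ 2 f y := h.of_le two_le_infty
    filter_upwards [h2.eventually (by simp)] with z hz using laplacian_eq_sum_partialD hz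
  refine ContDiffAt.congr_of_eventuallyEq ?_ h1
  refine ContDiffAt.sum fun i _ => ?_
  exact contDiffAt_partialD (contDiffAt_partialD h infty_add_one_le i) infty_add_one_le i

/-- The operator `-Δ`. -/
noncomputable def negLap (f : EuclideanSpace ℝ (Fin n) → ℝ) : EuclideanSpace ℝ (Fin n) → ℝ :=
  fun z => -(Δ f z)

theorem contDiffAt_negLap_iterate {f : EuclideanSpace ℝ (Fin n) → ℝ}
    {y : EuclideanSpace ℝ (Fin n)} (h : ContDiffAt ℝ ∞ f y) (k : ℕ) :
    ContDiffAt ℝ ∞ (negLap^[k] f) y := by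
  induction k generalizing f with
  | zero => exact h
  | succ k ih => exact ih (contDiffAt_laplacian h).neg

theorem negLap_iterate_congr {f g : EuclideanSpace ℝ (Fin n) → ℝ}
    {y : EuclideanSpace ℝ (Fin n)} (h : f =ᶠ[𝓝 y] g) (k : ℕ) :
    negLap^[k] f =ᶠ[𝓝 y] negLap^[k] g := by
  induction k generalizing f g with
  | zero => exact h
  | succ k ih =>
    refine ih ?_
    filter_upwards [InnerProductSpace.laplacian_congr_nhds h] with z hz
    simp [negLap, hz]

theorem negLap_iterate_zero (k : ℕ) :
    negLap^[k] (fun _ : EuclideanSpace ℝ (Fin n) => (0 : ℝ)) = fun _ => 0 := by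
  induction k with
  | zero => rfl
  | succ k ih =>
    rw [Function.iterate_succ_apply']
    funext z
    simp [negLap, ih]

theorem tsupport_negLap_iterate_subset (f : EuclideanSpace ℝ (Fin n) → ℝ) (k : ℕ) :
    tsupport (negLap^[k] f) ⊆ tsupport f := by
  intro x hx
  by_contra h
  rw [notMem_tsupport_iff_eventuallyEq] at h
  have := negLap_iterate_congr h k
  refine (notMem_tsupport_iff_eventuallyEq.2 ?_) hx
  refine this.trans ?_
  have h0 := negLap_iterate_zero (n := n) k
  change negLap^[k] (fun _ => (0 : ℝ)) =ᶠ[𝓝 x] _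
  rw [h0]
  rfl

/-- Smooth functions of compact support are Schwartz functions, for which the symmetry of `Δ` is
known. -/
theorem integral_mul_laplacian_comm {f g : EuclideanSpace ℝ (Fin n) → ℝ}
    (hf : ContDiff ℝ ∞ f) (hfc : HasCompactSupport f)
    (hg : ContDiff ℝ ∞ g) (hgc : HasCompactSupport g) :
    ∫ x, Δ f x * g x = ∫ x, f x * Δ g x := by
  have := SchwartzMap.integral_mul_laplacian_right_eq_left (μ := volume)
    (hfc.toSchwartzMap hf) (hgc.toSchwartzMap hg)
  simp only [SchwartzMap.laplacian_apply] at this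
  exact this.symm

theorem contDiff_negLap_iterate {f : EuclideanSpace ℝ (Fin n) → ℝ} (h : ContDiff ℝ ∞ f) (k : ℕ) :
    ContDiff ℝ ∞ (negLap^[k] f) :=
  contDiff_iff_contDiffAt.2 fun _ => contDiffAt_negLap_iterate h.contDiffAt k

theorem hasCompactSupport_negLap_iterate {f : EuclideanSpace ℝ (Fin n) → ℝ}
    (h : HasCompactSupport f) (k : ℕ) : HasCompactSupport (negLap^[k] f) :=
  IsCompact.of_isClosed_subset h (isClosed_tsupport _) (tsupport_negLap_iterate_subset f k)

theorem integral_negLap_iterate_mul {f g : EuclideanSpace ℝ (Fin n) → ℝ}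
    (hf : ContDiff ℝ ∞ f) (hfc : HasCompactSupport f)
    (hg : ContDiff ℝ ∞ g) (hgc : HasCompactSupport g) (k : ℕ) :
    ∫ x, negLap^[k] f x * g x = ∫ x, f x * negLap^[k] g x := by
  induction k generalizing f with
  | zero => rfl
  | succ k ih =>
    have h1 := contDiff_negLap_iterate hf 1
    have h2 := hasCompactSupport_negLap_iterate hfc 1
    have h3 := ih h1 h2
    rw [Function.iterate_succ_apply, Function.iterate_succ_apply']
    refine h3.trans ?_
    have := integral_mul_laplacian_comm hf hfc (contDiff_negLap_iterate hg k)
      (hasCompactSupport_negLap_iterate hgc k)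
    simp only [Function.iterate_one, negLap, neg_mul, mul_neg, integral_neg]
    exact congrArg Neg.neg this

/-- A smooth function on an open set agrees near a compact subset with a smooth compactly
supported function. -/
theorem exists_contDiff_eq_nhds {U K : Set (EuclideanSpace ℝ (Fin n))}
    {w : EuclideanSpace ℝ (Fin n) → ℝ} (hU : IsOpen U) (hK : IsCompact K) (hKU : K ⊆ U)
    (hw : ∀ x ∈ U, ContDiffAt ℝ ∞ w x) :
    ∃ v : EuclideanSpace ℝ (Fin n) → ℝ, ContDiff ℝ ∞ v ∧ HasCompactSupport v ∧
      ∀ x ∈ K, v =ᶠ[𝓝 x] w := by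
  -- Two nested compact neighbourhoods: the cutoff is 1 on `K'`, so agreement holds near each point
  -- of `K` and not only on `K`; it vanishes off the interior of `K''`, so the product is smooth
  -- outside `U` too.
  obtain ⟨K', hK', hKK', hK'U⟩ := exists_compact_between hK hU hKU
  obtain ⟨K'', hK'', hKK'', hK''U⟩ := exists_compact_between hK' hU hK'U
  obtain ⟨χ, hχ, hχ0, hχ1⟩ : ∃ χ : EuclideanSpace ℝ (Fin n) → ℝ, ContDiff ℝ ∞ χ ∧
      (∀ x ∉ interior K'', χ x = 0) ∧ ∀ x ∈ K', χ x = 1 := by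
    obtain ⟨χ, h1, h2, h3⟩ := exists_contMDiff_zero_iff_one_iff_of_isClosed (n := (⊤ : ℕ∞))
      (modelWithCornersSelf ℝ (EuclideanSpace ℝ (Fin n)))
      (s := (interior K'')ᶜ) (t := K') isOpen_interior.isClosed_compl hK'.isClosed
      (by
        rw [Set.disjoint_compl_left_iff_subset]
        exact hKK'')
    exact ⟨χ, h1.contDiff, fun x hx => (h3.1 x).1 hx, fun x hx => (h3.2 x).1 hx⟩
  refine ⟨fun x => χ x * w x, ?_, ?_, ?_⟩
  · rw [contDiff_iff_contDiffAt]
    intro x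
    by_cases hx : x ∈ U
    · exact hχ.contDiffAt.mul (hw x hx)
    · have : (fun x => χ x * w x) =ᶠ[𝓝 x] fun _ => 0 := by
        have hx' : x ∈ K''ᶜ := fun h => hx (hK''U h)
        filter_upwards [hK''.isClosed.isOpen_compl.mem_nhds hx'] with z hz
        rw [hχ0 z fun h => hz (interior_subset h), zero_mul]
      exact contDiffAt_const.congr_of_eventuallyEq this
  · refine HasCompactSupport.intro hK'' fun x hx => ?_
    rw [hχ0 x fun h => hx (interior_subset h), zero_mul]
  · intro x hx
    filter_upwards [isOpen_interior.mem_nhds (hKK' hx)] with z hz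
    rw [hχ1 z (interior_subset hz), one_mul]

/-- Integration by parts for a function that is smooth near the support of the test function. -/
theorem integral_negLap_iterate_mul_of_tsupport {U : Set (EuclideanSpace ℝ (Fin n))}
    {w g : EuclideanSpace ℝ (Fin n) → ℝ} (hU : IsOpen U)
    (hw : ∀ x ∈ U, ContDiffAt ℝ ∞ w x)
    (hg : ContDiff ℝ ∞ g) (hgc : HasCompactSupport g) (hgU : tsupport g ⊆ U) (k : ℕ) :
    ∫ x, negLap^[k] w x * g x = ∫ x, w x * negLap^[k] g x := by
  -- `negLap` is local, so both integrands see `w` only near the support of `g`, and `w` may be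
  -- traded for a globally smooth, compactly supported `v`.
  obtain ⟨v, hv, hvc, hvw⟩ := exists_contDiff_eq_nhds hU hgc hgU hw
  have := integral_negLap_iterate_mul hv hvc hg hgc k
  have e1 : ∀ x, negLap^[k] w x * g x = negLap^[k] v x * g x := by
    intro x
    by_cases hx : x ∈ tsupport g
    · rw [(negLap_iterate_congr (hvw x hx) k).eq_of_nhds]
    · simp [image_eq_zero_of_notMem_tsupport hx]
  have e2 : ∀ x, w x * negLap^[k] g x = v x * negLap^[k] g x := by
    intro x
    by_cases hx : x ∈ tsupport g
    · rw [(hvw x hx).eq_of_nhds]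
    · rw [image_eq_zero_of_notMem_tsupport fun h => hx (tsupport_negLap_iterate_subset g k h)]
      simp
  simp_rw [e1, e2, this]

theorem laplacian_comp_sub (f : EuclideanSpace ℝ (Fin n) → ℝ) (p x : EuclideanSpace ℝ (Fin n)) :
    Δ (fun z => f (z - p)) x = Δ f (x - p) := by
  rw [InnerProductSpace.laplacian_eq_iteratedFDeriv_stdOrthonormalBasis,
    InnerProductSpace.laplacian_eq_iteratedFDeriv_stdOrthonormalBasis]
  simp only [iteratedFDeriv_comp_sub]

theorem negLap_iterate_comp_sub (f : EuclideanSpace ℝ (Fin n) → ℝ)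
    (p x : EuclideanSpace ℝ (Fin n)) (k : ℕ) :
    negLap^[k] (fun z => f (z - p)) x = negLap^[k] f (x - p) := by
  induction k generalizing f with
  | zero => rfl
  | succ k ih =>
    have : negLap (fun z => f (z - p)) = fun z => negLap f (z - p) := by
      funext z
      simp [negLap, laplacian_comp_sub]
    rw [Function.iterate_succ_apply, this, ih, Function.iterate_succ_apply]

theorem hasFDerivAt_comp_log_norm {g : ℝ → ℝ} {g' : ℝ} {x : EuclideanSpace ℝ (Fin n)}
    (hx : x ≠ 0) (hg : HasDerivAt g g' (Real.log ‖x‖)) :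
    HasFDerivAt (fun z : EuclideanSpace ℝ (Fin n) => g (Real.log ‖z‖))
      ((g' * (‖x‖ ^ 2)⁻¹) • innerSL ℝ x) x := by
  have hx0 : (0 : ℝ) < ‖x‖ := norm_pos_iff.2 hx
  -- Half the logarithm of the squared norm: only `‖z‖ ^ 2` remains to be differentiated.
  have e : (fun z : EuclideanSpace ℝ (Fin n) => g (Real.log ‖z‖)) =
      fun z => g ((1 / 2) * Real.log (‖z‖ ^ 2)) := by
    funext z
    rw [Real.log_pow]
    norm_num
    ring_nf
  rw [e]
  have h1 : HasFDerivAt (fun z : EuclideanSpace ℝ (Fin n) => ‖z‖ ^ 2) (2 • innerSL ℝ x) x :=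
    (hasStrictFDerivAt_norm_sq x).hasFDerivAt
  have h2 := ((Real.hasDerivAt_log (pow_pos hx0 2).ne').const_mul (1 / 2 : ℝ)).comp_hasFDerivAt x h1
  have hg' : HasDerivAt g g' ((1 / 2) * Real.log (‖x‖ ^ 2)) := by
    rw [Real.log_pow]
    convert hg using 1
    norm_num
    ring
  have h3 := hg'.comp_hasFDerivAt x h2
  refine h3.congr_fderiv ?_
  ext v
  simp
  ring

/-- With `r = eᵗ` the radial Laplacian `f'' + (n-1) f'/r` turns into `e^{-2t} (g'' + (n-2) g')`:
constant coefficients apart from the factor `e^{-2t}`. -/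
theorem laplacian_comp_log_norm {g : ℝ → ℝ} (hg : ContDiff ℝ 2 g) {x : EuclideanSpace ℝ (Fin n)}
    (hx : x ≠ 0) :
    Δ (fun z : EuclideanSpace ℝ (Fin n) => g (Real.log ‖z‖)) x =
      (‖x‖ ^ 2)⁻¹ * (deriv (deriv g) (Real.log ‖x‖) + (n - 2) * deriv g (Real.log ‖x‖)) := by
  have hx0 : (0 : ℝ) < ‖x‖ := norm_pos_iff.2 hx
  have hcd : ContDiffAt ℝ 2 (fun z : EuclideanSpace ℝ (Fin n) => g (Real.log ‖z‖)) x :=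
    hg.contDiffAt.comp x ((contDiffAt_norm ℝ hx).log hx0.ne')
  have hg1 : ContDiff ℝ 1 (deriv g) := by
    have h11 : ContDiff ℝ (1 + 1) g := by
      rw [one_add_one_eq_two]
      exact hg
    exact (contDiff_succ_iff_deriv.1 h11).2.2
  rw [laplacian_eq_sum_partialD hcd]
  have hne : ∀ᶠ z in 𝓝 x, z ≠ 0 := isOpen_ne.mem_nhds hx
  have hp : ∀ i, partialD i (fun z : EuclideanSpace ℝ (Fin n) => g (Real.log ‖z‖)) =ᶠ[𝓝 x]
      fun z => deriv g (Real.log ‖z‖) * ((‖z‖ ^ 2)⁻¹ * z i) := by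
    intro i
    filter_upwards [hne] with z hz
    rw [partialD, (hasFDerivAt_comp_log_norm hz
      (hg.differentiable (by norm_num) _).hasDerivAt).fderiv]
    simp [EuclideanSpace.inner_single_right, mul_assoc]
  have h1 : HasFDerivAt (fun z : EuclideanSpace ℝ (Fin n) => ‖z‖ ^ 2) (2 • innerSL ℝ x) x :=
    (hasStrictFDerivAt_norm_sq x).hasFDerivAt
  have h2 := (hasDerivAt_inv (pow_pos hx0 2).ne').comp_hasFDerivAt x h1
  have hd : ∀ i, partialD i (partialD i (fun z : EuclideanSpace ℝ (Fin n) => g (Real.log ‖z‖))) x =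
      deriv (deriv g) (Real.log ‖x‖) * ((‖x‖ ^ 2)⁻¹) ^ 2 * x i ^ 2 +
      deriv g (Real.log ‖x‖) * ((‖x‖ ^ 2)⁻¹ - 2 * ((‖x‖ ^ 2)⁻¹) ^ 2 * x i ^ 2) := by
    intro i
    have h4 : HasFDerivAt (fun z : EuclideanSpace ℝ (Fin n) => z i)
        (EuclideanSpace.proj i : EuclideanSpace ℝ (Fin n) →L[ℝ] ℝ) x :=
      (EuclideanSpace.proj i : EuclideanSpace ℝ (Fin n) →L[ℝ] ℝ).hasFDerivAt
    have h5 := (hasFDerivAt_comp_log_norm hx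
      (hg1.differentiable (by norm_num) _).hasDerivAt).mul (h2.mul h4)
    rw [partialD, (hp i).fderiv_eq]
    erw [h5.fderiv]
    simp [EuclideanSpace.inner_single_right]
    ring
  simp_rw [hd]
  have hs : ∑ i, x i ^ 2 = ‖x‖ ^ 2 := (EuclideanSpace.real_norm_sq_eq x).symm
  rw [Finset.sum_add_distrib, ← Finset.mul_sum, ← Finset.mul_sum, Finset.sum_sub_distrib,
    ← Finset.mul_sum, hs]
  simp
  field_simp

end Calculus

/-! ### Scalar curvature of a conformally flat metric -/

section ConformalCurvature

variable {n : ℕ}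

/-- The Christoffel symbols of `e^{2w} |dx|²` in terms of the differential `a` of `w`. -/
noncomputable def conformalChristoffel (a : Fin n → ℝ) (k i j : Fin n) : ℝ :=
  (if j = k then a i else 0) + (if i = k then a j else 0) - (if i = j then a k else 0)

/-- This is the part of `∑ R_{ii}` quadratic in the Christoffel symbols; it produces the gradient
term of the scalar curvature. -/
theorem conformalChristoffel_quadratic (a : Fin n → ℝ) :
    ∑ i, ∑ l, ∑ p, (conformalChristoffel a l l p * conformalChristoffel a p i i -
      conformalChristoffel a l i p * conformalChristoffel a p i l) =
      -((n - 1) * (n - 2) * ∑ i, a i ^ 2) := by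
  have h1 : ∀ l p : Fin n, conformalChristoffel a l l p = a p := by
    intro l p
    simp only [conformalChristoffel]
    by_cases h : p = l
    · subst h; simp
    · simp [h, Ne.symm h]
  have h2 : ∀ i p : Fin n, conformalChristoffel a p i i = (if i = p then 2 * a i else 0) - a p := by
    intro i p
    simp only [conformalChristoffel, if_true]
    split_ifs <;> ring
  have h3 : ∀ i : Fin n, ∑ l, ∑ p, conformalChristoffel a l l p * conformalChristoffel a p i i =
      n * (2 * a i ^ 2 - ∑ p, a p ^ 2) := by
    intro i
    simp only [h1, h2, mul_sub, Finset.sum_sub_distrib, mul_ite, mul_zero, Finset.sum_ite_eq,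
      Finset.mem_univ, if_true, Finset.sum_const, Finset.card_univ, Fintype.card_fin, nsmul_eq_mul]
    simp only [pow_two]
    ring
  have h4 : ∀ i : Fin n, ∑ l, ∑ p, conformalChristoffel a l i p * conformalChristoffel a p i l =
      (n + 2) * a i ^ 2 - 2 * ∑ p, a p ^ 2 := by
    intro i
    have h5 : ∀ l p : Fin n, conformalChristoffel a l i p * conformalChristoffel a p i l =
        (if p = l then a i ^ 2 else 0) + (if i = l then (if i = p then 2 * a i * a i else 0) else 0)
         - (if i = p then a l ^ 2 else 0) - (if i = l then a p ^ 2 else 0) := by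
      intro l p
      simp only [conformalChristoffel]
      by_cases h6 : p = l
      · subst h6
        by_cases h7 : i = p
        · subst h7; simp; ring
        · simp [h7]; ring
      · by_cases h7 : i = l
        · subst h7
          simp [h6, Ne.symm h6]; ring
        · by_cases h8 : i = p
          · subst h8
            simp [h6, Ne.symm h6]; ring
          · simp [h6, h7, h8, Ne.symm h6]
    simp only [h5, Finset.sum_add_distrib, Finset.sum_sub_distrib, Finset.sum_ite_eq,
      Finset.sum_ite_eq', Finset.mem_univ, if_true, Finset.sum_const, Finset.card_univ,
      Fintype.card_fin, nsmul_eq_mul]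
    have h9 : ∀ l : Fin n, ∑ p, (if i = l then (if i = p then 2 * a i * a i else 0) else 0) =
        if i = l then 2 * a i * a i else 0 := by
      intro l
      split_ifs <;> simp
    have h10 : ∀ l : Fin n, ∑ p, (if i = l then a p ^ 2 else 0) =
        if i = l then ∑ p, a p ^ 2 else 0 := by
      intro l
      split_ifs <;> simp
    simp only [h9, h10, Finset.sum_ite_eq, Finset.mem_univ, if_true]
    ring
  simp only [Finset.sum_sub_distrib, h3, h4]
  simp only [← Finset.mul_sum, Finset.sum_sub_distrib, Finset.sum_const, Finset.card_univ,
    Fintype.card_fin, nsmul_eq_mul]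
  ring

theorem christoffel_conformal {w : EuclideanSpace ℝ (Fin n) → ℝ} {y : EuclideanSpace ℝ (Fin n)}
    (hw : DifferentiableAt ℝ w y) (k i j : Fin n) :
    christoffel (fun z => Real.exp (2 * w z) • (1 : Matrix (Fin n) (Fin n) ℝ)) k i j y =
      conformalChristoffel (fun i => partialD i w y) k i j := by
  have hinv : (Real.exp (2 * w y) • (1 : Matrix (Fin n) (Fin n) ℝ))⁻¹ =
      Real.exp (-(2 * w y)) • (1 : Matrix (Fin n) (Fin n) ℝ) := by
    refine Matrix.inv_eq_left_inv ?_
    rw [Matrix.smul_mul, Matrix.mul_smul, smul_smul, ← Real.exp_add]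
    simp
  have hp : ∀ i j l : Fin n, partialD i
      (fun z => (Real.exp (2 * w z) • (1 : Matrix (Fin n) (Fin n) ℝ)) j l) y =
      if j = l then Real.exp (2 * w y) * (2 * partialD i w y) else 0 := by
    intro i j l
    by_cases h : j = l
    · subst h
      simp only [Matrix.smul_apply, Matrix.one_apply_eq, smul_eq_mul, mul_one, if_true, partialD]
      rw [((hw.hasFDerivAt.const_mul 2).exp).fderiv]
      simp
    · simp [h, Matrix.one_apply_ne h, partialD]
  have he : ∀ x : ℝ, Real.exp (-(2 * w y)) * (Real.exp (2 * w y) * x) = x := by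
    intro x
    rw [← mul_assoc, ← Real.exp_add]; simp
  simp only [christoffel, hinv, hp]
  simp only [Matrix.smul_apply, Matrix.one_apply, smul_eq_mul, mul_ite,
    mul_one, mul_zero, ite_mul, zero_mul, Finset.sum_ite_eq, Finset.mem_univ, if_true]
  simp only [mul_ite, mul_add, mul_sub, he, mul_zero, conformalChristoffel]
  split_ifs <;> ring

/-- Trace of the Ricci tensor, split into the part linear in second derivatives of `w` and the part
quadratic in first derivatives. Through this formula the sign of the scalar curvature becomes a
differential inequality for `w`. -/
theorem scalarCurvatureCoord_conformal {w : EuclideanSpace ℝ (Fin n) → ℝ}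
    {y : EuclideanSpace ℝ (Fin n)} (hw : ContDiffAt ℝ 2 w y) :
    scalarCurvatureCoord (fun z => Real.exp (2 * w z) • (1 : Matrix (Fin n) (Fin n) ℝ)) y =
      -(Real.exp (-(2 * w y)) * ((n - 1) * (2 * Δ w y + (n - 2) * ‖fderiv ℝ w y‖ ^ 2))) := by
  have hinv : (Real.exp (2 * w y) • (1 : Matrix (Fin n) (Fin n) ℝ))⁻¹ =
      Real.exp (-(2 * w y)) • (1 : Matrix (Fin n) (Fin n) ℝ) := by
    refine Matrix.inv_eq_left_inv ?_
    rw [Matrix.smul_mul, Matrix.mul_smul, smul_smul, ← Real.exp_add]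
    simp
  set G : EuclideanSpace ℝ (Fin n) → Matrix (Fin n) (Fin n) ℝ :=
    fun z => Real.exp (2 * w z) • (1 : Matrix (Fin n) (Fin n) ℝ)
  have hev : ∀ k i j, christoffel G k i j =ᶠ[𝓝 y]
      fun z => conformalChristoffel (fun i => partialD i w z) k i j := by
    intro k i j
    filter_upwards [hw.eventually (by simp)] with z hz
    exact christoffel_conformal (hz.differentiableAt (by norm_num)) k i j
  have hd : ∀ i, DifferentiableAt ℝ (partialD i w) y := fun i =>
    (contDiffAt_partialD (l := 1) hw (by norm_num) i).differentiableAt (by norm_num)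
  have hpd : ∀ m k i j, partialD m (christoffel G k i j) y =
      conformalChristoffel (fun i => partialD m (partialD i w) y) k i j := by
    intro m k i j
    have hite : ∀ (c : Prop) [Decidable c] (i : Fin n),
        HasFDerivAt (fun z => if c then partialD i w z else 0)
          (if c then fderiv ℝ (partialD i w) y else 0) y := by
      intro c _ i
      split_ifs
      · exact (hd i).hasFDerivAt
      · exact hasFDerivAt_const _ _
    have h := ((hite (j = k) i).add (hite (i = k) j)).sub (hite (i = j) k)
    rw [partialD, (hev k i j).fderiv_eq]
    have h2 : (fun z => conformalChristoffel (fun i => partialD i w z) k i j) =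
      fun z => ((if j = k then partialD i w z else 0) + (if i = k then partialD j w z else 0)) -
        (if i = j then partialD k w z else 0) := rfl
    rw [h2]
    erw [h.fderiv]
    simp only [conformalChristoffel, partialD, ContinuousLinearMap.add_apply,
      ContinuousLinearMap.sub_apply]
    split_ifs <;> rfl
  have hric : ∀ i, ricci G i i y = ∑ l, (conformalChristoffel (fun i => partialD l (partialD i w) y)
      l i i - conformalChristoffel (fun j => partialD i (partialD j w) y) l i l) +
      ∑ l, ∑ p, (conformalChristoffel (fun i => partialD i w y) l l p *
        conformalChristoffel (fun i => partialD i w y) p i i -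
      conformalChristoffel (fun i => partialD i w y) l i p *
        conformalChristoffel (fun i => partialD i w y) p i l) := by
    intro i
    rw [ricci, ← Finset.sum_add_distrib]
    refine Finset.sum_congr rfl fun l _ => ?_
    simp only [hpd, (hev _ _ _).eq_of_nhds]
  -- The divergence term sums to `2 ∂_i² w - Δ w`, and the derivative of the contracted symbol to `n
  -- ∂_i² w`.
  have hlin : ∀ i : Fin n, ∑ l, (conformalChristoffel (fun i => partialD l (partialD i w) y)
      l i i - conformalChristoffel (fun j => partialD i (partialD j w) y) l i l) =
      (2 - n) * partialD i (partialD i w) y - Δ w y := by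
    intro i
    have h5 : ∀ l : Fin n, conformalChristoffel (fun i => partialD l (partialD i w) y)
        l i i - conformalChristoffel (fun j => partialD i (partialD j w) y) l i l =
        (if i = l then 2 * partialD i (partialD i w) y else 0) - partialD l (partialD l w) y -
          partialD i (partialD i w) y := by
      intro l
      simp only [conformalChristoffel]
      by_cases h : i = l
      · subst h; simp; ring
      · simp [h]
    simp only [h5, Finset.sum_sub_distrib, Finset.sum_ite_eq, Finset.mem_univ, if_true,
      Finset.sum_const, Finset.card_univ, Fintype.card_fin, nsmul_eq_mul,
      laplacian_eq_sum_partialD hw]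
    ring
  have hR : scalarCurvatureCoord G y = Real.exp (-(2 * w y)) * ∑ i, ricci G i i y := by
    rw [scalarCurvatureCoord, Finset.mul_sum]
    refine Finset.sum_congr rfl fun i _ => ?_
    simp only [show G y = Real.exp (2 * w y) • (1 : Matrix (Fin n) (Fin n) ℝ) from rfl, hinv,
      Matrix.smul_apply, Matrix.one_apply, smul_eq_mul, mul_ite, mul_one, mul_zero, ite_mul,
      zero_mul, Finset.sum_ite_eq, Finset.mem_univ, if_true]
  rw [hR]
  simp only [hric, hlin, Finset.sum_add_distrib]
  rw [conformalChristoffel_quadratic, sum_sq_partialD, Finset.sum_sub_distrib, ← Finset.mul_sum,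
    ← laplacian_eq_sum_partialD hw]
  simp only [Finset.sum_const, Finset.card_univ, Fintype.card_fin, nsmul_eq_mul]
  ring

end ConformalCurvature

/-! ### Logarithmic polar coordinates -/

section Polar

variable {n : ℕ}

/-- The surface measure on the unit sphere of `ℝⁿ`. -/
noncomputable abbrev sphereMeasure (n : ℕ) :
    Measure (Metric.sphere (0 : EuclideanSpace ℝ (Fin n)) 1) :=
  (volume : Measure (EuclideanSpace ℝ (Fin n))).toSphere

/-- Logarithmic polar coordinates `(t, θ) ↦ eᵗ θ`. -/
noncomputable def logPolar (p : ℝ × Metric.sphere (0 : EuclideanSpace ℝ (Fin n)) 1) :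
    EuclideanSpace ℝ (Fin n) :=
  Real.exp p.1 • (p.2 : EuclideanSpace ℝ (Fin n))

theorem norm_logPolar (p : ℝ × Metric.sphere (0 : EuclideanSpace ℝ (Fin n)) 1) :
    ‖logPolar p‖ = Real.exp p.1 := by
  rw [logPolar, norm_smul, norm_eq_of_mem_sphere p.2, mul_one, Real.norm_eq_abs, Real.abs_exp]

theorem log_norm_logPolar (p : ℝ × Metric.sphere (0 : EuclideanSpace ℝ (Fin n)) 1) :
    Real.log ‖logPolar p‖ = p.1 := by
  rw [norm_logPolar, Real.log_exp]

theorem logPolar_ne_zero (p : ℝ × Metric.sphere (0 : EuclideanSpace ℝ (Fin n)) 1) :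
    logPolar p ≠ 0 := by
  rw [← norm_pos_iff, norm_logPolar]
  exact Real.exp_pos _

theorem continuous_logPolar :
    Continuous (logPolar : ℝ × Metric.sphere (0 : EuclideanSpace ℝ (Fin n)) 1 → _) :=
  (Real.continuous_exp.comp continuous_fst).smul (continuous_subtype_val.comp continuous_snd)

/-- The substitution `r = eᵗ` turns `r^{n-1} dr` into `e^{nt} dt`. -/
theorem measurePreserving_expOrderIso (hn : 0 < n) :
    MeasurePreserving Real.expOrderIso
      ((volume : Measure ℝ).withDensity fun t => ENNReal.ofReal (Real.exp (n * t)))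
      (Measure.volumeIoiPow (n - 1)) := by
  have hmeas : Measurable (Real.expOrderIso : ℝ → Ioi (0 : ℝ)) :=
    Real.expOrderIso.continuous.measurable
  refine ⟨hmeas, ?_⟩
  ext s hs
  rw [Measure.map_apply hmeas hs, withDensity_apply _ (hmeas hs), Measure.volumeIoiPow,
    withDensity_apply _ hs]
  have h1 := setLIntegral_subtype (μ := volume) (measurableSet_Ioi (a := (0 : ℝ))) s
    (fun a : ℝ => ENNReal.ofReal (a ^ (n - 1)))
  erw [h1]
  have h2 : (Subtype.val '' s : Set ℝ) = Real.exp '' (Real.expOrderIso ⁻¹' s) := by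
    ext x
    constructor
    · rintro ⟨y, hy, rfl⟩
      refine ⟨Real.expOrderIso.symm y, by simpa using hy, ?_⟩
      rw [← Real.coe_expOrderIso_apply, OrderIso.apply_symm_apply]
    · rintro ⟨t, ht, rfl⟩
      exact ⟨Real.expOrderIso t, ht, Real.coe_expOrderIso_apply t⟩
  rw [h2, lintegral_image_eq_lintegral_abs_deriv_mul (hmeas hs)
    (fun x _ => (Real.hasDerivAt_exp x).hasDerivWithinAt) Real.exp_injective.injOn]
  refine lintegral_congr fun t => ?_
  rw [← ENNReal.ofReal_mul (abs_nonneg _), Real.abs_exp, ← pow_succ', Nat.sub_add_cancel hn,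
    ← Real.exp_nat_mul]

/-- Ordinary polar coordinates on the punctured space, composed with `r = eᵗ`; removing the origin
costs a null set. -/
theorem measurePreserving_logPolar (hn : 0 < n) :
    MeasurePreserving (logPolar (n := n))
      (((volume : Measure ℝ).prod (sphereMeasure n)).withDensity
        fun p => ENNReal.ofReal (Real.exp (n * p.1))) volume := by
  have : Nonempty (Fin n) := ⟨⟨0, hn⟩⟩
  have hn' : Module.finrank ℝ (EuclideanSpace ℝ (Fin n)) = n := finrank_euclideanSpace_fin
  have h1 := (Measure.measurePreserving_homeomorphUnitSphereProd
    (volume : Measure (EuclideanSpace ℝ (Fin n))))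
  rw [hn'] at h1
  have h1' := MeasurePreserving.symm (homeomorphUnitSphereProd (EuclideanSpace ℝ (Fin n))).toMeasurableEquiv h1
  have h2 : MeasurePreserving (Subtype.val : ({0}ᶜ : Set (EuclideanSpace ℝ (Fin n))) → _)
      ((volume : Measure (EuclideanSpace ℝ (Fin n))).comap Subtype.val) volume := by
    refine ⟨measurable_subtype_coe, ?_⟩
    rw [map_comap_subtype_coe (measurableSet_singleton _).compl]
    exact Measure.restrict_eq_self_of_ae_mem (compl_mem_ae_iff.2 (measure_singleton _))
  have h3 := ((measurePreserving_expOrderIso hn).prod (MeasurePreserving.id (sphereMeasure n)))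
  have h4 := Measure.measurePreserving_swap (μ := Measure.volumeIoiPow (n - 1))
    (ν := sphereMeasure n)
  have h5 := (h2.comp h1').comp (h4.comp h3)
  have e1 : ((volume : Measure ℝ).withDensity fun t => ENNReal.ofReal (Real.exp (n * t))).prod
      (sphereMeasure n) = (((volume : Measure ℝ).prod (sphereMeasure n)).withDensity
        fun p => ENNReal.ofReal (Real.exp (n * p.1))) := by
    rw [prod_withDensity_left₀]
    fun_prop
  rw [← e1]
  exact h5

/-- With an embedding, the change of variables formulas hold for arbitrary integrands, without
measurability hypotheses. -/
theorem measurableEmbedding_logPolar : MeasurableEmbedding (logPolar (n := n)) := by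
  have h1 : MeasurableEmbedding (Subtype.val : ({0}ᶜ : Set (EuclideanSpace ℝ (Fin n))) → _) :=
    MeasurableEmbedding.subtype_coe (measurableSet_singleton _).compl
  have h2 := (homeomorphUnitSphereProd
    (EuclideanSpace ℝ (Fin n))).symm.toMeasurableEquiv.measurableEmbedding
  have h3 := (Homeomorph.prodCongr (Homeomorph.refl
    (Metric.sphere (0 : EuclideanSpace ℝ (Fin n)) 1))
      Real.expOrderIso.toHomeomorph).toMeasurableEquiv.measurableEmbedding
  have h4 := (MeasurableEquiv.prodComm (α := ℝ)
    (β := Metric.sphere (0 : EuclideanSpace ℝ (Fin n)) 1)).measurableEmbedding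
  exact (h1.comp h2).comp (h3.comp h4)

theorem lintegral_logPolar (hn : 0 < n) (f : EuclideanSpace ℝ (Fin n) → ℝ≥0∞) :
    ∫⁻ x, f x = ∫⁻ p, ENNReal.ofReal (Real.exp (n * p.1)) * f (logPolar p)
      ∂((volume : Measure ℝ).prod (sphereMeasure n)) := by
  rw [← (measurePreserving_logPolar hn).lintegral_comp_emb measurableEmbedding_logPolar,
    lintegral_withDensity_eq_lintegral_mul_non_measurable]
  · rfl
  · fun_prop
  · exact ae_of_all _ fun _ => ENNReal.ofReal_lt_top

theorem integral_logPolar (hn : 0 < n) (f : EuclideanSpace ℝ (Fin n) → ℝ) :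
    ∫ x, f x = ∫ p, Real.exp (n * p.1) * f (logPolar p)
      ∂((volume : Measure ℝ).prod (sphereMeasure n)) := by
  rw [← (measurePreserving_logPolar hn).integral_comp measurableEmbedding_logPolar,
    integral_withDensity_eq_integral_toReal_smul]
  · simp [ENNReal.toReal_ofReal (Real.exp_pos _).le]
  · fun_prop
  · exact ae_of_all _ fun _ => ENNReal.ofReal_lt_top

theorem integrable_logPolar_iff (hn : 0 < n) (f : EuclideanSpace ℝ (Fin n) → ℝ) :
    Integrable f ↔ Integrable (fun p => Real.exp (n * p.1) * f (logPolar p))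
      ((volume : Measure ℝ).prod (sphereMeasure n)) := by
  rw [← (measurePreserving_logPolar hn).integrable_comp_emb measurableEmbedding_logPolar,
    integrable_withDensity_iff_integrable_smul']
  · simp [ENNReal.toReal_ofReal (Real.exp_pos _).le]
  · fun_prop
  · exact ae_of_all _ fun _ => ENNReal.ofReal_lt_top

end Polar

/-! ### Integrals over concentric spheres -/

section SphericalMean

variable {n : ℕ}

/-- The integral of `w` over the sphere of radius `eᵗ`, with respect to the measure of the unit
sphere. -/
noncomputable def sphereInt (w : EuclideanSpace ℝ (Fin n) → ℝ) (t : ℝ) : ℝ :=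
  ∫ θ, w (logPolar (t, θ)) ∂(sphereMeasure n)

/-- The spherical shell of points with `log ‖x‖ ∈ I`. -/
def shell (n : ℕ) (I : Set ℝ) : Set (EuclideanSpace ℝ (Fin n)) :=
  {x | x ≠ 0 ∧ Real.log ‖x‖ ∈ I}

theorem isOpen_shell {I : Set ℝ} (hI : IsOpen I) : IsOpen (shell n I) := by
  have h : ContinuousOn (fun x : EuclideanSpace ℝ (Fin n) => Real.log ‖x‖) {0}ᶜ :=
    ContinuousOn.log continuous_norm.continuousOn fun x hx => norm_ne_zero_iff.2 hx
  exact h.isOpen_inter_preimage isOpen_compl_singleton hI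

theorem logPolar_mem_shell {I : Set ℝ} {p : ℝ × Metric.sphere (0 : EuclideanSpace ℝ (Fin n)) 1} :
    logPolar p ∈ shell n I ↔ p.1 ∈ I := by
  simp [shell, logPolar_ne_zero, log_norm_logPolar]

/-- The derivative of `w` in the direction of the position vector. -/
noncomputable def radialD (w : EuclideanSpace ℝ (Fin n) → ℝ) (x : EuclideanSpace ℝ (Fin n)) : ℝ :=
  fderiv ℝ w x x

theorem contDiffAt_radialD {w : EuclideanSpace ℝ (Fin n) → ℝ} {x : EuclideanSpace ℝ (Fin n)}
    (h : ContDiffAt ℝ ∞ w x) : ContDiffAt ℝ ∞ (radialD w) x :=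
  (h.fderiv_right infty_add_one_le).clm_apply contDiffAt_id

theorem hasDerivAt_logPolar (t : ℝ) (θ : Metric.sphere (0 : EuclideanSpace ℝ (Fin n)) 1) :
    HasDerivAt (fun s => logPolar (s, θ)) (logPolar (t, θ)) t :=
  (Real.hasDerivAt_exp t).smul_const (θ : EuclideanSpace ℝ (Fin n))

theorem hasDerivAt_comp_logPolar {w : EuclideanSpace ℝ (Fin n) → ℝ} {t : ℝ}
    {θ : Metric.sphere (0 : EuclideanSpace ℝ (Fin n)) 1}
    (h : DifferentiableAt ℝ w (logPolar (t, θ))) :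
    HasDerivAt (fun s => w (logPolar (s, θ))) (radialD w (logPolar (t, θ))) t :=
  h.hasFDerivAt.comp_hasDerivAt t (hasDerivAt_logPolar t θ)

theorem continuousOn_comp_logPolar {w : EuclideanSpace ℝ (Fin n) → ℝ} {I : Set ℝ}
    (hw : ContinuousOn w (shell n I)) :
    ContinuousOn (fun p => w (logPolar p)) (I ×ˢ univ) :=
  hw.comp continuous_logPolar.continuousOn fun _ hp => logPolar_mem_shell.2 hp.1

theorem continuous_comp_logPolar {w : EuclideanSpace ℝ (Fin n) → ℝ} {I : Set ℝ} {t : ℝ}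
    (hw : ContinuousOn w (shell n I)) (ht : t ∈ I) : Continuous fun θ => w (logPolar (t, θ)) :=
  (continuousOn_comp_logPolar hw).comp_continuous (by fun_prop) fun _ => ⟨ht, mem_univ _⟩

theorem integrable_comp_logPolar {w : EuclideanSpace ℝ (Fin n) → ℝ} {I : Set ℝ} {t : ℝ}
    (hw : ContinuousOn w (shell n I)) (ht : t ∈ I) :
    Integrable (fun θ => w (logPolar (t, θ))) (sphereMeasure n) :=
  (continuous_comp_logPolar hw ht).integrable_of_hasCompactSupport
    (HasCompactSupport.of_compactSpace _)

/-- On a compact shell around the sphere of radius `eᵗ` the radial derivative is bounded uniformly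
in the angle, which permits differentiation under the integral. -/
theorem hasDerivAt_sphereInt {w : EuclideanSpace ℝ (Fin n) → ℝ} {I : Set ℝ} (hI : IsOpen I)
    (hw : ∀ x ∈ shell n I, ContDiffAt ℝ 1 w x) {t : ℝ} (ht : t ∈ I) :
    HasDerivAt (sphereInt w) (sphereInt (radialD w) t) t := by
  have hwc : ContinuousOn w (shell n I) := fun x hx => (hw x hx).continuousAt.continuousWithinAt
  have hrc : ContinuousOn (radialD w) (shell n I) := fun x hx =>
    (((hw x hx).fderiv_right (m := 0) (by norm_num)).clm_apply
      contDiffAt_id).continuousAt.continuousWithinAt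
  obtain ⟨δ, hδ, hδI⟩ := Metric.isOpen_iff.1 hI t ht
  have hsub : Metric.closedBall t (δ / 2) ⊆ I := fun s hs =>
    hδI (Metric.closedBall_subset_ball (by linarith) hs)
  obtain ⟨C, hC⟩ := ((isCompact_closedBall t (δ / 2)).prod
    (isCompact_univ (X := Metric.sphere (0 : EuclideanSpace ℝ (Fin n)) 1))).exists_bound_of_continuousOn
    ((continuousOn_comp_logPolar hrc).mono (prod_mono hsub subset_rfl))
  have hball : Metric.ball t (δ / 2) ∈ 𝓝 t := Metric.ball_mem_nhds _ (by linarith)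
  have := hasDerivAt_integral_of_dominated_loc_of_deriv_le (μ := sphereMeasure n)
    (F := fun s θ => w (logPolar (s, θ))) (F' := fun s θ => radialD w (logPolar (s, θ)))
    (x₀ := t) (s := Metric.ball t (δ / 2)) (bound := fun _ => C) hball
    (by
      filter_upwards [hball] with s hs
      exact (integrable_comp_logPolar hwc
        (hsub (Metric.ball_subset_closedBall hs))).aestronglyMeasurable)
    (integrable_comp_logPolar hwc ht) (integrable_comp_logPolar hrc ht).aestronglyMeasurable
    (ae_of_all _ fun θ s hs => hC (s, θ) ⟨Metric.ball_subset_closedBall hs, mem_univ _⟩)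
    (integrable_const C)
    (ae_of_all _ fun θ s hs => hasDerivAt_comp_logPolar
      ((hw _ (logPolar_mem_shell.2 (hsub (Metric.ball_subset_closedBall hs)))).differentiableAt
        (by norm_num)))
  exact this.2

theorem continuousOn_sphereInt {w : EuclideanSpace ℝ (Fin n) → ℝ} {I : Set ℝ} (hI : IsOpen I)
    (hw : ContinuousOn w (shell n I)) : ContinuousOn (sphereInt w) I := by
  intro t ht
  refine ContinuousAt.continuousWithinAt ?_
  obtain ⟨δ, hδ, hδI⟩ := Metric.isOpen_iff.1 hI t ht
  have hsub : Metric.closedBall t (δ / 2) ⊆ I := fun s hs =>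
    hδI (Metric.closedBall_subset_ball (by linarith) hs)
  obtain ⟨C, hC⟩ := ((isCompact_closedBall t (δ / 2)).prod
    (isCompact_univ (X := Metric.sphere (0 : EuclideanSpace ℝ (Fin n)) 1))).exists_bound_of_continuousOn
    ((continuousOn_comp_logPolar hw).mono (prod_mono hsub subset_rfl))
  have hball : Metric.closedBall t (δ / 2) ∈ 𝓝 t := Metric.closedBall_mem_nhds _ (by linarith)
  refine continuousAt_of_dominated (bound := fun _ => C) ?_ ?_ (integrable_const C) ?_
  · filter_upwards [hball] with s hs
    exact (integrable_comp_logPolar hw (hsub hs)).aestronglyMeasurable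
  · filter_upwards [hball] with s hs
    exact ae_of_all _ fun θ => hC (s, θ) ⟨hs, mem_univ _⟩
  · refine ae_of_all _ fun θ => ?_
    have h1 := (continuousOn_comp_logPolar hw).continuousAt (x := (t, θ))
      ((hI.prod isOpen_univ).mem_nhds ⟨ht, mem_univ _⟩)
    exact ContinuousAt.comp (f := fun s => (s, θ)) (g := fun p => w (logPolar p)) h1 (by fun_prop)

/-- Pairing of a function on a shell with a radial function. -/
theorem integral_mul_radial (hn : 0 < n) {w Φ : EuclideanSpace ℝ (Fin n) → ℝ} {I : Set ℝ} {q : ℝ → ℝ}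
    (hI : IsOpen I) (hw : ContinuousOn w (shell n I)) (hq : Continuous q) (hqc : HasCompactSupport q)
    (hqI : tsupport q ⊆ I) (hΦ : ∀ x ≠ 0, Φ x = q (Real.log ‖x‖)) :
    ∫ x, w x * Φ x = ∫ t, Real.exp (n * t) * (q t * sphereInt w t) := by
  rw [integral_logPolar hn]
  have e : ∀ p : ℝ × Metric.sphere (0 : EuclideanSpace ℝ (Fin n)) 1,
      Real.exp (n * p.1) * (w (logPolar p) * Φ (logPolar p)) =
      Real.exp (n * p.1) * (q p.1 * w (logPolar p)) := by
    intro p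
    rw [hΦ _ (logPolar_ne_zero p), log_norm_logPolar, mul_comm (w _)]
  simp_rw [e]
  have hcont : Continuous fun p : ℝ × Metric.sphere (0 : EuclideanSpace ℝ (Fin n)) 1 =>
      q p.1 * w (logPolar p) := by
    rw [continuous_iff_continuousAt]
    intro p
    by_cases hp : p.1 ∈ tsupport q
    · exact (hq.comp continuous_fst).continuousAt.mul ((continuousOn_comp_logPolar hw).continuousAt
        ((hI.prod isOpen_univ).mem_nhds ⟨hqI hp, mem_univ _⟩))
    · have : (fun p : ℝ × Metric.sphere (0 : EuclideanSpace ℝ (Fin n)) 1 =>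
          q p.1 * w (logPolar p)) =ᶠ[𝓝 p] fun _ => 0 := by
        filter_upwards [(isClosed_tsupport q).isOpen_compl.preimage continuous_fst |>.mem_nhds hp]
          with z hz
        rw [image_eq_zero_of_notMem_tsupport hz, zero_mul]
      exact continuousAt_const.congr this.symm
  have hsupp : HasCompactSupport fun p : ℝ × Metric.sphere (0 : EuclideanSpace ℝ (Fin n)) 1 =>
      Real.exp (n * p.1) * (q p.1 * w (logPolar p)) := by
    refine HasCompactSupport.intro (hqc.isCompact.prod isCompact_univ) fun p hp => ?_
    rw [image_eq_zero_of_notMem_tsupport fun h => hp ⟨h, mem_univ _⟩]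
    simp
  have hint := (Continuous.integrable_of_hasCompactSupport
    (μ := (volume : Measure ℝ).prod (sphereMeasure n)) (by fun_prop) hsupp)
  rw [integral_prod _ hint]
  refine integral_congr_ae (ae_of_all _ fun t => ?_)
  simp only [sphereInt, integral_const_mul]

end SphericalMean

/-! ### Radial test functions and the Laplace equation for spherical integrals -/

section RadialFunctions

variable {n : ℕ}

/-- The radial function with profile `g` in `log ‖x‖` and value `c` at the origin. -/
noncomputable def radialFn (n : ℕ) (c : ℝ) (g : ℝ → ℝ) (x : EuclideanSpace ℝ (Fin n)) : ℝ :=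
  open Classical in if x = 0 then c else g (Real.log ‖x‖)

theorem radialFn_of_ne {c : ℝ} {g : ℝ → ℝ} {x : EuclideanSpace ℝ (Fin n)} (hx : x ≠ 0) :
    radialFn n c g x = g (Real.log ‖x‖) := by
  simp [radialFn, hx]

theorem radialFn_eventuallyEq {c : ℝ} {g : ℝ → ℝ} {x : EuclideanSpace ℝ (Fin n)} (hx : x ≠ 0) :
    radialFn n c g =ᶠ[𝓝 x] fun z => g (Real.log ‖z‖) := by
  filter_upwards [isOpen_ne.mem_nhds hx] with z hz using radialFn_of_ne hz

theorem radialFn_eq_const {c a : ℝ} {g : ℝ → ℝ} (hc : ∀ t ≤ a, g t = c)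
    {x : EuclideanSpace ℝ (Fin n)} (hx : ‖x‖ ≤ Real.exp a) : radialFn n c g x = c := by
  by_cases h : x = 0
  · simp [radialFn, h]
  · rw [radialFn_of_ne h]
    exact hc _ ((Real.log_le_iff_le_exp (norm_pos_iff.2 h)).2 hx)

theorem contDiff_radialFn {c a : ℝ} {g : ℝ → ℝ} (hg : ContDiff ℝ ∞ g) (hc : ∀ t ≤ a, g t = c) :
    ContDiff ℝ ∞ (radialFn n c g) := by
  rw [contDiff_iff_contDiffAt]
  intro x
  by_cases hx : x = 0
  · have : radialFn n c g =ᶠ[𝓝 x] fun _ => c := by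
      subst hx
      filter_upwards [Metric.ball_mem_nhds (0 : EuclideanSpace ℝ (Fin n)) (Real.exp_pos a)] with z hz
      exact radialFn_eq_const hc (mem_ball_zero_iff.1 hz).le
    exact contDiffAt_const.congr_of_eventuallyEq this
  · exact (hg.contDiffAt.comp x ((contDiffAt_norm ℝ hx).log
      (norm_ne_zero_iff.2 hx))).congr_of_eventuallyEq (radialFn_eventuallyEq hx)

theorem hasCompactSupport_radialFn {c b : ℝ} {g : ℝ → ℝ} (hb : ∀ t, b ≤ t → g t = 0) :
    HasCompactSupport (radialFn n c g) := by
  refine HasCompactSupport.intro (isCompact_closedBall 0 (Real.exp b)) fun x hx => ?_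
  have hx' : Real.exp b < ‖x‖ := by simpa using hx
  have h0 : 0 < ‖x‖ := (Real.exp_pos b).trans hx'
  rw [radialFn_of_ne (norm_pos_iff.1 h0)]
  exact hb _ ((Real.lt_log_iff_exp_lt h0).2 hx').le

theorem tsupport_radialFn_subset {g : ℝ → ℝ} {a : ℝ} {K : Set ℝ} (hK : IsClosed K)
    (ha : ∀ t ≤ a, g t = 0) (hgK : ∀ t, t ∉ K → g t = 0) :
    tsupport (radialFn n 0 g) ⊆ shell n K := by
  intro x hx
  by_contra h
  refine notMem_tsupport_iff_eventuallyEq.2 ?_ hx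
  by_cases hx0 : x = 0
  · subst hx0
    filter_upwards [Metric.ball_mem_nhds (0 : EuclideanSpace ℝ (Fin n)) (Real.exp_pos a)] with z hz
    exact radialFn_eq_const ha (mem_ball_zero_iff.1 hz).le
  · have h1 : x ∈ shell n Kᶜ := ⟨hx0, fun h2 => h ⟨hx0, h2⟩⟩
    filter_upwards [(isOpen_shell hK.isOpen_compl).mem_nhds h1] with z hz
    rw [radialFn_of_ne hz.1]
    exact hgK _ hz.2

/-- The operator `-Δ` on radial functions, in the variable `log ‖x‖`. -/
noncomputable def radialNegLap (n : ℕ) (g : ℝ → ℝ) (t : ℝ) : ℝ :=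
  -(Real.exp (-(2 * t)) * (deriv (deriv g) t + (n - 2) * deriv g t))

theorem contDiff_deriv_infty {g : ℝ → ℝ} (hg : ContDiff ℝ ∞ g) : ContDiff ℝ ∞ (deriv g) :=
  (contDiff_infty_iff_deriv.1 hg).2

theorem contDiff_radialNegLap {g : ℝ → ℝ} (hg : ContDiff ℝ ∞ g) :
    ContDiff ℝ ∞ (radialNegLap n g) := by
  have h1 := contDiff_deriv_infty hg
  have h2 := contDiff_deriv_infty h1
  unfold radialNegLap
  fun_prop

theorem negLap_iterate_comp_log_norm {g : ℝ → ℝ} (hg : ContDiff ℝ ∞ g) (k : ℕ)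
    {x : EuclideanSpace ℝ (Fin n)} (hx : x ≠ 0) :
    negLap^[k] (fun z => g (Real.log ‖z‖)) x = (radialNegLap n)^[k] g (Real.log ‖x‖) := by
  induction k generalizing g with
  | zero => rfl
  | succ k ih =>
    rw [Function.iterate_succ_apply, Function.iterate_succ_apply, ← ih (contDiff_radialNegLap hg)]
    refine (negLap_iterate_congr ?_ k).eq_of_nhds
    filter_upwards [isOpen_ne.mem_nhds hx] with z hz
    rw [negLap, laplacian_comp_log_norm (hg.of_le two_le_infty) hz, radialNegLap]
    simp only [mul_comm (2 : ℝ)]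
    rw [Real.exp_neg, mul_comm _ (2 : ℝ), two_mul, Real.exp_add, Real.exp_log (norm_pos_iff.2 hz)]
    ring

theorem negLap_iterate_radialFn {c : ℝ} {g : ℝ → ℝ} (hg : ContDiff ℝ ∞ g) (k : ℕ)
    {x : EuclideanSpace ℝ (Fin n)} (hx : x ≠ 0) :
    negLap^[k] (radialFn n c g) x = (radialNegLap n)^[k] g (Real.log ‖x‖) := by
  rw [(negLap_iterate_congr (radialFn_eventuallyEq hx) k).eq_of_nhds,
    negLap_iterate_comp_log_norm hg k hx]

theorem continuous_mul_of_tsupport {X : Type*} [TopologicalSpace X] {f G : X → ℝ} {U : Set X}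
    (hU : IsOpen U) (hf : Continuous f) (hfU : tsupport f ⊆ U) (hG : ContinuousOn G U) :
    Continuous fun x => f x * G x := by
  rw [continuous_iff_continuousAt]
  intro x
  by_cases hx : x ∈ tsupport f
  · exact hf.continuousAt.mul (hG.continuousAt (hU.mem_nhds (hfU hx)))
  · refine continuousAt_const (y := (0 : ℝ)) |>.congr ?_
    filter_upwards [(isClosed_tsupport f).isOpen_compl.mem_nhds hx] with z hz
    rw [image_eq_zero_of_notMem_tsupport hz, zero_mul]

theorem integrable_mul_of_tsupport {f G : ℝ → ℝ} {I K : Set ℝ} (hI : IsOpen I) (hK : IsCompact K)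
    (hKI : K ⊆ I) (hf : Continuous f) (hfK : tsupport f ⊆ K) (hG : ContinuousOn G I) :
    Integrable fun t => f t * G t := by
  refine (continuous_mul_of_tsupport hI hf (hfK.trans hKI) hG).integrable_of_hasCompactSupport ?_
  refine HasCompactSupport.intro hK fun t ht => ?_
  rw [image_eq_zero_of_notMem_tsupport fun h => ht (hfK h), zero_mul]

theorem ContinuousOn.eq_zero_of_ae {F : ℝ → ℝ} {I : Set ℝ} (hI : IsOpen I) (hF : ContinuousOn F I)
    (hae : ∀ᵐ t, t ∈ I → F t = 0) {t : ℝ} (ht : t ∈ I) : F t = 0 := by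
  by_contra hne
  have hnhds : {s | F s ≠ 0} ∈ 𝓝 t := (hF.continuousAt (hI.mem_nhds ht)).eventually_ne hne
  have hmem : I ∩ {s | F s ≠ 0} ∈ 𝓝 t := inter_mem (hI.mem_nhds ht) hnhds
  have hpos : 0 < volume (I ∩ {s | F s ≠ 0}) := Measure.measure_pos_of_mem_nhds volume hmem
  refine hpos.ne' (measure_mono_null ?_ (ae_iff.1 hae))
  intro s hs
  simp only [mem_ofPred_eq, Classical.not_imp]
  exact ⟨hs.1, hs.2⟩

theorem integral_deriv_mul_of_tsupport {ψ B B' : ℝ → ℝ} {I : Set ℝ} (hI : IsOpen I)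
    (hψ : ContDiff ℝ 1 ψ) (hψc : HasCompactSupport ψ) (hψI : tsupport ψ ⊆ I)
    (hB : ∀ t ∈ I, HasDerivAt B (B' t) t) (hB' : ContinuousOn B' I) :
    ∫ t, deriv ψ t * B t = -∫ t, ψ t * B' t := by
  have hBc : ContinuousOn B I := fun t ht => (hB t ht).continuousAt.continuousWithinAt
  have hmul : ∀ {f F : ℝ → ℝ}, Continuous f → tsupport f ⊆ tsupport ψ → ContinuousOn F I →
      Integrable (fun t => f t * F t) := fun hf hfs hF =>
    integrable_mul_of_tsupport hI hψc hψI hf hfs hF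
  have h1 : Integrable fun t => deriv ψ t * B t :=
    hmul (hψ.continuous_deriv le_rfl) (tsupport_deriv_subset (𝕜 := ℝ)) hBc
  have h2 : Integrable fun t => ψ t * B' t := hmul hψ.continuous subset_rfl hB'
  have h3 : Integrable fun t => ψ t * B t := hmul hψ.continuous subset_rfl hBc
  have hd : ∀ t, HasDerivAt (fun t => ψ t * B t) (deriv ψ t * B t + ψ t * B' t) t := by
    intro t
    by_cases ht : t ∈ tsupport ψ
    · exact (hψ.differentiable (by norm_num) t).hasDerivAt.mul (hB t (hψI ht))
    · have h4 : (fun t => ψ t * B t) =ᶠ[𝓝 t] fun _ => 0 := by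
        filter_upwards [(isClosed_tsupport ψ).isOpen_compl.mem_nhds ht] with z hz
        rw [image_eq_zero_of_notMem_tsupport hz, zero_mul]
      have h5 : deriv ψ t = 0 := image_eq_zero_of_notMem_tsupport
        fun h => ht (tsupport_deriv_subset (𝕜 := ℝ) h)
      rw [image_eq_zero_of_notMem_tsupport ht, h5, zero_mul, zero_mul, zero_add]
      exact (hasDerivAt_const t (0 : ℝ)).congr_of_eventuallyEq h4
  have := integral_eq_zero_of_hasDerivAt_of_integrable hd (h1.add h2) h3
  rw [integral_add h1 h2] at this
  linarith

/-- The spherical integrals of `w` satisfy the radial Laplace equation. -/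
theorem sphereInt_laplacian (hn : 0 < n) {w : EuclideanSpace ℝ (Fin n) → ℝ} {I : Set ℝ}
    (hI : IsOpen I) (hw : ∀ x ∈ shell n I, ContDiffAt ℝ ∞ w x) {t : ℝ} (ht : t ∈ I) :
    sphereInt (radialD (radialD w)) t + (n - 2) * sphereInt (radialD w) t =
      Real.exp (2 * t) * sphereInt (Δ w) t := by
  have hone : (1 : WithTop ℕ∞) ≤ (∞ : WithTop ℕ∞) := le_trans (by norm_num) two_le_infty
  have hr : ∀ x ∈ shell n I, ContDiffAt ℝ ∞ (radialD w) x := fun x hx => contDiffAt_radialD (hw x hx)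
  have hrr : ∀ x ∈ shell n I, ContDiffAt ℝ ∞ (radialD (radialD w)) x :=
    fun x hx => contDiffAt_radialD (hr x hx)
  have hcont : ∀ {v : EuclideanSpace ℝ (Fin n) → ℝ}, (∀ x ∈ shell n I, ContDiffAt ℝ ∞ v x) →
      ContinuousOn v (shell n I) := fun hv x hx => (hv x hx).continuousAt.continuousWithinAt
  have hL : ContinuousOn (Δ w) (shell n I) :=
    hcont fun x hx => contDiffAt_laplacian (hw x hx)
  have hc0 := continuousOn_sphereInt hI (hcont hw)
  have hc1 := continuousOn_sphereInt hI (hcont hr)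
  have hc2 := continuousOn_sphereInt hI (hcont hrr)
  have hcL := continuousOn_sphereInt hI hL
  have hd0 : ∀ t ∈ I, HasDerivAt (sphereInt w) (sphereInt (radialD w) t) t := fun t ht =>
    hasDerivAt_sphereInt hI (fun x hx => (hw x hx).of_le hone) ht
  have hd1 : ∀ t ∈ I, HasDerivAt (sphereInt (radialD w)) (sphereInt (radialD (radialD w)) t) t :=
    fun t ht => hasDerivAt_sphereInt hI (fun x hx => (hr x hx).of_le hone) ht
  set F : ℝ → ℝ := fun t => sphereInt (radialD (radialD w)) t + (n - 2) * sphereInt (radialD w) t -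
      Real.exp (2 * t) * sphereInt (Δ w) t with hF
  have hFc : ContinuousOn F I := by
    refine (hc2.add (continuousOn_const.mul hc1)).sub (ContinuousOn.mul ?_ hcL)
    fun_prop
  -- The equation is proved weakly, by pairing with radial test functions, so `Δ` never has to be
  -- split into a radial and a spherical part. Continuity then turns the a.e. identity into a
  -- pointwise one.
  have hae : ∀ᵐ t, t ∈ I → F t = 0 := by
    refine hI.ae_eq_zero_of_integral_contDiff_smul_eq_zero
      (hFc.locallyIntegrableOn hI.measurableSet) fun ψ hψ hψc hψI => ?_
    have hint : ∀ {f G : ℝ → ℝ}, Continuous f → tsupport f ⊆ tsupport ψ → ContinuousOn G I →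
        Integrable (fun t => f t * G t) := fun hf hfs hG =>
      integrable_mul_of_tsupport hI hψc hψI hf hfs hG
    have hψ1 := contDiff_deriv_infty hψ
    have hψ2 := contDiff_deriv_infty hψ1
    have hs1 : tsupport (deriv ψ) ⊆ tsupport ψ := tsupport_deriv_subset (𝕜 := ℝ)
    have hs2 : tsupport (deriv (deriv ψ)) ⊆ tsupport ψ :=
      (tsupport_deriv_subset (𝕜 := ℝ)).trans hs1
    -- Against the Jacobian `e^{nt}` the factor `e^{-(n-2)t}` leaves the weight `e^{2t}` in front of
    -- `Δ w`, and on the other side it turns the operator on the test function into `-(ψ'' - (n-2)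
    -- ψ')`.
    set η : ℝ → ℝ := fun t => Real.exp (-((n - 2) * t)) * ψ t with hη
    have hηs : ContDiff ℝ ∞ η := by
      rw [hη]; fun_prop
    have hsupp : tsupport η ⊆ tsupport ψ := closure_mono fun t ht h =>
      ht (by simp only [hη, h, mul_zero])
    have hηc : HasCompactSupport η := hψc.of_isClosed_subset (isClosed_tsupport _) hsupp
    obtain ⟨a, ha⟩ := hηc.bddBelow
    have hη0 : ∀ t, t ∉ tsupport ψ → η t = 0 := fun t ht => by
      simp [hη, image_eq_zero_of_notMem_tsupport ht]
    have ha' : ∀ t ≤ a - 1, η t = 0 := fun t hta =>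
      image_eq_zero_of_notMem_tsupport fun h => by linarith [ha h]
    obtain ⟨b, hb⟩ := hηc.bddAbove
    have hb' : ∀ t, b + 1 ≤ t → η t = 0 := fun t hta =>
      image_eq_zero_of_notMem_tsupport fun h => by linarith [hb h]
    have key := integral_negLap_iterate_mul_of_tsupport (isOpen_shell hI) hw
      (contDiff_radialFn hηs ha') (hasCompactSupport_radialFn (n := n) (c := 0) hb')
      ((tsupport_radialFn_subset (isClosed_tsupport ψ) ha' hη0).trans fun x hx =>
        ⟨hx.1, hψI hx.2⟩) 1
    simp only [Function.iterate_one] at key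
    have hnegL : ContinuousOn (negLap w) (shell n I) := hL.neg
    rw [integral_mul_radial hn hI hnegL hηs.continuous hηc (hsupp.trans hψI)
      (fun x hx => radialFn_of_ne hx)] at key
    have hMs : tsupport (radialNegLap n η) ⊆ tsupport η := by
      refine closure_minimal ?_ (isClosed_tsupport _)
      intro t ht
      by_contra h
      apply ht
      have h1 : deriv η t = 0 := image_eq_zero_of_notMem_tsupport
        fun h' => h (tsupport_deriv_subset (𝕜 := ℝ) h')
      have h2 : deriv (deriv η) t = 0 := image_eq_zero_of_notMem_tsupport
        fun h' => h (tsupport_deriv_subset (𝕜 := ℝ) (tsupport_deriv_subset (𝕜 := ℝ) h'))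
      simp [radialNegLap, h1, h2]
    rw [integral_mul_radial (Φ := negLap (radialFn n 0 η)) hn hI (hcont hw) (contDiff_radialNegLap hηs).continuous
      (hηc.of_isClosed_subset (isClosed_tsupport _) hMs) (hMs.trans (hsupp.trans hψI))
      (fun x hx => negLap_iterate_radialFn hηs 1 hx)] at key
    have hη1 : ∀ t, deriv η t = Real.exp (-((n - 2) * t)) * (deriv ψ t - (n - 2) * ψ t) := by
      intro t
      have h1 : HasDerivAt (fun t : ℝ => Real.exp (-((n - 2) * t)))
          (Real.exp (-((n - 2) * t)) * (-((n - 2) * 1))) t :=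
        (((hasDerivAt_id t).const_mul ((n : ℝ) - 2)).neg).exp
      refine (h1.mul (hψ.differentiable (by simp) t).hasDerivAt).deriv.trans ?_
      ring
    have hη2 : ∀ t, deriv (deriv η) t = Real.exp (-((n - 2) * t)) * (deriv (deriv ψ) t -
        2 * (n - 2) * deriv ψ t + (n - 2) ^ 2 * ψ t) := by
      intro t
      have h1 : HasDerivAt (fun t : ℝ => Real.exp (-((n - 2) * t)))
          (Real.exp (-((n - 2) * t)) * (-((n - 2) * 1))) t :=
        (((hasDerivAt_id t).const_mul ((n : ℝ) - 2)).neg).exp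
      rw [show deriv η = fun t => Real.exp (-((n - 2) * t)) * (deriv ψ t - (n - 2) * ψ t) from
        funext hη1]
      refine (h1.mul ((hψ1.differentiable (by simp) t).hasDerivAt.sub
        ((hψ.differentiable (by simp) t).hasDerivAt.const_mul ((n : ℝ) - 2)))).deriv.trans ?_
      simp only [Pi.sub_apply]
      ring
    have hexp : ∀ t : ℝ, Real.exp (n * t) * Real.exp (-((n - 2) * t)) = Real.exp (2 * t) := by
      intro t
      rw [← Real.exp_add]
      ring_nf
    have hexp2 : ∀ t : ℝ, Real.exp (2 * t) * Real.exp (-(2 * t)) = 1 := by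
      intro t
      rw [← Real.exp_add]
      simp
    have e1 : ∀ t, Real.exp (n * t) * (η t * sphereInt (negLap w) t) =
        -(ψ t * (Real.exp (2 * t) * sphereInt (Δ w) t)) := by
      intro t
      have : sphereInt (negLap w) t = -sphereInt (Δ w) t := by
        simp only [sphereInt, negLap, integral_neg]
      rw [this, hη]
      linear_combination (-(ψ t * sphereInt (Δ w) t)) * hexp t
    have e2 : ∀ t, Real.exp (n * t) * (radialNegLap n η t * sphereInt w t) =
        -(deriv (deriv ψ) t * sphereInt w t - (n - 2) * (deriv ψ t * sphereInt w t)) := by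
      intro t
      rw [radialNegLap, hη1, hη2]
      linear_combination (-(Real.exp (-(2 * t)) * (deriv (deriv ψ) t - (n - 2) * deriv ψ t) *
        sphereInt w t)) * hexp t - (deriv (deriv ψ) t - (n - 2) * deriv ψ t) *
          sphereInt w t * hexp2 t
    have e2' : (fun t => Real.exp (n * t) * (radialNegLap n η t * sphereInt w t)) = fun t =>
        -(deriv (deriv ψ) t * sphereInt w t - (n - 2) * (deriv ψ t * sphereInt w t)) := funext e2
    -- `i1` and `i2` move the two derivatives of `ψ''` onto the spherical integrals, and `i3` does
    -- the same for the first-order term.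
    have i1 := integral_deriv_mul_of_tsupport hI (hψ1.of_le hone)
      (hψc.of_isClosed_subset (isClosed_tsupport _) hs1) (hs1.trans hψI) hd0 hc1
    have i2 := integral_deriv_mul_of_tsupport hI (hψ.of_le hone) hψc hψI hd1 hc2
    have i3 := integral_deriv_mul_of_tsupport hI (hψ.of_le hone) hψc hψI hd0 hc1
    simp_rw [e1] at key
    rw [e2', integral_neg, integral_neg, integral_sub (hint hψ2.continuous hs2 hc0)
      ((hint hψ1.continuous hs1 hc0).const_mul _), integral_const_mul] at key
    have hcE : ContinuousOn (fun t => Real.exp (2 * t) * sphereInt (Δ w) t) I := by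
      refine ContinuousOn.mul ?_ hcL
      fun_prop
    have e3 : ∀ t, ψ t • F t = ψ t * sphereInt (radialD (radialD w)) t +
        (n - 2) * (ψ t * sphereInt (radialD w) t) - ψ t * (Real.exp (2 * t) * sphereInt (Δ w) t) := by
      intro t
      simp only [hF, smul_eq_mul]
      ring
    simp_rw [e3]
    have j1 := hint hψ.continuous subset_rfl hc2
    have j2 := (hint hψ.continuous subset_rfl hc1).const_mul ((n : ℝ) - 2)
    have k1 := integral_sub (j1.add j2) (hint hψ.continuous subset_rfl hcE)
    have k2 := integral_add j1 j2
    simp only [Pi.add_apply] at k1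
    rw [k1, k2, integral_const_mul]
    linear_combination key - i1 + i2 + (n - 2) * i3
  have hzero : F t = 0 := hFc.eq_zero_of_ae hI hae ht
  simp only [hF] at hzero
  linarith

end RadialFunctions

/-! ### The radial polyharmonic operator as a polynomial in `d/dt` -/

section DifferentialPolynomials

open Polynomial

/-- The space of smooth functions on the line. -/
def smoothFns : Submodule ℝ (ℝ → ℝ) where
  carrier := {g | ContDiff ℝ ∞ g}
  add_mem' := fun {f g} (h1 : ContDiff ℝ ∞ f) (h2 : ContDiff ℝ ∞ g) => h1.add h2
  zero_mem' := (contDiff_const : ContDiff ℝ ∞ fun _ : ℝ => (0 : ℝ))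
  smul_mem' := fun c f (h : ContDiff ℝ ∞ f) =>
    (contDiff_const (c := c)).smul h

theorem mem_smoothFns {g : ℝ → ℝ} : g ∈ smoothFns ↔ ContDiff ℝ ∞ g := by
  change g ∈ {g : ℝ → ℝ | ContDiff ℝ ∞ g} ↔ _
  rw [mem_ofPred_eq]

theorem contDiff_smoothFns (g : smoothFns) : ContDiff ℝ ∞ (g : ℝ → ℝ) := mem_smoothFns.1 g.2

/-- Differentiation of smooth functions. -/
noncomputable def smoothDeriv : Module.End ℝ smoothFns where
  toFun g := ⟨deriv g.1, mem_smoothFns.2 (contDiff_deriv_infty (contDiff_smoothFns g))⟩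
  map_add' f g := Subtype.ext <| funext fun t =>
    deriv_add ((contDiff_smoothFns f).differentiable (by simp) t) ((contDiff_smoothFns g).differentiable (by simp) t)
  map_smul' c g := Subtype.ext <| funext fun t =>
    deriv_const_smul c ((contDiff_smoothFns g).differentiable (by simp) t)

/-- The constant coefficient differential operator `q(d/dt)`. -/
noncomputable def diffOp (q : ℝ[X]) (g : smoothFns) : smoothFns := aeval smoothDeriv q g

theorem diffOp_mul (p q : ℝ[X]) (g : smoothFns) : diffOp (p * q) g = diffOp p (diffOp q g) := by
  simp [diffOp, aeval_mul]

theorem diffOp_add (p q : ℝ[X]) (g : smoothFns) : diffOp (p + q) g = diffOp p g + diffOp q g := by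
  simp [diffOp]

theorem diffOp_X (g : smoothFns) : (diffOp X g : ℝ → ℝ) = deriv g := by
  simp [diffOp, smoothDeriv]

theorem diffOp_C (c : ℝ) (g : smoothFns) : diffOp (C c) g = c • g := by
  simp [diffOp]

theorem diffOp_sub_arg (q : ℝ[X]) (f g : smoothFns) :
    diffOp q (f - g) = diffOp q f - diffOp q g := map_sub _ _ _

theorem diffOp_smul_arg (q : ℝ[X]) (c : ℝ) (g : smoothFns) :
    diffOp q (c • g) = c • diffOp q g := map_smul _ _ _

theorem tsupport_diffOp_subset (q : ℝ[X]) (g : smoothFns) :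
    tsupport (diffOp q g : ℝ → ℝ) ⊆ tsupport (g : ℝ → ℝ) := by
  induction q using Polynomial.induction_on' with
  | add p q hp hq =>
    rw [diffOp_add]
    exact (tsupport_add (diffOp p g).1 (diffOp q g).1).trans (union_subset hp hq)
  | monomial k a =>
    induction k generalizing a with
    | zero =>
      rw [monomial_zero_left, diffOp_C]
      exact closure_mono fun t ht h => ht (by simp [h])
    | succ k ih =>
      rw [← X_mul_monomial, diffOp_mul]
      rw [diffOp_X]
      exact (tsupport_deriv_subset (𝕜 := ℝ)).trans (ih a)

theorem diffOp_comp_sub (q : ℝ[X]) (g : smoothFns) (a : ℝ) (h : smoothFns)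
    (hh : (h : ℝ → ℝ) = fun t => (g : ℝ → ℝ) (t - a)) :
    (diffOp q h : ℝ → ℝ) = fun t => (diffOp q g : ℝ → ℝ) (t - a) := by
  induction q using Polynomial.induction_on' with
  | add p q hp hq =>
    rw [diffOp_add, diffOp_add]
    funext t
    simp [hp, hq]
  | monomial k c =>
    induction k generalizing c with
    | zero =>
      rw [monomial_zero_left, diffOp_C, diffOp_C]
      funext t
      simp [hh]
    | succ k ih =>
      rw [← X_mul_monomial, diffOp_mul, diffOp_mul, diffOp_X, diffOp_X, ih]
      funext t
      rw [deriv_comp_sub_const]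

/-- Write `q = X r + q(0)`. The first summand applied to `g` is the derivative of a compactly
supported function, so it integrates to zero. -/
theorem integral_diffOp (q : ℝ[X]) (g : smoothFns) (hg : HasCompactSupport (g : ℝ → ℝ)) :
    ∫ t, (diffOp q g : ℝ → ℝ) t = q.eval 0 * ∫ t, (g : ℝ → ℝ) t := by
  have hcs : ∀ q : ℝ[X], HasCompactSupport (diffOp q g : ℝ → ℝ) := fun q =>
    hg.of_isClosed_subset (isClosed_tsupport _) (tsupport_diffOp_subset q g)
  have hint : ∀ q : ℝ[X], Integrable (diffOp q g : ℝ → ℝ) := fun q =>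
    (contDiff_smoothFns (diffOp q g)).continuous.integrable_of_hasCompactSupport (hcs q)
  obtain ⟨r, hr⟩ : ∃ r, q = X * r + C (q.eval 0) := ⟨q.divX, by
    rw [← coeff_zero_eq_eval_zero, X_mul_divX_add]⟩
  have h1 : ∫ t, (diffOp (X * r) g : ℝ → ℝ) t = 0 := by
    have h2 : (diffOp (X * r) g : ℝ → ℝ) = deriv (diffOp r g : ℝ → ℝ) := by
      rw [diffOp_mul, diffOp_X]
    refine integral_eq_zero_of_hasDerivAt_of_integrable (f := (diffOp r g : ℝ → ℝ))
      (fun t => ?_) (hint _) (hint r)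
    rw [h2]
    exact ((contDiff_smoothFns (diffOp r g)).differentiable (by simp) t).hasDerivAt
  conv_lhs => rw [hr]
  rw [diffOp_add, diffOp_C]
  have h3 := integral_add (hint (X * r)) ((hint 1).const_mul (q.eval 0))
  have h4 : (diffOp 1 g) = g := by simp [diffOp]
  rw [h4, h1, integral_const_mul, zero_add] at h3
  exact h3

/-- The polynomial of the radial polyharmonic operator `Δᵏ` in the variable `log ‖x‖`. -/
noncomputable def polyharmonicPoly (n k : ℕ) : ℝ[X] :=
  ∏ j ∈ Finset.range k, ((X - C (2 * j : ℝ)) * (X + C ((n : ℝ) - 2 - 2 * j)))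

/-- Conjugation by `e^{-2kt}` shifts `d/dt` by `-2k`. Hence the next factor of `-Δ` contributes `(X
- 2k)(X + n - 2 - 2k)` and one more `e^{-2t}`. -/
theorem radialNegLap_iterate (n k : ℕ) (g : smoothFns) (t : ℝ) :
    (radialNegLap n)^[k] (g : ℝ → ℝ) t =
      (-1) ^ k * (Real.exp (-(2 * k * t)) * (diffOp (polyharmonicPoly n k) g : ℝ → ℝ) t) := by
  induction k generalizing t with
  | zero => simp [polyharmonicPoly, diffOp]
  | succ k ih =>
    set G := diffOp (polyharmonicPoly n k) g with hG
    have hG1 := contDiff_deriv_infty (contDiff_smoothFns G)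
    have hexp : ∀ t : ℝ, HasDerivAt (fun t : ℝ => Real.exp (-(2 * k * t)))
        (Real.exp (-(2 * k * t)) * (-(2 * k * 1))) t := fun t =>
      ((hasDerivAt_id t).const_mul (2 * (k : ℝ))).neg.exp
    have e0 : (radialNegLap n)^[k] (g : ℝ → ℝ) =
        fun t => (-1) ^ k * (Real.exp (-(2 * k * t)) * (G : ℝ → ℝ) t) := funext ih
    have e1 : deriv ((radialNegLap n)^[k] (g : ℝ → ℝ)) = fun t => (-1) ^ k *
        (Real.exp (-(2 * k * t)) * (deriv (G : ℝ → ℝ) t - 2 * k * (G : ℝ → ℝ) t)) := by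
      funext t
      rw [e0]
      refine (((hexp t).mul ((contDiff_smoothFns G).differentiable (by simp) t).hasDerivAt).const_mul _).deriv.trans ?_
      ring
    have e2 : deriv (deriv ((radialNegLap n)^[k] (g : ℝ → ℝ))) t = (-1) ^ k *
        (Real.exp (-(2 * k * t)) * (deriv (deriv (G : ℝ → ℝ)) t - 4 * k * deriv (G : ℝ → ℝ) t +
          4 * k ^ 2 * (G : ℝ → ℝ) t)) := by
      rw [e1]
      refine (((hexp t).mul ((hG1.differentiable (by simp) t).hasDerivAt.sub
        (((contDiff_smoothFns G).differentiable (by simp) t).hasDerivAt.const_mul (2 * (k : ℝ))))).const_mul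
          _).deriv.trans ?_
      simp only [Pi.sub_apply]
      ring
    have e3 : (diffOp (polyharmonicPoly n (k + 1)) g : ℝ → ℝ) t =
        deriv (deriv (G : ℝ → ℝ)) t + (n - 2 - 4 * k) * deriv (G : ℝ → ℝ) t +
          (4 * k ^ 2 - 2 * k * (n - 2)) * (G : ℝ → ℝ) t := by
      have e4 : polyharmonicPoly n (k + 1) = (X * X + C ((n : ℝ) - 2 - 4 * k) * X +
          C (4 * (k : ℝ) ^ 2 - 2 * k * (n - 2))) * polyharmonicPoly n k := by
        rw [polyharmonicPoly, Finset.prod_range_succ, mul_comm _ (_ * _)]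
        congr 1
        simp only [map_sub, map_mul, map_pow, map_natCast, map_ofNat]
        ring
      rw [e4, diffOp_mul, diffOp_add, diffOp_add, diffOp_mul, diffOp_mul, diffOp_C, diffOp_C]
      have e5 : (diffOp X (diffOp X G) : ℝ → ℝ) = deriv (deriv (G : ℝ → ℝ)) := by
        rw [diffOp_X, diffOp_X]
      simp only [← hG, Submodule.coe_add, Submodule.coe_smul, Pi.add_apply, Pi.smul_apply,
        smul_eq_mul, e5, diffOp_X]
    have e6 : Real.exp (-(2 * ((k + 1 : ℕ) : ℝ) * t)) =
        Real.exp (-(2 * t)) * Real.exp (-(2 * k * t)) := by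
      rw [← Real.exp_add]
      push_cast
      ring_nf
    rw [Function.iterate_succ_apply', radialNegLap, e2, e1, e3, e6, pow_succ]
    ring

/-- In the critical dimension the factor `X - 2j` at `j = 0` and the factor `X + n - 2 - 2j` at `j =
k` both equal `X`: constants and `log ‖x‖` are both annihilated. At zero the remaining factors run
twice through `2, 4, …, 2k`, up to sign. -/
theorem polyharmonicPoly_eq (k : ℕ) :
    ∃ S : ℝ[X], polyharmonicPoly (2 * k + 2) (k + 1) = S * (X * X) ∧
      S.eval 0 = (-1) ^ k * ((((2 * k + 2 - 2)‼ : ℕ) : ℝ)) ^ 2 := by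
  refine ⟨(∏ j ∈ Finset.range k, (X - C (2 * ((j + 1 : ℕ) : ℝ)))) *
    ∏ j ∈ Finset.range k, (X + C (2 * ((k - j : ℕ) : ℝ))), ?_, ?_⟩
  · rw [polyharmonicPoly, Finset.prod_mul_distrib, Finset.prod_range_succ', Finset.prod_range_succ]
    have h : ∏ j ∈ Finset.range k, (X + C ((((2 * k + 2 : ℕ) : ℝ)) - 2 - 2 * j)) =
        ∏ j ∈ Finset.range k, (X + C (2 * ((k - j : ℕ) : ℝ))) := by
      refine Finset.prod_congr rfl fun j hj => ?_
      rw [Nat.cast_sub (Finset.mem_range.1 hj).le]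
      congr 2
      push_cast
      ring
    rw [h]
    have h0 : (((2 * k + 2 : ℕ) : ℝ)) - 2 - 2 * k = 0 := by push_cast; ring
    rw [h0]
    simp
    ring
  · rw [eval_mul, eval_prod, eval_prod]
    simp only [eval_sub, eval_X, eval_C, eval_add, zero_sub, zero_add]
    have h1 : ∏ j ∈ Finset.range k, -(2 * ((j + 1 : ℕ) : ℝ)) = (-1) ^ k * (2 ^ k * (k ! : ℕ)) := by
      rw [Finset.prod_neg, Finset.prod_mul_distrib, ← Nat.cast_prod, Finset.prod_range_add_one_eq_factorial]
      simp
    have h2 : ∏ j ∈ Finset.range k, (2 * ((k - j : ℕ) : ℝ)) = 2 ^ k * (k ! : ℕ) := by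
      rw [← Finset.prod_range_reflect, ← Finset.prod_range_add_one_eq_factorial, Nat.cast_prod,
        Finset.prod_mul_distrib]
      simp only [Finset.prod_const, Finset.card_range]
      congr 1
      refine Finset.prod_congr rfl fun j hj => ?_
      have := Finset.mem_range.1 hj
      congr 1
      omega
    rw [h1, h2, show 2 * k + 2 - 2 = 2 * k by omega, Nat.doubleFactorial_two_mul]
    push_cast
    ring

end DifferentialPolynomials

/-! ### A cutoff linear in the logarithmic variable -/

section Cutoff

/-- A smooth function that vanishes for `s ≤ 0` and equals `s` for `1 ≤ s`. -/
noncomputable def smoothRamp (s : ℝ) : ℝ := s * Real.smoothTransition s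

theorem contDiff_smoothRamp : ContDiff ℝ ∞ smoothRamp :=
  contDiff_id.mul Real.smoothTransition.contDiff

theorem smoothRamp_of_nonpos {s : ℝ} (hs : s ≤ 0) : smoothRamp s = 0 := by
  rw [smoothRamp, Real.smoothTransition.zero_of_nonpos hs, mul_zero]

theorem smoothRamp_of_one_le {s : ℝ} (hs : 1 ≤ s) : smoothRamp s = s := by
  rw [smoothRamp, Real.smoothTransition.one_of_one_le hs, mul_one]

theorem smoothRamp_nonneg (s : ℝ) : 0 ≤ smoothRamp s := by
  rcases le_total s 0 with hs | hs
  · rw [smoothRamp_of_nonpos hs]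
  · exact mul_nonneg hs (Real.smoothTransition.nonneg s)

theorem smoothRamp_le {s : ℝ} (hs : 0 ≤ s) : smoothRamp s ≤ s :=
  mul_le_of_le_one_right hs (Real.smoothTransition.le_one s)

theorem sub_one_le_smoothRamp (s : ℝ) : s - 1 ≤ smoothRamp s := by
  rcases le_total s 1 with hs | hs
  · linarith [smoothRamp_nonneg s]
  · rw [smoothRamp_of_one_le hs]; linarith

/-- A cutoff in the variable `ε t`, equal to `1` before `T` and to `0` after `T + L + 1`, with
slope of order `1 / L`. -/
noncomputable def cutoffProfile (ε T L t : ℝ) : ℝ :=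
  1 - (smoothRamp (ε * t - T) - smoothRamp (ε * t - (T + L))) / L

theorem contDiff_cutoffProfile (ε T L : ℝ) : ContDiff ℝ ∞ (cutoffProfile ε T L) := by
  have h := contDiff_smoothRamp
  unfold cutoffProfile
  refine contDiff_const.sub (ContDiff.div_const (ContDiff.sub ?_ ?_) _)
  · exact h.comp (by fun_prop)
  · exact h.comp (by fun_prop)

theorem cutoffProfile_eq_one {ε T L t : ℝ} (hL : 0 ≤ L) (ht : ε * t ≤ T) :
    cutoffProfile ε T L t = 1 := by
  rw [cutoffProfile, smoothRamp_of_nonpos (by linarith), smoothRamp_of_nonpos (by linarith)]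
  simp

theorem cutoffProfile_eq_zero {ε T L t : ℝ} (hL : 0 < L) (ht : T + L + 1 ≤ ε * t) :
    cutoffProfile ε T L t = 0 := by
  rw [cutoffProfile, smoothRamp_of_one_le (by linarith), smoothRamp_of_one_le (by linarith)]
  field_simp
  ring

/-- The bound does not depend on `L`, which makes dominated convergence available as `L → ∞`. -/
theorem abs_cutoffProfile_le {L : ℝ} (hL : 1 ≤ L) (ε T t : ℝ) : |cutoffProfile ε T L t| ≤ 2 := by
  have hL0 : 0 < L := by linarith
  set a := ε * t - T with ha
  have hb : ε * t - (T + L) = a - L := by rw [ha]; ring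
  rw [cutoffProfile, hb, ← ha]
  have h1 : smoothRamp a - smoothRamp (a - L) ≤ L + 1 := by
    have h2 := sub_one_le_smoothRamp (a - L)
    have h3 := smoothRamp_nonneg (a - L)
    rcases le_total 0 a with h | h
    · have := smoothRamp_le h
      linarith
    · rw [smoothRamp_of_nonpos h]; linarith
  have h2 : -1 ≤ smoothRamp a - smoothRamp (a - L) := by
    have h3 := sub_one_le_smoothRamp a
    rcases le_total 0 (a - L) with h | h
    · have := smoothRamp_le h
      linarith
    · rw [smoothRamp_of_nonpos h]; linarith [smoothRamp_nonneg a]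
  have h3 : (smoothRamp a - smoothRamp (a - L)) / L ≤ 2 := by
    rw [div_le_iff₀ hL0]; linarith
  have h4 : -1 ≤ (smoothRamp a - smoothRamp (a - L)) / L := by
    rw [le_div_iff₀ hL0]; linarith
  rw [abs_le]
  constructor <;> linarith

/-- At a fixed point the second ramp vanishes once `L` is large, and the first is a fixed number
divided by `L`. -/
theorem tendsto_cutoffProfile (ε T t : ℝ) :
    Tendsto (fun L => cutoffProfile ε T L t) atTop (𝓝 1) := by
  have h : Tendsto (fun L : ℝ => 1 - smoothRamp (ε * t - T) / L) atTop (𝓝 (1 - 0)) :=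
    tendsto_const_nhds.sub (tendsto_const_nhds.div_atTop tendsto_id)
  rw [sub_zero] at h
  refine h.congr' ?_
  filter_upwards [eventually_ge_atTop (ε * t - T)] with L hL
  rw [cutoffProfile, smoothRamp_of_nonpos (s := ε * t - (T + L)) (by linarith), sub_zero]

end Cutoff

/-! ### The bump kernel produced by a ramp -/

section Kernel

open Polynomial

/-- `smoothRamp (ε t - c)` as a smooth function. -/
noncomputable def rampFn (ε c : ℝ) : smoothFns :=
  ⟨fun t => smoothRamp (ε * t - c), mem_smoothFns.2 (contDiff_smoothRamp.comp (by fun_prop))⟩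

/-- The kernel obtained by applying the polyharmonic operator to the ramp. -/
noncomputable def rampKernel (n k : ℕ) (ε : ℝ) : ℝ → ℝ :=
  (diffOp (polyharmonicPoly n k) (rampFn ε 0) : ℝ → ℝ)

variable {ε : ℝ}

/-- Off the interval `0 ≤ ε t ≤ 1` the ramp is locally linear, so its second derivative vanishes
there. -/
theorem tsupport_diffOp_XX_ramp (ε : ℝ) :
    tsupport (diffOp (X * X) (rampFn ε 0) : ℝ → ℝ) ⊆ {t | ε * t ∈ Icc (0 : ℝ) 1} := by
  have hcl : IsClosed {t : ℝ | ε * t ∈ Icc (0 : ℝ) 1} :=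
    isClosed_Icc.preimage (f := fun t : ℝ => ε * t) (by fun_prop)
  refine closure_minimal (fun t ht => ?_) hcl
  by_contra hmem
  apply ht
  have hcont : Continuous fun t : ℝ => ε * t := by fun_prop
  have e : (diffOp (X * X) (rampFn ε 0) : ℝ → ℝ) = deriv (deriv (rampFn ε 0 : ℝ → ℝ)) := by
    rw [diffOp_mul, diffOp_X, diffOp_X]
  rw [e]
  have hlin : ∃ a : ℝ, (rampFn ε 0 : ℝ → ℝ) =ᶠ[𝓝 t] fun t => a * t := by
    by_cases h : ε * t < 0
    · refine ⟨0, ?_⟩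
      filter_upwards [hcont.continuousAt.eventually_lt_const h] with s hs
      simp only [rampFn, zero_mul]
      exact smoothRamp_of_nonpos (by linarith)
    · have h' : 1 < ε * t := by
        by_contra h2
        exact hmem ⟨not_lt.1 h, not_lt.1 h2⟩
      refine ⟨ε, ?_⟩
      filter_upwards [hcont.continuousAt.eventually_const_lt h'] with s hs
      simp only [rampFn]
      rw [sub_zero, smoothRamp_of_one_le hs.le]
  obtain ⟨a, ha⟩ := hlin
  have h1 : deriv (rampFn ε 0 : ℝ → ℝ) =ᶠ[𝓝 t] fun _ => a := by
    filter_upwards [ha.eventuallyEq_nhds] with s hs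
    rw [hs.deriv_eq]
    simp
  rw [h1.deriv_eq]
  simp

/-- The slope of the ramp increases by 1 from left to right: from 0 to 1 if `ε = 1`, from -1 to 0 if
`ε = -1`. -/
theorem integral_diffOp_XX_ramp (hε : ε = 1 ∨ ε = -1) :
    ∫ t, (diffOp (X * X) (rampFn ε 0) : ℝ → ℝ) t = 1 := by
  have e : (diffOp (X * X) (rampFn ε 0) : ℝ → ℝ) = deriv (deriv (rampFn ε 0 : ℝ → ℝ)) := by
    rw [diffOp_mul, diffOp_X, diffOp_X]
  have hcs : HasCompactSupport (diffOp (X * X) (rampFn ε 0) : ℝ → ℝ) := by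
    refine (isCompact_Icc (a := (-1 : ℝ)) (b := 1)).of_isClosed_subset (isClosed_tsupport _) ?_
    refine (tsupport_diffOp_XX_ramp ε).trans fun t ht => ?_
    have h1 : 0 ≤ ε * t := ht.1
    have h2 : ε * t ≤ 1 := ht.2
    rcases hε with rfl | rfl <;> constructor <;> linarith
  have hint := (contDiff_smoothFns (diffOp (X * X) (rampFn ε 0))).continuous.integrable_of_hasCompactSupport
    (μ := volume) hcs
  rw [e] at hint ⊢
  have hsm := contDiff_deriv_infty (contDiff_smoothFns (rampFn ε 0))
  have hd : ∀ t, HasDerivAt (deriv (rampFn ε 0 : ℝ → ℝ)) (deriv (deriv (rampFn ε 0 : ℝ → ℝ)) t) t :=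
    fun t => (hsm.differentiable (by simp) t).hasDerivAt
  have hneg : ∀ t, ε * t < 0 → deriv (rampFn ε 0 : ℝ → ℝ) t = 0 := by
    intro t ht
    have hcont : Continuous fun t : ℝ => ε * t := by fun_prop
    have h : (rampFn ε 0 : ℝ → ℝ) =ᶠ[𝓝 t] fun _ => 0 := by
      filter_upwards [hcont.continuousAt.eventually_lt_const ht] with s hs
      exact smoothRamp_of_nonpos (by linarith)
    rw [h.deriv_eq]
    simp
  have hpos : ∀ t, 1 < ε * t → deriv (rampFn ε 0 : ℝ → ℝ) t = ε := by
    intro t ht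
    have hcont : Continuous fun t : ℝ => ε * t := by fun_prop
    have h : (rampFn ε 0 : ℝ → ℝ) =ᶠ[𝓝 t] fun t => ε * t := by
      filter_upwards [hcont.continuousAt.eventually_const_lt ht] with s hs
      simp only [rampFn]
      rw [sub_zero, smoothRamp_of_one_le hs.le]
    rw [h.deriv_eq]
    simp
  rcases hε with rfl | rfl
  · have hbot : Tendsto (deriv (rampFn 1 0 : ℝ → ℝ)) atBot (𝓝 0) := by
      refine tendsto_const_nhds.congr' ?_
      filter_upwards [eventually_lt_atBot 0] with t ht
      exact (hneg t (by linarith)).symm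
    have htop : Tendsto (deriv (rampFn 1 0 : ℝ → ℝ)) atTop (𝓝 1) := by
      refine tendsto_const_nhds.congr' ?_
      filter_upwards [eventually_gt_atTop 1] with t ht
      exact (hpos t (by linarith)).symm
    rw [integral_of_hasDerivAt_of_tendsto hd hint hbot htop]
    norm_num
  · have hbot : Tendsto (deriv (rampFn (-1) 0 : ℝ → ℝ)) atBot (𝓝 (-1)) := by
      refine tendsto_const_nhds.congr' ?_
      filter_upwards [eventually_lt_atBot (-1)] with t ht
      exact (hpos t (by linarith)).symm
    have htop : Tendsto (deriv (rampFn (-1) 0 : ℝ → ℝ)) atTop (𝓝 0) := by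
      refine tendsto_const_nhds.congr' ?_
      filter_upwards [eventually_gt_atTop 0] with t ht
      exact (hneg t (by linarith)).symm
    rw [integral_of_hasDerivAt_of_tendsto hd hint hbot htop]
    norm_num

theorem continuous_rampKernel (n k : ℕ) : Continuous (rampKernel n k ε) :=
  (contDiff_smoothFns _).continuous

theorem tsupport_rampKernel (ε : ℝ) (k : ℕ) :
    tsupport (rampKernel (2 * k + 2) (k + 1) ε) ⊆ {t | ε * t ∈ Icc (0 : ℝ) 1} := by
  obtain ⟨S, hS, -⟩ := polyharmonicPoly_eq k
  rw [rampKernel, hS, diffOp_mul]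
  exact (tsupport_diffOp_subset S _).trans (tsupport_diffOp_XX_ramp ε)

theorem hasCompactSupport_rampKernel (hε : ε = 1 ∨ ε = -1) (k : ℕ) :
    HasCompactSupport (rampKernel (2 * k + 2) (k + 1) ε) := by
  refine (isCompact_Icc (a := (-1 : ℝ)) (b := 1)).of_isClosed_subset (isClosed_tsupport _) ?_
  refine (tsupport_rampKernel ε k).trans fun t ht => ?_
  have h1 : 0 ≤ ε * t := ht.1
  have h2 : ε * t ≤ 1 := ht.2
  rcases hε with rfl | rfl <;> constructor <;> linarith

/-- After the double root has been used to form the second derivative of the ramp, the other factors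
act on the integral only through their value at 0. The constant `((n-2)!!)²` of the theorem enters
here. -/
theorem integral_rampKernel (hε : ε = 1 ∨ ε = -1) (k : ℕ) :
    ∫ t, rampKernel (2 * k + 2) (k + 1) ε t = (-1) ^ k * (((2 * k + 2 - 2)‼ : ℕ) : ℝ) ^ 2 := by
  obtain ⟨S, hS, hS0⟩ := polyharmonicPoly_eq k
  rw [rampKernel, hS, diffOp_mul, integral_diffOp, integral_diffOp_XX_ramp hε, hS0, mul_one]
  refine (isCompact_Icc (a := (-1 : ℝ)) (b := 1)).of_isClosed_subset (isClosed_tsupport _) ?_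
  refine (tsupport_diffOp_XX_ramp ε).trans fun t ht => ?_
  have h1 : 0 ≤ ε * t := ht.1
  have h2 : ε * t ≤ 1 := ht.2
  rcases hε with rfl | rfl <;> constructor <;> linarith

/-- The polyharmonic operator applied to the cutoff is a difference of two translated kernels. -/
theorem radialNegLap_iterate_cutoffProfile (hε : ε = 1 ∨ ε = -1) (k : ℕ) (T L t : ℝ) :
    (radialNegLap (2 * k + 2))^[k + 1] (cutoffProfile ε T L) t =
      (-1) ^ (k + 1) * (Real.exp (-((2 * k + 2 : ℕ) * t)) *
        ((rampKernel (2 * k + 2) (k + 1) ε (t - ε * (T + L)) -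
          rampKernel (2 * k + 2) (k + 1) ε (t - ε * T)) / L)) := by
  have hε2 : ε * ε = 1 := by rcases hε with rfl | rfl <;> norm_num
  have hshift : ∀ c : ℝ, (diffOp (polyharmonicPoly (2 * k + 2) (k + 1)) (rampFn ε c) : ℝ → ℝ) =
      fun t => rampKernel (2 * k + 2) (k + 1) ε (t - ε * c) := by
    intro c
    refine diffOp_comp_sub _ (rampFn ε 0) (ε * c) (rampFn ε c) ?_
    funext t
    simp only [rampFn]
    congr 1
    linear_combination c * hε2
  -- The constant in the cutoff is killed by a factor `X`, so only the two ramps contribute.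
  let one : smoothFns := ⟨fun _ => 1, mem_smoothFns.2 contDiff_const⟩
  have h1 : diffOp (polyharmonicPoly (2 * k + 2) (k + 1)) one = 0 := by
    obtain ⟨S, hS, -⟩ := polyharmonicPoly_eq k
    have h2 : diffOp X one = 0 := by
      refine Subtype.ext ?_
      rw [diffOp_X]
      funext t
      exact deriv_const t 1
    rw [hS, diffOp_mul, diffOp_mul, h2]
    simp [diffOp]
  let g : smoothFns := one - L⁻¹ • (rampFn ε T - rampFn ε (T + L))
  have hg : (g : ℝ → ℝ) = cutoffProfile ε T L := by
    funext t
    simp only [g, one, rampFn, cutoffProfile, Submodule.coe_sub, Submodule.coe_smul, Pi.sub_apply,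
      Pi.smul_apply, smul_eq_mul]
    ring
  rw [← hg, radialNegLap_iterate]
  have h3 : (diffOp (polyharmonicPoly (2 * k + 2) (k + 1)) g : ℝ → ℝ) t =
      (rampKernel (2 * k + 2) (k + 1) ε (t - ε * (T + L)) -
          rampKernel (2 * k + 2) (k + 1) ε (t - ε * T)) / L := by
    simp only [g, diffOp_sub_arg, diffOp_smul_arg, h1, Submodule.coe_sub, Submodule.coe_smul,
      Pi.sub_apply, Pi.smul_apply, smul_eq_mul, hshift, Submodule.coe_zero, Pi.zero_apply]
    ring
  rw [h3]
  congr 3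
  push_cast
  ring

end Kernel

/-! ### Pairing a function with the operator applied to the cutoff -/

section Pairing

variable {ε : ℝ}

/-- The pairing of `w` with the polyharmonic operator applied to the cutoff. -/
noncomputable def cutoffPairing (k : ℕ) (ε T c L : ℝ)
    (w : EuclideanSpace ℝ (Fin (2 * k + 2)) → ℝ) : ℝ :=
  ∫ x, w x * negLap^[k + 1] (radialFn (2 * k + 2) c (cutoffProfile ε T L)) x

theorem tsupport_rampKernel_comp_sub (hε : ε = 1 ∨ ε = -1) (k : ℕ) (s : ℝ) :
    tsupport (fun t => rampKernel (2 * k + 2) (k + 1) ε (t - ε * s)) ⊆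
      {t | ε * t ∈ Icc s (s + 1)} := by
  have hε2 : ε * ε = 1 := by rcases hε with rfl | rfl <;> norm_num
  have hcl : IsClosed {t : ℝ | ε * t ∈ Icc s (s + 1)} :=
    isClosed_Icc.preimage (f := fun t : ℝ => ε * t) (by fun_prop)
  refine closure_minimal (fun t ht => ?_) hcl
  have h1 := tsupport_rampKernel ε k (subset_tsupport _ ht)
  have h2 : ε * (t - ε * s) = ε * t - s := by linear_combination -s * hε2
  simp only [mem_ofPred_eq, h2, mem_Icc] at h1 ⊢
  constructor <;> linarith [h1.1, h1.2]

theorem isCompact_mul_mem_Icc (hε : ε = 1 ∨ ε = -1) (a b : ℝ) :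
    IsCompact {t : ℝ | ε * t ∈ Icc a b} := by
  have hcl : IsClosed {t : ℝ | ε * t ∈ Icc a b} :=
    isClosed_Icc.preimage (f := fun t : ℝ => ε * t) (by fun_prop)
  refine (isCompact_Icc (a := min a (-b)) (b := max b (-a))).of_isClosed_subset hcl ?_
  intro t ht
  have h1 : a ≤ ε * t := ht.1
  have h2 : ε * t ≤ b := ht.2
  rcases hε with rfl | rfl
  · exact ⟨(min_le_left _ _).trans (by linarith), le_max_of_le_left (by linarith)⟩
  · exact ⟨(min_le_right _ _).trans (by linarith), le_max_of_le_right (by linarith)⟩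

theorem isOpen_mul_gt (ε T : ℝ) : IsOpen {t : ℝ | T < ε * t} :=
  isOpen_Ioi.preimage (f := fun t : ℝ => ε * t) (by fun_prop)

theorem integrable_rampKernel_mul (hε : ε = 1 ∨ ε = -1) (k : ℕ) {T s : ℝ} {B : ℝ → ℝ}
    (hB : ContinuousOn B {t | T < ε * t}) (hs : T < s) :
    Integrable fun t => rampKernel (2 * k + 2) (k + 1) ε (t - ε * s) * B t := by
  refine integrable_mul_of_tsupport (isOpen_mul_gt ε T) (isCompact_mul_mem_Icc hε s (s + 1))
    (fun t ht => hs.trans_le ht.1) ?_ (tsupport_rampKernel_comp_sub hε k s) hB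
  exact (continuous_rampKernel _ _).comp (by fun_prop)

/-- Pairing with the translated kernel is, up to a bounded error, evaluation. -/
theorem abs_integral_rampKernel_mul_sub_le (hε : ε = 1 ∨ ε = -1) (k : ℕ) {T C s : ℝ} {B : ℝ → ℝ}
    (hB : ContinuousOn B {t | T < ε * t}) (hs : T < s)
    (hosc : ∀ τ ∈ Icc (0 : ℝ) 1, |B (ε * (s + τ)) - B (ε * s)| ≤ C) :
    |(∫ t, rampKernel (2 * k + 2) (k + 1) ε (t - ε * s) * B t) -
      (-1) ^ k * (((2 * k + 2 - 2)‼ : ℕ) : ℝ) ^ 2 * B (ε * s)| ≤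
      C * ∫ t, |rampKernel (2 * k + 2) (k + 1) ε t| := by
  have hε2 : ε * ε = 1 := by rcases hε with rfl | rfl <;> norm_num
  set K := rampKernel (2 * k + 2) (k + 1) ε with hK
  have hKint : Integrable K := (continuous_rampKernel _ _).integrable_of_hasCompactSupport
    (hasCompactSupport_rampKernel hε k)
  have e1 : ∫ t, K (t - ε * s) * B t = ∫ t, K t * B (t + ε * s) := by
    rw [← integral_add_right_eq_self (fun t => K (t - ε * s) * B t) (ε * s)]
    simp only [add_sub_cancel_right]
  have i1 : Integrable fun t => K t * B (t + ε * s) := by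
    have := (integrable_rampKernel_mul hε k hB hs).comp_add_right (ε * s)
    simpa only [add_sub_cancel_right] using this
  rw [e1, ← integral_rampKernel hε k, ← integral_mul_const, ← integral_sub i1 (hKint.mul_const _),
    ← integral_const_mul, ← Real.norm_eq_abs]
  refine norm_integral_le_of_norm_le (hKint.abs.const_mul C) (ae_of_all _ fun t => ?_)
  rw [← mul_sub, norm_mul, Real.norm_eq_abs, Real.norm_eq_abs, mul_comm C]
  by_cases ht : t ∈ tsupport K
  · refine mul_le_mul_of_nonneg_left ?_ (abs_nonneg _)
    have h1 := hosc (ε * t) (tsupport_rampKernel ε k ht)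
    have h2 : ε * (s + ε * t) = t + ε * s := by linear_combination t * hε2
    rwa [h2] at h1
  · rw [image_eq_zero_of_notMem_tsupport ht]
    simp

/-- The Jacobian `e^{nt}` cancels the factor `e^{-nt}` of the operator, leaving two unweighted
one-dimensional integrals against translates of the same kernel. -/
theorem cutoffPairing_eq (hε : ε = 1 ∨ ε = -1) (k : ℕ) {T₀ T c L : ℝ}
    {w : EuclideanSpace ℝ (Fin (2 * k + 2)) → ℝ} (hT : T₀ < T) (hL : 0 < L)
    (hw : ContinuousOn w (shell (2 * k + 2) {t | T₀ < ε * t})) :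
    cutoffPairing k ε T c L w = (-1) ^ (k + 1) / L *
      ((∫ t, rampKernel (2 * k + 2) (k + 1) ε (t - ε * (T + L)) * sphereInt w t) -
        ∫ t, rampKernel (2 * k + 2) (k + 1) ε (t - ε * T) * sphereInt w t) := by
  set q := (radialNegLap (2 * k + 2))^[k + 1] (cutoffProfile ε T L) with hq
  have hqe := radialNegLap_iterate_cutoffProfile hε k T L
  have hqc : Continuous q := by
    have h1 : q = fun t => (-1) ^ (k + 1) * (Real.exp (-((2 * k + 2 : ℕ) * t)) *
        ((rampKernel (2 * k + 2) (k + 1) ε (t - ε * (T + L)) -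
          rampKernel (2 * k + 2) (k + 1) ε (t - ε * T)) / L)) := funext hqe
    rw [h1]
    have := continuous_rampKernel (ε := ε) (2 * k + 2) (k + 1)
    fun_prop
  have hcl : IsClosed {t : ℝ | ε * t ∈ Icc T (T + L + 1)} :=
    isClosed_Icc.preimage (f := fun t : ℝ => ε * t) (by fun_prop)
  have hqs : tsupport q ⊆ {t | ε * t ∈ Icc T (T + L + 1)} := by
    refine closure_minimal (fun t ht => ?_) hcl
    by_contra hmem
    apply ht
    have hz : ∀ s, T ≤ s → s ≤ T + L → rampKernel (2 * k + 2) (k + 1) ε (t - ε * s) = 0 := by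
      intro s h1 h2
      by_contra hne
      have h3 := tsupport_rampKernel_comp_sub hε k s (subset_tsupport _ hne)
      exact hmem ⟨h1.trans h3.1, h3.2.trans (by linarith)⟩
    rw [hq, hqe, hz _ (by linarith) le_rfl, hz _ le_rfl (by linarith)]
    simp
  have hsub : {t | ε * t ∈ Icc T (T + L + 1)} ⊆ {t | T₀ < ε * t} := fun t ht => hT.trans_le ht.1
  rw [cutoffPairing, integral_mul_radial (by omega) (isOpen_mul_gt ε T₀) hw hqc
    ((isCompact_mul_mem_Icc hε _ _).of_isClosed_subset (isClosed_tsupport _) hqs) (hqs.trans hsub)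
    (fun x hx => negLap_iterate_radialFn (contDiff_cutoffProfile ε T L) (k + 1) hx)]
  have hB := continuousOn_sphereInt (isOpen_mul_gt ε T₀) hw
  rw [← integral_sub (integrable_rampKernel_mul hε k hB (by linarith))
    (integrable_rampKernel_mul hε k hB hT), ← integral_const_mul]
  refine integral_congr_ae (ae_of_all _ fun t => ?_)
  have hexp : Real.exp ((2 * k + 2 : ℕ) * t) * Real.exp (-((2 * k + 2 : ℕ) * t)) = 1 := by
    rw [← Real.exp_add]; simp
  simp only [hq, hqe]
  linear_combination ((-1) ^ (k + 1) * ((rampKernel (2 * k + 2) (k + 1) ε (t - ε * (T + L)) -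
    rampKernel (2 * k + 2) (k + 1) ε (t - ε * T)) / L) * sphereInt w t) * hexp

/-- The kernel at the near corner contributes a fixed number, and replacing the far kernel by
evaluation costs a bounded error. Division by `L` removes both. The signs `(-1)^(k+1)` and `(-1)^k`
combine to the minus sign in the flux. -/
theorem tendsto_cutoffPairing_add (hε : ε = 1 ∨ ε = -1) (k : ℕ) {T₀ T c C : ℝ}
    {w : EuclideanSpace ℝ (Fin (2 * k + 2)) → ℝ} (hT : T₀ < T)
    (hw : ContinuousOn w (shell (2 * k + 2) {t | T₀ < ε * t}))
    (hosc : ∀ s ≥ T, ∀ τ ∈ Icc (0 : ℝ) 1,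
      |sphereInt w (ε * (s + τ)) - sphereInt w (ε * s)| ≤ C) :
    Tendsto (fun L => cutoffPairing k ε T c L w + (((2 * k + 2 - 2)‼ : ℕ) : ℝ) ^ 2 *
      (sphereInt w (ε * (T + L)) / L)) atTop (𝓝 0) := by
  have hB := continuousOn_sphereInt (isOpen_mul_gt ε T₀) hw
  set c₀ := (((2 * k + 2 - 2)‼ : ℕ) : ℝ) ^ 2
  set D := C * ∫ t, |rampKernel (2 * k + 2) (k + 1) ε t|
  set A := ∫ t, rampKernel (2 * k + 2) (k + 1) ε (t - ε * T) * sphereInt w t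
  have hlim : Tendsto (fun L : ℝ => (D + |A|) / L) atTop (𝓝 0) :=
    tendsto_const_nhds.div_atTop tendsto_id
  refine squeeze_zero_norm' ?_ hlim
  filter_upwards [eventually_gt_atTop 0] with L hL
  have h1 := abs_integral_rampKernel_mul_sub_le hε k hB (s := T + L) (by linarith)
    (hosc (T + L) (by linarith))
  set J := ∫ t, rampKernel (2 * k + 2) (k + 1) ε (t - ε * (T + L)) * sphereInt w t
  rw [cutoffPairing_eq hε k hT hL hw]
  have e : (-1) ^ (k + 1) / L * (J - A) + c₀ * (sphereInt w (ε * (T + L)) / L) =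
      (-1) ^ (k + 1) * ((J - (-1) ^ k * c₀ * sphereInt w (ε * (T + L))) - A) / L := by
    have h2 : ((-1 : ℝ) ^ k) * (-1) ^ k = 1 := by rw [← mul_pow]; norm_num
    rw [pow_succ]
    field_simp
    linear_combination (-c₀ * sphereInt w (ε * (T + L))) * h2
  rw [e, norm_div, norm_mul, norm_pow, norm_neg, norm_one, one_pow, one_mul, Real.norm_of_nonneg hL.le]
  refine div_le_div_of_nonneg_right ?_ hL.le
  exact (norm_sub_le _ _).trans (add_le_add h1 le_rfl)

end Pairing

/-! ### Riccati inequalities on a half line -/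

section Riccati

variable {z z' : ℝ → ℝ} {κ T : ℝ}

/-- At a level `c` with `c² > 1` the right side of the inequality is negative, so `z` can only cross
that level downwards. -/
theorem le_of_deriv_le_riccati (hκ : 0 < κ) (hz : ∀ s ≥ T, HasDerivAt z (z' s) s)
    (h : ∀ s ≥ T, z' s ≤ κ * (1 - z s ^ 2)) {a c : ℝ} (ha : T ≤ a) (hc : 1 < c ^ 2)
    (hac : z a ≤ c) {s : ℝ} (hs : a ≤ s) : z s ≤ c := by
  refine image_le_of_deriv_right_lt_deriv_boundary' (f := z) (f' := z') (B := fun _ => c)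
    (B' := fun _ => 0) (a := a) (b := s) ?_ ?_ hac continuousOn_const ?_ ?_ ⟨hs, le_rfl⟩
  · exact fun x hx => (hz x (ha.trans hx.1)).continuousAt.continuousWithinAt
  · exact fun x hx => (hz x (ha.trans hx.1)).hasDerivWithinAt
  · exact fun x _ => (hasDerivAt_const x c).hasDerivWithinAt
  · intro x hx he
    have := h x (ha.trans hx.1)
    rw [he] at this
    nlinarith

/-- A supersolution-type Riccati inequality on a half line forces boundedness. -/
theorem bounded_of_deriv_le_riccati (hκ : 0 < κ) (hz : ∀ s ≥ T, HasDerivAt z (z' s) s)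
    (h : ∀ s ≥ T, z' s ≤ κ * (1 - z s ^ 2)) {s : ℝ} (hs : T ≤ s) :
    -1 ≤ z s ∧ z s ≤ max (z T) 1 + 1 := by
  refine ⟨?_, ?_⟩
  · by_contra! hlt
    have hle : ∀ r ≥ s, z r ≤ z s := fun r hr =>
      le_of_deriv_le_riccati hκ hz h hs (by nlinarith) le_rfl hr
    have hv : ∀ r ≥ s, z r + 1 < 0 := fun r hr => by linarith [hle r hr]
    -- With `y = z + 1 < 0` the inequality gives `y' ≤ -κ y²`, so the positive quantity `-1/y`
    -- decreases at rate at least `κ`. It would have to become negative in finite time.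
    have hp : ∀ r ≥ s, HasDerivAt (fun r => -(z r + 1)⁻¹ + κ * r)
        (-(-(z' r) / (z r + 1) ^ 2) + κ * 1) r := fun r hr =>
      ((((hz r (hs.trans hr)).add_const 1).fun_inv (hv r hr).ne).neg).add
        ((hasDerivAt_id r).const_mul κ)
    have hanti : AntitoneOn (fun r => -(z r + 1)⁻¹ + κ * r) (Ici s) := by
      refine antitoneOn_of_deriv_nonpos (convex_Ici s)
        (fun r hr => (hp r hr).continuousAt.continuousWithinAt) ?_ ?_
      · exact fun r hr => (hp r (interior_subset hr)).differentiableAt.differentiableWithinAt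
      · intro r hr
        have hr' : s ≤ r := interior_subset hr
        rw [(hp r hr').deriv]
        have h1 := h r (hs.trans hr')
        have h2 := hv r hr'
        have h3 : 0 < (z r + 1) ^ 2 := sq_pos_of_neg h2
        have h4 : z' r / (z r + 1) ^ 2 ≤ -κ := by
          rw [div_le_iff₀ h3]
          nlinarith [mul_pos hκ (neg_pos.2 h2)]
        have : -(-(z' r) / (z r + 1) ^ 2) = z' r / (z r + 1) ^ 2 := by ring
        linarith
    -- One unit past the latest time at which `-1/y` could still be positive.
    set R := s + -(z s + 1)⁻¹ / κ + 1 with hR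
    have hp0 : 0 < -(z s + 1)⁻¹ := neg_pos.2 (inv_lt_zero.2 (hv s le_rfl))
    have hsR : s ≤ R := by have := div_pos hp0 hκ; linarith
    have h1 := hanti (mem_Ici.2 le_rfl) (mem_Ici.2 hsR) hsR
    have h2 : 0 < -(z R + 1)⁻¹ := neg_pos.2 (inv_lt_zero.2 (hv R hsR))
    have h3 : κ * R = κ * s + -(z s + 1)⁻¹ + κ := by
      rw [hR]; field_simp
    simp only at h1
    linarith
  · have h1 := le_max_left (z T) 1
    have h2 := le_max_right (z T) 1
    exact le_of_deriv_le_riccati hκ hz h le_rfl (by nlinarith) (by linarith) hs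

/-- If `κ E ≤ -z' + C` with `z` bounded, then `E / s²` is integrable near infinity. -/
theorem integrableOn_div_sq_of_le_deriv {E : ℝ → ℝ} {M C : ℝ} (hκ : 0 < κ) (hT : 0 < T)
    (hz : ∀ s ≥ T, HasDerivAt z (z' s) s) (hM : ∀ s ≥ T, |z s| ≤ M)
    (hE : ∀ s ≥ T, 0 ≤ E s) (hEc : ContinuousOn E (Ici T))
    (h : ∀ s ≥ T, κ * E s ≤ -z' s + C) :
    IntegrableOn (fun s => E s / s ^ 2) (Ioi T) := by
  -- The derivative of `-z/s²` is `-z'/s² + 2z/s³`. The term `-D/s` compensates both the constant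
  -- `C` and the second summand, which is at least `-(2M/T)/s²`.
  set D := C + 2 * M / T with hD
  have hg : ∀ s ∈ Ioi T, HasDerivAt (fun s => -(z s) * (s ^ 2)⁻¹ - D * s⁻¹)
      (-(z' s) * (s ^ 2)⁻¹ + -(z s) * (-(2 * s) / (s ^ 2) ^ 2) - D * (-(s ^ 2)⁻¹)) s := by
    intro s hs
    have hs0 : s ≠ 0 := (hT.trans hs).ne'
    have h1 : HasDerivAt (fun s : ℝ => s ^ 2) (2 * s) s := by simpa using hasDerivAt_pow 2 s
    exact ((hz s (le_of_lt hs)).neg.mul (h1.fun_inv (by positivity))).sub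
      ((hasDerivAt_inv hs0).const_mul D)
  have hlim : Tendsto (fun s => -(z s) * (s ^ 2)⁻¹ - D * s⁻¹) atTop (𝓝 (0 - D * 0)) := by
    refine Tendsto.sub ?_ (tendsto_inv_atTop_zero.const_mul D)
    have h0 : Tendsto (fun s : ℝ => M * (s ^ 2)⁻¹) atTop (𝓝 0) := by
      simpa using (tendsto_inv_atTop_zero.comp (tendsto_pow_atTop (α := ℝ) two_ne_zero)).const_mul M
    refine squeeze_zero_norm' ?_ h0
    filter_upwards [eventually_ge_atTop T] with s hs
    rw [norm_mul, norm_neg, Real.norm_eq_abs, Real.norm_eq_abs, abs_of_nonneg (a := (s ^ 2)⁻¹)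
      (by positivity)]
    gcongr
    exact hM s hs
  have hpt : ∀ s ∈ Ioi T, κ * E s / s ^ 2 ≤
      -(z' s) * (s ^ 2)⁻¹ + -(z s) * (-(2 * s) / (s ^ 2) ^ 2) - D * (-(s ^ 2)⁻¹) := by
    intro s hs
    have hs' : T < s := hs
    have hs0 : 0 < s := hT.trans hs
    have hM0 : 0 ≤ M := (abs_nonneg _).trans (hM T le_rfl)
    have e : -(z' s) * (s ^ 2)⁻¹ + -(z s) * (-(2 * s) / (s ^ 2) ^ 2) - D * (-(s ^ 2)⁻¹) =
        (-(z' s) + 2 * z s / s + D) / s ^ 2 := by field_simp; ring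
    rw [e]
    gcongr
    have h1 := h s hs'.le
    have h2 : -(2 * M / T) ≤ 2 * z s / s := by
      have h4 := (abs_le.1 (hM s hs'.le)).1
      have h3 : 2 * M / s ≤ 2 * M / T := by gcongr
      have h5 : -(2 * M / s) ≤ 2 * z s / s := by
        rw [← neg_div]; gcongr; linarith
      linarith
    linarith
  have hpos : ∀ s ∈ Ioi T, 0 ≤ κ * E s / s ^ 2 := fun s hs => by
    have := hE s (le_of_lt hs)
    positivity
  have hint := integrableOn_Ioi_deriv_of_nonneg (a := T)
    (g := fun s => -(z s) * (s ^ 2)⁻¹ - D * s⁻¹) ?_ hg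
    (fun s hs => (hpos s hs).trans (hpt s hs)) hlim
  · have h1 : IntegrableOn (fun s => κ * E s / s ^ 2) (Ioi T) := by
      refine Integrable.mono' hint ?_ ?_
      · refine ContinuousOn.aestronglyMeasurable ?_ measurableSet_Ioi
        exact (continuousOn_const.mul (hEc.mono Ioi_subset_Ici_self)).div (by fun_prop)
          fun s hs => by have := hT.trans hs; positivity
      · filter_upwards [ae_restrict_mem measurableSet_Ioi] with s hs
        rw [Real.norm_of_nonneg (hpos s hs)]
        exact hpt s hs
    refine (h1.const_mul κ⁻¹).congr (ae_of_all _ fun s => ?_)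
    field_simp
  · have h1 : ContinuousAt z T := (hz T le_rfl).continuousAt
    have hT0 : T ^ 2 ≠ 0 := by positivity
    have hT1 : T ≠ 0 := hT.ne'
    exact (((h1.neg.mul ((continuousAt_id.pow 2).inv₀ hT0))).sub
      (continuousAt_const.mul (continuousAt_id.inv₀ hT1))).continuousWithinAt

end Riccati

/-! ### A priori bounds on the spherical integrals at an end -/

section EndEstimate

variable {n : ℕ} {ε T : ℝ} {w : EuclideanSpace ℝ (Fin n) → ℝ}

/-- The scale-invariant energy density `‖x‖² |∇w|²`. -/
noncomputable def energyDensity (w : EuclideanSpace ℝ (Fin n) → ℝ)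
    (x : EuclideanSpace ℝ (Fin n)) : ℝ :=
  ‖x‖ ^ 2 * ‖fderiv ℝ w x‖ ^ 2

theorem sq_radialD_le (x : EuclideanSpace ℝ (Fin n)) : radialD w x ^ 2 ≤ energyDensity w x := by
  have h : ‖radialD w x‖ ≤ ‖fderiv ℝ w x‖ * ‖x‖ := (fderiv ℝ w x).le_opNorm x
  rw [← sq_abs, ← Real.norm_eq_abs, energyDensity, ← mul_pow, mul_comm ‖x‖]
  gcongr

theorem sphereMeasure_real_univ_pos (hn : 0 < n) : 0 < (sphereMeasure n).real univ := by
  rw [Measure.toSphere_real_apply_univ, finrank_euclideanSpace_fin]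
  have h1 : 0 < (volume : Measure (EuclideanSpace ℝ (Fin n))).real (Metric.ball 0 1) := by
    rw [Measure.real, ENNReal.toReal_pos_iff]
    exact ⟨Metric.measure_ball_pos _ _ one_pos, measure_ball_lt_top⟩
  positivity

/-- Cauchy-Schwarz against the constant 1, obtained from the nonnegativity of the variance; mass
zero is treated apart because the mean divides by the mass. -/
theorem sq_integral_le {X : Type*} [MeasurableSpace X] {μ : Measure X} [IsFiniteMeasure μ]
    {f : X → ℝ} (hf : Integrable f μ) (hf2 : Integrable (fun x => f x ^ 2) μ) :
    (∫ x, f x ∂μ) ^ 2 ≤ μ.real univ * ∫ x, f x ^ 2 ∂μ := by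
  rcases eq_or_ne (μ.real univ) 0 with h0 | h0
  · have : μ = 0 := by
      rw [← Measure.measure_univ_eq_zero]
      exact (measureReal_eq_zero_iff (measure_ne_top μ univ)).1 h0
    simp [this]
  have hS : 0 < μ.real univ := lt_of_le_of_ne measureReal_nonneg h0.symm
  set A := ∫ x, f x ∂μ
  have h1 : 0 ≤ ∫ x, (f x - A / μ.real univ) ^ 2 ∂μ := integral_nonneg fun x => sq_nonneg _
  have h2 : ∫ x, (f x - A / μ.real univ) ^ 2 ∂μ =
      (∫ x, f x ^ 2 ∂μ) - 2 * (A / μ.real univ) * A + μ.real univ * (A / μ.real univ) ^ 2 := by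
    have e : ∀ x, (f x - A / μ.real univ) ^ 2 =
        f x ^ 2 - 2 * (A / μ.real univ) * f x + (A / μ.real univ) ^ 2 := fun x => by ring
    simp_rw [e]
    rw [integral_add (f := fun x => f x ^ 2 - 2 * (A / μ.real univ) * f x)
      (hf2.sub (hf.const_mul _)) (integrable_const _), integral_sub hf2 (hf.const_mul _), integral_const_mul, integral_const, smul_eq_mul]
  rw [h2] at h1
  have h3 : (∫ x, f x ^ 2 ∂μ) - 2 * (A / μ.real univ) * A + μ.real univ * (A / μ.real univ) ^ 2 =
      (μ.real univ * (∫ x, f x ^ 2 ∂μ) - A ^ 2) / μ.real univ := by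
    field_simp; ring
  rw [h3] at h1
  have := (div_nonneg_iff.1 h1).resolve_right (fun h => absurd h.2 (not_le.2 hS))
  linarith [this.1]

theorem continuousOn_energyDensity {I : Set ℝ} (hw : ∀ x ∈ shell n I, ContDiffAt ℝ ∞ w x) :
    ContinuousOn (energyDensity w) (shell n I) := fun x hx =>
  ((continuous_norm.continuousAt.pow 2).mul
    ((((hw x hx).fderiv_right infty_add_one_le).continuousAt.norm).pow 2)).continuousWithinAt

theorem continuousOn_radialD {I : Set ℝ} (hw : ∀ x ∈ shell n I, ContDiffAt ℝ ∞ w x) :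
    ContinuousOn (radialD w) (shell n I) := fun x hx =>
  (contDiffAt_radialD (hw x hx)).continuousAt.continuousWithinAt

theorem continuousOn_laplacian {I : Set ℝ} (hw : ∀ x ∈ shell n I, ContDiffAt ℝ ∞ w x) :
    ContinuousOn (Δ w) (shell n I) := fun x hx =>
  (contDiffAt_laplacian (hw x hx)).continuousAt.continuousWithinAt

/-- The sign condition on the scalar curvature, integrated over a sphere. -/
theorem sphereInt_laplacian_le {I : Set ℝ}
    (hw : ∀ x ∈ shell n I, ContDiffAt ℝ ∞ w x)
    (hineq : ∀ x ∈ shell n I, 2 * Δ w x + (n - 2) * ‖fderiv ℝ w x‖ ^ 2 ≤ 0) {t : ℝ} (ht : t ∈ I) :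
    2 * (Real.exp (2 * t) * sphereInt (Δ w) t) + (n - 2) * sphereInt (energyDensity w) t ≤ 0 := by
  have h1 := integrable_comp_logPolar (continuousOn_laplacian hw) ht
  have h2 := integrable_comp_logPolar (continuousOn_energyDensity hw) ht
  simp only [sphereInt]
  rw [← integral_const_mul, ← integral_const_mul, ← integral_const_mul,
    ← integral_add ((h1.const_mul _).const_mul _) (h2.const_mul _)]
  refine integral_nonpos fun θ => ?_
  have h3 := hineq (logPolar (t, θ)) (logPolar_mem_shell.2 ht)
  have h4 : ‖logPolar (t, θ)‖ ^ 2 = Real.exp (2 * t) := by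
    rw [norm_logPolar, two_mul, Real.exp_add, sq]
  simp only [energyDensity, h4, Pi.zero_apply]
  have := mul_nonpos_of_nonneg_of_nonpos (Real.exp_pos (2 * t)).le h3
  linarith

theorem hasDerivAt_sphereInt_radialD_mul (hε : ε = 1 ∨ ε = -1)
    (hw : ∀ x ∈ shell n {t | T < ε * t}, ContDiffAt ℝ ∞ w x) {s : ℝ} (hs : T < s) :
    HasDerivAt (fun s => ε * sphereInt (radialD w) (ε * s))
      (sphereInt (radialD (radialD w)) (ε * s)) s := by
  have hε2 : ε * ε = 1 := by rcases hε with rfl | rfl <;> norm_num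
  have ht : ε * s ∈ {t | T < ε * t} := by
    change T < ε * (ε * s); rwa [← mul_assoc, hε2, one_mul]
  have h1 := hasDerivAt_sphereInt (isOpen_mul_gt ε T)
    (fun x hx => (contDiffAt_radialD (hw x hx)).of_le (by exact_mod_cast le_top)) ht
  have h2 := ((h1.comp s ((hasDerivAt_id s).const_mul ε)).const_mul ε)
  refine h2.congr_deriv ?_
  rw [mul_one, mul_comm, mul_assoc, hε2, mul_one]

theorem mul_mem_end (hε : ε = 1 ∨ ε = -1) {s : ℝ} (hs : T < s) : ε * s ∈ {t | T < ε * t} := by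
  have hε2 : ε * ε = 1 := by rcases hε with rfl | rfl <;> norm_num
  change T < ε * (ε * s); rwa [← mul_assoc, hε2, one_mul]

/-- The integrated curvature inequality bounds `κ E` by minus the second derivative of the spherical
integral along the end plus a first-order term. Since the energy `E` dominates the square of the
first derivative, this is a Riccati inequality and bounds that derivative. Returning to the
inequality with the bound in hand controls `E` itself. -/
theorem sphereInt_radialD_bound_of_two_lt (hn : 2 < n) (hε : ε = 1 ∨ ε = -1)
    (hw : ∀ x ∈ shell n {t | T < ε * t}, ContDiffAt ℝ ∞ w x)
    (hineq : ∀ x ∈ shell n {t | T < ε * t}, 2 * Δ w x + (n - 2) * ‖fderiv ℝ w x‖ ^ 2 ≤ 0)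
    {T' : ℝ} (hT' : T < T') (hT0 : 0 < T') :
    (∃ M, ∀ s ≥ T', |sphereInt (radialD w) (ε * s)| ≤ M) ∧
      IntegrableOn (fun s => sphereInt (energyDensity w) (ε * s) / s ^ 2) (Ioi T') := by
  have hn0 : 0 < n := by omega
  have hε2 : ε * ε = 1 := by rcases hε with rfl | rfl <;> norm_num
  have hε1 : |ε| = 1 := by rcases hε with rfl | rfl <;> norm_num
  set S := (sphereMeasure n).real univ with hSdef
  have hS : 0 < S := sphereMeasure_real_univ_pos hn0
  set κ : ℝ := (n - 2) / 2 with hκdef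
  have hκ : 0 < κ := by
    have : (2 : ℝ) < n := by exact_mod_cast hn
    rw [hκdef]; linarith
  set a := fun s => sphereInt (radialD w) (ε * s) with ha
  set E := fun s => sphereInt (energyDensity w) (ε * s) with hE
  -- The shift by `ε` completes the square in `-(a/S)² - 2 a/S`; the factor `ε` makes `z'` the
  -- derivative in `s` rather than in `t = ε s`.
  set z := fun s => (ε * a s) / S + ε with hz
  set z' := fun s => sphereInt (radialD (radialD w)) (ε * s) / S with hz'
  have hder : ∀ s ≥ T', HasDerivAt z (z' s) s := fun s hs =>
    ((hasDerivAt_sphereInt_radialD_mul hε hw (hT'.trans_le hs)).div_const S).add_const ε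
  have hmem : ∀ s ≥ T', ε * s ∈ {t | T < ε * t} := fun s hs => mul_mem_end hε (hT'.trans_le hs)
  have hCS : ∀ s ≥ T', a s ^ 2 ≤ S * E s := by
    intro s hs
    have hrc := integrable_comp_logPolar (continuousOn_radialD hw) (hmem s hs)
    have hrc2 := integrable_comp_logPolar ((continuousOn_radialD hw).pow 2) (hmem s hs)
    refine (sq_integral_le hrc hrc2).trans ?_
    refine mul_le_mul_of_nonneg_left ?_ hS.le
    exact integral_mono hrc2 (integrable_comp_logPolar (continuousOn_energyDensity hw) (hmem s hs))
      fun θ => sq_radialD_le _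
  have hmain : ∀ s ≥ T', κ * (E s / S) ≤ - z' s - 2 * κ * (a s / S) := by
    intro s hs
    have h1 := sphereInt_laplacian hn0 (isOpen_mul_gt ε T) hw (hmem s hs)
    have h2 := sphereInt_laplacian_le hw hineq (hmem s hs)
    rw [← h1] at h2
    have h3 : κ * E s ≤ -sphereInt (radialD (radialD w)) (ε * s) - 2 * κ * a s := by
      simp only [hκdef, ha, hE]; linarith
    have h4 := div_le_div_of_nonneg_right h3 hS.le
    simp only [hz']
    calc κ * (E s / S) = κ * E s / S := by ring
      _ ≤ _ := h4
      _ = _ := by ring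
  have hric : ∀ s ≥ T', z' s ≤ κ * (1 - z s ^ 2) := by
    intro s hs
    have h1 := hmain s hs
    have h2 : (a s / S) ^ 2 ≤ E s / S := by
      rw [div_pow, div_le_div_iff₀ (by positivity) hS]
      nlinarith [hCS s hs]
    have h3 : z s ^ 2 = (a s / S) ^ 2 + 2 * (a s / S) + 1 := by
      simp only [hz]
      linear_combination ((a s / S) ^ 2 + 2 * (a s / S) + 1) * hε2
    rw [h3]
    have := mul_le_mul_of_nonneg_left h2 hκ.le
    linarith
  set M₀ := max (z T') 1 + 1 with hM₀
  have hM1 : 1 ≤ M₀ := by have := le_max_right (z T') 1; linarith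
  have hzM : ∀ s ≥ T', |z s| ≤ M₀ := fun s hs => by
    have := bounded_of_deriv_le_riccati hκ hder hric hs
    exact abs_le.2 ⟨by linarith [this.1], this.2⟩
  have haM : ∀ s ≥ T', |a s / S| ≤ M₀ + 1 := fun s hs => by
    have h1 : a s / S = ε * (z s - ε) := by
      simp only [hz]
      linear_combination (-(a s / S)) * hε2
    rw [h1, abs_mul, hε1, one_mul]
    calc |z s - ε| ≤ |z s| + |ε| := abs_sub _ _
      _ ≤ M₀ + 1 := by rw [hε1]; linarith [hzM s hs]
  refine ⟨⟨(M₀ + 1) * S, fun s hs => ?_⟩, ?_⟩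
  · have := haM s hs
    rwa [abs_div, abs_of_pos hS, div_le_iff₀ hS] at this
  · have hEc : ContinuousOn (fun s => E s / S) (Ici T') := by
      refine ContinuousOn.div_const ?_ S
      exact (continuousOn_sphereInt (isOpen_mul_gt ε T) (continuousOn_energyDensity hw)).comp
        (by fun_prop) fun s hs => hmem s hs
    have hE0 : ∀ s ≥ T', 0 ≤ E s / S := fun s _ =>
      div_nonneg (integral_nonneg fun θ => mul_nonneg (sq_nonneg _) (sq_nonneg _)) hS.le
    have := integrableOn_div_sq_of_le_deriv (C := 2 * κ * (M₀ + 1)) hκ hT0 hder hzM hE0 hEc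
      fun s hs => by
        have h1 := hmain s hs
        have h2 := (abs_le.1 (haM s hs)).1
        nlinarith
    refine (this.const_mul S).congr (ae_of_all _ fun s => ?_)
    simp only [hE]; field_simp

/-- In dimension two, integrability of the Laplacian bounds the radial derivative. -/
theorem sphereInt_radialD_bound_two {w : EuclideanSpace ℝ (Fin 2) → ℝ} (hε : ε = 1 ∨ ε = -1)
    (hw : ∀ x ∈ shell 2 {t | T < ε * t}, ContDiffAt ℝ ∞ w x)
    (hint : IntegrableOn (Δ w) (shell 2 {t | T < ε * t}))
    {T' : ℝ} (hT' : T < T') :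
    ∃ M, ∀ s ≥ T', |sphereInt (radialD w) (ε * s)| ≤ M := by
  have hε2 : ε * ε = 1 := by rcases hε with rfl | rfl <;> norm_num
  have hε1 : |ε| = 1 := by rcases hε with rfl | rfl <;> norm_num
  have hmeas : MeasurableSet (shell 2 {t | T < ε * t}) := (isOpen_shell (isOpen_mul_gt ε T)).measurableSet
  have h1 : Integrable (indicator (shell 2 {t | T < ε * t}) (Δ w)) :=
    (integrable_indicator_iff hmeas).2 hint
  rw [integrable_logPolar_iff two_pos] at h1
  have h2 := h1.integral_prod_left
  -- For `n = 2` the equation for spherical integrals has no first-order term: the derivative of the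
  -- radial integral is `e^{2t}` times the spherical integral of `Δ w`, which Fubini makes
  -- integrable.
  have h3 : IntegrableOn (fun t => Real.exp (2 * t) * sphereInt (Δ w) t) {t | T < ε * t} := by
    refine (h2.integrableOn (s := {t | T < ε * t})).congr ?_
    filter_upwards [ae_restrict_mem (isOpen_mul_gt ε T).measurableSet] with t ht
    simp only [sphereInt]
    rw [← integral_const_mul]
    refine integral_congr_ae (ae_of_all _ fun θ => ?_)
    simp only [indicator_of_mem (logPolar_mem_shell.2 (show (t, θ).1 ∈ {t | T < ε * t} from ht))]
    norm_num
  have h4 : IntegrableOn (fun s => sphereInt (radialD (radialD w)) (ε * s)) (Ioi T) := by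
    have h5 : IntegrableOn (fun s => Real.exp (2 * (ε * s)) * sphereInt (Δ w) (ε * s)) (Ioi T) := by
      rw [← integrable_indicator_iff measurableSet_Ioi]
      rw [← integrable_indicator_iff (isOpen_mul_gt ε T).measurableSet] at h3
      have hε0 : ε ≠ 0 := by rintro rfl; simp at hε2
      refine (h3.comp_mul_left' hε0).congr (ae_of_all _ fun s => ?_)
      by_cases hs : s ∈ Ioi T
      · simp only [indicator_of_mem hs, indicator_of_mem (mul_mem_end hε hs)]
      · have : ε * s ∉ {t | T < ε * t} := fun h => hs (by
          have h' : T < ε * (ε * s) := h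
          rwa [← mul_assoc, hε2, one_mul] at h')
        simp only [indicator_of_notMem hs, indicator_of_notMem this]
    refine h5.congr ?_
    filter_upwards [ae_restrict_mem measurableSet_Ioi] with s hs
    have := sphereInt_laplacian two_pos (isOpen_mul_gt ε T) hw (mul_mem_end hε hs)
    simp only [Nat.cast_ofNat, sub_self, zero_mul, add_zero] at this
    exact this.symm
  set I := ∫ s in Ioi T, |sphereInt (radialD (radialD w)) (ε * s)|
  refine ⟨|sphereInt (radialD w) (ε * T')| + I, fun s hs => ?_⟩
  have hFTC := intervalIntegral.integral_eq_sub_of_hasDerivAt_of_le (a := T') (b := s) hs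
    (f := fun s => ε * sphereInt (radialD w) (ε * s))
    (fun r hr => (hasDerivAt_sphereInt_radialD_mul hε hw
      (hT'.trans_le hr.1)).continuousAt.continuousWithinAt)
    (fun r hr => hasDerivAt_sphereInt_radialD_mul hε hw (hT'.trans hr.1))
    (by
      rw [intervalIntegrable_iff_integrableOn_Ioc_of_le hs]
      exact h4.mono_set fun r hr => hT'.trans hr.1)
  have hle : |∫ r in T'..s, sphereInt (radialD (radialD w)) (ε * r)| ≤ I := by
    rw [intervalIntegral.integral_of_le hs]
    refine (abs_integral_le_integral_abs).trans ?_
    exact setIntegral_mono_set h4.abs (ae_of_all _ fun _ => abs_nonneg _)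
      (LE.le.eventuallyLE fun r hr => hT'.trans hr.1)
  rw [hFTC, ← mul_sub, abs_mul, hε1, one_mul] at hle
  have := abs_sub_abs_le_abs_sub (sphereInt (radialD w) (ε * s)) (sphereInt (radialD w) (ε * T'))
  linarith

/-- A bound on the derivative of the spherical integrals controls their oscillation. -/
theorem sphereInt_osc_le (hε : ε = 1 ∨ ε = -1)
    (hw : ∀ x ∈ shell n {t | T < ε * t}, ContDiffAt ℝ ∞ w x) {T' M : ℝ} (hT' : T < T')
    (hM : ∀ s ≥ T', |sphereInt (radialD w) (ε * s)| ≤ M) {s r : ℝ} (hs : T' ≤ s) (hr : T' ≤ r) :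
    |sphereInt w (ε * r) - sphereInt w (ε * s)| ≤ M * |r - s| := by
  have hε1 : |ε| = 1 := by rcases hε with rfl | rfl <;> norm_num
  have hder : ∀ s ∈ Ici T', HasDerivWithinAt (fun s => sphereInt w (ε * s))
      (sphereInt (radialD w) (ε * s) * (ε * 1)) (Ici T') s := by
    intro s hs
    have h1 := hasDerivAt_sphereInt (isOpen_mul_gt ε T)
      (fun x hx => (hw x hx).of_le (by exact_mod_cast le_top))
      (mul_mem_end hε (hT'.trans_le hs))
    exact (h1.comp s ((hasDerivAt_id s).const_mul ε)).hasDerivWithinAt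
  have := Convex.norm_image_sub_le_of_norm_hasDerivWithin_le (C := M) hder
    (fun x hx => by
      rw [norm_mul, mul_one, Real.norm_eq_abs ε, hε1, mul_one]; exact hM x hx)
    (convex_Ici T') hs hr
  simpa using this

end EndEstimate

/-! ### Linearity of the iterated Laplacian -/

section NegLapLinear

variable {n : ℕ} {f g : EuclideanSpace ℝ (Fin n) → ℝ}

theorem negLap_iterate_add (hf : ContDiff ℝ ∞ f) (hg : ContDiff ℝ ∞ g) (k : ℕ) :
    negLap^[k] (fun x => f x + g x) = fun x => negLap^[k] f x + negLap^[k] g x := by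
  induction k generalizing f g with
  | zero => rfl
  | succ k ih =>
    have h1 : negLap (fun x => f x + g x) = fun x => negLap f x + negLap g x := by
      funext x
      have := ((hf.of_le two_le_infty).contDiffAt (x := x)).laplacian_add
        ((hg.of_le two_le_infty).contDiffAt (x := x))
      change -(Δ (f + g) x) = -(Δ f x) + -(Δ g x)
      rw [this]; ring
    simp only [Function.iterate_succ_apply]
    rw [h1]
    exact ih (contDiff_negLap_iterate hf 1) (contDiff_negLap_iterate hg 1)

theorem negLap_const (c : ℝ) : negLap (fun _ : EuclideanSpace ℝ (Fin n) => c) = fun _ => 0 := by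
  funext x
  simp [negLap, InnerProductSpace.laplacian_const]

theorem negLap_iterate_succ_const (c : ℝ) (k : ℕ) :
    negLap^[k + 1] (fun _ : EuclideanSpace ℝ (Fin n) => c) = fun _ => 0 := by
  rw [Function.iterate_succ_apply, negLap_const, negLap_iterate_zero]

theorem negLap_iterate_sub (hf : ContDiff ℝ ∞ f) (hg : ContDiff ℝ ∞ g) (k : ℕ) :
    negLap^[k] (fun x => f x - g x) = fun x => negLap^[k] f x - negLap^[k] g x := by
  have h := negLap_iterate_add (hf.sub hg) hg k
  simp only [sub_add_cancel] at h
  rw [h]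
  simp

theorem negLap_iterate_succ_sub_const (hf : ContDiff ℝ ∞ f) (c : ℝ) (k : ℕ) :
    negLap^[k + 1] (fun x => f x - c) = negLap^[k + 1] f := by
  rw [negLap_iterate_sub hf contDiff_const, negLap_iterate_succ_const]
  simp

theorem negLap_iterate_sum {ι : Type*} (s : Finset ι) {F : ι → EuclideanSpace ℝ (Fin n) → ℝ}
    (hF : ∀ i ∈ s, ContDiff ℝ ∞ (F i)) (k : ℕ) :
    negLap^[k] (fun x => ∑ i ∈ s, F i x) = fun x => ∑ i ∈ s, negLap^[k] (F i) x := by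
  classical
  induction s using Finset.induction_on with
  | empty => simp only [Finset.sum_empty]; exact negLap_iterate_zero k
  | insert i s hi ih =>
    simp only [Finset.sum_insert hi]
    rw [negLap_iterate_add (hF i (Finset.mem_insert_self i s))
      (ContDiff.sum fun j hj => hF j (Finset.mem_insert_of_mem hj)),
      ih fun j hj => hF j (Finset.mem_insert_of_mem hj)]

end NegLapLinear

/-! ### Cutoffs of an end and its flux -/

section EndCutoff

variable {ε : ℝ} {k : ℕ}

theorem isCompact_shell {n : ℕ} {K : Set ℝ} (hK : IsCompact K) : IsCompact (shell n K) := by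
  have : shell n K = logPolar '' (K ×ˢ univ) := by
    ext x
    constructor
    · rintro ⟨hx, hxK⟩
      refine ⟨(Real.log ‖x‖, ⟨‖x‖⁻¹ • x, ?_⟩), ⟨hxK, mem_univ _⟩, ?_⟩
      · rw [mem_sphere_zero_iff_norm, norm_smul, norm_inv, norm_norm,
          inv_mul_cancel₀ (norm_ne_zero_iff.2 hx)]
      · simp only [logPolar]
        rw [Real.exp_log (norm_pos_iff.2 hx), smul_smul, mul_inv_cancel₀ (norm_ne_zero_iff.2 hx),
          one_smul]
    · rintro ⟨p, hp, rfl⟩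
      exact logPolar_mem_shell.2 hp.1
  rw [this]
  exact (hK.prod isCompact_univ).image continuous_logPolar

/-- The value of the cutoff at the centre of polar coordinates: the end is at infinity for `ε = 1`
and at the centre for `ε = -1`. -/
noncomputable def centreValue (ε : ℝ) : ℝ := (1 + ε) / 2

/-- The cutoff function of an end, equal to `1` away from the end. -/
noncomputable def endCutoff (k : ℕ) (ε T L : ℝ) : EuclideanSpace ℝ (Fin (2 * k + 2)) → ℝ :=
  radialFn (2 * k + 2) (centreValue ε) (cutoffProfile ε T L)

theorem cutoffProfile_eq_centreValue (hε : ε = 1 ∨ ε = -1) {T L : ℝ} (hL : 0 < L) :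
    ∃ a, ∀ t ≤ a, cutoffProfile ε T L t = centreValue ε := by
  rcases hε with rfl | rfl
  · refine ⟨T, fun t ht => ?_⟩
    rw [cutoffProfile_eq_one hL.le (by linarith)]; norm_num [centreValue]
  · refine ⟨-(T + L + 1), fun t ht => ?_⟩
    rw [cutoffProfile_eq_zero hL (by linarith)]; norm_num [centreValue]

theorem contDiff_endCutoff (hε : ε = 1 ∨ ε = -1) {T L : ℝ} (hL : 0 < L) :
    ContDiff ℝ ∞ (endCutoff k ε T L) := by
  obtain ⟨a, ha⟩ := cutoffProfile_eq_centreValue hε (T := T) hL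
  exact contDiff_radialFn (contDiff_cutoffProfile ε T L) ha

theorem abs_endCutoff_le {T L : ℝ} (hε : ε = 1 ∨ ε = -1) (hL : 1 ≤ L)
    (x : EuclideanSpace ℝ (Fin (2 * k + 2))) : |endCutoff k ε T L x| ≤ 2 := by
  by_cases hx : x = 0
  · rw [endCutoff, radialFn, if_pos hx, centreValue]
    rcases hε with rfl | rfl <;> norm_num
  · rw [endCutoff, radialFn_of_ne hx]
    exact abs_cutoffProfile_le hL ε T _

theorem tendsto_endCutoff (T : ℝ) {x : EuclideanSpace ℝ (Fin (2 * k + 2))} (hx : x ≠ 0) :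
    Tendsto (fun L => endCutoff k ε T L x) atTop (𝓝 1) := by
  simp only [endCutoff, radialFn_of_ne hx]
  exact tendsto_cutoffProfile ε T _

theorem tsupport_negLap_iterate_endCutoff (hε : ε = 1 ∨ ε = -1) {T L : ℝ} (hL : 0 < L) :
    tsupport (negLap^[k + 1] (endCutoff k ε T L)) ⊆
      shell (2 * k + 2) {t | ε * t ∈ Icc T (T + L + 1)} := by
  refine closure_minimal (fun x hx => ?_) (isCompact_shell (isCompact_mul_mem_Icc hε _ _)).isClosed
  have hx0 : x ≠ 0 := by
    rintro rfl
    obtain ⟨a, ha⟩ := cutoffProfile_eq_centreValue hε (T := T) hL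
    have h1 : endCutoff k ε T L =ᶠ[𝓝 0] fun _ => centreValue ε := by
      filter_upwards [Metric.ball_mem_nhds (0 : EuclideanSpace ℝ (Fin (2 * k + 2)))
        (Real.exp_pos a)] with z hz
      exact radialFn_eq_const ha (mem_ball_zero_iff.1 hz).le
    have h2 := (negLap_iterate_congr h1 (k + 1)).eq_of_nhds
    rw [negLap_iterate_succ_const] at h2
    exact hx h2
  refine ⟨hx0, ?_⟩
  by_contra hmem
  apply hx
  have hz : ∀ s, T ≤ s → s ≤ T + L →
      rampKernel (2 * k + 2) (k + 1) ε (Real.log ‖x‖ - ε * s) = 0 := by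
    intro s h1 h2
    by_contra hne
    have h3 := tsupport_rampKernel_comp_sub hε k s (subset_tsupport _ hne)
    exact hmem ⟨h1.trans h3.1, h3.2.trans (by linarith)⟩
  rw [endCutoff, negLap_iterate_radialFn (contDiff_cutoffProfile ε T L) (k + 1) hx0,
    radialNegLap_iterate_cutoffProfile hε, hz _ (by linarith) le_rfl, hz _ le_rfl (by linarith)]
  simp

/-- Far from the centre the cutoff is constant: 0 if the end is at infinity, 1 if it is at the
centre. Both values are `1 - centreValue ε`. -/
theorem hasCompactSupport_endCutoff_sub (hε : ε = 1 ∨ ε = -1) {T L : ℝ} (hL : 0 < L) :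
    HasCompactSupport fun x => endCutoff k ε T L x - (1 - centreValue ε) := by
  rcases hε with rfl | rfl
  · have : (fun x => endCutoff k 1 T L x - (1 - centreValue 1)) = endCutoff k 1 T L := by
      funext x; norm_num [centreValue]
    rw [this]
    exact hasCompactSupport_radialFn (b := T + L + 1)
      fun t ht => cutoffProfile_eq_zero hL (by linarith)
  · have : (fun x => endCutoff k (-1) T L x - (1 - centreValue (-1))) =
        radialFn (2 * k + 2) (-1) fun t => cutoffProfile (-1) T L t - 1 := by
      funext x
      by_cases hx : x = 0
      · simp [endCutoff, radialFn, hx, centreValue]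
      · rw [endCutoff, radialFn_of_ne hx, radialFn_of_ne hx]; norm_num [centreValue]
    rw [this]
    refine hasCompactSupport_radialFn (b := -T) fun t ht => ?_
    rw [cutoffProfile_eq_one hL.le (by linarith), sub_self]

/-- Before `T` both cutoffs are 1, and past the longer transition both are 0; hence only a compact
shell inside the end is affected by a change of `L`. -/
theorem tsupport_endCutoff_sub (hε : ε = 1 ∨ ε = -1) {T L L' : ℝ} (hL : 0 < L) (hL' : 0 < L') :
    tsupport (fun x => endCutoff k ε T L x - endCutoff k ε T L' x) ⊆
      shell (2 * k + 2) {t | ε * t ∈ Icc T (T + max L L' + 1)} := by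
  have e : (fun x => endCutoff k ε T L x - endCutoff k ε T L' x) =
      radialFn (2 * k + 2) 0 fun t => cutoffProfile ε T L t - cutoffProfile ε T L' t := by
    funext x
    by_cases hx : x = 0
    · simp [endCutoff, radialFn, hx]
    · rw [endCutoff, endCutoff, radialFn_of_ne hx, radialFn_of_ne hx, radialFn_of_ne hx]
  rw [e]
  obtain ⟨a, ha⟩ := cutoffProfile_eq_centreValue hε (T := T) hL
  obtain ⟨b, hb⟩ := cutoffProfile_eq_centreValue hε (T := T) hL'
  refine tsupport_radialFn_subset (a := min a b)
    (isClosed_Icc.preimage (f := fun t : ℝ => ε * t) (by fun_prop)) (fun t ht => ?_) fun t ht => ?_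
  · rw [ha t (ht.trans (min_le_left _ _)), hb t (ht.trans (min_le_right _ _)), sub_self]
  · have ht' : ¬ (ε * t ∈ Icc T (T + max L L' + 1)) := ht
    rw [mem_Icc, not_and_or, not_le, not_le] at ht'
    have h1 := le_max_left L L'
    have h2 := le_max_right L L'
    rcases ht' with h | h
    · rw [cutoffProfile_eq_one hL.le h.le, cutoffProfile_eq_one hL'.le h.le, sub_self]
    · rw [cutoffProfile_eq_zero hL (by linarith), cutoffProfile_eq_zero hL' (by linarith), sub_self]

theorem integrable_mul_negLap_iterate_endCutoff (hε : ε = 1 ∨ ε = -1) {T₀ T L : ℝ} (hT : T₀ < T)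
    (hL : 0 < L) {w : EuclideanSpace ℝ (Fin (2 * k + 2)) → ℝ}
    (hw : ContinuousOn w (shell (2 * k + 2) {t | T₀ < ε * t})) :
    Integrable fun x => w x * negLap^[k + 1] (endCutoff k ε T L) x := by
  have hsub : shell (2 * k + 2) {t | ε * t ∈ Icc T (T + L + 1)} ⊆
      shell (2 * k + 2) {t | T₀ < ε * t} := fun x hx => ⟨hx.1, hT.trans_le hx.2.1⟩
  have hts := tsupport_negLap_iterate_endCutoff (k := k) hε (T := T) hL
  have h1 := continuous_mul_of_tsupport (isOpen_shell (isOpen_mul_gt ε T₀))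
    (contDiff_negLap_iterate (contDiff_endCutoff (k := k) hε (T := T) hL) (k + 1)).continuous
    (hts.trans hsub) hw
  simp_rw [mul_comm (w _)]
  refine h1.integrable_of_hasCompactSupport ?_
  refine HasCompactSupport.intro
    (isCompact_shell (isCompact_mul_mem_Icc hε T (T + L + 1))) fun x hx => ?_
  rw [image_eq_zero_of_notMem_tsupport fun h => hx (hts h), zero_mul]

/-- The flux of an end, and its relation to the growth of spherical integrals. -/
theorem exists_tendsto_cutoffPairing (hε : ε = 1 ∨ ε = -1) {T₀ T C : ℝ} (hT : T₀ < T)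
    {w : EuclideanSpace ℝ (Fin (2 * k + 2)) → ℝ}
    (hw : ∀ x ∈ shell (2 * k + 2) {t | T₀ < ε * t}, ContDiffAt ℝ ∞ w x)
    (hf : IntegrableOn (negLap^[k + 1] w) (shell (2 * k + 2) {t | T₀ < ε * t}))
    (hosc : ∀ s ≥ T, ∀ τ ∈ Icc (0 : ℝ) 1,
      |sphereInt w (ε * (s + τ)) - sphereInt w (ε * s)| ≤ C) :
    ∃ a, Tendsto (fun L => cutoffPairing k ε T (centreValue ε) L w) atTop (𝓝 a) ∧
      Tendsto (fun s => sphereInt w (ε * s) / s) atTop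
        (𝓝 (-a / (((2 * k + 2 - 2)‼ : ℕ) : ℝ) ^ 2)) := by
  set c₀ := (((2 * k + 2 - 2)‼ : ℕ) : ℝ) ^ 2 with hc₀
  have hc0 : 0 < c₀ := by
    have := Nat.doubleFactorial_pos (2 * k + 2 - 2)
    positivity
  set U := shell (2 * k + 2) {t | T₀ < ε * t} with hU
  have hUo : IsOpen U := isOpen_shell (isOpen_mul_gt ε T₀)
  have hwc : ContinuousOn w U := fun x hx => (hw x hx).continuousAt.continuousWithinAt
  set f := negLap^[k + 1] w
  set Θ := endCutoff k ε T with hΘ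
  -- Integration by parts on the compact shell where the cutoffs for `L` and 1 differ turns the
  -- change of the pairing into an integral of `f`, although `w` itself may be singular at the end.
  have hdiff : ∀ L ≥ 1, cutoffPairing k ε T (centreValue ε) L w =
      cutoffPairing k ε T (centreValue ε) 1 w + ∫ x in U, f x * (Θ L x - Θ 1 x) := by
    intro L hL
    have hL0 : 0 < L := by linarith
    have hts := tsupport_endCutoff_sub (k := k) hε (T := T) hL0 one_pos
    have hsub : shell (2 * k + 2) {t | ε * t ∈ Icc T (T + max L 1 + 1)} ⊆ U :=
      fun x hx => ⟨hx.1, hT.trans_le hx.2.1⟩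
    have hcd := (contDiff_endCutoff (k := k) hε (T := T) hL0).sub
      (contDiff_endCutoff (k := k) hε (T := T) one_pos)
    have hcs : HasCompactSupport (fun x => Θ L x - Θ 1 x) :=
      (isCompact_shell (isCompact_mul_mem_Icc hε _ _)).of_isClosed_subset (isClosed_tsupport _) hts
    have h1 := integral_negLap_iterate_mul_of_tsupport hUo hw hcd hcs (hts.trans hsub) (k + 1)
    have h2 : ∫ x in U, f x * (Θ L x - Θ 1 x) = ∫ x, f x * (Θ L x - Θ 1 x) := by
      refine setIntegral_eq_integral_of_forall_compl_eq_zero fun x hx => ?_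
      rw [image_eq_zero_of_notMem_tsupport (f := fun x => Θ L x - Θ 1 x)
        fun h => hx (hsub (hts h)), mul_zero]
    have h3 : ∀ x, w x * negLap^[k + 1] (fun x => Θ L x - Θ 1 x) x =
        w x * negLap^[k + 1] (Θ L) x - w x * negLap^[k + 1] (Θ 1) x := fun x => by
      rw [negLap_iterate_sub (contDiff_endCutoff (k := k) hε (T := T) hL0)
        (contDiff_endCutoff (k := k) hε (T := T) one_pos), mul_sub]
    rw [h2, h1]
    rw [integral_congr_ae (ae_of_all _ h3), integral_sub (integrable_mul_negLap_iterate_endCutoff hε hT hL0 hwc)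
      (integrable_mul_negLap_iterate_endCutoff hε hT one_pos hwc)]
    simp only [cutoffPairing, endCutoff]
    ring
  -- Absolute integrability of `f` is what makes the pairings converge; each cutoff is bounded by 2,
  -- hence the factor 4.
  have hlim : Tendsto (fun L => ∫ x in U, f x * (Θ L x - Θ 1 x)) atTop
      (𝓝 (∫ x in U, f x * (1 - Θ 1 x))) := by
    refine tendsto_integral_filter_of_dominated_convergence (fun x => 4 * |f x|) ?_ ?_
      (hf.abs.const_mul 4) ?_
    · filter_upwards [eventually_ge_atTop 1] with L hL
      exact hf.aestronglyMeasurable.mul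
        (((contDiff_endCutoff (k := k) hε (T := T) (by linarith)).continuous.sub
          (contDiff_endCutoff (k := k) hε (T := T) one_pos).continuous).aestronglyMeasurable)
    · filter_upwards [eventually_ge_atTop 1] with L hL
      refine ae_of_all _ fun x => ?_
      rw [norm_mul, mul_comm, Real.norm_eq_abs, Real.norm_eq_abs]
      refine mul_le_mul_of_nonneg_right ?_ (abs_nonneg _)
      have h1 := abs_endCutoff_le (k := k) (T := T) hε hL x
      have h2 := abs_endCutoff_le (k := k) (T := T) hε le_rfl x
      have h3 := abs_sub (Θ L x) (Θ 1 x)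
      simp only [hΘ] at h3 ⊢
      linarith
    · filter_upwards [ae_restrict_mem hUo.measurableSet] with x hx
      exact ((tendsto_endCutoff T hx.1).sub_const _).const_mul _
  set a := cutoffPairing k ε T (centreValue ε) 1 w + ∫ x in U, f x * (1 - Θ 1 x) with ha
  have hA : Tendsto (fun L => cutoffPairing k ε T (centreValue ε) L w) atTop (𝓝 a) := by
    refine (hlim.const_add (cutoffPairing k ε T (centreValue ε) 1 w)).congr' ?_
    filter_upwards [eventually_ge_atTop 1] with L hL using (hdiff L hL).symm
  refine ⟨a, hA, ?_⟩
  -- The pairing plus `c₀` times the spherical integral at `T + L` over `L` tends to zero, so that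
  -- quotient converges as well; what follows replaces `L` by `s = T + L`.
  have h1 := (tendsto_cutoffPairing_add (c := centreValue ε) hε k hT hwc hosc).sub hA
  have h2 : Tendsto (fun L => sphereInt w (ε * (T + L)) / L) atTop (𝓝 (-a / c₀)) := by
    have h3 := h1.div_const c₀
    rw [zero_sub] at h3
    refine h3.congr fun L => ?_
    field_simp
    ring
  have h4 : Tendsto (fun s : ℝ => s - T) atTop atTop := tendsto_atTop_add_const_right _ _ tendsto_id
  have h5 : Tendsto (fun s : ℝ => 1 - T / s) atTop (𝓝 (1 - 0)) :=
    tendsto_const_nhds.sub (tendsto_const_nhds.div_atTop tendsto_id)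
  have h6 := (h2.comp h4).mul h5
  rw [sub_zero, mul_one] at h6
  refine h6.congr' ?_
  filter_upwards [eventually_gt_atTop 0, eventually_gt_atTop T] with s hs hsT
  have : s - T ≠ 0 := by linarith
  simp only [Function.comp_apply, add_sub_cancel]
  field_simp

end EndCutoff

/-! ### The Riemannian distance defined by `C¹` curves -/

section Curves

variable {n : ℕ} {u : USphere n → ℝ} {Ω : Set (USphere n)} {x y z : USphere n}
  {γ : ℝ → USphere n}

/-- The speed of a curve in the sphere for the metric `e^{2u} g`. -/
noncomputable def curveSpeed (n : ℕ) (u : USphere n → ℝ) (γ : ℝ → USphere n) (t : ℝ) : ℝ≥0∞ :=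
  ENNReal.ofReal (Real.exp (u (γ t)) *
    ‖derivWithin (fun s => (γ s : EuclideanSpace ℝ (Fin (n + 1)))) (Icc 0 1) t‖)

theorem curveLength_eq (γ : ℝ → USphere n) :
    curveLength n u γ = ∫⁻ t in Ioo (0 : ℝ) 1, curveSpeed n u γ t := by
  refine setLIntegral_congr_fun measurableSet_Ioo fun t ht => ?_
  simp only [curveSpeed]
  rw [derivWithin_of_mem_nhds (Icc_mem_nhds ht.1 ht.2)]

/-- Change of parameter in a curve. -/
theorem curveLength_comp (hγ : ContDiffOn ℝ 1 (fun s => (γ s : EuclideanSpace ℝ (Fin (n + 1))))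
    (Icc 0 1)) {τ τ' : ℝ → ℝ} (hτ : ∀ t, HasDerivAt τ (τ' t) t)
    (hmaps : MapsTo τ (Icc 0 1) (Icc 0 1))
    (hmono : (Monotone τ ∧ ∀ t, 0 ≤ τ' t) ∨ (Antitone τ ∧ ∀ t, τ' t ≤ 0)) :
    curveLength n u (γ ∘ τ) = ∫⁻ t in τ '' Ioo 0 1, curveSpeed n u γ t := by
  have h1 : curveLength n u (γ ∘ τ) =
      ∫⁻ t in Ioo (0 : ℝ) 1, ENNReal.ofReal |τ' t| * curveSpeed n u γ (τ t) := by
    refine setLIntegral_congr_fun measurableSet_Ioo fun t ht => ?_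
    have hτt : τ t ∈ Icc (0 : ℝ) 1 := hmaps (Ioo_subset_Icc_self ht)
    have h2 := ((hγ.differentiableOn (by norm_num)) (τ t) hτt).hasDerivWithinAt
    have h3 := (h2.scomp t (hτ t).hasDerivWithinAt hmaps).hasDerivAt (Icc_mem_nhds ht.1 ht.2)
    simp only [curveSpeed]
    have h4 : deriv (fun s => ((γ ∘ τ) s : EuclideanSpace ℝ (Fin (n + 1)))) t = _ := h3.deriv
    rw [h4, norm_smul, Real.norm_eq_abs, ← ENNReal.ofReal_mul (abs_nonneg _)]
    congr 1
    simp only [Function.comp_apply]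
    ring
  rw [h1]
  rcases hmono with ⟨hm, hp⟩ | ⟨hm, hp⟩
  · rw [lintegral_image_eq_lintegral_deriv_mul_of_monotoneOn measurableSet_Ioo
      (fun t _ => (hτ t).hasDerivWithinAt) (hm.monotoneOn _)]
    simp_rw [abs_of_nonneg (hp _)]
  · rw [lintegral_image_eq_lintegral_deriv_mul_of_antitoneOn measurableSet_Ioo
      (fun t _ => (hτ t).hasDerivWithinAt) (hm.antitoneOn _)]
    simp_rw [abs_of_nonpos (hp _)]

theorem curveLength_comp_le (hγ : ContDiffOn ℝ 1 (fun s => (γ s : EuclideanSpace ℝ (Fin (n + 1))))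
    (Icc 0 1)) {τ τ' : ℝ → ℝ} (hτ : ∀ t, HasDerivAt τ (τ' t) t)
    (hmaps : MapsTo τ (Icc 0 1) (Icc 0 1))
    (hmono : (Monotone τ ∧ ∀ t, 0 ≤ τ' t) ∨ (Antitone τ ∧ ∀ t, τ' t ≤ 0)) :
    curveLength n u (γ ∘ τ) ≤ curveLength n u γ := by
  rw [curveLength_comp hγ hτ hmaps hmono, curveLength_eq]
  refine lintegral_mono_set' ?_
  exact (LE.le.eventuallyLE ((image_mono Ioo_subset_Icc_self).trans hmaps.image_subset)).trans
    (Ioo_ae_eq_Icc (a := (0 : ℝ)) (b := 1) (μ := volume)).symm.le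

theorem IsC1Curve.reverse (h : IsC1Curve n Ω x y γ) : IsC1Curve n Ω y x fun t => γ (1 - t) := by
  have hm : ∀ t ∈ Icc (0 : ℝ) 1, 1 - t ∈ Icc (0 : ℝ) 1 := fun t ht =>
    ⟨by linarith [ht.2], by linarith [ht.1]⟩
  refine ⟨h.1.comp (f := fun t : ℝ => 1 - t) (by fun_prop) hm, fun t ht => h.2.1 _ (hm t ht), ?_, ?_⟩
  · simpa using h.2.2.2
  · simpa using h.2.2.1

theorem metricDist_le_of_curve (h : IsC1Curve n Ω x y γ) :
    metricDist n u Ω x y ≤ curveLength n u γ := iInf₂_le γ h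

theorem metricDist_le_swap : metricDist n u Ω y x ≤ metricDist n u Ω x y := by
  refine le_iInf₂ fun γ h => (metricDist_le_of_curve h.reverse).trans ?_
  refine curveLength_comp_le h.1 (τ := fun t => 1 - t) (τ' := fun _ => -1) (fun t => ?_)
    (fun t ht => ⟨by linarith [ht.2], by linarith [ht.1]⟩) (Or.inr ⟨fun a b hab => ?_, fun _ => ?_⟩)
  · simpa using (hasDerivAt_id t).const_sub 1
  · linarith
  · norm_num

theorem metricDist_comm : metricDist n u Ω x y = metricDist n u Ω y x :=
  le_antisymm metricDist_le_swap metricDist_le_swap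

/-- Two curves can be joined, after a change of parameter making them constant near the ends. -/
theorem IsC1Curve.exists_trans {γ₁ γ₂ : ℝ → USphere n} (h₁ : IsC1Curve n Ω x y γ₁)
    (h₂ : IsC1Curve n Ω y z γ₂) : ∃ γ, IsC1Curve n Ω x z γ ∧
      curveLength n u γ ≤ curveLength n u γ₁ + curveLength n u γ₂ := by
  set σ := Real.smoothTransition with hσ
  have hσ01 : ∀ t, σ t ∈ Icc (0 : ℝ) 1 := fun t =>
    ⟨Real.smoothTransition.nonneg t, Real.smoothTransition.le_one t⟩
  have hσcd : ContDiff ℝ 1 σ := Real.smoothTransition.contDiff (n := 1)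
  have hσd : ∀ t, HasDerivAt σ (deriv σ t) t := fun t =>
    (hσcd.differentiable (by norm_num) t).hasDerivAt
  have hσ0 : ∀ t, 0 ≤ deriv σ t := fun t => Real.smoothTransition.monotone.deriv_nonneg
  -- The first piece has arrived at `y` from time 1/3 on and the second stays at `y` until time 2/3.
  -- On the overlap both formulas agree, so the joined curve is `C¹` with no condition on
  -- velocities.
  set τ₁ : ℝ → ℝ := fun t => σ (3 * t) with hτ₁
  set τ₂ : ℝ → ℝ := fun t => σ (3 * t - 2) with hτ₂
  have hd1 : ∀ t, HasDerivAt τ₁ (deriv σ (3 * t) * 3) t := fun t => by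
    have := (hσd (3 * t)).comp t ((hasDerivAt_id t).const_mul 3)
    exact this.congr_deriv (by ring)
  have hd2 : ∀ t, HasDerivAt τ₂ (deriv σ (3 * t - 2) * 3) t := fun t => by
    have := (hσd (3 * t - 2)).comp t (((hasDerivAt_id t).const_mul 3).sub_const 2)
    exact this.congr_deriv (by ring)
  have hm1 : Monotone τ₁ := fun a b hab => Real.smoothTransition.monotone (by linarith)
  have hm2 : Monotone τ₂ := fun a b hab => Real.smoothTransition.monotone (by linarith)
  set γ : ℝ → USphere n := fun t => if t ≤ 1 / 2 then γ₁ (τ₁ t) else γ₂ (τ₂ t) with hγ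
  have e1 : ∀ t < 2 / 3, γ t = γ₁ (τ₁ t) := by
    intro t ht
    by_cases h : t ≤ 1 / 2
    · simp only [hγ, if_pos h]
    · simp only [hγ, if_neg h]
      have a1 : τ₁ t = 1 := Real.smoothTransition.one_of_one_le (by linarith)
      have a2 : τ₂ t = 0 := Real.smoothTransition.zero_of_nonpos (by linarith)
      rw [a1, a2, h₁.2.2.2, h₂.2.2.1]
  have e2 : ∀ t, 1 / 3 < t → γ t = γ₂ (τ₂ t) := by
    intro t ht
    by_cases h : t ≤ 1 / 2
    · simp only [hγ, if_pos h]
      have a1 : τ₁ t = 1 := Real.smoothTransition.one_of_one_le (by linarith)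
      have a2 : τ₂ t = 0 := Real.smoothTransition.zero_of_nonpos (by linarith)
      rw [a1, a2, h₁.2.2.2, h₂.2.2.1]
    · simp only [hγ, if_neg h]
  have hc1 : ContDiff ℝ 1 fun t => (γ₁ (τ₁ t) : EuclideanSpace ℝ (Fin (n + 1))) :=
    contDiffOn_univ.1 (h₁.1.comp (hσcd.comp (by fun_prop)).contDiffOn fun t _ => hσ01 _)
  have hc2 : ContDiff ℝ 1 fun t => (γ₂ (τ₂ t) : EuclideanSpace ℝ (Fin (n + 1))) :=
    contDiffOn_univ.1 (h₂.1.comp (hσcd.comp (by fun_prop)).contDiffOn fun t _ => hσ01 _)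
  have hcd : ContDiff ℝ 1 fun t => (γ t : EuclideanSpace ℝ (Fin (n + 1))) := by
    rw [contDiff_iff_contDiffAt]
    intro t
    rcases lt_or_ge t (2 / 3) with ht | ht
    · refine hc1.contDiffAt.congr_of_eventuallyEq ?_
      filter_upwards [Iio_mem_nhds ht] with s hs
      rw [e1 s hs]
    · refine hc2.contDiffAt.congr_of_eventuallyEq ?_
      filter_upwards [Ioi_mem_nhds (show 1 / 3 < t by linarith)] with s hs
      rw [e2 s hs]
  refine ⟨γ, ⟨hcd.contDiffOn, fun t _ => ?_, ?_, ?_⟩, ?_⟩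
  · rcases lt_or_ge t (2 / 3) with ht | ht
    · rw [e1 t ht]; exact h₁.2.1 _ (hσ01 _)
    · rw [e2 t (by linarith)]; exact h₂.2.1 _ (hσ01 _)
  · rw [e1 0 (by norm_num)]
    have : τ₁ 0 = 0 := by simp [hτ₁, hσ]
    rw [this, h₁.2.2.1]
  · rw [e2 1 (by norm_num)]
    have : τ₂ 1 = 1 := Real.smoothTransition.one_of_one_le (by norm_num)
    rw [this, h₂.2.2.2]
  · have hl1 := curveLength_comp_le (u := u) h₁.1 hd1 (fun t _ => hσ01 _)
      (Or.inl ⟨hm1, fun t => mul_nonneg (hσ0 _) (by norm_num)⟩)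
    have hl2 := curveLength_comp_le (u := u) h₂.1 hd2 (fun t _ => hσ01 _)
      (Or.inl ⟨hm2, fun t => mul_nonneg (hσ0 _) (by norm_num)⟩)
    refine le_trans ?_ (add_le_add hl1 hl2)
    have hsub : Ioo (0 : ℝ) 1 ⊆ Ioo 0 (2 / 3) ∪ Ioo (1 / 3) 1 := by
      intro t ht
      rcases lt_or_ge t (2 / 3) with h | h
      · exact Or.inl ⟨ht.1, h⟩
      · exact Or.inr ⟨by linarith, ht.2⟩
    refine (lintegral_mono_set hsub).trans ((lintegral_union_le _ _ _).trans (add_le_add ?_ ?_))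
    · refine le_trans (le_of_eq ?_) (lintegral_mono_set (s := Ioo (0 : ℝ) (2 / 3))
        (Ioo_subset_Ioo_right (by norm_num)))
      refine setLIntegral_congr_fun measurableSet_Ioo fun t ht => ?_
      have : (fun s => (γ s : EuclideanSpace ℝ (Fin (n + 1)))) =ᶠ[𝓝 t]
          fun s => ((γ₁ ∘ τ₁) s : _) := by
        filter_upwards [Iio_mem_nhds ht.2] with s hs
        rw [e1 s hs]; rfl
      rw [this.deriv_eq, e1 t ht.2]; rfl
    · refine le_trans (le_of_eq ?_) (lintegral_mono_set (s := Ioo (1 / 3 : ℝ) 1)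
        (Ioo_subset_Ioo_left (by norm_num)))
      refine setLIntegral_congr_fun measurableSet_Ioo fun t ht => ?_
      have : (fun s => (γ s : EuclideanSpace ℝ (Fin (n + 1)))) =ᶠ[𝓝 t]
          fun s => ((γ₂ ∘ τ₂) s : _) := by
        filter_upwards [Ioi_mem_nhds ht.1] with s hs
        rw [e2 s hs]; rfl
      rw [this.deriv_eq, e2 t ht.1]; rfl

theorem metricDist_triangle :
    metricDist n u Ω x z ≤ metricDist n u Ω x y + metricDist n u Ω y z := by
  conv_rhs => rw [metricDist, metricDist]
  simp only [ENNReal.iInf_add, ENNReal.add_iInf]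
  refine le_iInf₂ fun γ₁ h₁ => le_iInf₂ fun γ₂ h₂ => ?_
  obtain ⟨γ, hγ, hl⟩ := h₂.exists_trans (u := u) h₁
  exact (metricDist_le_of_curve hγ).trans hl

/-- The two affine reparametrizations cover the parts of the curve before and after `c`; these
overlap in one parameter only, which is a null set. -/
theorem IsC1Curve.exists_split (h : IsC1Curve n Ω x y γ) {c : ℝ} (hc : c ∈ Icc (0 : ℝ) 1) :
    metricDist n u Ω x (γ c) + metricDist n u Ω (γ c) y ≤ curveLength n u γ := by
  set τ₁ : ℝ → ℝ := fun t => c * t with hτ₁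
  set τ₂ : ℝ → ℝ := fun t => c + (1 - c) * t with hτ₂
  have hm1 : MapsTo τ₁ (Icc 0 1) (Icc 0 1) := fun t ht =>
    ⟨mul_nonneg hc.1 ht.1, mul_le_one₀ hc.2 ht.1 ht.2⟩
  have hm2 : MapsTo τ₂ (Icc 0 1) (Icc 0 1) := fun t ht =>
    ⟨add_nonneg hc.1 (mul_nonneg (by linarith [hc.2]) ht.1), by
      simp only [hτ₂]; nlinarith [hc.2, ht.2]⟩
  have hd1 : ∀ t, HasDerivAt τ₁ c t := fun t => by simpa using (hasDerivAt_id t).const_mul c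
  have hd2 : ∀ t, HasDerivAt τ₂ (1 - c) t := fun t =>
    (((hasDerivAt_id t).const_mul (1 - c)).const_add c).congr_deriv (by ring)
  have c1 : IsC1Curve n Ω x (γ c) (γ ∘ τ₁) :=
    ⟨h.1.comp (f := τ₁) (by fun_prop) hm1, fun t ht => h.2.1 _ (hm1 ht), by simp [hτ₁, h.2.2.1],
      by simp [hτ₁]⟩
  have c2 : IsC1Curve n Ω (γ c) y (γ ∘ τ₂) :=
    ⟨h.1.comp (f := τ₂) (by fun_prop) hm2, fun t ht => h.2.1 _ (hm2 ht), by simp [hτ₂],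
      by simp [hτ₂, h.2.2.2]⟩
  refine (add_le_add (metricDist_le_of_curve c1) (metricDist_le_of_curve c2)).trans ?_
  rw [curveLength_comp h.1 hd1 hm1
      (Or.inl ⟨fun a b hab => mul_le_mul_of_nonneg_left hab hc.1, fun _ => hc.1⟩),
    curveLength_comp h.1 hd2 hm2
      (Or.inl ⟨fun a b hab => add_le_add le_rfl
        (mul_le_mul_of_nonneg_left hab (by linarith [hc.2])), fun _ => by linarith [hc.2]⟩),
    curveLength_eq]
  have hlt2 : ∀ t ∈ Ioo (0 : ℝ) 1, c ≤ τ₂ t := fun t ht => by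
    simp only [hτ₂]; nlinarith [hc.2, ht.1]
  have hlt1 : ∀ t ∈ Ioo (0 : ℝ) 1, τ₁ t ≤ c := fun t ht => by
    simp only [hτ₁]; nlinarith [hc.1, ht.2]
  calc _ ≤ (∫⁻ t in Icc 0 c, curveSpeed n u γ t) + ∫⁻ t in Icc c 1, curveSpeed n u γ t := by
        refine add_le_add (lintegral_mono_set ?_) (lintegral_mono_set ?_)
        · rintro _ ⟨t, ht, rfl⟩
          exact ⟨(hm1 (Ioo_subset_Icc_self ht)).1, hlt1 t ht⟩
        · rintro _ ⟨t, ht, rfl⟩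
          exact ⟨hlt2 t ht, (hm2 (Ioo_subset_Icc_self ht)).2⟩
    _ = (∫⁻ t in Ico 0 c, curveSpeed n u γ t) + ∫⁻ t in Ico c 1, curveSpeed n u γ t := by
        rw [setLIntegral_congr Ico_ae_eq_Icc, setLIntegral_congr Ico_ae_eq_Icc]
    _ = ∫⁻ t in Ico 0 1, curveSpeed n u γ t := by
        rw [← lintegral_union measurableSet_Ico, Ico_union_Ico_eq_Ico hc.1 hc.2]
        exact Set.disjoint_left.2 fun t h1 h2 => absurd h1.2 (not_lt.2 h2.1)
    _ = _ := by rw [setLIntegral_congr Ioo_ae_eq_Ico]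

/-- A lower bound for lengths: a curve reaching `q` from outside a ball on which `u ≥ m` has
length at least `eᵐ r`. -/
theorem le_metricDist {q : USphere n} {m r : ℝ}
    (hm : ∀ z, dist z q ≤ r → m ≤ u z) (hx : r ≤ dist x q) :
    ENNReal.ofReal (Real.exp m * r) ≤ metricDist n u Ω x q := by
  refine le_iInf₂ fun γ h => ?_
  set f : ℝ → EuclideanSpace ℝ (Fin (n + 1)) := fun s => (γ s : EuclideanSpace ℝ (Fin (n + 1)))
  have hfc : ContinuousOn f (Icc 0 1) := h.1.continuousOn
  have hdist : ∀ t, dist (γ t) q = ‖f t - q‖ := fun t => by rw [Subtype.dist_eq, dist_eq_norm]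
  have hgc : ContinuousOn (fun t => ‖f t - q‖) (Icc 0 1) := (hfc.sub continuousOn_const).norm
  set A := Icc (0 : ℝ) 1 ∩ {t | r ≤ ‖f t - q‖} with hA
  have hAc : IsCompact A := by
    have : A = Icc (0 : ℝ) 1 ∩ (fun t => ‖f t - q‖) ⁻¹' (Ici r) := rfl
    rw [this]
    exact isCompact_Icc.of_isClosed_subset
      (hgc.preimage_isClosed_of_isClosed isClosed_Icc isClosed_Ici) inter_subset_left
  have h0A : (0 : ℝ) ∈ A := by
    refine ⟨⟨le_rfl, zero_le_one⟩, ?_⟩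
    change r ≤ ‖f 0 - q‖
    rw [← hdist, h.2.2.1]; exact hx
  -- The last time at distance at least `r` from `q`. From then on the curve lies in the ball where
  -- `u ≥ m`, and still has to cover the distance `r`.
  obtain ⟨t₀, ht₀⟩ := hAc.exists_isGreatest ⟨0, h0A⟩
  have ht01 : t₀ ∈ Icc (0 : ℝ) 1 := ht₀.1.1
  have hball : ∀ t ∈ Ioc t₀ 1, dist (γ t) q ≤ r := by
    intro t ht
    by_contra! hlt
    have : t ∈ A := ⟨⟨ht01.1.trans ht.1.le, ht.2⟩, by
      change r ≤ ‖f t - q‖; rw [← hdist]; exact hlt.le⟩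
    exact absurd (ht₀.2 this) (not_le.2 ht.1)
  have hder : ∀ t ∈ Ioo t₀ 1, HasDerivAt f (derivWithin f (Icc 0 1) t) t := fun t ht =>
    ((h.1.differentiableOn (by norm_num)) t
      ⟨ht01.1.trans ht.1.le, ht.2.le⟩).hasDerivWithinAt.hasDerivAt
      (Icc_mem_nhds (ht01.1.trans_lt ht.1) ht.2)
  have hdc : ContinuousOn (derivWithin f (Icc 0 1)) (Icc 0 1) :=
    h.1.continuousOn_derivWithin (uniqueDiffOn_Icc zero_lt_one) le_rfl
  have hsub : Icc t₀ 1 ⊆ Icc (0 : ℝ) 1 := Icc_subset_Icc_left ht01.1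
  have hFTC := intervalIntegral.integral_eq_sub_of_hasDerivAt_of_le ht01.2 (hfc.mono hsub) hder
    ((hdc.mono hsub).intervalIntegrable_of_Icc ht01.2)
  have h1 : r ≤ ‖∫ t in t₀..1, derivWithin f (Icc 0 1) t‖ := by
    rw [hFTC]
    have : f 1 = q := by simp only [f, h.2.2.2]
    rw [this, norm_sub_rev]
    exact ht₀.1.2
  rw [intervalIntegral.integral_of_le ht01.2] at h1
  have h2 : ENNReal.ofReal r ≤ ∫⁻ t in Ioc t₀ 1, ‖derivWithin f (Icc 0 1) t‖ₑ := by
    refine le_trans ?_ (enorm_integral_le_lintegral_enorm _)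
    rw [← ofReal_norm]
    exact ENNReal.ofReal_le_ofReal h1
  rw [ENNReal.ofReal_mul (Real.exp_pos m).le]
  refine (mul_le_mul_of_nonneg_left h2 (zero_le)).trans ?_
  rw [← lintegral_const_mul' _ _ ENNReal.ofReal_ne_top, curveLength_eq,
    setLIntegral_congr (Ioo_ae_eq_Ioc (a := (0 : ℝ)) (b := 1))]
  refine (setLIntegral_mono' measurableSet_Ioc fun t ht => ?_).trans
    (lintegral_mono_set (Ioc_subset_Ioc_left ht01.1))
  simp only [curveSpeed]
  rw [← ofReal_norm, ← ENNReal.ofReal_mul (Real.exp_pos m).le]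
  refine ENNReal.ofReal_le_ofReal (mul_le_mul_of_nonneg_right ?_ (norm_nonneg _))
  exact Real.exp_le_exp.2 (hm _ (hball t ht))

/-- Convergence for the Riemannian distance implies convergence in the sphere. -/
theorem tendsto_of_tendsto_metricDist (hΩ : IsOpen Ω) (hu : ContinuousOn u Ω) {q : USphere n}
    (hq : q ∈ Ω) {X : ℕ → USphere n}
    (hX : Tendsto (fun i => metricDist n u Ω (X i) q) atTop (𝓝 0)) : Tendsto X atTop (𝓝 q) := by
  rw [Metric.tendsto_nhds]
  intro ε hε
  have hcont : ∀ᶠ z in 𝓝 q, u q - 1 < u z :=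
    ((hu q hq).continuousAt (hΩ.mem_nhds hq)).eventually (lt_mem_nhds (by linarith))
  obtain ⟨δ, hδ, hδu⟩ := Metric.eventually_nhds_iff.1 hcont
  set r := min (δ / 2) ε with hr
  have hr0 : 0 < r := lt_min (by linarith) hε
  have hpos : 0 < ENNReal.ofReal (Real.exp (u q - 1) * r) := by
    rw [ENNReal.ofReal_pos]; positivity
  filter_upwards [hX.eventually (gt_mem_nhds hpos)] with i hi
  by_contra! hge
  refine absurd hi (not_lt.2 (le_metricDist (fun z hz => (hδu ?_).le) ((min_le_right _ _).trans hge)))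
  exact lt_of_le_of_lt (hz.trans (min_le_left _ _)) (by linarith)

/-- In a complete conformal metric, no sequence leaving `Ω` is Cauchy. -/
theorem IsCompleteMetric.not_cauchy (hcomp : IsCompleteMetric n u Ω) (hΩ : IsOpen Ω)
    (hu : ContinuousOn u Ω) {p : USphere n} (hp : p ∉ Ω) {X : ℕ → USphere n} (hX : ∀ i, X i ∈ Ω)
    (hlim : Tendsto X atTop (𝓝 p)) :
    ¬ ∀ ε : ℝ≥0∞, 0 < ε → ∃ N, ∀ i ≥ N, ∀ j ≥ N, metricDist n u Ω (X i) (X j) < ε := by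
  intro hc
  obtain ⟨q, hq, hqlim⟩ := hcomp X hX hc
  have := tendsto_nhds_unique hlim (tendsto_of_tendsto_metricDist hΩ hu hq hqlim)
  exact hp (this ▸ hq)

/-- Summable consecutive distances make a Cauchy sequence. -/
theorem cauchy_of_tsum_metricDist {X : ℕ → USphere n}
    (hΩX : ∀ i, metricDist n u Ω (X i) (X i) = 0)
    (hs : ∑' i, metricDist n u Ω (X i) (X (i + 1)) ≠ ⊤) :
    ∀ ε : ℝ≥0∞, 0 < ε → ∃ N, ∀ i ≥ N, ∀ j ≥ N, metricDist n u Ω (X i) (X j) < ε := by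
  intro ε hε
  have ht := ENNReal.tendsto_sum_nat_add (fun i => metricDist n u Ω (X i) (X (i + 1))) hs
  obtain ⟨N, hN⟩ := (ht.eventually (gt_mem_nhds hε)).exists
  have key : ∀ i j, i ≤ j → metricDist n u Ω (X i) (X j) ≤
      ∑ l ∈ Finset.Ico i j, metricDist n u Ω (X l) (X (l + 1)) := by
    intro i j hij
    induction j, hij using Nat.le_induction with
    | base => simp [hΩX]
    | succ j hij ih =>
      rw [Finset.sum_Ico_succ_top hij]
      exact metricDist_triangle.trans (add_le_add ih le_rfl)
  have key2 : ∀ i j, N ≤ i → i ≤ j → metricDist n u Ω (X i) (X j) < ε := by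
    intro i j hi hij
    refine ((key i j hij).trans ?_).trans_lt hN
    calc ∑ l ∈ Finset.Ico i j, metricDist n u Ω (X l) (X (l + 1))
        ≤ ∑ l ∈ Finset.Ico N j, metricDist n u Ω (X l) (X (l + 1)) :=
          Finset.sum_le_sum_of_subset (Finset.Ico_subset_Ico_left hi)
      _ = ∑ l ∈ Finset.range (j - N), metricDist n u Ω (X (N + l)) (X (N + l + 1)) := by
          rw [Finset.sum_Ico_eq_sum_range]
      _ ≤ _ := by
          simp_rw [add_comm N]
          exact ENNReal.sum_le_tsum _
  refine ⟨N, fun i hi j hj => ?_⟩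
  rcases le_total i j with h | h
  · exact key2 i j hi h
  · rw [metricDist_comm]; exact key2 j i hj h

end Curves

/-! ### Stereographic charts and lengths read in them -/

section Chart

variable {n : ℕ} {u : USphere n → ℝ} {Ω : Set (USphere n)} {v : USphere n}

theorem exists_stereoParam_eq (n : ℕ) (v : USphere n) :
    ∃ L : EuclideanSpace ℝ (Fin n) →ₗᵢ[ℝ] EuclideanSpace ℝ (Fin (n + 1)),
      (∀ z, stereoParam n v z = (‖z‖ ^ 2 + 4)⁻¹ • ((4 : ℝ) • L z + (‖z‖ ^ 2 - 4) • v.val)) ∧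
      ∀ z, inner ℝ (L z) v.val = 0 := by
  have := finrank_euclidean_succ n
  let U : (ℝ ∙ (v : EuclideanSpace ℝ (Fin (n + 1))))ᗮ ≃ₗᵢ[ℝ] EuclideanSpace ℝ (Fin n) :=
      (OrthonormalBasis.fromOrthogonalSpanSingleton n (ne_zero_of_mem_unit_sphere v)).repr
  refine ⟨(Submodule.subtypeₗᵢ _).comp U.symm.toLinearIsometry, ?_, ?_⟩
  · intro z
    have h := stereographic'_symm_apply (n := n) v z
    have hz : ‖((U.symm z : (ℝ ∙ (v : EuclideanSpace ℝ (Fin (n + 1))))ᗮ) :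
        EuclideanSpace ℝ (Fin (n + 1)))‖ = ‖z‖ :=
      (Submodule.coe_norm _).symm.trans (U.symm.norm_map z)
    simp only at h
    change ((stereographic' n v).symm z : EuclideanSpace ℝ (Fin (n + 1))) = _
    rw [h, smul_add]
    change (‖((U.symm z : (ℝ ∙ (v : EuclideanSpace ℝ (Fin (n + 1))))ᗮ) :
        EuclideanSpace ℝ (Fin (n + 1)))‖ ^ 2 + 4)⁻¹ • _ + (‖((U.symm z :
        (ℝ ∙ (v : EuclideanSpace ℝ (Fin (n + 1))))ᗮ) :
        EuclideanSpace ℝ (Fin (n + 1)))‖ ^ 2 + 4)⁻¹ • (‖((U.symm z :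
        (ℝ ∙ (v : EuclideanSpace ℝ (Fin (n + 1))))ᗮ) :
        EuclideanSpace ℝ (Fin (n + 1)))‖ ^ 2 - 4) • _ = _
    rw [hz]
    rfl
  · intro z
    have := (U.symm z).2
    rw [Submodule.mem_orthogonal_singleton_iff_inner_left] at this
    exact this

theorem contDiff_stereoParam : ContDiff ℝ ∞ (stereoParam n v) := by
  obtain ⟨L, hL, -⟩ := exists_stereoParam_eq n v
  have : stereoParam n v = _ := funext hL
  rw [this]
  have h1 : ContDiff ℝ ∞ fun z : EuclideanSpace ℝ (Fin n) => ‖z‖ ^ 2 := contDiff_norm_sq ℝ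
  refine ((h1.add contDiff_const).inv fun z => by positivity).smul ?_
  exact (L.toContinuousLinearMap.contDiff.const_smul (4 : ℝ)).add
    ((h1.sub contDiff_const).smul contDiff_const)

/-- Conformality of stereographic projection, read off from `metricCoord_eq` with `u = 0` by
expanding the vector in the standard basis. -/
theorem norm_fderiv_stereoParam (y a : EuclideanSpace ℝ (Fin n)) :
    ‖fderiv ℝ (stereoParam n v) y a‖ = 4 / (‖y‖ ^ 2 + 4) * ‖a‖ := by
  have hpos : (0 : ℝ) < 4 / (‖y‖ ^ 2 + 4) := by positivity
  have h0 := metricCoord_eq n (fun _ => 0) v y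
  have hij : ∀ i j, inner ℝ (fderiv ℝ (stereoParam n v) y (EuclideanSpace.single i 1))
      (fderiv ℝ (stereoParam n v) y (EuclideanSpace.single j 1)) =
      (4 / (‖y‖ ^ 2 + 4)) ^ 2 * (if i = j then 1 else 0) := by
    intro i j
    have h1 := congrFun (congrFun h0 i) j
    simp only [metricCoord, Matrix.of_apply, mul_zero, Real.exp_zero, one_mul, flatFactor, zero_add,
      Matrix.smul_apply, Matrix.one_apply, smul_eq_mul] at h1
    rw [h1, two_mul, Real.exp_add, Real.exp_log hpos, ← sq]
  have ha : a = ∑ i, a i • EuclideanSpace.single i (1 : ℝ) := by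
    have := (EuclideanSpace.basisFun (Fin n) ℝ).sum_repr a
    simpa using this.symm
  have hsq : ‖fderiv ℝ (stereoParam n v) y a‖ ^ 2 = (4 / (‖y‖ ^ 2 + 4) * ‖a‖) ^ 2 := by
    rw [← real_inner_self_eq_norm_sq]
    conv_lhs => rw [ha]
    simp only [map_sum, map_smul, sum_inner, inner_sum, inner_smul_left, inner_smul_right, hij]
    rw [mul_pow, EuclideanSpace.norm_sq_eq a, Finset.mul_sum]
    refine Finset.sum_congr rfl fun i _ => ?_
    simp
    ring
  exact (pow_left_inj₀ (norm_nonneg _) (by positivity) two_ne_zero).1 hsq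

theorem stereoChart_target : (stereoChart n v).target = univ := by
  have := finrank_euclidean_succ n
  exact stereographic'_target v

theorem stereoChart_source : (stereoChart n v).source = {v}ᶜ := by
  have := finrank_euclidean_succ n
  exact stereographic'_source v

theorem stereoChart_apply_symm (y : EuclideanSpace ℝ (Fin n)) :
    stereoChart n v ((stereoChart n v).symm y) = y :=
  (stereoChart n v).right_inv (by rw [stereoChart_target]; trivial)

theorem stereoChart_symm_apply {x : USphere n} (hx : x ≠ v) :
    (stereoChart n v).symm (stereoChart n v x) = x :=
  (stereoChart n v).left_inv (by rw [stereoChart_source]; exact hx)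

theorem stereoChart_symm_ne (y : EuclideanSpace ℝ (Fin n)) : (stereoChart n v).symm y ≠ v := by
  have h := (stereoChart n v).map_target (x := y) (by rw [stereoChart_target]; trivial)
  rwa [stereoChart_source] at h

theorem injective_stereoChart_symm : Function.Injective (stereoChart n v).symm :=
  Function.LeftInverse.injective stereoChart_apply_symm

theorem continuous_stereoChart_symm : Continuous (stereoChart n v).symm := by
  have h := (stereoChart n v).continuousOn_symm
  rwa [stereoChart_target, continuousOn_univ] at h

theorem tendsto_stereoChart_symm_cocompact :
    Tendsto (stereoChart n v).symm (cocompact _) (𝓝 v) := by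
  rw [tendsto_subtype_rng]
  change Tendsto (stereoParam n v) (cocompact _) (𝓝 _)
  obtain ⟨L, hL, -⟩ := exists_stereoParam_eq n v
  have hN : Tendsto (fun z : EuclideanSpace ℝ (Fin n) => ‖z‖) (cocompact _) atTop :=
    tendsto_norm_cocompact_atTop
  rw [tendsto_iff_norm_sub_tendsto_zero]
  have hb : ∀ z : EuclideanSpace ℝ (Fin n), 1 ≤ ‖z‖ → ‖stereoParam n v z - v.val‖ ≤ 12 * ‖z‖⁻¹ := by
    intro z hz
    have hp : (0 : ℝ) < ‖z‖ ^ 2 + 4 := by positivity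
    -- The difference has a numerator of order `‖z‖` and a denominator of order `‖z‖²`.
    have e : stereoParam n v z - v.val =
        (‖z‖ ^ 2 + 4)⁻¹ • ((4 : ℝ) • L z - (8 : ℝ) • v.val) := by
      rw [hL]
      match_scalars <;> field_simp <;> ring
    rw [e, norm_smul, norm_inv, Real.norm_of_nonneg hp.le, inv_mul_le_iff₀ hp]
    have h1 : ‖(4 : ℝ) • L z - (8 : ℝ) • v.val‖ ≤ 4 * ‖z‖ + 8 := by
      refine (norm_sub_le _ _).trans ?_
      rw [norm_smul, norm_smul, L.norm_map, norm_eq_of_mem_sphere v]; norm_num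
    have h2 : (‖z‖ ^ 2 + 4) * (12 * ‖z‖⁻¹) = 12 * ‖z‖ + 48 * ‖z‖⁻¹ := by
      field_simp; ring
    rw [h2]
    have : 0 ≤ ‖z‖⁻¹ := by positivity
    linarith
  have hlim : Tendsto (fun z : EuclideanSpace ℝ (Fin n) => 12 * ‖z‖⁻¹) (cocompact _) (𝓝 0) := by
    simpa using (tendsto_inv_atTop_zero.comp hN).const_mul 12
  refine squeeze_zero' (Eventually.of_forall fun _ => norm_nonneg _) ?_ hlim
  filter_upwards [hN.eventually_ge_atTop 1] with z hz using hb z hz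

/-- The Riemannian distance is bounded by the length of a curve in a stereographic chart. -/
theorem metricDist_le_of_chart_curve {c c' : ℝ → EuclideanSpace ℝ (Fin n)}
    (hc : ContDiff ℝ 1 c) (hc' : ∀ t, HasDerivAt c (c' t) t)
    (hΩ : ∀ t ∈ Icc (0 : ℝ) 1, (stereoChart n v).symm (c t) ∈ Ω) :
    metricDist n u Ω ((stereoChart n v).symm (c 0)) ((stereoChart n v).symm (c 1)) ≤
      ∫⁻ t in Ioo (0 : ℝ) 1, ENNReal.ofReal (Real.exp (flatFactor n u v (c t)) * ‖c' t‖) := by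
  have h : IsC1Curve n Ω ((stereoChart n v).symm (c 0)) ((stereoChart n v).symm (c 1))
      fun t => (stereoChart n v).symm (c t) :=
    ⟨((contDiff_stereoParam.of_le (by exact_mod_cast le_top)).comp hc).contDiffOn, hΩ, rfl, rfl⟩
  refine (metricDist_le_of_curve h).trans (le_of_eq ?_)
  refine setLIntegral_congr_fun measurableSet_Ioo fun t _ => ?_
  have hd : HasDerivAt (fun s => stereoParam n v (c s)) (fderiv ℝ (stereoParam n v) (c t) (c' t)) t :=
    ((contDiff_stereoParam.differentiable (by simp)) (c t)).hasFDerivAt.comp_hasDerivAt t (hc' t)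
  have hd' : deriv (fun s => (((stereoChart n v).symm (c s) : USphere n) :
    EuclideanSpace ℝ (Fin (n + 1)))) t = _ := hd.deriv
  have hpos : (0 : ℝ) < 4 / (‖c t‖ ^ 2 + 4) := by positivity
  rw [hd', norm_fderiv_stereoParam, flatFactor, Real.exp_add, Real.exp_log hpos, mul_assoc]

theorem metricDist_segment_le {x y : EuclideanSpace ℝ (Fin n)} {M : ℝ}
    (h : ∀ z ∈ segment ℝ x y, (stereoChart n v).symm z ∈ Ω ∧ flatFactor n u v z ≤ M) :
    metricDist n u Ω ((stereoChart n v).symm x) ((stereoChart n v).symm y) ≤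
      ENNReal.ofReal (Real.exp M * ‖y - x‖) := by
  set c : ℝ → EuclideanSpace ℝ (Fin n) := fun t => x + t • (y - x) with hc
  have hseg : ∀ t ∈ Icc (0 : ℝ) 1, c t ∈ segment ℝ x y := fun t ht => by
    rw [segment_eq_image']; exact ⟨t, ht, rfl⟩
  have h1 := metricDist_le_of_chart_curve (u := u) (Ω := Ω) (v := v) (c := c) (c' := fun _ => y - x)
    (by fun_prop)
    (fun t => (((hasDerivAt_id t).smul_const (y - x)).const_add x).congr_deriv (one_smul _ _))
    fun t ht => (h _ (hseg t ht)).1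
  have e0 : c 0 = x := by simp [hc]
  have e1 : c 1 = y := by simp [hc]
  rw [e0, e1] at h1
  refine h1.trans ?_
  calc _ ≤ ∫⁻ t in Ioo (0 : ℝ) 1, ENNReal.ofReal (Real.exp M * ‖y - x‖) := by
        refine setLIntegral_mono' measurableSet_Ioo fun t ht => ENNReal.ofReal_le_ofReal ?_
        exact mul_le_mul_of_nonneg_right
          (Real.exp_le_exp.2 (h _ (hseg t (Ioo_subset_Icc_self ht))).2) (norm_nonneg _)
    _ = _ := by simp

theorem metricDist_self_chart {y : EuclideanSpace ℝ (Fin n)}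
    (hy : (stereoChart n v).symm y ∈ Ω) :
    metricDist n u Ω ((stereoChart n v).symm y) ((stereoChart n v).symm y) = 0 := by
  have := metricDist_segment_le (u := u) (Ω := Ω) (v := v) (x := y) (y := y)
    (M := flatFactor n u v y) (fun z hz => by
      rw [segment_same] at hz
      rw [mem_singleton_iff.1 hz]; exact ⟨hy, le_rfl⟩)
  simpa using this

/-- Distances along a ray, in logarithmic polar coordinates. -/
theorem metricDist_ray_le {ε : ℝ} (hε : ε = 1 ∨ ε = -1) (p : EuclideanSpace ℝ (Fin n))
    (θ : Metric.sphere (0 : EuclideanSpace ℝ (Fin n)) 1) {a b : ℝ} (hab : a ≤ b)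
    (hΩ : ∀ s ∈ Icc a b, (stereoChart n v).symm (p + logPolar (ε * s, θ)) ∈ Ω) :
    metricDist n u Ω ((stereoChart n v).symm (p + logPolar (ε * a, θ)))
      ((stereoChart n v).symm (p + logPolar (ε * b, θ))) ≤
      ∫⁻ s in Ioc a b, ENNReal.ofReal
        (Real.exp (flatFactor n u v (p + logPolar (ε * s, θ)) + ε * s)) := by
  have hε1 : |ε| = 1 := by rcases hε with rfl | rfl <;> norm_num
  set τ : ℝ → ℝ := fun t => a + (b - a) * t with hτ
  have hτd : ∀ t, HasDerivAt τ (b - a) t := fun t =>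
    (((hasDerivAt_id t).const_mul (b - a)).const_add a).congr_deriv (by ring)
  have hτI : ∀ t ∈ Icc (0 : ℝ) 1, τ t ∈ Icc a b := fun t ht =>
    ⟨by simp only [hτ]; nlinarith [ht.1], by simp only [hτ]; nlinarith [ht.2]⟩
  have hτm : Monotone τ := fun x y hxy => by simp only [hτ]; nlinarith
  set c : ℝ → EuclideanSpace ℝ (Fin n) := fun t => p + logPolar (ε * τ t, θ) with hc
  have hcd : ∀ t, HasDerivAt c ((Real.exp (ε * τ t) * (ε * (b - a))) •
      (θ : EuclideanSpace ℝ (Fin n))) t := fun t =>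
    ((((hτd t).const_mul ε).exp).smul_const (θ : EuclideanSpace ℝ (Fin n))).const_add p
  have hcc : ContDiff ℝ 1 c := by
    have h : ContDiff ℝ 1 fun t => Real.exp (ε * τ t) :=
      Real.contDiff_exp.comp (by simp only [hτ]; fun_prop)
    have h2 : ContDiff ℝ 1 fun t => Real.exp (ε * τ t) • (θ : EuclideanSpace ℝ (Fin n)) :=
      h.smul contDiff_const
    exact contDiff_const.add h2
  have h1 := metricDist_le_of_chart_curve (u := u) (Ω := Ω) (v := v) hcc hcd
    fun t ht => hΩ _ (hτI t ht)
  have e0 : c 0 = p + logPolar (ε * a, θ) := by simp [hc, hτ]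
  have e1 : c 1 = p + logPolar (ε * b, θ) := by simp [hc, hτ]
  rw [e0, e1] at h1
  refine h1.trans ?_
  have h2 := lintegral_image_eq_lintegral_deriv_mul_of_monotoneOn (s := Ioo (0 : ℝ) 1)
    measurableSet_Ioo (fun t _ => (hτd t).hasDerivWithinAt) (hτm.monotoneOn _)
    (fun s => ENNReal.ofReal (Real.exp (flatFactor n u v (p + logPolar (ε * s, θ)) + ε * s)))
  have h3 : ∫⁻ s in τ '' Ioo 0 1, ENNReal.ofReal
        (Real.exp (flatFactor n u v (p + logPolar (ε * s, θ)) + ε * s)) ≤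
      ∫⁻ s in Icc a b, ENNReal.ofReal
        (Real.exp (flatFactor n u v (p + logPolar (ε * s, θ)) + ε * s)) :=
    lintegral_mono_set (image_subset_iff.2 fun t ht => hτI t (Ioo_subset_Icc_self ht))
  rw [setLIntegral_congr (Ioc_ae_eq_Icc (a := a) (b := b))]
  refine le_trans (le_of_eq ?_) (h2 ▸ h3)
  refine setLIntegral_congr_fun measurableSet_Ioo fun t _ => ?_
  simp only [hc]
  rw [← ENNReal.ofReal_mul (by linarith), norm_smul, norm_eq_of_mem_sphere θ, Real.exp_add,
    Real.norm_eq_abs, abs_mul, abs_mul, hε1, Real.abs_exp, abs_of_nonneg (sub_nonneg.2 hab)]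
  congr 1; ring

/-- A ray of finite length running to a point outside `Ω` contradicts completeness. -/
theorem IsCompleteMetric.lintegral_ray_eq_top (hcomp : IsCompleteMetric n u Ω) (hΩ : IsOpen Ω)
    (hu : ContinuousOn u Ω) {ε : ℝ} (hε : ε = 1 ∨ ε = -1) {p : EuclideanSpace ℝ (Fin n)}
    {q : USphere n} (hq : q ∉ Ω) {θ : Metric.sphere (0 : EuclideanSpace ℝ (Fin n)) 1} {T : ℝ}
    (hray : ∀ s ≥ T, (stereoChart n v).symm (p + logPolar (ε * s, θ)) ∈ Ω)
    (hlim : Tendsto (fun s => (stereoChart n v).symm (p + logPolar (ε * s, θ))) atTop (𝓝 q)) :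
    ∫⁻ s in Ioi T, ENNReal.ofReal
        (Real.exp (flatFactor n u v (p + logPolar (ε * s, θ)) + ε * s)) = ⊤ := by
  by_contra hfin
  -- Sampling at unit steps: consecutive distances are bounded by the lengths of disjoint pieces of
  -- the ray, so finite length would give a Cauchy sequence running to `q ∉ Ω`.
  set X : ℕ → USphere n := fun i => (stereoChart n v).symm (p + logPolar (ε * (T + i), θ)) with hX
  have hTi : Tendsto (fun i : ℕ => T + (i : ℝ)) atTop atTop :=
    tendsto_atTop_add_const_left _ _ tendsto_natCast_atTop_atTop
  have hXΩ : ∀ i, X i ∈ Ω := fun i => hray _ (by have : (0 : ℝ) ≤ i := Nat.cast_nonneg i; linarith)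
  refine hcomp.not_cauchy hΩ hu hq hXΩ (hlim.comp hTi) ?_
  refine cauchy_of_tsum_metricDist (fun i => metricDist_self_chart (hXΩ i)) ?_
  refine ne_top_of_le_ne_top hfin ?_
  have hle : ∀ i : ℕ, metricDist n u Ω (X i) (X (i + 1)) ≤
      ∫⁻ s in Ioc (T + i) (T + (i + 1 : ℕ)), ENNReal.ofReal
        (Real.exp (flatFactor n u v (p + logPolar (ε * s, θ)) + ε * s)) := fun i =>
    metricDist_ray_le hε p θ (by push_cast; linarith) fun s hs =>
      hray s (by have : (0 : ℝ) ≤ i := Nat.cast_nonneg i; linarith [hs.1])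
  refine (ENNReal.tsum_le_tsum hle).trans ?_
  rw [← lintegral_iUnion (fun i => measurableSet_Ioc)]
  · refine lintegral_mono_set (iUnion_subset fun i s hs => ?_)
    have : (0 : ℝ) ≤ i := Nat.cast_nonneg i
    exact lt_of_le_of_lt (by linarith) hs.1
  · have hmono : Monotone fun i : ℕ => T + (i : ℝ) := fun i j hij => by
      have : (i : ℝ) ≤ j := by exact_mod_cast hij
      linarith
    simpa using hmono.pairwise_disjoint_on_Ioc_succ

theorem contDiffAt_flatFactor {y : EuclideanSpace ℝ (Fin n)} (hΩ : IsOpen Ω)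
    (hu : ContMDiffOn (𝓡 n) 𝓘(ℝ, ℝ) ∞ u Ω) (hy : (stereoChart n v).symm y ∈ Ω) :
    ContDiffAt ℝ ∞ (flatFactor n u v) y := by
  have := finrank_euclidean_succ n
  have h1 : ContMDiffAt (𝓡 n) 𝓘(ℝ, ℝ) ∞ u ((stereoChart n v).symm y) :=
    hu.contMDiffAt (hΩ.mem_nhds hy)
  have hmem : stereoChart n v ∈ IsManifold.maximalAtlas (𝓡 n) ∞ (USphere n) :=
    IsManifold.subset_maximalAtlas ⟨v, rfl⟩
  have h2 : ContMDiffAt (𝓡 n) (𝓡 n) ∞ (stereoChart n v).symm y :=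
    (contMDiffOn_symm_of_mem_maximalAtlas hmem).contMDiffAt
      ((stereoChart n v).open_target.mem_nhds (by rw [stereoChart_target]; trivial))
  have h3 : ContDiffAt ℝ ∞ (fun y => u ((stereoChart n v).symm y)) y :=
    contMDiffAt_iff_contDiffAt.1 (h1.comp y h2)
  refine h3.add ?_
  have h4 : ContDiff ℝ ∞ fun z : EuclideanSpace ℝ (Fin n) => ‖z‖ ^ 2 := contDiff_norm_sq ℝ
  have h5 : (4 : ℝ) / (‖y‖ ^ 2 + 4) ≠ 0 := by positivity
  exact ((contDiff_const.div (h4.add contDiff_const)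
    fun z => by positivity).contDiffAt).log h5

end Chart

/-! ### Rotations of pairs of vectors -/

section Rotation

variable {n : ℕ}

/-- The rotation of pairs of vectors by the angle `s`. -/
noncomputable def pairRotation (s : ℝ)
    (p : EuclideanSpace ℝ (Fin n) × EuclideanSpace ℝ (Fin n)) :
    EuclideanSpace ℝ (Fin n) × EuclideanSpace ℝ (Fin n) :=
  (Real.cos s • p.1 + Real.sin s • p.2, -Real.sin s • p.1 + Real.cos s • p.2)

theorem measurePreserving_shear (a : ℝ) :
    MeasurePreserving (fun p : EuclideanSpace ℝ (Fin n) × EuclideanSpace ℝ (Fin n) =>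
      (p.1, p.2 + a • p.1)) (volume.prod volume) (volume.prod volume) :=
  (MeasurePreserving.id volume).skew_product (g := fun x y => y + a • x)
    (by fun_prop : Continuous _).measurable
    (ae_of_all _ fun x => (measurePreserving_add_right volume (a • x)).map_eq)

theorem measurePreserving_shear' (a : ℝ) :
    MeasurePreserving (fun p : EuclideanSpace ℝ (Fin n) × EuclideanSpace ℝ (Fin n) =>
      (p.1 + a • p.2, p.2)) (volume.prod volume) (volume.prod volume) :=
  (Measure.measurePreserving_swap.comp (measurePreserving_shear a)).comp
    Measure.measurePreserving_swap

/-- A plane rotation is a product of three shears, with parameters `tan (s/2)`, `-sin s`, `tan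
(s/2)`, and each shear preserves the product measure by Fubini. The range of `s` keeps `cos (s/2)`
away from zero. -/
theorem measurePreserving_pairRotation {s : ℝ} (hs : s ∈ Icc 0 (Real.pi / 2)) :
    MeasurePreserving (pairRotation (n := n) s) (volume.prod volume) (volume.prod volume) := by
  have hpi := Real.pi_pos
  have hc : Real.cos (s / 2) ≠ 0 :=
    (Real.cos_pos_of_mem_Ioo ⟨by linarith [hs.1], by linarith [hs.2]⟩).ne'
  set τ := Real.sin (s / 2) / Real.cos (s / 2) with hτ
  have h1 : Real.sin s = 2 * Real.sin (s / 2) * Real.cos (s / 2) := by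
    rw [← Real.sin_two_mul]; congr 1; ring
  have h2 : Real.cos s = 2 * Real.cos (s / 2) ^ 2 - 1 := by
    rw [← Real.cos_two_mul]; congr 1; ring
  have h3 : Real.sin (s / 2) ^ 2 = 1 - Real.cos (s / 2) ^ 2 := Real.sin_sq _
  have e1 : 1 - Real.sin s * τ = Real.cos s := by
    rw [h1, h2, hτ]; field_simp; rw [h3]; ring
  have e2 : τ * (1 + Real.cos s) = Real.sin s := by
    rw [h1, h2, hτ]; field_simp; ring
  clear_value τ
  have key := ((measurePreserving_shear' (n := n) τ).comp
    (measurePreserving_shear (-Real.sin s))).comp (measurePreserving_shear' τ)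
  convert key using 1
  funext p
  refine Prod.ext ?_ ?_
  · change Real.cos s • p.1 + Real.sin s • p.2 =
      (p.1 + τ • p.2) + τ • (p.2 + -Real.sin s • (p.1 + τ • p.2))
    match_scalars
    · linear_combination -e1
    · linear_combination -e2 - τ * e1
  · change -Real.sin s • p.1 + Real.cos s • p.2 = p.2 + -Real.sin s • (p.1 + τ • p.2)
    match_scalars
    · ring
    · linear_combination -e1

theorem norm_sq_pairRotation (s : ℝ) (p : EuclideanSpace ℝ (Fin n) × EuclideanSpace ℝ (Fin n)) :
    ‖(pairRotation s p).1‖ ^ 2 + ‖(pairRotation s p).2‖ ^ 2 = ‖p.1‖ ^ 2 + ‖p.2‖ ^ 2 := by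
  simp only [pairRotation, ← real_inner_self_eq_norm_sq, inner_add_left, inner_add_right,
    inner_smul_left, inner_smul_right, real_inner_comm p.1 p.2, conj_trivial]
  linear_combination (inner ℝ p.1 p.1 + inner ℝ p.2 p.2) * Real.sin_sq_add_cos_sq s

/-- Almost every pair of vectors is such that the great arc joining them avoids the origin. -/
theorem ae_pairRotation_ne_zero (hn : 2 ≤ n) :
    ∀ᵐ p : EuclideanSpace ℝ (Fin n) × EuclideanSpace ℝ (Fin n) ∂(volume.prod volume),
      ∀ s, (pairRotation s p).1 ≠ 0 := by
  -- Equality in Cauchy-Schwarz, that is, linear dependence. For `x ≠ 0` the slice lies in a line,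
  -- which is null since `n ≥ 2`.
  set D : Set (EuclideanSpace ℝ (Fin n) × EuclideanSpace ℝ (Fin n)) :=
    {p | inner ℝ p.1 p.2 ^ 2 = ‖p.1‖ ^ 2 * ‖p.2‖ ^ 2} with hD
  have hDc : IsClosed D := isClosed_eq (by fun_prop) (by fun_prop)
  have hnull : (volume.prod volume) D = 0 := by
    refine Measure.measure_prod_null_of_ae_null hDc.measurableSet ?_
    have : Nontrivial (Fin n) := Fin.nontrivial_iff_two_le.2 hn
    have h0 : ∀ᵐ x : EuclideanSpace ℝ (Fin n), x ≠ 0 := by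
      have : Nonempty (Fin n) := inferInstance
      exact Measure.ae_ne volume 0
    filter_upwards [h0] with x hx
    have hsub : Prod.mk x ⁻¹' D ⊆ (ℝ ∙ x : Submodule ℝ (EuclideanSpace ℝ (Fin n))) := by
      intro y hy
      have hy' : inner ℝ x y ^ 2 = ‖x‖ ^ 2 * ‖y‖ ^ 2 := hy
      have hx2 : ‖x‖ ^ 2 ≠ 0 := by positivity
      have h1 : ‖y - (inner ℝ x y / ‖x‖ ^ 2) • x‖ ^ 2 = 0 := by
        rw [norm_sub_sq_real, norm_smul, mul_pow, inner_smul_right, real_inner_comm x y,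
          Real.norm_eq_abs, sq_abs]
        field_simp
        linear_combination -hy'
      have h2 : y = (inner ℝ x y / ‖x‖ ^ 2) • x := by
        rw [← sub_eq_zero, ← norm_eq_zero]
        exact pow_eq_zero_iff two_ne_zero |>.1 h1
      exact Submodule.mem_span_singleton.2 ⟨_, h2.symm⟩
    refine measure_mono_null hsub (Measure.addHaar_submodule _ _ fun htop => ?_)
    have h1 := finrank_span_singleton (K := ℝ) hx
    rw [htop, finrank_top, finrank_euclideanSpace_fin] at h1
    omega
  have hae : ∀ᵐ p : EuclideanSpace ℝ (Fin n) × EuclideanSpace ℝ (Fin n) ∂(volume.prod volume),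
      p ∉ D := measure_eq_zero_iff_ae_notMem.1 hnull
  filter_upwards [hae] with p hp s hs
  apply hp
  have hs' : Real.cos s • p.1 + Real.sin s • p.2 = 0 := hs
  have h1 : Real.cos s * ‖p.1‖ ^ 2 + Real.sin s * inner ℝ p.1 p.2 = 0 := by
    have := congrArg (fun z => inner ℝ z p.1) hs'
    simpa [inner_add_left, inner_smul_left, real_inner_self_eq_norm_sq,
      real_inner_comm p.1 p.2] using this
  have h2 : Real.cos s * inner ℝ p.1 p.2 + Real.sin s * ‖p.2‖ ^ 2 = 0 := by
    have := congrArg (fun z => inner ℝ z p.2) hs'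
    simpa [inner_add_left, inner_smul_left, real_inner_self_eq_norm_sq] using this
  change inner ℝ p.1 p.2 ^ 2 = ‖p.1‖ ^ 2 * ‖p.2‖ ^ 2
  have h3 := Real.sin_sq_add_cos_sq s
  set c := Real.cos s
  set σ := Real.sin s
  set X := ‖p.1‖ ^ 2
  set Y := ‖p.2‖ ^ 2
  set Z : ℝ := inner ℝ p.1 p.2
  have a1 : c ^ 2 * (Z ^ 2 - X * Y) = 0 := by
    linear_combination (c * Z - σ * Y) * h2 + (-c * Y) * h1 + σ * Y * h2
  have a2 : σ ^ 2 * (Z ^ 2 - X * Y) = 0 := by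
    linear_combination (σ * Z - c * X) * h1 + (-σ * X) * h2 + c * X * h1
  linear_combination a1 + a2 - (Z ^ 2 - X * Y) * h3

end Rotation

/-! ### A Poincaré inequality on spheres -/

section Poincare

variable {n : ℕ} {W : EuclideanSpace ℝ (Fin n) → ℝ}

/-- The first component of the rotated pair moves from `p.1` to `p.2` during a quarter turn, and its
velocity is the second component. The fundamental theorem of calculus and Cauchy-Schwarz on an
interval of length `π/2` do the rest. -/
theorem sq_sub_le_lintegral_pairRotation (hW : ∀ x ≠ 0, ContDiffAt ℝ 1 W x)
    {p : EuclideanSpace ℝ (Fin n) × EuclideanSpace ℝ (Fin n)}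
    (hp : ∀ s, (pairRotation s p).1 ≠ 0) :
    ENNReal.ofReal ((W p.2 - W p.1) ^ 2) ≤ ENNReal.ofReal (Real.pi / 2) *
      ∫⁻ s in Ioc 0 (Real.pi / 2), ENNReal.ofReal
        (‖fderiv ℝ W (pairRotation s p).1‖ ^ 2 * ‖(pairRotation s p).2‖ ^ 2) := by
  have hpi : 0 ≤ Real.pi / 2 := by have := Real.pi_pos; positivity
  set X : ℝ → EuclideanSpace ℝ (Fin n) := fun s => (pairRotation s p).1 with hX
  set X' : ℝ → EuclideanSpace ℝ (Fin n) := fun s => (pairRotation s p).2 with hX'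
  have hXd : ∀ s, HasDerivAt X (X' s) s := fun s =>
    ((Real.hasDerivAt_cos s).smul_const p.1).add ((Real.hasDerivAt_sin s).smul_const p.2)
  have hXc : Continuous X := continuous_iff_continuousAt.2 fun s => (hXd s).continuousAt
  have hXc' : Continuous X' := by simp only [hX', pairRotation]; fun_prop
  set g : ℝ → ℝ := fun s => fderiv ℝ W (X s) (X' s) with hg
  have hWd : ∀ s, HasDerivAt (fun s => W (X s)) (g s) s := fun s =>
    ((hW _ (hp s)).differentiableAt (by norm_num)).hasFDerivAt.comp_hasDerivAt s (hXd s)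
  have hfc : Continuous fun s => fderiv ℝ W (X s) := by
    refine continuous_iff_continuousAt.2 fun s => ?_
    exact ContinuousAt.comp (f := X)
      ((hW _ (hp s)).fderiv_right (m := 0) (by norm_num)).continuousAt hXc.continuousAt
  have hgc : Continuous g := hfc.clm_apply hXc'
  have hFTC := intervalIntegral.integral_eq_sub_of_hasDerivAt (a := 0) (b := Real.pi / 2)
    (fun s _ => hWd s) (hgc.intervalIntegrable _ _)
  rw [intervalIntegral.integral_of_le hpi] at hFTC
  have e0 : X 0 = p.1 := by simp [hX, pairRotation]
  have e1 : X (Real.pi / 2) = p.2 := by simp [hX, pairRotation]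
  rw [e0, e1] at hFTC
  have i1 : Integrable g (volume.restrict (Ioc 0 (Real.pi / 2))) :=
    (hgc.integrableOn_Icc (a := 0) (b := Real.pi / 2)).mono_set Ioc_subset_Icc_self
  have i2 : Integrable (fun s => g s ^ 2) (volume.restrict (Ioc 0 (Real.pi / 2))) :=
    ((hgc.pow 2).integrableOn_Icc (a := 0) (b := Real.pi / 2)).mono_set Ioc_subset_Icc_self
  have h1 := sq_integral_le i1 i2
  rw [hFTC] at h1
  have h2 : (volume.restrict (Ioc 0 (Real.pi / 2))).real univ = Real.pi / 2 := by
    rw [measureReal_restrict_apply_univ, Real.volume_real_Ioc_of_le hpi, sub_zero]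
  rw [h2] at h1
  refine (ENNReal.ofReal_le_ofReal h1).trans ?_
  rw [ENNReal.ofReal_mul hpi, ofReal_integral_eq_lintegral_ofReal i2 (ae_of_all _ fun s => sq_nonneg _)]
  refine mul_le_mul_of_nonneg_left (lintegral_mono fun s => ENNReal.ofReal_le_ofReal ?_) zero_le
  rw [← mul_pow, ← sq_abs (g s)]
  exact pow_le_pow_left₀ (abs_nonneg _) ((fderiv ℝ W (X s)).le_opNorm _) 2

/-- After Fubini, rotation invariance of the product measure and of the set `‖x‖² + ‖y‖² ≤ 2` makes
the inner integral independent of the angle. This set lies between the products of the balls of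
radius 1 and of radius 2. A factor `π/2` comes from Cauchy-Schwarz and another from the angle
integral. -/
theorem lintegral_sq_sub_le (hn : 2 ≤ n) (hW : ∀ x ≠ 0, ContDiffAt ℝ 1 W x) :
    ∫⁻ p in Metric.closedBall 0 1 ×ˢ Metric.closedBall 0 1,
        ENNReal.ofReal ((W p.2 - W p.1) ^ 2) ∂(volume.prod volume) ≤
      ENNReal.ofReal (Real.pi / 2) * (ENNReal.ofReal (Real.pi / 2) *
        ((∫⁻ x in Metric.closedBall 0 2, ENNReal.ofReal (‖fderiv ℝ W x‖ ^ 2)) *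
          (4 * volume (Metric.closedBall (0 : EuclideanSpace ℝ (Fin n)) 2)))) := by
  have hpi : 0 ≤ Real.pi / 2 := by have := Real.pi_pos; positivity
  set Q : Set (EuclideanSpace ℝ (Fin n) × EuclideanSpace ℝ (Fin n)) :=
    {p | ‖p.1‖ ^ 2 + ‖p.2‖ ^ 2 ≤ 2} with hQ
  have hQc : MeasurableSet Q := (isClosed_le (by fun_prop) (by fun_prop)).measurableSet
  set F : EuclideanSpace ℝ (Fin n) × EuclideanSpace ℝ (Fin n) → ℝ≥0∞ :=
    Q.indicator fun p => ENNReal.ofReal (‖fderiv ℝ W p.1‖ ^ 2 * ‖p.2‖ ^ 2) with hF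
  have hFm : Measurable F := by
    refine Measurable.indicator ?_ hQc
    have := measurable_fderiv ℝ W
    fun_prop
  have hrotm : Measurable fun q : (EuclideanSpace ℝ (Fin n) × EuclideanSpace ℝ (Fin n)) × ℝ =>
      F (pairRotation q.2 q.1) := by
    refine hFm.comp ?_
    have : Continuous fun q : (EuclideanSpace ℝ (Fin n) × EuclideanSpace ℝ (Fin n)) × ℝ =>
        pairRotation q.2 q.1 := by unfold pairRotation; fun_prop
    exact this.measurable
  have hpt : ∀ᵐ p : EuclideanSpace ℝ (Fin n) × EuclideanSpace ℝ (Fin n) ∂(volume.prod volume),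
      p ∈ Metric.closedBall (0 : EuclideanSpace ℝ (Fin n)) 1 ×ˢ
        Metric.closedBall (0 : EuclideanSpace ℝ (Fin n)) 1 →
      ENNReal.ofReal ((W p.2 - W p.1) ^ 2) ≤ ENNReal.ofReal (Real.pi / 2) *
        ∫⁻ s in Ioc 0 (Real.pi / 2), F (pairRotation s p) := by
    filter_upwards [ae_pairRotation_ne_zero hn] with p hp hmem
    refine (sq_sub_le_lintegral_pairRotation hW hp).trans (le_of_eq ?_)
    congr 1
    refine lintegral_congr fun s => ?_
    have h1 : ‖p.1‖ ≤ 1 := by simpa using hmem.1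
    have h2 : ‖p.2‖ ≤ 1 := by simpa using hmem.2
    have hmemQ : pairRotation s p ∈ Q := by
      change _ ≤ (2 : ℝ)
      rw [norm_sq_pairRotation]
      nlinarith [norm_nonneg p.1, norm_nonneg p.2]
    rw [hF, indicator_of_mem hmemQ]
  have hinv : ∀ s ∈ Ioc 0 (Real.pi / 2),
      ∫⁻ p, F (pairRotation s p) ∂(volume.prod volume) = ∫⁻ p, F p ∂(volume.prod volume) :=
    fun s hs => (measurePreserving_pairRotation ⟨hs.1.le, hs.2⟩).lintegral_comp hFm
  have hFle : ∫⁻ p, F p ∂(volume.prod volume) ≤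
      (∫⁻ x in Metric.closedBall 0 2, ENNReal.ofReal (‖fderiv ℝ W x‖ ^ 2)) *
        (4 * volume (Metric.closedBall (0 : EuclideanSpace ℝ (Fin n)) 2)) := by
    have hm1 : Measurable ((Metric.closedBall (0 : EuclideanSpace ℝ (Fin n)) 2).indicator
        fun x => ENNReal.ofReal (‖fderiv ℝ W x‖ ^ 2)) := by
      refine Measurable.indicator ?_ Metric.isClosed_closedBall.measurableSet
      have := measurable_fderiv ℝ W
      fun_prop
    have hm2 : Measurable ((Metric.closedBall (0 : EuclideanSpace ℝ (Fin n)) 2).indicator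
        fun _ => (4 : ℝ≥0∞)) :=
      measurable_const.indicator Metric.isClosed_closedBall.measurableSet
    have h3 := lintegral_prod_mul (μ := (volume : Measure (EuclideanSpace ℝ (Fin n))))
      (ν := (volume : Measure (EuclideanSpace ℝ (Fin n)))) hm1.aemeasurable hm2.aemeasurable
    rw [lintegral_indicator Metric.isClosed_closedBall.measurableSet,
      lintegral_indicator Metric.isClosed_closedBall.measurableSet, setLIntegral_const] at h3
    rw [← h3]
    refine lintegral_mono fun p => ?_
    by_cases hp : p ∈ Q
    · have hp' : ‖p.1‖ ^ 2 + ‖p.2‖ ^ 2 ≤ 2 := hp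
      have h1 : ‖p.1‖ ≤ 2 := by nlinarith [norm_nonneg p.1, sq_nonneg ‖p.2‖]
      have h2 : ‖p.2‖ ≤ 2 := by nlinarith [norm_nonneg p.2, sq_nonneg ‖p.1‖]
      have h4 : ‖p.2‖ ^ 2 ≤ 4 := by nlinarith [sq_nonneg ‖p.1‖]
      rw [hF, indicator_of_mem hp, indicator_of_mem (by simpa using h1),
        indicator_of_mem (by simpa using h2), ENNReal.ofReal_mul (sq_nonneg _)]
      refine mul_le_mul_of_nonneg_left ?_ zero_le
      exact (ENNReal.ofReal_le_ofReal h4).trans (by norm_num)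
    · rw [hF, indicator_of_notMem hp]; exact zero_le
  calc _ ≤ ∫⁻ p : EuclideanSpace ℝ (Fin n) × EuclideanSpace ℝ (Fin n),
          (ENNReal.ofReal (Real.pi / 2) * ∫⁻ s in Ioc 0 (Real.pi / 2), F (pairRotation s p))
            ∂(volume.prod volume) := by
        rw [← lintegral_indicator (Metric.isClosed_closedBall.prod
          Metric.isClosed_closedBall).measurableSet]
        refine lintegral_mono_ae ?_
        filter_upwards [hpt] with p hp
        exact indicator_apply_le' hp fun _ => zero_le
    _ = ENNReal.ofReal (Real.pi / 2) * ∫⁻ s in Ioc 0 (Real.pi / 2),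
          (∫⁻ p, F (pairRotation s p) ∂(volume.prod volume)) := by
        rw [lintegral_const_mul' _ _ ENNReal.ofReal_ne_top,
          lintegral_lintegral_swap hrotm.aemeasurable]
    _ = ENNReal.ofReal (Real.pi / 2) * (ENNReal.ofReal (Real.pi / 2) *
          ∫⁻ p, F p ∂(volume.prod volume)) := by
        rw [setLIntegral_congr_fun measurableSet_Ioc hinv, setLIntegral_const, Real.volume_Ioc,
          sub_zero, mul_comm (∫⁻ p, F p ∂_)]
    _ ≤ _ := by gcongr

/-- The radial retraction onto the sphere of radius `eᵗ`. -/
noncomputable def sphereRetract (t : ℝ) (x : EuclideanSpace ℝ (Fin n)) :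
    EuclideanSpace ℝ (Fin n) :=
  (Real.exp t / ‖x‖) • x

theorem sphereRetract_logPolar (t : ℝ) (p : ℝ × Metric.sphere (0 : EuclideanSpace ℝ (Fin n)) 1) :
    sphereRetract t (logPolar p) = logPolar (t, p.2) := by
  rw [sphereRetract, norm_logPolar, logPolar, smul_smul, div_mul_cancel₀ _ (Real.exp_pos _).ne',
    logPolar]

theorem norm_sphereRetract (t : ℝ) {x : EuclideanSpace ℝ (Fin n)} (hx : x ≠ 0) :
    ‖sphereRetract t x‖ = Real.exp t := by
  have : ‖x‖ ≠ 0 := norm_ne_zero_iff.2 hx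
  rw [sphereRetract, norm_smul, norm_div, Real.norm_eq_abs, Real.abs_exp, norm_norm,
    div_mul_cancel₀ _ this]

theorem sphereRetract_mem_shell {I : Set ℝ} {t : ℝ} (ht : t ∈ I) {x : EuclideanSpace ℝ (Fin n)}
    (hx : x ≠ 0) : sphereRetract t x ∈ shell n I := by
  have h := norm_sphereRetract t hx
  refine ⟨norm_pos_iff.1 (by rw [h]; exact Real.exp_pos t), ?_⟩
  rwa [h, Real.log_exp]

theorem contDiffAt_sphereRetract (t : ℝ) {x : EuclideanSpace ℝ (Fin n)} (hx : x ≠ 0) :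
    ContDiffAt ℝ 1 (sphereRetract t) x :=
  (contDiffAt_const.div (contDiffAt_norm ℝ hx) (norm_ne_zero_iff.2 hx)).smul contDiffAt_id

theorem norm_fderiv_sphereRetract_le (t : ℝ) {x : EuclideanSpace ℝ (Fin n)} (hx : x ≠ 0) :
    ‖fderiv ℝ (sphereRetract t) x‖ ≤ 2 * Real.exp t / ‖x‖ := by
  have hx0 : 0 < ‖x‖ := norm_pos_iff.2 hx
  refine ((contDiffAt_sphereRetract t hx).differentiableAt (by norm_num)).hasFDerivAt.le_of_lip'
    (by positivity) ?_
  filter_upwards [isOpen_ne.mem_nhds hx] with y hy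
  have hy0 : 0 < ‖y‖ := norm_pos_iff.2 hy
  have e : sphereRetract t y - sphereRetract t x =
      (Real.exp t / ‖x‖) • ((y - x) + ((‖x‖ - ‖y‖) / ‖y‖) • y) := by
    simp only [sphereRetract]
    match_scalars <;> field_simp
    ring
  rw [e, norm_smul, norm_div, norm_norm, Real.norm_eq_abs, Real.abs_exp]
  have h1 : ‖((‖x‖ - ‖y‖) / ‖y‖) • y‖ ≤ ‖y - x‖ := by
    rw [norm_smul, norm_div, norm_norm, div_mul_cancel₀ _ hy0.ne', norm_sub_rev y x]
    exact abs_norm_sub_norm_le x y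
  calc Real.exp t / ‖x‖ * ‖(y - x) + ((‖x‖ - ‖y‖) / ‖y‖) • y‖
      ≤ Real.exp t / ‖x‖ * (‖y - x‖ + ‖y - x‖) := by
        gcongr
        exact (norm_add_le _ _).trans (add_le_add le_rfl h1)
    _ = _ := by ring

/-- For an integrand that is a product in polar coordinates the integral over a ball factors; it
converts inequalities on balls into inequalities on spheres. -/
theorem setLIntegral_closedBall_logPolar (hn : 0 < n) (b : ℝ) {a : ℝ → ℝ≥0∞}
    {g : Metric.sphere (0 : EuclideanSpace ℝ (Fin n)) 1 → ℝ≥0∞} (ha : Measurable a)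
    (hg : Measurable g) {f : EuclideanSpace ℝ (Fin n) → ℝ≥0∞}
    (hf : ∀ p, f (logPolar p) = a p.1 * g p.2) :
    ∫⁻ x in Metric.closedBall 0 (Real.exp b), f x =
      (∫⁻ t in Iic b, ENNReal.ofReal (Real.exp (n * t)) * a t) * ∫⁻ θ, g θ ∂(sphereMeasure n) := by
  rw [← lintegral_indicator Metric.isClosed_closedBall.measurableSet, lintegral_logPolar hn,
    ← lintegral_indicator measurableSet_Iic, ← lintegral_prod_mul]
  · refine lintegral_congr fun p => ?_
    have hiff : logPolar p ∈ Metric.closedBall (0 : EuclideanSpace ℝ (Fin n)) (Real.exp b) ↔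
        p.1 ∈ Iic b := by simp [norm_logPolar]
    by_cases h : p.1 ∈ Iic b
    · rw [indicator_of_mem (hiff.2 h), indicator_of_mem h, hf, mul_assoc]
    · rw [indicator_of_notMem fun h' => h (hiff.1 h'), indicator_of_notMem h, mul_zero, zero_mul]
  · exact (Measurable.indicator (by fun_prop) measurableSet_Iic).aemeasurable
  · exact hg.aemeasurable

/-- A Poincaré-type inequality on spheres, with a constant depending only on the dimension. -/
theorem exists_sphere_poincare (hn : 2 < n) : ∃ C : ℝ≥0∞, C ≠ ⊤ ∧
    ∀ (w : EuclideanSpace ℝ (Fin n) → ℝ) (I : Set ℝ), IsOpen I →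
      (∀ x ∈ shell n I, ContDiffAt ℝ ∞ w x) → ∀ t ∈ I,
      ∫⁻ θ, ∫⁻ θ', ENNReal.ofReal ((w (logPolar (t, θ')) - w (logPolar (t, θ))) ^ 2)
        ∂(sphereMeasure n) ∂(sphereMeasure n) ≤
      C * ∫⁻ θ, ENNReal.ofReal (energyDensity w (logPolar (t, θ))) ∂(sphereMeasure n) := by
  have hn0 : 0 < n := by omega
  set c₁ : ℝ≥0∞ := ∫⁻ t in Iic (0 : ℝ), ENNReal.ofReal (Real.exp (n * t)) * 1 with hc₁
  -- The radial integral of `4 ‖x‖⁻²` over the ball of radius 2; its finiteness requires `n > 2`.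
  set c₂ : ℝ≥0∞ := ∫⁻ t in Iic (Real.log 2), ENNReal.ofReal (Real.exp (n * t)) *
    ENNReal.ofReal (4 * Real.exp (-(2 * t))) with hc₂
  have hc₁0 : c₁ ≠ 0 := by
    rw [hc₁]
    simp only [mul_one]
    refine (setLIntegral_pos_iff (by fun_prop)).2 ?_ |>.ne'
    have : (Function.support fun t : ℝ => ENNReal.ofReal (Real.exp (n * t))) = univ := by
      ext t; simp [Real.exp_pos]
    rw [this, univ_inter, Real.volume_Iic]
    exact ENNReal.zero_lt_top
  have hc₁t : c₁ ≠ ⊤ := by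
    rw [hc₁]
    simp only [mul_one]
    have := integrableOn_exp_mul_Iic (a := (n : ℝ)) (by positivity) 0
    exact this.lintegral_lt_top.ne
  have hc₂t : c₂ ≠ ⊤ := by
    have hpos : (0 : ℝ) < n - 2 := by
      have : (2 : ℝ) < n := by exact_mod_cast hn
      linarith
    have := (integrableOn_exp_mul_Iic hpos (Real.log 2)).const_mul 4
    have e : c₂ = ∫⁻ t in Iic (Real.log 2), ENNReal.ofReal (4 * Real.exp ((n - 2) * t)) := by
      refine lintegral_congr fun t => ?_
      rw [← ENNReal.ofReal_mul (Real.exp_pos _).le]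
      congr 1
      rw [mul_left_comm, ← Real.exp_add]; congr 2; ring
    rw [e]
    exact this.lintegral_lt_top.ne
  set V := 4 * volume (Metric.closedBall (0 : EuclideanSpace ℝ (Fin n)) 2) with hV
  have hVt : V ≠ ⊤ := ENNReal.mul_ne_top (by norm_num) measure_closedBall_lt_top.ne
  refine ⟨(c₁ * c₁)⁻¹ * (ENNReal.ofReal (Real.pi / 2) * (ENNReal.ofReal (Real.pi / 2) * (c₂ * V))),
    ?_, ?_⟩
  · refine ENNReal.mul_ne_top (ENNReal.inv_ne_top.2 (mul_ne_zero hc₁0 hc₁0)) ?_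
    exact ENNReal.mul_ne_top ENNReal.ofReal_ne_top
      (ENNReal.mul_ne_top ENNReal.ofReal_ne_top (ENNReal.mul_ne_top hc₂t hVt))
  intro w I hI hw t ht
  -- The extension of `w`, restricted to one sphere, to a function homogeneous of degree zero. Its
  -- singularity at the origin is harmless because almost every great arc avoids the origin.
  set W : EuclideanSpace ℝ (Fin n) → ℝ := fun x => w (sphereRetract t x) with hWdef
  have hW : ∀ x ≠ 0, ContDiffAt ℝ 1 W x := fun x hx =>
    ((hw _ (sphereRetract_mem_shell ht hx)).of_le (by exact_mod_cast le_top)).comp x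
      (contDiffAt_sphereRetract t hx)
  have hWm : Measurable W := measurable_of_continuousOn_compl_singleton 0 fun x hx =>
    (hW x hx).continuousAt.continuousWithinAt
  have hWp : ∀ p, W (logPolar p) = w (logPolar (t, p.2)) := fun p => by
    rw [hWdef]; simp only [sphereRetract_logPolar]
  have hwc : Continuous fun θ : Metric.sphere (0 : EuclideanSpace ℝ (Fin n)) 1 =>
      w (logPolar (t, θ)) := continuous_comp_logPolar
    (fun x hx => (hw x hx).continuousAt.continuousWithinAt) ht
  have hec := continuous_comp_logPolar (continuousOn_energyDensity hw) ht
  have key := lintegral_sq_sub_le (by omega : 2 ≤ n) hW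
  have hball : ∀ {f : EuclideanSpace ℝ (Fin n) → ℝ≥0∞}, ∫⁻ x in Metric.closedBall 0 1, f x =
      ∫⁻ x in Metric.closedBall 0 (Real.exp 0), f x := by rw [Real.exp_zero]; simp
  have hL : ∫⁻ p in Metric.closedBall 0 1 ×ˢ Metric.closedBall 0 1,
        ENNReal.ofReal ((W p.2 - W p.1) ^ 2) ∂(volume.prod volume) =
      c₁ * c₁ * ∫⁻ θ, ∫⁻ θ', ENNReal.ofReal ((w (logPolar (t, θ')) - w (logPolar (t, θ))) ^ 2)
        ∂(sphereMeasure n) ∂(sphereMeasure n) := by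
    have hmeas : Measurable fun p : EuclideanSpace ℝ (Fin n) × EuclideanSpace ℝ (Fin n) =>
      ENNReal.ofReal ((W p.2 - W p.1) ^ 2) := by fun_prop
    rw [← Measure.prod_restrict, lintegral_prod _ hmeas.aemeasurable]
    have hin : ∀ x, ∫⁻ y in Metric.closedBall (0 : EuclideanSpace ℝ (Fin n)) 1,
        ENNReal.ofReal ((W y - W x) ^ 2) = c₁ * ∫⁻ θ', ENNReal.ofReal
          ((w (logPolar (t, θ')) - W x) ^ 2) ∂(sphereMeasure n) := by
      intro x
      rw [hball, setLIntegral_closedBall_logPolar hn0 0 (a := fun _ => 1)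
        (g := fun θ' => ENNReal.ofReal ((w (logPolar (t, θ')) - W x) ^ 2)) measurable_const
        (((hwc.measurable.sub_const _).pow_const 2).ennreal_ofReal) (fun p => by rw [hWp, one_mul])]
    simp only [hin]
    have hout : Measurable fun θ : Metric.sphere (0 : EuclideanSpace ℝ (Fin n)) 1 =>
        c₁ * ∫⁻ θ', ENNReal.ofReal ((w (logPolar (t, θ')) - w (logPolar (t, θ))) ^ 2)
          ∂(sphereMeasure n) := by
      exact Measurable.const_mul (Measurable.lintegral_prod_right
        ((((hwc.measurable.comp measurable_snd).sub
          (hwc.measurable.comp measurable_fst)).pow_const 2).ennreal_ofReal)) _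
    rw [hball, setLIntegral_closedBall_logPolar hn0 0 (a := fun _ => 1) measurable_const hout
      (fun p => by rw [hWp, one_mul]), lintegral_const_mul' _ _ hc₁t, mul_assoc]
  have hlog2 : Metric.closedBall (0 : EuclideanSpace ℝ (Fin n)) 2 =
      Metric.closedBall 0 (Real.exp (Real.log 2)) := by rw [Real.exp_log two_pos]
  have hR : ∫⁻ x in Metric.closedBall 0 2, ENNReal.ofReal (‖fderiv ℝ W x‖ ^ 2) ≤
      c₂ * ∫⁻ θ, ENNReal.ofReal (energyDensity w (logPolar (t, θ))) ∂(sphereMeasure n) := by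
    set f : EuclideanSpace ℝ (Fin n) → ℝ≥0∞ := fun x =>
      ENNReal.ofReal (4 * Real.exp (-(2 * Real.log ‖x‖))) *
        ENNReal.ofReal (energyDensity w (sphereRetract t x)) with hf
    have := setLIntegral_closedBall_logPolar hn0 (Real.log 2)
      (a := fun s => ENNReal.ofReal (4 * Real.exp (-(2 * s))))
      (g := fun θ => ENNReal.ofReal (energyDensity w (logPolar (t, θ)))) (f := f) (by fun_prop)
      (by have := hec.measurable; fun_prop)
      (fun p => by simp only [hf, log_norm_logPolar, sphereRetract_logPolar])
    rw [hlog2, ← this]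
    have hne : ∀ᵐ x : EuclideanSpace ℝ (Fin n), x ≠ 0 := by
      have : Nonempty (Fin n) := ⟨⟨0, hn0⟩⟩
      exact Measure.ae_ne volume 0
    refine lintegral_mono_ae (ae_restrict_of_ae ?_)
    filter_upwards [hne] with x hx
    have hx0 : 0 < ‖x‖ := norm_pos_iff.2 hx
    simp only [hf]
    rw [← ENNReal.ofReal_mul (by positivity)]
    refine ENNReal.ofReal_le_ofReal ?_
    have h1 : fderiv ℝ W x = (fderiv ℝ w (sphereRetract t x)).comp (fderiv ℝ (sphereRetract t) x) :=
      fderiv_comp x ((hw _ (sphereRetract_mem_shell ht hx)).differentiableAt (by simp))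
        ((contDiffAt_sphereRetract t hx).differentiableAt (by norm_num))
    have h2 : ‖fderiv ℝ W x‖ ≤ ‖fderiv ℝ w (sphereRetract t x)‖ * (2 * Real.exp t / ‖x‖) := by
      rw [h1]
      exact (ContinuousLinearMap.opNorm_comp_le _ _).trans
        (mul_le_mul_of_nonneg_left (norm_fderiv_sphereRetract_le t hx) (norm_nonneg _))
    have h3 : Real.exp (-(2 * Real.log ‖x‖)) = (‖x‖ ^ 2)⁻¹ := by
      rw [Real.exp_neg, two_mul, Real.exp_add, Real.exp_log hx0, sq]
    calc ‖fderiv ℝ W x‖ ^ 2 ≤ (‖fderiv ℝ w (sphereRetract t x)‖ * (2 * Real.exp t / ‖x‖)) ^ 2 := by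
          gcongr
      _ = _ := by
          rw [h3, energyDensity, norm_sphereRetract t hx]
          field_simp
          ring
  rw [hL] at key
  rw [mul_assoc (c₁ * c₁)⁻¹]
  refine le_trans (le_of_eq ?_) (mul_le_mul_of_nonneg_left (key.trans ?_) zero_le)
  · rw [← mul_assoc, ENNReal.inv_mul_cancel (mul_ne_zero hc₁0 hc₁0)
      (ENNReal.mul_ne_top hc₁t hc₁t), one_mul]
  calc _ ≤ ENNReal.ofReal (Real.pi / 2) * (ENNReal.ofReal (Real.pi / 2) *
        ((c₂ * ∫⁻ θ, ENNReal.ofReal (energyDensity w (logPolar (t, θ))) ∂(sphereMeasure n)) * V)) := by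
        gcongr
    _ = _ := by ring

end Poincare

/-! ### Growth along a ray, dimension greater than two -/

section EndGrowth

variable {n : ℕ} {ε T : ℝ} {w : EuclideanSpace ℝ (Fin n) → ℝ}

/-- The deviation of `w` from its spherical mean. -/
noncomputable def sphereDev (w : EuclideanSpace ℝ (Fin n) → ℝ) (t : ℝ)
    (θ : Metric.sphere (0 : EuclideanSpace ℝ (Fin n)) 1) : ℝ :=
  w (logPolar (t, θ)) - sphereInt w t / (sphereMeasure n).real univ

/-- The deviation at `θ` is, up to sign, the average over `θ'` of the difference of the values at
`θ'` and `θ`, to which Cauchy-Schwarz applies. -/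
theorem lintegral_sq_sphereDev_le (hn : 0 < n) {I : Set ℝ}
    (hw : ContinuousOn w (shell n I)) {t : ℝ} (ht : t ∈ I) :
    ∫⁻ θ, ENNReal.ofReal (sphereDev w t θ ^ 2) ∂(sphereMeasure n) ≤
      ENNReal.ofReal ((sphereMeasure n).real univ)⁻¹ * ∫⁻ θ, ∫⁻ θ', ENNReal.ofReal
        ((w (logPolar (t, θ')) - w (logPolar (t, θ))) ^ 2) ∂(sphereMeasure n)
          ∂(sphereMeasure n) := by
  set S := (sphereMeasure n).real univ with hSdef
  have hS : 0 < S := sphereMeasure_real_univ_pos hn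
  have hc := continuous_comp_logPolar hw ht
  rw [← lintegral_const_mul' _ _ ENNReal.ofReal_ne_top]
  refine lintegral_mono fun θ => ?_
  have hd : Continuous fun θ' => w (logPolar (t, θ')) - w (logPolar (t, θ)) :=
    hc.sub continuous_const
  have i1 : Integrable (fun θ' => w (logPolar (t, θ')) - w (logPolar (t, θ))) (sphereMeasure n) :=
    hd.integrable_of_hasCompactSupport (HasCompactSupport.of_compactSpace _)
  have i2 : Integrable (fun θ' => (w (logPolar (t, θ')) - w (logPolar (t, θ))) ^ 2)
      (sphereMeasure n) :=
    (hd.pow 2).integrable_of_hasCompactSupport (HasCompactSupport.of_compactSpace _)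
  have h1 := sq_integral_le i1 i2
  rw [integral_sub (integrable_comp_logPolar hw ht) (integrable_const _), integral_const,
    smul_eq_mul] at h1
  have h2 : sphereDev w t θ ^ 2 ≤
      S⁻¹ * ∫ θ', (w (logPolar (t, θ')) - w (logPolar (t, θ))) ^ 2 ∂(sphereMeasure n) := by
    have e : sphereDev w t θ = -((sphereInt w t - S * w (logPolar (t, θ))) / S) := by
      rw [sphereDev, ← hSdef]; field_simp; ring
    rw [e, neg_sq, div_pow, div_le_iff₀ (by positivity)]
    refine h1.trans (le_of_eq ?_)
    rw [← hSdef]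
    field_simp
  refine (ENNReal.ofReal_le_ofReal h2).trans (le_of_eq ?_)
  rw [ENNReal.ofReal_mul (by positivity),
    ofReal_integral_eq_lintegral_ofReal i2 (ae_of_all _ fun _ => sq_nonneg _)]

/-- The spherical energy controls both summands after integration over `θ`: the deviation by the
Poincaré inequality, with a constant independent of the radius, and the radial derivative pointwise.
The double integral is then finite, so by Fubini it is finite along some direction. -/
theorem exists_ray_integrable (hn : 2 < n) (hε : ε = 1 ∨ ε = -1)
    (hw : ∀ x ∈ shell n {t | T < ε * t}, ContDiffAt ℝ ∞ w x) {T' : ℝ} (hT' : T < T')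
    (hT0 : 0 < T')
    (hE : IntegrableOn (fun s => sphereInt (energyDensity w) (ε * s) / s ^ 2) (Ioi T')) :
    ∃ θ, IntegrableOn (fun s => (sphereDev w (ε * s) θ ^ 2 +
      radialD w (logPolar (ε * s, θ)) ^ 2) / s ^ 2) (Ioi T') := by
  have hn0 : 0 < n := by omega
  obtain ⟨C, hC, hP⟩ := exists_sphere_poincare hn
  have hS : 0 < (sphereMeasure n).real univ := sphereMeasure_real_univ_pos hn0
  set c := ENNReal.ofReal ((sphereMeasure n).real univ)⁻¹
  have hwc : ContinuousOn w (shell n {t | T < ε * t}) :=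
    fun x hx => (hw x hx).continuousAt.continuousWithinAt
  have hmem : ∀ s ∈ Ioi T', ε * s ∈ {t | T < ε * t} := fun s hs => mul_mem_end hε (hT'.trans hs)
  set F : ℝ → Metric.sphere (0 : EuclideanSpace ℝ (Fin n)) 1 → ℝ := fun s θ =>
    (sphereDev w (ε * s) θ ^ 2 + radialD w (logPolar (ε * s, θ)) ^ 2) / s ^ 2 with hF
  have hpolar : ∀ {f : EuclideanSpace ℝ (Fin n) → ℝ}, ContinuousOn f (shell n {t | T < ε * t}) →
      ContinuousOn (fun q : ℝ × Metric.sphere (0 : EuclideanSpace ℝ (Fin n)) 1 =>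
        f (logPolar (ε * q.1, q.2))) (Ioi T' ×ˢ univ) := fun {f} hf =>
    (continuousOn_comp_logPolar hf).comp (f := fun q :
      ℝ × Metric.sphere (0 : EuclideanSpace ℝ (Fin n)) 1 => (ε * q.1, q.2)) (by fun_prop)
      fun q hq => ⟨hmem _ hq.1, mem_univ _⟩
  have hb : ContinuousOn (fun s => sphereInt w (ε * s)) (Ioi T') :=
    (continuousOn_sphereInt (isOpen_mul_gt ε T) hwc).comp (by fun_prop) hmem
  have hFc : ContinuousOn (fun q : ℝ × Metric.sphere (0 : EuclideanSpace ℝ (Fin n)) 1 =>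
      F q.1 q.2) (Ioi T' ×ˢ univ) := by
    refine ContinuousOn.div (ContinuousOn.add (ContinuousOn.pow (ContinuousOn.sub (hpolar hwc) ?_) 2)
      ((hpolar (continuousOn_radialD hw)).pow 2)) (by fun_prop) fun q hq => ?_
    · exact (hb.comp continuousOn_fst fun q hq => hq.1).div_const _
    · have : 0 < q.1 := hT0.trans hq.1
      positivity
  have hF0 : ∀ s θ, 0 ≤ F s θ := fun s θ => by simp only [hF]; positivity
  have hFm : AEMeasurable (Function.uncurry fun s θ => ENNReal.ofReal (F s θ))
      ((volume.restrict (Ioi T')).prod (sphereMeasure n)) := by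
    have h1 := hFc.aemeasurable (μ := (volume : Measure ℝ).prod (sphereMeasure n))
      (measurableSet_Ioi.prod MeasurableSet.univ)
    rw [← Measure.prod_restrict, Measure.restrict_univ] at h1
    exact h1.ennreal_ofReal
  have hslice : ∀ s ∈ Ioi T', ∫⁻ θ, ENNReal.ofReal (F s θ) ∂(sphereMeasure n) ≤
      (c * C + 1) * ENNReal.ofReal (sphereInt (energyDensity w) (ε * s) / s ^ 2) := by
    intro s hs
    have hs0 : 0 < s := hT0.trans hs
    have hec := integrable_comp_logPolar (continuousOn_energyDensity hw) (hmem s hs)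
    have hen : ENNReal.ofReal (sphereInt (energyDensity w) (ε * s)) =
        ∫⁻ θ, ENNReal.ofReal (energyDensity w (logPolar (ε * s, θ))) ∂(sphereMeasure n) :=
      ofReal_integral_eq_lintegral_ofReal hec
        (ae_of_all _ fun θ => mul_nonneg (sq_nonneg _) (sq_nonneg _))
    have e : ∀ θ, ENNReal.ofReal (F s θ) = ENNReal.ofReal (s ^ 2)⁻¹ *
        (ENNReal.ofReal (sphereDev w (ε * s) θ ^ 2) +
          ENNReal.ofReal (radialD w (logPolar (ε * s, θ)) ^ 2)) := fun θ => by
      rw [← ENNReal.ofReal_add (sq_nonneg _) (sq_nonneg _), ← ENNReal.ofReal_mul (by positivity)]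
      simp only [hF]; congr 1; field_simp
    simp_rw [e]
    have hdm : Measurable fun θ => ENNReal.ofReal (sphereDev w (ε * s) θ ^ 2) := by
      have := (continuous_comp_logPolar hwc (hmem s hs)).measurable
      exact ((this.sub_const _).pow_const 2).ennreal_ofReal
    rw [lintegral_const_mul' _ _ ENNReal.ofReal_ne_top, lintegral_add_left hdm,
      div_eq_mul_inv, ENNReal.ofReal_mul' (by positivity), hen, ← mul_assoc, mul_comm _ (ENNReal.ofReal _)]
    refine mul_le_mul_of_nonneg_left ?_ zero_le
    rw [add_mul, one_mul]
    refine add_le_add ?_ ?_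
    · refine (lintegral_sq_sphereDev_le hn0 hwc (hmem s hs)).trans ?_
      rw [mul_assoc]
      refine mul_le_mul_of_nonneg_left ?_ zero_le
      exact hP w _ (isOpen_mul_gt ε T) hw _ (hmem s hs)
    · exact lintegral_mono fun θ => ENNReal.ofReal_le_ofReal (sq_radialD_le _)
  have htot : ∫⁻ θ, (∫⁻ s in Ioi T', ENNReal.ofReal (F s θ)) ∂(sphereMeasure n) ≠ ⊤ := by
    rw [← lintegral_lintegral_swap hFm]
    refine ne_top_of_le_ne_top ?_ (setLIntegral_mono' measurableSet_Ioi hslice)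
    have hcC : c * C + 1 ≠ ⊤ :=
      ENNReal.add_ne_top.2 ⟨ENNReal.mul_ne_top ENNReal.ofReal_ne_top hC, ENNReal.one_ne_top⟩
    rw [lintegral_const_mul' _ _ hcC]
    exact ENNReal.mul_ne_top hcC hE.lintegral_lt_top.ne
  have hex : ∃ θ, ∫⁻ s in Ioi T', ENNReal.ofReal (F s θ) ≠ ⊤ := by
    by_contra! hall
    simp_rw [hall] at htot
    rw [lintegral_const, ENNReal.top_mul] at htot
    · exact htot rfl
    · intro h0
      rw [Measure.real, h0] at hS
      simp at hS
  obtain ⟨θ, hθ⟩ := hex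
  refine ⟨θ, ?_, ?_⟩
  · refine ContinuousOn.aestronglyMeasurable ?_ measurableSet_Ioi
    exact hFc.comp (f := fun s => (s, θ)) (by fun_prop) fun s hs => ⟨hs, mem_univ _⟩
  · rw [hasFiniteIntegral_iff_ofReal (ae_of_all _ fun s => hF0 s θ)]
    exact lt_top_iff_ne_top.2 hθ

/-- The Riccati integrability lemma with `E = 1` and `z = 0`. -/
theorem integrableOn_inv_sq_Ioi {T : ℝ} (hT : 0 < T) :
    IntegrableOn (fun s : ℝ => 1 / s ^ 2) (Ioi T) :=
  integrableOn_div_sq_of_le_deriv (z := fun _ => 0) (z' := fun _ => 0) (κ := 1) (M := 0) (C := 1)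
    (E := fun _ => 1) one_pos hT (fun s _ => hasDerivAt_const s 0) (by simp) (by simp)
    continuousOn_const (by simp)

/-- Along a suitable ray, `w` has the same linear growth as its spherical means. -/
theorem tendsto_sphereDev_div (hn : 0 < n) (hε : ε = 1 ∨ ε = -1)
    (hw : ∀ x ∈ shell n {t | T < ε * t}, ContDiffAt ℝ ∞ w x) {T' M : ℝ} (hT' : T < T')
    (hT1 : 1 ≤ T') (hM : ∀ s ≥ T', |sphereInt (radialD w) (ε * s)| ≤ M)
    {θ : Metric.sphere (0 : EuclideanSpace ℝ (Fin n)) 1}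
    (hθ : IntegrableOn (fun s => (sphereDev w (ε * s) θ ^ 2 +
      radialD w (logPolar (ε * s, θ)) ^ 2) / s ^ 2) (Ioi T')) :
    Tendsto (fun s => sphereDev w (ε * s) θ / s) atTop (𝓝 0) := by
  have hε2 : ε * ε = 1 := by rcases hε with rfl | rfl <;> norm_num
  set S := (sphereMeasure n).real univ with hSdef
  have hS : 0 < S := sphereMeasure_real_univ_pos hn
  have hT0 : 0 < T' := by linarith
  have hmem : ∀ s ∈ Ioi T', ε * s ∈ {t | T < ε * t} := fun s hs => mul_mem_end hε (hT'.trans hs)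
  set D : ℝ → ℝ := fun s => sphereDev w (ε * s) θ with hD
  set r : ℝ → ℝ := fun s => radialD w (logPolar (ε * s, θ)) with hr
  set a : ℝ → ℝ := fun s => sphereInt (radialD w) (ε * s) / S with ha
  have hDd : ∀ s ∈ Ioi T', HasDerivAt D (ε * (r s - a s)) s := by
    intro s hs
    have h1 := hasDerivAt_comp_logPolar (θ := θ) (t := ε * s)
      ((hw _ (logPolar_mem_shell.2 (hmem s hs))).differentiableAt (by simp))
    have h2 := hasDerivAt_sphereInt (isOpen_mul_gt ε T)
      (fun x hx => (hw x hx).of_le (by exact_mod_cast le_top)) (hmem s hs)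
    have h3 := ((h1.sub (h2.div_const S)).comp s ((hasDerivAt_id s).const_mul ε))
    refine h3.congr_deriv ?_
    simp only [hr, ha]; ring
  have hrc : ContinuousOn r (Ioi T') :=
    (continuousOn_comp_logPolar (continuousOn_radialD hw)).comp (f := fun s => (ε * s, θ))
      (by fun_prop) fun s hs => ⟨hmem s hs, mem_univ _⟩
  have hac : ContinuousOn a (Ioi T') :=
    ((continuousOn_sphereInt (isOpen_mul_gt ε T) (continuousOn_radialD hw)).comp
      (f := fun s => ε * s) (by fun_prop) hmem).div_const S
  have hDc : ContinuousOn D (Ioi T') := fun s hs => (hDd s hs).continuousAt.continuousWithinAt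
  -- The square of `D/s` is integrable and so is its derivative, hence it tends to zero.
  have hq : ∀ s ∈ Ioi T', HasDerivAt (fun s => D s ^ 2 * (s ^ 2)⁻¹)
      (2 * D s * (ε * (r s - a s)) * (s ^ 2)⁻¹ + D s ^ 2 * (-(2 * s) / (s ^ 2) ^ 2)) s := by
    intro s hs
    have hs0 : s ≠ 0 := (hT0.trans hs).ne'
    have h1 : HasDerivAt (fun s : ℝ => s ^ 2) (2 * s) s := by simpa using hasDerivAt_pow 2 s
    have h2 := ((hDd s hs).fun_pow 2).mul (h1.fun_inv (by positivity))
    refine h2.congr_deriv ?_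
    simp
  have hmeas : MeasurableSet (Ioi T') := measurableSet_Ioi
  have hpos : ∀ s ∈ Ioi T', s ≠ 0 := fun s hs => (hT0.trans hs).ne'
  have hqint : IntegrableOn (fun s => D s ^ 2 * (s ^ 2)⁻¹) (Ioi T') := by
    refine Integrable.mono' hθ ?_ ?_
    · exact ((hDc.pow 2).mul (ContinuousOn.inv₀ (by fun_prop)
        fun s hs => pow_ne_zero 2 (hpos s hs))).aestronglyMeasurable hmeas
    · filter_upwards [ae_restrict_mem hmeas] with s hs
      rw [Real.norm_of_nonneg (by positivity), ← div_eq_mul_inv]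
      gcongr
      exact le_add_of_nonneg_right (sq_nonneg _)
  have hdom : IntegrableOn (fun s => 5 * ((D s ^ 2 + r s ^ 2) / s ^ 2) +
      (2 * (M / S) ^ 2) * (1 / s ^ 2)) (Ioi T') :=
    (hθ.const_mul 5).add ((integrableOn_inv_sq_Ioi hT0).const_mul _)
  have hq'int : IntegrableOn (fun s => 2 * D s * (ε * (r s - a s)) * (s ^ 2)⁻¹ +
      D s ^ 2 * (-(2 * s) / (s ^ 2) ^ 2)) (Ioi T') := by
    refine Integrable.mono' hdom ?_ ?_
    · refine ContinuousOn.aestronglyMeasurable ?_ hmeas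
      refine ContinuousOn.add (ContinuousOn.mul (by fun_prop) (ContinuousOn.inv₀ (by fun_prop)
        fun s hs => pow_ne_zero 2 (hpos s hs))) ((hDc.pow 2).mul (ContinuousOn.div (by fun_prop)
          (by fun_prop) fun s hs => pow_ne_zero 2 (pow_ne_zero 2 (hpos s hs))))
    · filter_upwards [ae_restrict_mem hmeas] with s hs
      have hs1 : 1 ≤ s := hT1.trans (le_of_lt hs)
      have hs0 : 0 < s := by linarith
      have haM : a s ^ 2 ≤ (M / S) ^ 2 := by
        rw [← sq_abs]
        refine pow_le_pow_left₀ (abs_nonneg _) ?_ 2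
        simp only [ha]
        rw [abs_div, abs_of_pos hS]
        exact div_le_div_of_nonneg_right (hM s (le_of_lt hs)) hS.le
      have e : 2 * D s * (ε * (r s - a s)) * (s ^ 2)⁻¹ + D s ^ 2 * (-(2 * s) / (s ^ 2) ^ 2) =
          (2 * D s * (ε * (r s - a s)) - 2 * D s ^ 2 / s) / s ^ 2 := by field_simp; ring
      have e' : 5 * ((D s ^ 2 + r s ^ 2) / s ^ 2) + (2 * (M / S) ^ 2) * (1 / s ^ 2) =
          (5 * (D s ^ 2 + r s ^ 2) + 2 * (M / S) ^ 2) / s ^ 2 := by ring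
      rw [e, e', norm_div, Real.norm_of_nonneg (sq_nonneg s)]
      gcongr
      have h1 : D s ^ 2 / s ≤ D s ^ 2 := div_le_self (sq_nonneg _) hs1
      have h2 : 0 ≤ D s ^ 2 / s := by positivity
      have h3 : (ε * (r s - a s)) ^ 2 ≤ 2 * r s ^ 2 + 2 * a s ^ 2 := by
        have : (ε * (r s - a s)) ^ 2 = (r s - a s) ^ 2 := by
          linear_combination (r s - a s) ^ 2 * hε2
        rw [this]; nlinarith [sq_nonneg (r s + a s)]
      set y := ε * (r s - a s)
      have h4 : 2 * D s ^ 2 / s = 2 * (D s ^ 2 / s) := by ring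
      rw [Real.norm_eq_abs, h4]
      refine abs_le.2 ⟨?_, ?_⟩
      · nlinarith [sq_nonneg (D s + y), sq_nonneg (r s)]
      · nlinarith [sq_nonneg (D s - y), sq_nonneg (r s)]
  have hlim := tendsto_zero_of_hasDerivAt_of_integrableOn_Ioi hq hq'int hqint
  have h2 : Tendsto (fun s => Real.sqrt (D s ^ 2 * (s ^ 2)⁻¹)) atTop (𝓝 0) := by
    have := (Real.continuous_sqrt.tendsto 0).comp hlim
    rwa [Real.sqrt_zero] at this
  rw [tendsto_zero_iff_abs_tendsto_zero]
  refine h2.congr fun s => ?_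
  rw [← inv_pow, ← mul_pow, Real.sqrt_sq_eq_abs, ← div_eq_mul_inv]
  rfl

/-- In dimension greater than two, the growth at an end all of whose rays have infinite length. -/
theorem end_growth_of_two_lt (hn : 2 < n) (hε : ε = 1 ∨ ε = -1)
    (hw : ∀ x ∈ shell n {t | T < ε * t}, ContDiffAt ℝ ∞ w x)
    (hineq : ∀ x ∈ shell n {t | T < ε * t}, 2 * Δ w x + (n - 2) * ‖fderiv ℝ w x‖ ^ 2 ≤ 0)
    (hray : ∀ θ, ∀ T₁ > T, ∫⁻ s in Ioi T₁,
      ENNReal.ofReal (Real.exp (w (logPolar (ε * s, θ)) + ε * s)) = ⊤)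
    {l : ℝ} (hl : Tendsto (fun s => sphereInt w (ε * s) / s) atTop (𝓝 l)) :
    -ε * (sphereMeasure n).real univ ≤ l := by
  have hn0 : 0 < n := by omega
  set S := (sphereMeasure n).real univ with hSdef
  have hS : 0 < S := sphereMeasure_real_univ_pos hn0
  by_contra! hlt
  set T' := max T 0 + 1 with hT'def
  have hTT' : T < T' := by have := le_max_left T 0; linarith
  have hT1 : 1 ≤ T' := by have := le_max_right T 0; linarith
  obtain ⟨⟨M, hM⟩, hE⟩ := sphereInt_radialD_bound_of_two_lt hn hε hw hineq hTT' (by linarith)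
  obtain ⟨θ, hθ⟩ := exists_ray_integrable hn hε hw hTT' (by linarith) hE
  have hdev := tendsto_sphereDev_div hn0 hε hw hTT' hT1 hM hθ
  -- Half the excess decay: along the chosen ray the logarithm of the speed behaves like `-2δ s`,
  -- eventually below `-δ s`, so the ray would have finite length.
  set δ := -(l / S + ε) / 2 with hδ
  have hδ0 : 0 < δ := by
    have : l / S < -ε := by rw [div_lt_iff₀ hS]; exact hlt
    rw [hδ]; linarith
  have hlim : Tendsto (fun s => (w (logPolar (ε * s, θ)) + ε * s) / s) atTop (𝓝 (-(2 * δ))) := by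
    have h1 := (hdev.add (hl.div_const S)).add_const ε
    have e : (0 + l / S + ε) = -(2 * δ) := by rw [hδ]; ring
    rw [e] at h1
    refine h1.congr' ?_
    filter_upwards [eventually_gt_atTop 0] with s hs
    rw [sphereDev, ← hSdef]
    field_simp
    ring
  have hev := hlim.eventually (gt_mem_nhds (show -(2 * δ) < -δ by linarith))
  obtain ⟨T₁, hT₁⟩ := eventually_atTop.1 hev
  set T₂ := max T₁ T' with hT₂
  have h1 : T < T₂ := hTT'.trans_le (le_max_right _ _)
  have hle : ∫⁻ s in Ioi T₂, ENNReal.ofReal (Real.exp (w (logPolar (ε * s, θ)) + ε * s)) ≤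
      ∫⁻ s in Ioi T₂, ENNReal.ofReal (Real.exp (-δ * s)) := by
    refine setLIntegral_mono' measurableSet_Ioi fun s hs => ?_
    refine ENNReal.ofReal_le_ofReal (Real.exp_le_exp.2 ?_)
    have hs1 : T₁ ≤ s := (le_max_left _ _).trans (le_of_lt hs)
    have hs0 : 0 < s := by
      have : T' < s := lt_of_le_of_lt (le_max_right _ _) hs
      linarith
    have := hT₁ s hs1
    rw [div_lt_iff₀ hs0] at this
    exact this.le
  rw [hray θ T₂ h1] at hle
  have hfin := (integrableOn_exp_mul_Ioi (a := -δ) (by linarith) T₂).lintegral_lt_top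
  exact absurd hle (not_le.2 hfin)

end EndGrowth

/-! ### The Riemannian distance to an end -/

section EndDistance

variable {n : ℕ} {u : USphere n → ℝ} {Ω : Set (USphere n)} {v : USphere n}
  {p : EuclideanSpace ℝ (Fin n)} {ε : ℝ}

/-- Stereographic coordinates centred at `p`. -/
noncomputable def centredParam (v : USphere n) (p y : EuclideanSpace ℝ (Fin n)) : USphere n :=
  (stereoChart n v).symm (p + y)

theorem continuous_centredParam : Continuous (centredParam v p) :=
  continuous_stereoChart_symm.comp (by fun_prop)

theorem injective_centredParam : Function.Injective (centredParam v p) :=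
  injective_stereoChart_symm.comp (add_right_injective p)

theorem isOpen_image_centredParam {A : Set (EuclideanSpace ℝ (Fin n))} (hA : IsOpen A) :
    IsOpen (centredParam v p '' A) := by
  have h1 : centredParam v p '' A = (stereoChart n v).symm '' ((p + ·) '' A) := by
    rw [image_image]; rfl
  rw [h1]
  refine (stereoChart n v).isOpen_image_symm_of_subset_target ?_ ?_
  · exact (Homeomorph.addLeft p).isOpenMap _ hA
  · rw [stereoChart_target]; exact subset_univ _

/-- The Riemannian distance to the part of the end beyond the parameter `s`. -/
noncomputable def endDist (n : ℕ) (u : USphere n → ℝ) (Ω : Set (USphere n)) (v : USphere n)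
    (p : EuclideanSpace ℝ (Fin n)) (ε s : ℝ) (x : EuclideanSpace ℝ (Fin n)) : ℝ≥0∞ :=
  ⨅ z ∈ shell n {t | s ≤ ε * t}, metricDist n u Ω (centredParam v p x) (centredParam v p z)

theorem endDist_mono {s r : ℝ} (h : s ≤ r) (x : EuclideanSpace ℝ (Fin n)) :
    endDist n u Ω v p ε s x ≤ endDist n u Ω v p ε r x :=
  biInf_mono fun _ hz => ⟨hz.1, h.trans hz.2⟩

theorem endDist_le_add (s : ℝ) (x y : EuclideanSpace ℝ (Fin n)) :
    endDist n u Ω v p ε s x ≤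
      metricDist n u Ω (centredParam v p x) (centredParam v p y) + endDist n u Ω v p ε s y := by
  conv_rhs => rw [endDist]
  simp only [ENNReal.add_iInf]
  exact le_iInf₂ fun z hz => (iInf₂_le z hz).trans metricDist_triangle

theorem metricDist_centredParam_self {x : EuclideanSpace ℝ (Fin n)}
    (h : centredParam v p x ∈ Ω) :
    metricDist n u Ω (centredParam v p x) (centredParam v p x) = 0 :=
  metricDist_self_chart h

theorem endDist_eq_zero {s : ℝ} {x : EuclideanSpace ℝ (Fin n)} (h : centredParam v p x ∈ Ω)
    (hx : x ∈ shell n {t | s ≤ ε * t}) : endDist n u Ω v p ε s x = 0 := by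
  refine le_antisymm ((iInf₂_le x hx).trans ?_) zero_le
  rw [metricDist_centredParam_self h]

/-- Locally, the distance is controlled by the conformal factor. -/
theorem eventually_metricDist_centredParam_le (hΩ : IsOpen Ω) {x : EuclideanSpace ℝ (Fin n)}
    (hx : centredParam v p x ∈ Ω) (hw : ContinuousAt (fun y => flatFactor n u v (p + y)) x) {M : ℝ}
    (hM : flatFactor n u v (p + x) < M) :
    ∃ r > 0, ∀ y ∈ Metric.ball x r, ∀ z ∈ Metric.ball x r,
      metricDist n u Ω (centredParam v p y) (centredParam v p z) ≤
        ENNReal.ofReal (Real.exp M * ‖z - y‖) := by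
  have h1 : ∀ᶠ y in 𝓝 x, centredParam v p y ∈ Ω ∧ flatFactor n u v (p + y) < M :=
    ((continuous_centredParam.continuousAt).eventually (hΩ.mem_nhds hx)).and
      (hw.eventually (gt_mem_nhds hM))
  obtain ⟨r, hr, hball⟩ := Metric.eventually_nhds_iff_ball.1 h1
  refine ⟨r, hr, fun y hy z hz => ?_⟩
  have h2 := metricDist_segment_le (u := u) (Ω := Ω) (v := v) (x := p + y) (y := p + z) (M := M) ?_
  · rwa [add_sub_add_left_eq_sub] at h2
  · intro q hq
    rw [← segment_translate_image] at hq
    obtain ⟨q', hq', rfl⟩ := hq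
    have h3 := hball q' ((convex_ball x r).segment_subset hy hz hq')
    exact ⟨h3.1, h3.2.le⟩

theorem exp_sign_mul_log (hε : ε = 1 ∨ ε = -1) {s : ℝ} {y : EuclideanSpace ℝ (Fin n)} :
    y ∈ shell n {t | ε * t = s} ↔ ‖y‖ = Real.exp (ε * s) := by
  have hε2 : ε * ε = 1 := by rcases hε with rfl | rfl <;> norm_num
  constructor
  · rintro ⟨h0, h⟩
    have h' : ε * Real.log ‖y‖ = s := h
    rw [← h', ← mul_assoc, hε2, one_mul, Real.exp_log (norm_pos_iff.2 h0)]
  · intro h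
    have h0 : y ≠ 0 := norm_pos_iff.1 (by rw [h]; exact Real.exp_pos _)
    refine ⟨h0, ?_⟩
    change ε * Real.log ‖y‖ = s
    rw [h, Real.log_exp, ← mul_assoc, hε2, one_mul]

/-- A curve entering the end crosses every intermediate sphere. -/
theorem IsC1Curve.exists_crossing (hε : ε = 1 ∨ ε = -1) {γ : ℝ → USphere n}
    {x z : EuclideanSpace ℝ (Fin n)} {s : ℝ}
    (h : IsC1Curve n Ω (centredParam v p x) (centredParam v p z) γ)
    (hx : x ∈ shell n {t | ε * t ≤ s}) (hz : z ∈ shell n {t | s ≤ ε * t}) :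
    ∃ c ∈ Icc (0 : ℝ) 1, ∃ y ∈ shell n {t | ε * t = s}, γ c = centredParam v p y := by
  set r := Real.exp (ε * s) with hr
  have hx' : ε * Real.log ‖x‖ ≤ s := hx.2
  have hz' : s ≤ ε * Real.log ‖z‖ := hz.2
  have hx0 := norm_pos_iff.2 hx.1
  have hz0 := norm_pos_iff.2 hz.1
  by_contra! hno
  have hgc : ContinuousOn γ (Icc 0 1) := by
    rw [continuousOn_iff_continuous_domRestrict, continuous_induced_rng]
    exact continuousOn_iff_continuous_domRestrict.1 h.1.continuousOn
  have hpre : IsPreconnected (γ '' Icc 0 1) := isPreconnected_Icc.image γ hgc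
  -- A curve missing the sphere of radius `r` would lie in two disjoint open sets, the image of the
  -- open ball and the complement of the image of the closed ball. Compactness of the closed ball
  -- makes the complement open in the whole sphere, so curves through the pole are covered.
  set B := centredParam v p '' Metric.ball 0 r
  set K := centredParam v p '' Metric.closedBall 0 r
  have hB : IsOpen B := isOpen_image_centredParam Metric.isOpen_ball
  have hK : IsOpen Kᶜ :=
    ((isCompact_closedBall 0 r).image continuous_centredParam).isClosed.isOpen_compl
  have hBK : B ⊆ K := image_mono Metric.ball_subset_closedBall
  have hsub : γ '' Icc 0 1 ⊆ B ∪ Kᶜ := by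
    rintro _ ⟨c, hc, rfl⟩
    by_contra hcon
    rw [mem_union, not_or, notMem_compl_iff] at hcon
    obtain ⟨y, hy, hyc⟩ := hcon.2
    have hyr : ‖y‖ = r := by
      refine le_antisymm (by simpa using hy) (not_lt.1 fun hlt => hcon.1 ⟨y, by simpa using hlt, hyc⟩)
    exact hno c hc y ((exp_sign_mul_log hε).2 hyr) hyc.symm
  have h0 : γ 0 ∈ γ '' Icc (0 : ℝ) 1 := mem_image_of_mem γ ⟨le_rfl, zero_le_one⟩
  have h1 : γ 1 ∈ γ '' Icc (0 : ℝ) 1 := mem_image_of_mem γ ⟨zero_le_one, le_rfl⟩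
  have hmB : ∀ y : EuclideanSpace ℝ (Fin n), ‖y‖ ≤ r →
      centredParam v p y ∈ γ '' Icc (0 : ℝ) 1 → (γ '' Icc (0 : ℝ) 1 ∩ B).Nonempty := by
    intro y hy hmem
    refine ⟨_, hmem, (hsub hmem).resolve_right fun hc => hc ⟨y, by simpa using hy, rfl⟩⟩
  have hmK : ∀ y : EuclideanSpace ℝ (Fin n), r ≤ ‖y‖ →
      centredParam v p y ∈ γ '' Icc (0 : ℝ) 1 → (γ '' Icc (0 : ℝ) 1 ∩ Kᶜ).Nonempty := by
    intro y hy hmem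
    refine ⟨_, hmem, (hsub hmem).resolve_left fun hc => ?_⟩
    obtain ⟨y', hy', he⟩ := hc
    rw [injective_centredParam he] at hy'
    exact absurd (mem_ball_zero_iff.1 hy') (not_lt.2 hy)
  rw [h.2.2.1] at h0
  rw [h.2.2.2] at h1
  have hne : (γ '' Icc (0 : ℝ) 1 ∩ B).Nonempty ∧ (γ '' Icc (0 : ℝ) 1 ∩ Kᶜ).Nonempty := by
    rcases hε with rfl | rfl
    · refine ⟨hmB x ?_ h0, hmK z ?_ h1⟩
      · rw [hr, ← Real.log_le_iff_le_exp hx0]; linarith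
      · rw [hr, ← Real.le_log_iff_exp_le hz0]; linarith
    · refine ⟨hmB z ?_ h1, hmK x ?_ h0⟩
      · rw [hr, ← Real.log_le_iff_le_exp hz0]; linarith
      · rw [hr, ← Real.le_log_iff_exp_le hx0]; linarith
  obtain ⟨q, -, hqB, hqK⟩ := hpre B Kᶜ hB hK hsub hne.1 hne.2
  exact hqK (hBK hqB)

/-- From a point at finite distance from the end one can move further along the end without
wasting length. -/
theorem exists_step_of_endDist (hε : ε = 1 ∨ ε = -1) (hΩ : IsOpen Ω) {T : ℝ}
    (hmem : ∀ y ∈ shell n {t | T < ε * t}, centredParam v p y ∈ Ω)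
    (hw : ∀ y ∈ shell n {t | T < ε * t}, ContinuousAt (fun y => flatFactor n u v (p + y)) y)
    {x : EuclideanSpace ℝ (Fin n)} {s : ℝ} (hx : x ∈ shell n {t | ε * t ≤ s}) (hs : T < s)
    (hfin : ⨆ j : ℕ, endDist n u Ω v p ε j x ≠ ⊤) :
    ∃ y ∈ shell n {t | ε * t = s}, metricDist n u Ω (centredParam v p x) (centredParam v p y) +
      ⨆ j : ℕ, endDist n u Ω v p ε j y ≤ ⨆ j : ℕ, endDist n u Ω v p ε j x := by
  set a := ⨆ j : ℕ, endDist n u Ω v p ε j x with ha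
  -- An almost optimal curve to the `j`-th truncation of the end crosses the sphere at parameter
  -- `s`; splitting it at the crossing loses only `1/(j+1)`.
  have hex : ∀ j : ℕ, ∃ y ∈ shell n {t | ε * t = s}, s ≤ j →
      metricDist n u Ω (centredParam v p x) (centredParam v p y) + endDist n u Ω v p ε j y ≤
        a + ((j : ℝ≥0∞) + 1)⁻¹ := by
    intro j
    have hlt : endDist n u Ω v p ε (max s j) x < a + ((j : ℝ≥0∞) + 1)⁻¹ := by
      obtain ⟨m, hm⟩ := exists_nat_ge (max s j)
      have h1 : endDist n u Ω v p ε (max s j) x ≤ a :=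
        (endDist_mono hm x).trans (le_iSup (fun j : ℕ => endDist n u Ω v p ε j x) m)
      refine lt_of_le_of_lt h1 (ENNReal.lt_add_right hfin ?_)
      simp
    rw [endDist] at hlt
    simp only [iInf_lt_iff] at hlt
    obtain ⟨z, hz, hlt⟩ := hlt
    rw [metricDist] at hlt
    simp only [iInf_lt_iff] at hlt
    obtain ⟨γ, hγ, hlen⟩ := hlt
    have hz' : max s j ≤ ε * Real.log ‖z‖ := hz.2
    obtain ⟨c, hc, y, hy, hyc⟩ := hγ.exists_crossing hε hx ⟨hz.1, (le_max_left _ _).trans hz'⟩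
    refine ⟨y, hy, fun _ => ?_⟩
    have h2 := hγ.exists_split (u := u) hc
    rw [hyc] at h2
    refine le_trans (add_le_add le_rfl ?_) (h2.trans hlen.le)
    exact iInf₂_le z ⟨hz.1, (le_max_right _ _).trans hz'⟩
  choose Y hYs hY using hex
  -- The crossing points accumulate on the compact sphere. Near the limit Riemannian distances are
  -- at most a constant times Euclidean ones, so moving to the limit costs nothing in the end.
  have hcomp : IsCompact (shell n {t | ε * t = s}) := by
    have := isCompact_mul_mem_Icc hε s s
    simp only [Icc_self, mem_singleton_iff] at this
    exact isCompact_shell this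
  obtain ⟨y, hy, k, hk, hlim⟩ := hcomp.tendsto_subseq hYs
  have hyT : y ∈ shell n {t | T < ε * t} := ⟨hy.1, by
    have h : ε * Real.log ‖y‖ = s := hy.2
    change T < ε * Real.log ‖y‖; rwa [h]⟩
  refine ⟨y, hy, ?_⟩
  obtain ⟨r, hr, hball⟩ := eventually_metricDist_centredParam_le hΩ (hmem y hyT) (hw y hyT)
    (lt_add_one (flatFactor n u v (p + y)))
  set C := Real.exp (flatFactor n u v (p + y) + 1)
  rw [ENNReal.add_iSup]
  refine iSup_le fun m => ?_
  have hbound : ∀ᶠ i in atTop, metricDist n u Ω (centredParam v p x) (centredParam v p y) +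
      endDist n u Ω v p ε m y ≤ a + ((k i : ℝ≥0∞) + 1)⁻¹ +
        (ENNReal.ofReal (C * ‖y - Y (k i)‖) + ENNReal.ofReal (C * ‖Y (k i) - y‖)) := by
    obtain ⟨m', hm'⟩ := exists_nat_ge (max s m)
    filter_upwards [hlim.eventually (Metric.ball_mem_nhds y hr), eventually_ge_atTop m'] with i hi him
    have hki : max s m ≤ (k i : ℝ) := hm'.trans (by exact_mod_cast him.trans (hk.id_le i))
    have h1 := hball (Y (k i)) hi y (Metric.mem_ball_self hr)
    have h2 := hball y (Metric.mem_ball_self hr) (Y (k i)) hi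
    have h3 := hY (k i) ((le_max_left _ _).trans hki)
    calc _ ≤ (metricDist n u Ω (centredParam v p x) (centredParam v p (Y (k i))) +
            metricDist n u Ω (centredParam v p (Y (k i))) (centredParam v p y)) +
          (metricDist n u Ω (centredParam v p y) (centredParam v p (Y (k i))) +
            endDist n u Ω v p ε (k i) (Y (k i))) :=
          add_le_add metricDist_triangle ((endDist_le_add _ _ _).trans
            (add_le_add le_rfl (endDist_mono ((le_max_right _ _).trans hki) _)))
      _ = (metricDist n u Ω (centredParam v p x) (centredParam v p (Y (k i))) +
            endDist n u Ω v p ε (k i) (Y (k i))) +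
          (metricDist n u Ω (centredParam v p (Y (k i))) (centredParam v p y) +
            metricDist n u Ω (centredParam v p y) (centredParam v p (Y (k i)))) := by ring
      _ ≤ _ := add_le_add h3 (add_le_add h1 h2)
  have hn1 : Tendsto (fun i => ‖y - Y (k i)‖) atTop (𝓝 0) := by
    have := (tendsto_const_nhds (x := y)).sub hlim
    simpa using this.norm
  have hn2 : Tendsto (fun i => ‖Y (k i) - y‖) atTop (𝓝 0) := by
    simpa [norm_sub_rev] using hn1
  have ho : ∀ {f : ℕ → ℝ}, Tendsto f atTop (𝓝 0) →
      Tendsto (fun i => ENNReal.ofReal (C * f i)) atTop (𝓝 0) := fun {f} hf => by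
    have h := ENNReal.tendsto_ofReal (hf.const_mul C)
    simpa using h
  have hinv : Tendsto (fun i => ((k i : ℝ≥0∞) + 1)⁻¹) atTop (𝓝 0) := by
    have h1 : Tendsto (fun i : ℕ => ((i : ℝ≥0∞) + 1)⁻¹) atTop (𝓝 0) := by
      have := (tendsto_add_atTop_iff_nat 1).2 ENNReal.tendsto_inv_nat_nhds_zero
      simpa using this
    exact h1.comp hk.tendsto_atTop
  have hR := (hinv.const_add a).add ((ho hn1).add (ho hn2))
  simp only [add_zero] at hR
  exact ge_of_tendsto hR hbound

/-- In a complete metric the ends are at infinite distance. -/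
theorem IsCompleteMetric.iSup_endDist_eq_top (hcomp : IsCompleteMetric n u Ω) (hΩ : IsOpen Ω)
    (hu : ContinuousOn u Ω) (hε : ε = 1 ∨ ε = -1) {T : ℝ}
    (hmem : ∀ y ∈ shell n {t | T < ε * t}, centredParam v p y ∈ Ω)
    (hw : ∀ y ∈ shell n {t | T < ε * t}, ContinuousAt (fun y => flatFactor n u v (p + y)) y)
    {q : USphere n} (hq : q ∉ Ω)
    (hlim : ∀ X : ℕ → EuclideanSpace ℝ (Fin n), Tendsto (fun k => ε * Real.log ‖X k‖) atTop atTop →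
      Tendsto (fun k => centredParam v p (X k)) atTop (𝓝 q))
    {x : EuclideanSpace ℝ (Fin n)} (hx : x ∈ shell n {t | T < ε * t}) :
    ⨆ j : ℕ, endDist n u Ω v p ε j x = ⊤ := by
  by_contra hfin
  -- Steps of size one in the parameter. The lengths telescope against the remaining distance to the
  -- end, so their sum stays below the supposedly finite total distance: the points form a Cauchy
  -- sequence that leaves `Ω`.
  have hstep : ∀ y : {y : EuclideanSpace ℝ (Fin n) // y ∈ shell n {t | T < ε * t} ∧
      ⨆ j : ℕ, endDist n u Ω v p ε j y ≠ ⊤}, ∃ z : {y : EuclideanSpace ℝ (Fin n) //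
        y ∈ shell n {t | T < ε * t} ∧ ⨆ j : ℕ, endDist n u Ω v p ε j y ≠ ⊤},
      ε * Real.log ‖z.1‖ = ε * Real.log ‖y.1‖ + 1 ∧
        metricDist n u Ω (centredParam v p y.1) (centredParam v p z.1) +
        ⨆ j : ℕ, endDist n u Ω v p ε j z.1 ≤ ⨆ j : ℕ, endDist n u Ω v p ε j y.1 := by
    rintro ⟨y, hyT, hyf⟩
    have hyT' : T < ε * Real.log ‖y‖ := hyT.2
    obtain ⟨z, hz, hle⟩ := exists_step_of_endDist (s := ε * Real.log ‖y‖ + 1) hε hΩ hmem hw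
      ⟨hyT.1, (le_add_of_nonneg_right zero_le_one :
        ε * Real.log ‖y‖ ≤ ε * Real.log ‖y‖ + 1)⟩ (by linarith) hyf
    have hz' : ε * Real.log ‖z‖ = ε * Real.log ‖y‖ + 1 := hz.2
    refine ⟨⟨z, ⟨hz.1, ?_⟩, ?_⟩, hz', hle⟩
    · change T < ε * Real.log ‖z‖; linarith
    · exact ne_top_of_le_ne_top hyf (le_add_self.trans hle)
  choose F hFlog hF using hstep
  set X : ℕ → {y : EuclideanSpace ℝ (Fin n) // y ∈ shell n {t | T < ε * t} ∧
      ⨆ j : ℕ, endDist n u Ω v p ε j y ≠ ⊤} := fun k => F^[k] ⟨x, hx, hfin⟩ with hX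
  have hXs : ∀ k, X (k + 1) = F (X k) := fun k => Function.iterate_succ_apply' F k _
  have hlog : ∀ k : ℕ, ε * Real.log ‖(X k).1‖ = ε * Real.log ‖x‖ + k := by
    intro k
    induction k with
    | zero => simp [hX]
    | succ k ih => rw [hXs, hFlog, ih]; push_cast; ring
  have hsum : ∀ N : ℕ, ∑ k ∈ Finset.range N, metricDist n u Ω (centredParam v p (X k).1)
      (centredParam v p (X (k + 1)).1) + ⨆ j : ℕ, endDist n u Ω v p ε j (X N).1 ≤
      ⨆ j : ℕ, endDist n u Ω v p ε j x := by
    intro N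
    induction N with
    | zero => simp [hX]
    | succ N ih =>
      rw [Finset.sum_range_succ, add_assoc, hXs]
      exact (add_le_add le_rfl (hF (X N))).trans ih
  have hXΩ : ∀ k, centredParam v p (X k).1 ∈ Ω := fun k => hmem _ (X k).2.1
  refine hcomp.not_cauchy hΩ hu hq hXΩ (hlim (fun k => (X k).1) ?_) ?_
  · simp only [hlog]
    exact tendsto_atTop_add_const_left _ _ tendsto_natCast_atTop_atTop
  · refine cauchy_of_tsum_metricDist (fun k => metricDist_centredParam_self (hXΩ k)) ?_
    refine ne_top_of_le_ne_top hfin (ENNReal.tsum_le_of_sum_range_le fun N => ?_)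
    exact le_self_add.trans (hsum N)

end EndDistance

/-! ### Caccioppoli's inequality with Lipschitz cutoffs -/

section Caccioppoli

variable {n : ℕ}

/-- A point outside the ball of radius `R + 1` is at distance at least 1 from the support, so for
pairs involving it the supremum of `|f|` serves as a Lipschitz constant; compactness handles pairs
inside. -/
theorem LocallyLipschitz.exists_lipschitzWith_of_hasCompactSupport
    {f : EuclideanSpace ℝ (Fin n) → ℝ} (hf : LocallyLipschitz f) (hc : HasCompactSupport f) :
    ∃ K, LipschitzWith K f := by
  obtain ⟨R, hR⟩ := hc.isCompact.isBounded.subset_closedBall 0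
  obtain ⟨M, hM⟩ := hc.exists_bound_of_continuous hf.continuous
  obtain ⟨K, hK⟩ := LocallyLipschitzOn.exists_lipschitzOnWith_of_compact
    (isCompact_closedBall (0 : EuclideanSpace ℝ (Fin n)) (R + 1)) hf.locallyLipschitzOn
  have hM0 : 0 ≤ M := (norm_nonneg _).trans (hM 0)
  have hz : ∀ x, R < ‖x‖ → f x = 0 := fun x hx =>
    image_eq_zero_of_notMem_tsupport fun h => absurd (hR h) (by simpa using hx)
  have hout : ∀ x y, ‖x‖ ≤ R + 1 → R + 1 < ‖y‖ → dist (f x) (f y) ≤ M * dist x y := by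
    intro x y hx hy
    rw [hz y (by linarith), Real.dist_eq, sub_zero]
    by_cases hxR : R < ‖x‖
    · rw [hz x hxR, abs_zero]; positivity
    · have h1 : 1 ≤ dist x y := by
        have := norm_sub_norm_le y x
        rw [dist_comm, dist_eq_norm]; linarith
      calc |f x| ≤ M := hM x
        _ ≤ M * dist x y := le_mul_of_one_le_right hM0 h1
  refine ⟨max K ⟨M, hM0⟩, LipschitzWith.of_dist_le_mul fun x y => ?_⟩
  have hKM : (K : ℝ) ≤ ((max K ⟨M, hM0⟩ : NNReal) : ℝ) := NNReal.coe_le_coe.2 (le_max_left _ _)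
  have hMM : M ≤ ((max K ⟨M, hM0⟩ : NNReal) : ℝ) :=
    NNReal.coe_le_coe.2 (le_max_right K ⟨M, hM0⟩)
  by_cases hx : ‖x‖ ≤ R + 1 <;> by_cases hy : ‖y‖ ≤ R + 1
  · exact (hK.dist_le_mul x (by simpa using hx) y (by simpa using hy)).trans
      (mul_le_mul_of_nonneg_right hKM dist_nonneg)
  · exact (hout x y hx (not_le.1 hy)).trans (mul_le_mul_of_nonneg_right hMM dist_nonneg)
  · rw [dist_comm, dist_comm x]
    exact (hout y x hy (not_le.1 hx)).trans (mul_le_mul_of_nonneg_right hMM dist_nonneg)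
  · rw [hz x (by linarith [not_le.1 hx]), hz y (by linarith [not_le.1 hy]), dist_self]
    positivity

theorem measurable_partialD (i : Fin n) (f : EuclideanSpace ℝ (Fin n) → ℝ) :
    Measurable (partialD i f) :=
  measurable_fderiv_apply_const ℝ f _

/-- Integration by parts, with `ψ` differentiable almost everywhere by Rademacher, followed by
completing the square: `-∂(ψ² v) ∂v = v² (∂ψ)² - (ψ ∂v + v ∂ψ)²`. -/
theorem integral_partialD_partialD_mul_le {C : NNReal} {ψ v : EuclideanSpace ℝ (Fin n) → ℝ}
    (hψ : LipschitzWith C ψ) (hv : ContDiff ℝ ∞ v) (hvc : HasCompactSupport v)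
    (i : Fin n) :
    Integrable (fun x => v x ^ 2 * partialD i ψ x ^ 2) ∧
    ∫ x, partialD i (partialD i v) x * (ψ x ^ 2 * v x) ≤
      ∫ x, v x ^ 2 * partialD i ψ x ^ 2 := by
  have hv1 : ContDiff ℝ 1 v := hv.of_le (by exact_mod_cast le_top)
  have hpd : ContDiff ℝ ∞ (partialD i v) :=
    contDiff_iff_contDiffAt.2 fun y => contDiffAt_partialD hv.contDiffAt infty_add_one_le i
  have hpc : HasCompactSupport (partialD i v) := 
    hvc.fderiv_apply ℝ (EuclideanSpace.single i 1)
  obtain ⟨D, hD⟩ := ContDiff.lipschitzWith_of_hasCompactSupport hpc hpd (by simp)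
  have hgc : HasCompactSupport fun x => ψ x ^ 2 * v x := hvc.mul_left
  have hgl : LocallyLipschitz fun x => ψ x ^ 2 * v x := by
    have h1 : ContDiff ℝ 1 fun p : ℝ × ℝ => p.1 ^ 2 * p.2 := by fun_prop
    exact h1.locallyLipschitz.comp (hψ.locallyLipschitz.prodMk hv1.locallyLipschitz)
  obtain ⟨K, hK⟩ := hgl.exists_lipschitzWith_of_hasCompactSupport hgc
  have hint : Integrable (fun x => v x ^ 2 * partialD i ψ x ^ 2) := by
    have hc2 : HasCompactSupport fun x => v x ^ 2 := by
      simp only [pow_two]; exact hvc.mul_left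
    have h1 : Integrable fun x => v x ^ 2 :=
      (hv.continuous.pow 2).integrable_of_hasCompactSupport hc2
    have h0 : AEStronglyMeasurable (fun x => partialD i ψ x ^ 2) :=
      ((measurable_partialD i ψ).pow_const 2).aestronglyMeasurable
    have h2 : ∀ x, ‖partialD i ψ x ^ 2‖ ≤ (C : ℝ) ^ 2 := fun x => by
      have h3 := (fderiv ℝ ψ x).le_opNorm (EuclideanSpace.single i (1 : ℝ))
      have h4 : ‖fderiv ℝ ψ x‖ ≤ C := norm_fderiv_le_of_lipschitz ℝ hψ
      rw [PiLp.norm_single, norm_one, mul_one] at h3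
      rw [norm_pow]
      exact pow_le_pow_left₀ (norm_nonneg _) (h3.trans h4) 2
    exact Integrable.mul_bdd h1 h0 (Eventually.of_forall h2)
  refine ⟨hint, ?_⟩
  have hlhs : ∫ x, partialD i (partialD i v) x * (ψ x ^ 2 * v x) =
      ∫ x, lineDeriv ℝ (fun x => ψ x ^ 2 * v x) x (-(EuclideanSpace.single i 1)) * partialD i v x := by
    rw [← LipschitzWith.integral_lineDeriv_mul_eq hD hK hgc]
    refine integral_congr_ae (Eventually.of_forall fun x => ?_)
    simp only
    rw [DifferentiableAt.lineDeriv_eq_fderiv ((hpd.differentiable (by simp)) x)]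
    rfl
  rw [hlhs]
  have hle : ∀ᵐ x, lineDeriv ℝ (fun x => ψ x ^ 2 * v x) x (-(EuclideanSpace.single i 1)) *
      partialD i v x ≤ v x ^ 2 * partialD i ψ x ^ 2 := by
    filter_upwards [hψ.ae_differentiableAt] with x hx
    have hvd : DifferentiableAt ℝ v x := hv.differentiable (by simp) x
    have hd := ((hx.hasFDerivAt.pow 2).mul hvd.hasFDerivAt)
    have : lineDeriv ℝ (fun x => ψ x ^ 2 * v x) x (-(EuclideanSpace.single i 1)) =
        -(2 * ψ x * v x * partialD i ψ x + ψ x ^ 2 * partialD i v x) := by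
      have h2 := hd.hasLineDerivAt (-(EuclideanSpace.single i 1))
      have h3 := h2.lineDeriv
      refine h3.trans ?_
      simp [partialD]
      ring
    rw [this]
    nlinarith [sq_nonneg (ψ x * partialD i v x + v x * partialD i ψ x)]
  -- Without integrability the left side is 0 by convention and the right side is nonnegative, so
  -- that case needs no separate argument.
  by_cases hI : Integrable fun x => lineDeriv ℝ (fun x => ψ x ^ 2 * v x) x
      (-(EuclideanSpace.single i 1)) * partialD i v x
  · exact integral_mono_ae hI hint hle
  · rw [integral_undef hI]
    exact integral_nonneg fun x => by positivity

/-- Caccioppoli's inequality for a compactly supported Lipschitz cutoff. -/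
theorem integral_sq_mul_laplacian_le {C : NNReal} {U : Set (EuclideanSpace ℝ (Fin n))}
    {ψ v : EuclideanSpace ℝ (Fin n) → ℝ} (hψ : LipschitzWith C ψ) (hψc : HasCompactSupport ψ)
    (hU : IsOpen U) (hψU : tsupport ψ ⊆ U) (hv : ∀ x ∈ U, ContDiffAt ℝ ∞ v x) :
    ∫ x, ψ x ^ 2 * (v x * Δ v x) ≤ ∫ x, v x ^ 2 * ‖fderiv ℝ ψ x‖ ^ 2 := by
  obtain ⟨v', hv', hvc, heq⟩ := exists_contDiff_eq_nhds hU hψc.isCompact hψU hv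
  have hz : ∀ x ∉ tsupport ψ, fderiv ℝ ψ x = 0 := fun x hx =>
    image_eq_zero_of_notMem_tsupport fun h => hx (tsupport_fderiv_subset ℝ h)
  have h1 : ∫ x, ψ x ^ 2 * (v x * Δ v x) = ∫ x, ψ x ^ 2 * (v' x * Δ v' x) := by
    congr 1; ext x
    by_cases hx : x ∈ tsupport ψ
    · rw [(heq x hx).eq_of_nhds, InnerProductSpace.laplacian_congr_nhds (heq x hx) |>.eq_of_nhds]
    · rw [image_eq_zero_of_notMem_tsupport hx]; ring
  have h2 : ∫ x, v x ^ 2 * ‖fderiv ℝ ψ x‖ ^ 2 = ∫ x, v' x ^ 2 * ‖fderiv ℝ ψ x‖ ^ 2 := by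
    congr 1; ext x
    by_cases hx : x ∈ tsupport ψ
    · rw [(heq x hx).eq_of_nhds]
    · rw [hz x hx]; simp
  have hpd : ∀ i, ContDiff ℝ ∞ (partialD i (partialD i v')) := fun i =>
    contDiff_iff_contDiffAt.2 fun y => contDiffAt_partialD
      (contDiffAt_partialD hv'.contDiffAt infty_add_one_le i) infty_add_one_le i
  rw [h1, h2]
  calc ∫ x, ψ x ^ 2 * (v' x * Δ v' x)
      = ∫ x, ∑ i, partialD i (partialD i v') x * (ψ x ^ 2 * v' x) := by
        congr 1; ext x
        rw [laplacian_eq_sum_partialD (hv'.contDiffAt.of_le two_le_infty),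
          ← Finset.sum_mul]; ring
    _ = ∑ i, ∫ x, partialD i (partialD i v') x * (ψ x ^ 2 * v' x) := by
        refine integral_finsetSum _ fun i _ => ?_
        exact ((hpd i).continuous.mul ((hψ.continuous.pow 2).mul hv'.continuous))
          |>.integrable_of_hasCompactSupport (hvc.mul_left.mul_left)
    _ ≤ ∑ i, ∫ x, v' x ^ 2 * partialD i ψ x ^ 2 :=
        Finset.sum_le_sum fun i _ => (integral_partialD_partialD_mul_le hψ hv' hvc i).2
    _ = ∫ x, v' x ^ 2 * ‖fderiv ℝ ψ x‖ ^ 2 := by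
        rw [← integral_finsetSum _ fun i _ => (integral_partialD_partialD_mul_le hψ hv' hvc i).1]
        simp only [← sum_sq_partialD, Finset.mul_sum]

end Caccioppoli

/-! ### Laplacian of an exponential -/

section Exp

variable {n : ℕ}

theorem laplacian_exp {h : EuclideanSpace ℝ (Fin n) → ℝ} {x : EuclideanSpace ℝ (Fin n)}
    (hh : ContDiffAt ℝ ∞ h x) :
    Δ (fun y => Real.exp (h y)) x = Real.exp (h x) * (Δ h x + ‖fderiv ℝ h x‖ ^ 2) := by
  have h2 : ContDiffAt ℝ 2 h x := hh.of_le two_le_infty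
  rw [laplacian_eq_sum_partialD h2.exp, laplacian_eq_sum_partialD h2, ← sum_sq_partialD,
    ← Finset.sum_add_distrib, Finset.mul_sum]
  refine Finset.sum_congr rfl fun i _ => ?_
  have hev : partialD i (fun y => Real.exp (h y)) =ᶠ[𝓝 x]
      fun y => Real.exp (h y) * partialD i h y := by
    have h1 : ContDiffAt ℝ 1 h x := hh.of_le (by exact_mod_cast le_top)
    filter_upwards [h1.eventually (by simp)] with y hy
    have := (hy.differentiableAt (by simp)).hasFDerivAt.exp
    simp only [partialD, this.fderiv]
    simp
  have hd : DifferentiableAt ℝ h x := h2.differentiableAt (by simp)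
  have hpd : DifferentiableAt ℝ (partialD i h) x :=
    (contDiffAt_partialD hh infty_add_one_le i).differentiableAt (by simp)
  have := (hd.hasFDerivAt.exp.mul hpd.hasFDerivAt)
  rw [partialD, hev.fderiv_eq]
  refine (congrArg (fun L : EuclideanSpace ℝ (Fin n) →L[ℝ] ℝ => L (EuclideanSpace.single i 1))
    this.fderiv).trans ?_
  simp [partialD]
  ring

end Exp

/-! ### Pointwise Lipschitz bounds for a product of cutoffs -/

section TestFunction

variable {n : ℕ} {χ ρ w : EuclideanSpace ℝ (Fin n) → ℝ} {x : EuclideanSpace ℝ (Fin n)}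

/-- The product rule `|χρ(y) - χρ(z)| ≤ |χ(y) - χ(z)| ρ(y) + χ(z) |ρ(y) - ρ(z)|`. Near `x` the three
local constants exceed their values at `x` by at most `η`, and the strict inequality in `hK` leaves
room for such an `η`. -/
theorem exists_lipschitzOnWith_mul (hχ : ContDiffAt ℝ ∞ χ x) (hχ0 : ∀ y, 0 ≤ χ y)
    (hρ : ∀ y, ρ y ∈ Icc (0 : ℝ) 1)
    (hlip : ∀ M > w x, ∃ r > 0, ∀ y ∈ Metric.ball x r, ∀ z ∈ Metric.ball x r,
      |ρ y - ρ z| ≤ Real.exp M * ‖y - z‖) {K : NNReal}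
    (hK : ‖fderiv ℝ χ x‖ + χ x * Real.exp (w x) < K) :
    ∃ s ∈ 𝓝 x, LipschitzOnWith K (fun y => χ y * ρ y) s := by
  have hc : ContinuousAt (fun η : ℝ => (‖fderiv ℝ χ x‖ + η) + (χ x + η) * Real.exp (w x + η)) 0 := by
    fun_prop
  have hev : ∀ᶠ η in 𝓝[>] (0 : ℝ),
      (‖fderiv ℝ χ x‖ + η) + (χ x + η) * Real.exp (w x + η) < K :=
    (hc.eventually (gt_mem_nhds (by simpa using hK))).filter_mono nhdsWithin_le_nhds
  obtain ⟨η, hη, hη0⟩ := (hev.and self_mem_nhdsWithin).exists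
  have hη0 : 0 < η := hη0
  obtain ⟨s₁, hs₁, hl₁⟩ := (hχ.hasStrictFDerivAt (by simp)).exists_lipschitzOnWith_of_nnnorm_lt
    (NNReal.mk (‖fderiv ℝ χ x‖ + η) (by positivity)) (by
      rw [← NNReal.coe_lt_coe]; change ‖fderiv ℝ χ x‖ < ‖fderiv ℝ χ x‖ + η; linarith)
  obtain ⟨r, hr, hl₂⟩ := hlip (w x + η) (by linarith)
  have hs₂ : {z | χ z < χ x + η} ∈ 𝓝 x := hχ.continuousAt.eventually (gt_mem_nhds (by linarith))
  refine ⟨s₁ ∩ (Metric.ball x r ∩ {z | χ z < χ x + η}),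
    inter_mem hs₁ (inter_mem (Metric.ball_mem_nhds x hr) hs₂), LipschitzOnWith.of_dist_le_mul ?_⟩
  rintro y ⟨hy1, hy2, -⟩ z ⟨hz1, hz2, hz3⟩
  have h1 := hl₁.dist_le_mul y hy1 z hz1
  have h2 := hl₂ y hy2 z hz2
  rw [Real.dist_eq, dist_eq_norm] at *
  have h1' : |χ y - χ z| ≤ (‖fderiv ℝ χ x‖ + η) * ‖y - z‖ := h1
  calc |χ y * ρ y - χ z * ρ z| = |(χ y - χ z) * ρ y + χ z * (ρ y - ρ z)| := by ring_nf
    _ ≤ |χ y - χ z| * ρ y + χ z * |ρ y - ρ z| := by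
        refine (abs_add_le _ _).trans (le_of_eq ?_)
        rw [abs_mul, abs_mul, abs_of_nonneg (hρ y).1, abs_of_nonneg (hχ0 z)]
    _ ≤ (‖fderiv ℝ χ x‖ + η) * ‖y - z‖ * 1 +
          (χ x + η) * (Real.exp (w x + η) * ‖y - z‖) := by
        refine add_le_add (mul_le_mul h1' (hρ y).2 (hρ y).1 (by positivity))
          (mul_le_mul (le_of_lt hz3) h2 (abs_nonneg _) ?_)
        have := hχ0 x; positivity
    _ = ((‖fderiv ℝ χ x‖ + η) + (χ x + η) * Real.exp (w x + η)) * ‖y - z‖ := by ring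
    _ ≤ K * ‖y - z‖ := mul_le_mul_of_nonneg_right hη.le (norm_nonneg _)

/-- Each larger number is a local Lipschitz constant, hence bounds the derivative. No
differentiability of `ρ` is needed: where the product is not differentiable, `fderiv` is zero. -/
theorem norm_fderiv_mul_le (hχ : ContDiffAt ℝ ∞ χ x) (hχ0 : ∀ y, 0 ≤ χ y)
    (hρ : ∀ y, ρ y ∈ Icc (0 : ℝ) 1)
    (hlip : ∀ M > w x, ∃ r > 0, ∀ y ∈ Metric.ball x r, ∀ z ∈ Metric.ball x r,
      |ρ y - ρ z| ≤ Real.exp M * ‖y - z‖) :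
    ‖fderiv ℝ (fun y => χ y * ρ y) x‖ ≤ ‖fderiv ℝ χ x‖ + χ x * Real.exp (w x) := by
  have h0 : 0 ≤ ‖fderiv ℝ χ x‖ + χ x * Real.exp (w x) := by have := hχ0 x; positivity
  refine le_of_forall_gt_imp_ge_of_dense fun K hK => ?_
  obtain ⟨s, hs, hl⟩ := exists_lipschitzOnWith_mul hχ hχ0 hρ hlip
    (K := NNReal.mk K (h0.trans hK.le)) hK
  exact norm_fderiv_le_of_lipschitzOn ℝ hs hl

end TestFunction

/-! ### Radial step functions and compactly supported test functions -/

section RadialCutoff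

variable {n : ℕ} {ε T : ℝ}

/-- A radial cutoff which is `1` beyond the parameter `T + 1` and `0` before `T`. -/
noncomputable def radialStep (n : ℕ) (ε T : ℝ) : EuclideanSpace ℝ (Fin n) → ℝ :=
  radialFn n 0 fun t => Real.smoothTransition (ε * t - T)

theorem radialStep_mem_Icc (x : EuclideanSpace ℝ (Fin n)) : radialStep n ε T x ∈ Icc (0 : ℝ) 1 := by
  rw [radialStep, radialFn]
  split_ifs
  · simp
  · exact ⟨Real.smoothTransition.nonneg _, Real.smoothTransition.le_one _⟩

theorem contDiffAt_radialStep {x : EuclideanSpace ℝ (Fin n)} (hx : x ≠ 0) :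
    ContDiffAt ℝ ∞ (radialStep n ε T) x := by
  refine ContDiffAt.congr_of_eventuallyEq ?_ (radialFn_eventuallyEq hx)
  have h1 : ContDiffAt ℝ ∞ (fun z : EuclideanSpace ℝ (Fin n) => Real.log ‖z‖) x :=
    (contDiffAt_norm ℝ hx).log (norm_ne_zero_iff.2 hx)
  exact Real.smoothTransition.contDiffAt.comp x ((contDiffAt_const.mul h1).sub contDiffAt_const)

theorem radialStep_eq_zero {x : EuclideanSpace ℝ (Fin n)} (hx : ε * Real.log ‖x‖ ≤ T) :
    radialStep n ε T x = 0 := by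
  rw [radialStep, radialFn]
  split_ifs
  · rfl
  · exact Real.smoothTransition.zero_of_nonpos (by linarith)

theorem radialStep_eq_one {x : EuclideanSpace ℝ (Fin n)} (hx0 : x ≠ 0)
    (hx : T + 1 ≤ ε * Real.log ‖x‖) : radialStep n ε T x = 1 := by
  rw [radialStep, radialFn_of_ne hx0]
  exact Real.smoothTransition.one_of_one_le (by linarith)

theorem fderiv_radialStep_eq_zero {x : EuclideanSpace ℝ (Fin n)} (hx0 : x ≠ 0)
    (hx : ε * Real.log ‖x‖ ∉ Icc T (T + 1)) : fderiv ℝ (radialStep n ε T) x = 0 := by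
  have hc : ContinuousAt (fun y : EuclideanSpace ℝ (Fin n) => ε * Real.log ‖y‖) x :=
    continuousAt_const.mul (continuous_norm.continuousAt.log (norm_ne_zero_iff.2 hx0))
  rw [mem_Icc, not_and_or, not_le, not_le] at hx
  rcases hx with hx | hx
  · have : radialStep n ε T =ᶠ[𝓝 x] fun _ => 0 := by
      filter_upwards [hc.eventually (gt_mem_nhds hx)] with y hy
      exact radialStep_eq_zero hy.le
    rw [this.fderiv_eq]; simp
  · have : radialStep n ε T =ᶠ[𝓝 x] fun _ => 1 := by
      filter_upwards [hc.eventually (lt_mem_nhds hx), isOpen_compl_singleton.mem_nhds hx0] with y hy hy0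
      exact radialStep_eq_one hy0 hy.le
    rw [this.fderiv_eq]; simp

/-- The properties of the truncated cutoffs used as test functions on an end. -/
theorem exists_lipschitzWith_radialStep_mul (hε : ε = 1 ∨ ε = -1) {T₁ J : ℝ} (hT : T < T₁)
    {ρ w : EuclideanSpace ℝ (Fin n) → ℝ} (hρ : ∀ y, ρ y ∈ Icc (0 : ℝ) 1)
    (hlip : ∀ x ∈ shell n {t | T < ε * t}, ∀ M > w x, ∃ r > 0, ∀ y ∈ Metric.ball x r,
      ∀ z ∈ Metric.ball x r, |ρ y - ρ z| ≤ Real.exp M * ‖y - z‖)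
    (hJ : ∀ x ∈ shell n {t | T < ε * t}, J ≤ ε * Real.log ‖x‖ → ρ x = 0) :
    (∃ C, LipschitzWith C fun x => radialStep n ε T₁ x * ρ x) ∧
      HasCompactSupport (fun x => radialStep n ε T₁ x * ρ x) ∧
      tsupport (fun x => radialStep n ε T₁ x * ρ x) ⊆ shell n {t | T < ε * t} := by
  set ψ := fun x => radialStep n ε T₁ x * ρ x with hψ
  have hK : IsCompact (shell n {t | ε * t ∈ Icc T₁ J}) :=
    isCompact_shell (isCompact_mul_mem_Icc hε _ _)
  have hsub : Function.support ψ ⊆ shell n {t | ε * t ∈ Icc T₁ J} := by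
    intro x hx
    have h1 : T₁ < ε * Real.log ‖x‖ := by
      by_contra! h
      exact hx (by simp only [hψ, radialStep_eq_zero h, zero_mul])
    have h0 : x ≠ 0 := by
      rintro rfl
      exact hx (by simp [hψ, radialStep, radialFn])
    refine ⟨h0, h1.le, ?_⟩
    by_contra! h
    exact hx (by simp only [hψ, hJ x ⟨h0, hT.trans h1⟩ h.le, mul_zero])
  have hts : tsupport ψ ⊆ shell n {t | ε * t ∈ Icc T₁ J} := closure_minimal hsub hK.isClosed
  have hψc : HasCompactSupport ψ := hK.of_isClosed_subset (isClosed_tsupport _) hts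
  have hts' : tsupport ψ ⊆ shell n {t | T < ε * t} := fun x hx =>
    ⟨(hts hx).1, hT.trans_le (hts hx).2.1⟩
  refine ⟨LocallyLipschitz.exists_lipschitzWith_of_hasCompactSupport (fun x => ?_) hψc, hψc, hts'⟩
  by_cases hx : x ∈ tsupport ψ
  · have h := hts' hx
    obtain ⟨K, hK⟩ := exists_nat_gt (‖fderiv ℝ (radialStep n ε T₁) x‖ +
      radialStep n ε T₁ x * Real.exp (w x))
    obtain ⟨s, hs, hl⟩ := exists_lipschitzOnWith_mul (contDiffAt_radialStep h.1)
      (fun y => (radialStep_mem_Icc y).1) hρ (hlip x h) (K := K) (by simpa using hK)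
    exact ⟨K, s, hs, hl⟩
  · refine ⟨0, (tsupport ψ)ᶜ, (isClosed_tsupport ψ).isOpen_compl.mem_nhds hx, ?_⟩
    refine LipschitzOnWith.of_dist_le_mul fun y hy z hz => ?_
    rw [image_eq_zero_of_notMem_tsupport hy, image_eq_zero_of_notMem_tsupport hz, dist_self]
    positivity

end RadialCutoff

/-! ### Growth at a two-dimensional end -/

section TwoDimEnd

variable {ε T δ : ℝ} {w : EuclideanSpace ℝ (Fin 2) → ℝ}

/-- The radial part of the weight used on two-dimensional ends. -/
noncomputable def endWeight (ε δ t : ℝ) : ℝ := -(1 + ε * δ) * t + Real.exp (-(ε * δ) * t)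

theorem contDiff_endWeight : ContDiff ℝ ∞ (endWeight ε δ) := by
  unfold endWeight; fun_prop

/-- The linear part of the weight, harmonic in `log ‖x‖`, sets the decay rate. The exponential part
is bounded along the end and only supplies strict convexity, hence a positive Laplacian. -/
theorem deriv_deriv_endWeight (hε : ε = 1 ∨ ε = -1) (t : ℝ) :
    deriv (deriv (endWeight ε δ)) t = δ ^ 2 * Real.exp (-(ε * δ) * t) := by
  have hε2 : ε * ε = 1 := by rcases hε with rfl | rfl <;> norm_num
  have he : ∀ t, HasDerivAt (fun t => Real.exp (-(ε * δ) * t))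
      (Real.exp (-(ε * δ) * t) * -(ε * δ)) t := fun t =>
    ((hasDerivAt_id t).const_mul (-(ε * δ))).exp.congr_deriv (by simp)
  have h1 : deriv (endWeight ε δ) =
      fun t => -(1 + ε * δ) + Real.exp (-(ε * δ) * t) * -(ε * δ) := by
    ext t
    exact (((hasDerivAt_id t).const_mul (-(1 + ε * δ))).add (he t)).deriv.trans (by simp)
  rw [h1, (((he t).mul_const (-(ε * δ))).const_add (-(1 + ε * δ))).deriv]
  linear_combination (δ ^ 2 * Real.exp (-(ε * δ) * t)) * hε2

/-- The exponent of the comparison function on a two-dimensional end. -/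
noncomputable def endExponent (w : EuclideanSpace ℝ (Fin 2) → ℝ) (ε δ : ℝ)
    (x : EuclideanSpace ℝ (Fin 2)) : ℝ := endWeight ε δ (Real.log ‖x‖) - w x

theorem contDiffAt_endWeight_log {x : EuclideanSpace ℝ (Fin 2)} (hx : x ≠ 0) :
    ContDiffAt ℝ ∞ (fun x : EuclideanSpace ℝ (Fin 2) => endWeight ε δ (Real.log ‖x‖)) x :=
  contDiff_endWeight.contDiffAt.comp x
    ((contDiffAt_norm ℝ hx).log (norm_ne_zero_iff.2 hx))

theorem contDiffAt_endExponent {x : EuclideanSpace ℝ (Fin 2)} (hx : x ≠ 0)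
    (hw : ContDiffAt ℝ ∞ w x) : ContDiffAt ℝ ∞ (endExponent w ε δ) x :=
  (contDiffAt_endWeight_log hx).sub hw

/-- Both discarded terms, the squared gradient of the exponent and `-Δ w`, are nonnegative; what
remains is the Laplacian of the radial weight. -/
theorem le_exp_mul_laplacian_exp (hε : ε = 1 ∨ ε = -1) {x : EuclideanSpace ℝ (Fin 2)} (hx : x ≠ 0)
    (hw : ContDiffAt ℝ ∞ w x) (hΔ : Δ w x ≤ 0) :
    Real.exp (2 * endExponent w ε δ x) *
        (δ ^ 2 * ((‖x‖ ^ 2)⁻¹ * Real.exp (-(ε * δ) * Real.log ‖x‖))) ≤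
      Real.exp (endExponent w ε δ x) * Δ (fun y => Real.exp (endExponent w ε δ y)) x := by
  have hΔH : Δ (endExponent w ε δ) x =
      (‖x‖ ^ 2)⁻¹ * (δ ^ 2 * Real.exp (-(ε * δ) * Real.log ‖x‖)) - Δ w x := by
    have h1 := ((contDiffAt_endWeight_log (ε := ε) (δ := δ) hx).of_le two_le_infty).laplacian_sub
      (hw.of_le two_le_infty)
    refine h1.trans ?_
    rw [laplacian_comp_log_norm (contDiff_endWeight.of_le two_le_infty) hx,
      deriv_deriv_endWeight hε]
    simp
  rw [laplacian_exp (contDiffAt_endExponent hx hw), hΔH, two_mul, Real.exp_add, mul_assoc]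
  refine mul_le_mul_of_nonneg_left (mul_le_mul_of_nonneg_left ?_ (Real.exp_pos _).le)
    (Real.exp_pos _).le
  nlinarith [sq_nonneg ‖fderiv ℝ (endExponent w ε δ) x‖]

theorem integrableOn_exp_neg_mul (hε : ε = 1 ∨ ε = -1) {a : ℝ} (ha : 0 < a) (T : ℝ) :
    IntegrableOn (fun t => Real.exp (-(ε * a) * t)) {t | T ≤ ε * t} := by
  rcases hε with rfl | rfl
  · have h : {t : ℝ | T ≤ 1 * t} = Ici T := by ext; simp
    rw [h, integrableOn_Ici_iff_integrableOn_Ioi]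
    exact integrableOn_exp_mul_Ioi (by linarith) T
  · have h : {t : ℝ | T ≤ -1 * t} = Iic (-T) := by
      ext t; change T ≤ -1 * t ↔ t ≤ -T; constructor <;> intro h <;> linarith
    rw [h]
    exact integrableOn_exp_mul_Iic (by linarith) _

/-- With the Jacobian `e^{2t}` the integrand becomes `e^{-2δ ε t}` times a factor bounded on the
end. This function dominates the main term on the right of Caccioppoli's inequality. -/
theorem integrable_indicator_exp_endWeight (hε : ε = 1 ∨ ε = -1) (hδ : 0 < δ) (T : ℝ) :
    Integrable ((shell 2 {t | T ≤ ε * t}).indicator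
      fun x => Real.exp (2 * endWeight ε δ (Real.log ‖x‖))) := by
  rw [integrable_logPolar_iff two_pos]
  have hms : MeasurableSet {t : ℝ | T ≤ ε * t} :=
    measurableSet_le measurable_const (measurable_const.mul measurable_id)
  have hF : Integrable ({t : ℝ | T ≤ ε * t}.indicator fun t =>
      Real.exp (2 * t) * Real.exp (2 * endWeight ε δ t)) := by
    rw [integrable_indicator_iff hms]
    refine ((integrableOn_exp_neg_mul hε (show 0 < 2 * δ by linarith) T).const_mul
      (Real.exp (2 * Real.exp (-δ * T)))).mono' ?_ ?_
    · have : Continuous (endWeight ε δ) := contDiff_endWeight.continuous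
      exact Continuous.aestronglyMeasurable (by fun_prop)
    · refine (ae_restrict_iff' hms).2 (ae_of_all _ fun t ht => ?_)
      have ht : T ≤ ε * t := ht
      rw [← Real.exp_add, Real.norm_eq_abs, Real.abs_exp, ← Real.exp_add]
      refine Real.exp_le_exp.2 ?_
      have h1 : Real.exp (-(ε * δ) * t) ≤ Real.exp (-δ * T) :=
        Real.exp_le_exp.2 (by nlinarith)
      rw [endWeight]; linarith
  refine (hF.comp_fst (sphereMeasure 2)).congr (ae_of_all _ fun p => ?_)
  by_cases hp : p.1 ∈ {t : ℝ | T ≤ ε * t}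
  · simp only
    rw [indicator_of_mem hp, indicator_of_mem (logPolar_mem_shell.2 hp), log_norm_logPolar]
    simp
  · simp only
    rw [indicator_of_notMem hp, indicator_of_notMem fun h => hp (logPolar_mem_shell.1 h), mul_zero]

/-- The density bounding the weighted Laplacian of the comparison function from below. -/
noncomputable def endDensity (w : EuclideanSpace ℝ (Fin 2) → ℝ) (ε δ : ℝ)
    (x : EuclideanSpace ℝ (Fin 2)) : ℝ :=
  Real.exp (2 * endExponent w ε δ x) *
    (δ ^ 2 * ((‖x‖ ^ 2)⁻¹ * Real.exp (-(ε * δ) * Real.log ‖x‖)))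

theorem endDensity_nonneg (x : EuclideanSpace ℝ (Fin 2)) : 0 ≤ endDensity w ε δ x := by
  unfold endDensity; positivity

/-- In logarithmic coordinates the density is `δ²` times the exponential of `2 (endWeight - w) - δ ε
t`. The assumed decay of the spherical integrals makes the angular mean of this exponent positive
far out, so `eˣ ≥ 1 + x` bounds each angular integral below by `δ² S`; the range of `t` is infinite.
-/
theorem lintegral_eq_top_of_endDensity (hε : ε = 1 ∨ ε = -1) (hδ : 0 < δ)
    (hw : ContinuousOn w (shell 2 {t | T < ε * t})) {l : ℝ}
    (hl : Tendsto (fun s => sphereInt w (ε * s) / s) atTop (𝓝 l))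
    (hlδ : l < -(ε + 2 * δ) * (sphereMeasure 2).real univ)
    {F : EuclideanSpace ℝ (Fin 2) → ℝ≥0∞} (hF : Measurable F)
    (hFq : ∀ x ∈ shell 2 {t | T < ε * t}, F x = ENNReal.ofReal (endDensity w ε δ x)) :
    ∫⁻ x, F x = ⊤ := by
  have hε2 : ε * ε = 1 := by rcases hε with rfl | rfl <;> norm_num
  set S := (sphereMeasure 2).real univ with hSdef
  have hS : 0 < S := sphereMeasure_real_univ_pos two_pos
  obtain ⟨T₁, hT₁⟩ := eventually_atTop.1 (hl.eventually (gt_mem_nhds hlδ))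
  set T₂ := max (max T₁ T) 0 with hT₂
  have hinner : ∀ t, T₂ < ε * t → ENNReal.ofReal (δ ^ 2 * S) ≤
      ∫⁻ θ, ENNReal.ofReal (Real.exp ((2 : ℕ) * t)) * F (logPolar (t, θ)) ∂(sphereMeasure 2) := by
    intro t ht
    have h1 : T₁ ≤ ε * t := ((le_max_left _ _).trans (le_max_left _ _)).trans ht.le
    have h2 : T < ε * t := ((le_max_right _ _).trans (le_max_left _ _)).trans_lt ht
    have h3 : 0 < ε * t := (le_max_right _ _).trans_lt ht
    have hcw := continuous_comp_logPolar hw (show t ∈ {t | T < ε * t} from h2)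
    have hiw := integrable_comp_logPolar hw (show t ∈ {t | T < ε * t} from h2)
    have hb : sphereInt w t < -(ε + 2 * δ) * S * (ε * t) := by
      have := hT₁ _ h1
      rwa [← mul_assoc, hε2, one_mul, div_lt_iff₀ h3] at this
    have hpt : ∀ θ, ENNReal.ofReal (Real.exp ((2 : ℕ) * t)) * F (logPolar (t, θ)) =
        ENNReal.ofReal (δ ^ 2 * Real.exp (2 * (endWeight ε δ t - w (logPolar (t, θ))) -
          δ * (ε * t))) := by
      intro θ
      rw [hFq _ (logPolar_mem_shell.2 (show t ∈ {t | T < ε * t} from h2)), ← ENNReal.ofReal_mul (Real.exp_pos _).le, endDensity,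
        endExponent, log_norm_logPolar, norm_logPolar, sub_eq_add_neg _ (δ * (ε * t)), Real.exp_add]
      congr 1
      have e : Real.exp ((2 : ℕ) * t) = Real.exp t ^ 2 := by rw [← Real.exp_nat_mul]
      have e2 : -(ε * δ) * t = -(δ * (ε * t)) := by ring
      simp only [e, e2]
      field_simp
    simp only [hpt]
    have hce : Continuous fun θ => δ ^ 2 * Real.exp (2 * (endWeight ε δ t - w (logPolar (t, θ))) -
          δ * (ε * t)) :=
      continuous_const.mul (Real.continuous_exp.comp
        (((continuous_const.sub hcw).const_mul 2).sub continuous_const))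
    have hie : Integrable (fun θ => δ ^ 2 * Real.exp (2 * (endWeight ε δ t - w (logPolar (t, θ))) -
          δ * (ε * t))) (sphereMeasure 2) :=
      hce.integrable_of_hasCompactSupport (HasCompactSupport.of_compactSpace _)
    rw [← ofReal_integral_eq_lintegral_ofReal hie (ae_of_all _ fun θ => by positivity)]
    refine ENNReal.ofReal_le_ofReal ?_
    have hlin : Integrable (fun θ => δ ^ 2 * ((2 * endWeight ε δ t - δ * (ε * t) + 1) -
        2 * w (logPolar (t, θ)))) (sphereMeasure 2) :=
      ((integrable_const _).sub (hiw.const_mul 2)).const_mul _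
    refine le_trans ?_ (integral_mono hlin hie fun θ => mul_le_mul_of_nonneg_left
      (le_trans (le_of_eq (by ring)) (Real.add_one_le_exp _)) (sq_nonneg δ))
    rw [integral_const_mul, integral_sub (integrable_const _) (hiw.const_mul 2),
      integral_const_mul, integral_const, smul_eq_mul, ← hSdef]
    refine mul_le_mul_of_nonneg_left ?_ (sq_nonneg δ)
    change S ≤ S * _ - 2 * sphereInt w t
    have hb' : sphereInt w t < -(S * t) - 2 * (S * (δ * (ε * t))) :=
      hb.trans_eq (by linear_combination (-(S * t)) * hε2)
    have e4 : 0 < Real.exp (-(ε * δ) * t) := Real.exp_pos _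
    rw [endWeight]
    nlinarith [mul_pos hS e4, mul_pos hS (mul_pos hδ h3)]
  rw [lintegral_logPolar two_pos, lintegral_prod _ (Measurable.aemeasurable ?_)]
  · refine top_unique ?_
    calc (⊤ : ℝ≥0∞) = ∫⁻ _ in {t : ℝ | T₂ < ε * t}, ENNReal.ofReal (δ ^ 2 * S) := by
          rw [setLIntegral_const]
          have hv : volume {t : ℝ | T₂ < ε * t} = ⊤ := by
            rcases hε with rfl | rfl
            · have h : {t : ℝ | T₂ < 1 * t} = Ioi T₂ := by ext; simp
              rw [h, Real.volume_Ioi]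
            · have h : {t : ℝ | T₂ < -1 * t} = Iio (-T₂) := by
                ext t; change T₂ < -1 * t ↔ t < -T₂; constructor <;> intro h <;> linarith
              rw [h, Real.volume_Iio]
          rw [hv, ENNReal.mul_top]
          rw [ENNReal.ofReal_ne_zero_iff]; positivity
      _ ≤ ∫⁻ t in {t : ℝ | T₂ < ε * t}, ∫⁻ θ, ENNReal.ofReal (Real.exp ((2 : ℕ) * t)) *
            F (logPolar (t, θ)) ∂(sphereMeasure 2) :=
          setLIntegral_mono' (measurableSet_lt measurable_const (measurable_const.mul measurable_id))
            hinner
      _ ≤ _ := setLIntegral_le_lintegral _ _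
  · exact (Measurable.ennreal_ofReal (by fun_prop)).mul (hF.comp continuous_logPolar.measurable)

/-- On a complete two-dimensional end with nonnegative curvature the spherical averages of the
conformal factor cannot decay too fast. -/
theorem end_growth_two (hε : ε = 1 ∨ ε = -1)
    (hw : ∀ x ∈ shell 2 {t | T < ε * t}, ContDiffAt ℝ ∞ w x)
    (hΔ : ∀ x ∈ shell 2 {t | T < ε * t}, Δ w x ≤ 0)
    {ρ : ℕ → EuclideanSpace ℝ (Fin 2) → ℝ} (hρ : ∀ j y, ρ j y ∈ Icc (0 : ℝ) 1)
    (hlip : ∀ j, ∀ x ∈ shell 2 {t | T < ε * t}, ∀ M > w x, ∃ r > 0, ∀ y ∈ Metric.ball x r,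
      ∀ z ∈ Metric.ball x r, |ρ j y - ρ j z| ≤ Real.exp M * ‖y - z‖)
    (hJ : ∀ j : ℕ, ∀ x ∈ shell 2 {t | T < ε * t}, j ≤ ε * Real.log ‖x‖ → ρ j x = 0)
    (hlim : ∀ x ∈ shell 2 {t | T < ε * t}, Tendsto (fun j => ρ j x) atTop (𝓝 1))
    {l : ℝ} (hl : Tendsto (fun s => sphereInt w (ε * s) / s) atTop (𝓝 l)) :
    -ε * (sphereMeasure 2).real univ ≤ l := by
  set S := (sphereMeasure 2).real univ with hSdef
  have hS : 0 < S := sphereMeasure_real_univ_pos two_pos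
  by_contra! hlt
  -- A third of the excess, so that `l/S = -(ε + 3δ)` lies strictly below `-(ε + 2δ)`.
  set δ := -(l / S + ε) / 3 with hδ
  have hlS : l / S < -ε := by rw [div_lt_iff₀ hS]; exact hlt
  have hδ0 : 0 < δ := by rw [hδ]; linarith
  have hlδ : l < -(ε + 2 * δ) * S := by rw [← div_lt_iff₀ hS]; linarith
  set T₁ := T + 1
  have hT : T < T₁ := lt_add_one T
  set U := shell 2 {t | T < ε * t}
  have hU : IsOpen U := isOpen_shell (isOpen_lt continuous_const (continuous_const.mul continuous_id))
  set χ := radialStep 2 ε T₁ with hχ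
  set v := fun x => Real.exp (endExponent w ε δ x) with hv
  have hvs : ∀ x ∈ U, ContDiffAt ℝ ∞ v x := fun x hx =>
    (contDiffAt_endExponent hx.1 (hw x hx)).exp
  set ψ := fun (j : ℕ) x => χ x * ρ j x with hψ
  have hψp := fun j : ℕ => exists_lipschitzWith_radialStep_mul hε hT (hρ j) (hlip j) (hJ j)
  set A := shell 2 {t | ε * t ∈ Icc T₁ (T₁ + 1)}
  set B := shell 2 {t | T₁ ≤ ε * t}
  have hA : IsCompact A := isCompact_shell (isCompact_mul_mem_Icc hε _ _)
  have hAU : A ⊆ U := fun x hx => ⟨hx.1, hT.trans_le hx.2.1⟩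
  -- A majorant independent of `j`: the first term comes from the gradient of the radial step,
  -- supported in a compact shell; the second from the distance function, whose gradient bound `e^w`
  -- cancels the `e^{-w}` in `v`.
  set G := fun x => 2 * A.indicator (fun x => v x ^ 2 * ‖fderiv ℝ χ x‖ ^ 2) x +
    2 * B.indicator (fun x => Real.exp (2 * endWeight ε δ (Real.log ‖x‖))) x with hG
  have hGi : Integrable G := by
    refine (Integrable.const_mul ?_ 2).add
      ((integrable_indicator_exp_endWeight hε hδ0 T₁).const_mul 2)
    rw [integrable_indicator_iff hA.measurableSet]
    refine ContinuousOn.integrableOn_compact hA fun x hx => ContinuousAt.continuousWithinAt ?_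
    have h1 : ContinuousAt (fderiv ℝ χ) x :=
      ((contDiffAt_radialStep hx.1).fderiv_right infty_add_one_le).continuousAt
    exact ((hvs x (hAU hx)).continuousAt.pow 2).mul (h1.norm.pow 2)
  have hbound : ∀ j x, v x ^ 2 * ‖fderiv ℝ (ψ j) x‖ ^ 2 ≤ G x := by
    intro j x
    have hA0 : 0 ≤ A.indicator (fun x => v x ^ 2 * ‖fderiv ℝ χ x‖ ^ 2) x :=
      indicator_nonneg (fun _ _ => by positivity) _
    have hB0 : 0 ≤ B.indicator (fun x => Real.exp (2 * endWeight ε δ (Real.log ‖x‖))) x :=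
      indicator_nonneg (fun _ _ => by positivity) _
    by_cases hx : x ∈ U
    · have h1 := norm_fderiv_mul_le (contDiffAt_radialStep (T := T₁) (ε := ε) hx.1)
        (fun y => (radialStep_mem_Icc y).1) (hρ j) (hlip j x hx)
      have h2 : v x ^ 2 * ‖fderiv ℝ χ x‖ ^ 2 ≤
          A.indicator (fun x => v x ^ 2 * ‖fderiv ℝ χ x‖ ^ 2) x := by
        by_cases hxA : x ∈ A
        · rw [indicator_of_mem hxA]
        · rw [fderiv_radialStep_eq_zero hx.1 fun h => hxA ⟨hx.1, h⟩]
          simpa using hA0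
      have h3 : v x ^ 2 * (χ x * Real.exp (w x)) ^ 2 ≤
          B.indicator (fun x => Real.exp (2 * endWeight ε δ (Real.log ‖x‖))) x := by
        by_cases hxB : T₁ ≤ ε * Real.log ‖x‖
        · rw [indicator_of_mem (show x ∈ B from ⟨hx.1, hxB⟩)]
          have h4 : χ x ^ 2 ≤ 1 := pow_le_one₀ (radialStep_mem_Icc x).1 (radialStep_mem_Icc x).2
          have h5 : v x ^ 2 * Real.exp (w x) ^ 2 = Real.exp (2 * endWeight ε δ (Real.log ‖x‖)) := by
            rw [hv, ← mul_pow, ← Real.exp_add, ← Real.exp_nat_mul, endExponent]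
            norm_num
          rw [mul_pow, ← h5]
          calc _ = v x ^ 2 * Real.exp (w x) ^ 2 * χ x ^ 2 := by ring
            _ ≤ _ := mul_le_of_le_one_right (by positivity) h4
        · rw [hχ, radialStep_eq_zero (not_le.1 hxB).le]
          simpa using hB0
      have h6 : ‖fderiv ℝ (ψ j) x‖ ^ 2 ≤
          2 * ‖fderiv ℝ χ x‖ ^ 2 + 2 * (χ x * Real.exp (w x)) ^ 2 :=
        (pow_le_pow_left₀ (norm_nonneg _) h1 2).trans (add_sq_le.trans (le_of_eq (by ring)))
      calc v x ^ 2 * ‖fderiv ℝ (ψ j) x‖ ^ 2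
          ≤ v x ^ 2 * (2 * ‖fderiv ℝ χ x‖ ^ 2 + 2 * (χ x * Real.exp (w x)) ^ 2) :=
            mul_le_mul_of_nonneg_left h6 (sq_nonneg _)
        _ ≤ G x := by rw [hG]; simp only; linarith
    · have h0 : fderiv ℝ (ψ j) x = 0 := image_eq_zero_of_notMem_tsupport fun h =>
        hx ((hψp j).2.2 (tsupport_fderiv_subset ℝ h))
      rw [h0, norm_zero]
      have : 0 ≤ G x := by rw [hG]; simp only; linarith
      simpa using this
  have hqc : ContinuousOn (endDensity w ε δ) U := fun x hx => ContinuousAt.continuousWithinAt (by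
    have h1 := (contDiffAt_endExponent (ε := ε) (δ := δ) hx.1 (hw x hx)).continuousAt
    have h2 : ContinuousAt (fun x : EuclideanSpace ℝ (Fin 2) => Real.log ‖x‖) x :=
      continuous_norm.continuousAt.log (norm_ne_zero_iff.2 hx.1)
    have h3 : ContinuousAt (fun x : EuclideanSpace ℝ (Fin 2) => (‖x‖ ^ 2)⁻¹) x :=
      (continuous_norm.continuousAt.pow 2).inv₀ (pow_ne_zero 2 (norm_ne_zero_iff.2 hx.1))
    unfold endDensity
    fun_prop)
  have hsq : ∀ j, tsupport (fun x => ψ j x ^ 2) ⊆ tsupport (ψ j) := fun j =>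
    closure_mono fun x hx h => hx (by simp only [h]; norm_num)
  have hcont : ∀ (f : EuclideanSpace ℝ (Fin 2) → ℝ), ContinuousOn f U → ∀ j,
      Continuous (fun x => ψ j x ^ 2 * f x) ∧ Integrable (fun x => ψ j x ^ 2 * f x) := by
    intro f hf j
    obtain ⟨⟨C, hC⟩, hcs, hts⟩ := hψp j
    have hc : Continuous (fun x => ψ j x ^ 2 * f x) := by
      have := continuous_mul_of_tsupport hU (hC.continuous.pow 2) ((hsq j).trans hts) hf
      exact this
    refine ⟨hc, hc.integrable_of_hasCompactSupport ?_⟩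
    have : HasCompactSupport fun x => ψ j x ^ 2 :=
      hcs.of_isClosed_subset (isClosed_tsupport _) (hsq j)
    exact this.mul_right
  have hle : ∀ j, ∫⁻ x, ENNReal.ofReal (ψ j x ^ 2 * endDensity w ε δ x) ≤
      ENNReal.ofReal (∫ x, G x) := by
    intro j
    obtain ⟨⟨C, hC⟩, hcs, hts⟩ := hψp j
    have hvc : ContinuousOn (fun x => v x * Δ v x) U := fun x hx =>
      ((hvs x hx).continuousAt.mul
        (contDiffAt_laplacian (hvs x hx)).continuousAt).continuousWithinAt
    rw [← ofReal_integral_eq_lintegral_ofReal (hcont _ hqc j).2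
      (ae_of_all _ fun x => mul_nonneg (sq_nonneg _) (endDensity_nonneg x))]
    refine ENNReal.ofReal_le_ofReal ?_
    calc ∫ x, ψ j x ^ 2 * endDensity w ε δ x ≤ ∫ x, ψ j x ^ 2 * (v x * Δ v x) := by
          refine integral_mono (hcont _ hqc j).2 (hcont _ hvc j).2 fun x => ?_
          by_cases hx : x ∈ U
          · exact mul_le_mul_of_nonneg_left
              (le_exp_mul_laplacian_exp hε hx.1 (hw x hx) (hΔ x hx)) (sq_nonneg _)
          · have : ψ j x = 0 := image_eq_zero_of_notMem_tsupport fun h => hx (hts h)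
            simp [this]
      _ ≤ ∫ x, v x ^ 2 * ‖fderiv ℝ (ψ j) x‖ ^ 2 :=
          integral_sq_mul_laplacian_le hC hcs hU hts hvs
      _ ≤ ∫ x, G x := integral_mono_of_nonneg (ae_of_all _ fun x => by positivity) hGi
          (ae_of_all _ (hbound j))
  have hptl : ∀ x, Tendsto (fun j => ENNReal.ofReal (ψ j x ^ 2 * endDensity w ε δ x)) atTop
      (𝓝 (ENNReal.ofReal (χ x ^ 2 * endDensity w ε δ x))) := by
    intro x
    refine ENNReal.tendsto_ofReal (Tendsto.mul_const _ (Tendsto.pow ?_ 2))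
    by_cases hx : x ∈ U
    · simpa using (hlim x hx).const_mul (χ x)
    · have h0 : χ x = 0 := by
        rcases eq_or_ne x 0 with rfl | h
        · simp [hχ, radialStep, radialFn]
        · refine radialStep_eq_zero (not_lt.1 fun hlt => hx ⟨h, hT.trans hlt⟩)
      simp [hψ, h0]
  have hmeas : ∀ j, Measurable fun x => ENNReal.ofReal (ψ j x ^ 2 * endDensity w ε δ x) :=
    fun j => (hcont _ hqc j).1.measurable.ennreal_ofReal
  -- Divergence is needed only where the radial step equals 1, that is beyond `T₁ + 1`.
  have htop := lintegral_eq_top_of_endDensity (T := T₁ + 1) hε hδ0 (w := w)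
    (fun x hx => (hw x ⟨hx.1, (show T < T₁ + 1 by linarith).trans hx.2⟩).continuousAt.continuousWithinAt)
    hl hlδ (F := fun x => ENNReal.ofReal (χ x ^ 2 * endDensity w ε δ x))
    (measurable_of_tendsto_metrizable hmeas (tendsto_pi_nhds.2 hptl)) (fun x hx => by
      simp only [hχ]
      rw [radialStep_eq_one hx.1 (le_of_lt hx.2)]
      simp)
  -- Fatou's lemma carries the uniform bound to the limit, contradicting the divergence.
  have hfin : ∫⁻ x, ENNReal.ofReal (χ x ^ 2 * endDensity w ε δ x) ≤ ENNReal.ofReal (∫ x, G x) := by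
    calc _ = ∫⁻ x, liminf (fun j => ENNReal.ofReal (ψ j x ^ 2 * endDensity w ε δ x)) atTop :=
          lintegral_congr fun x => (hptl x).liminf_eq.symm
      _ ≤ liminf (fun j => ∫⁻ x, ENNReal.ofReal (ψ j x ^ 2 * endDensity w ε δ x)) atTop :=
          lintegral_liminf_le hmeas
      _ ≤ _ := liminf_le_of_frequently_le' (Eventually.of_forall hle).frequently
  rw [htop] at hfin
  exact ENNReal.ofReal_ne_top (top_unique hfin)

end TwoDimEnd

/-! ### Growth at a complete end, all dimensions -/

section EndGrowth

variable {n : ℕ} {u : USphere n → ℝ} {Ω : Set (USphere n)} {v q : USphere n}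
  {p : EuclideanSpace ℝ (Fin n)} {ε T : ℝ}

/-- The filter of an end: parameters tending to infinity. -/
noncomputable def endFilter (n : ℕ) (ε : ℝ) : Filter (EuclideanSpace ℝ (Fin n)) :=
  comap (fun y => ε * Real.log ‖y‖) atTop

theorem tendsto_logPolar_endFilter (hε : ε = 1 ∨ ε = -1)
    (θ : Metric.sphere (0 : EuclideanSpace ℝ (Fin n)) 1) :
    Tendsto (fun s => logPolar (ε * s, θ)) atTop (endFilter n ε) := by
  have hε2 : ε * ε = 1 := by rcases hε with rfl | rfl <;> norm_num
  rw [endFilter, tendsto_comap_iff]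
  refine tendsto_id.congr fun s => ?_
  simp only [Function.comp, log_norm_logPolar, ← mul_assoc, hε2, one_mul, id]

theorem endFilter_one_le_cocompact : endFilter n 1 ≤ cocompact _ := by
  have h : Tendsto (fun y : EuclideanSpace ℝ (Fin n) => ‖y‖) (endFilter n 1) atTop := by
    refine tendsto_atTop_mono (fun y => ?_) tendsto_comap
    rw [one_mul]; exact Real.log_le_self (norm_nonneg y)
  rw [← Metric.cobounded_eq_cocompact, ← comap_norm_atTop]
  exact tendsto_iff_comap.1 h

theorem endFilter_neg_one_le_nhds : endFilter n (-1) ≤ 𝓝 0 := by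
  have h : Tendsto (fun y : EuclideanSpace ℝ (Fin n) => -1 * Real.log ‖y‖) (endFilter n (-1)) atTop :=
    tendsto_comap
  have h1 : Tendsto (fun y : EuclideanSpace ℝ (Fin n) => Real.exp (Real.log ‖y‖)) (endFilter n (-1))
      (𝓝 0) := by
    refine (Real.tendsto_exp_neg_atTop_nhds_zero.comp h).congr fun y => ?_
    simp [Function.comp]
  have h2 : Tendsto (fun y : EuclideanSpace ℝ (Fin n) => ‖y‖) (endFilter n (-1)) (𝓝 0) := by
    refine h1.congr' ?_
    filter_upwards [h.eventually_gt_atTop 0] with y hy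
    refine Real.exp_log (norm_pos_iff.2 ?_)
    rintro rfl
    simp at hy
  exact tendsto_zero_iff_norm_tendsto_zero.2 h2

theorem tendsto_centredParam_endFilter_one :
    Tendsto (centredParam v p) (endFilter n 1) (𝓝 v) := by
  refine tendsto_stereoChart_symm_cocompact.comp (Tendsto.mono_left ?_ endFilter_one_le_cocompact)
  exact (Homeomorph.addLeft p).isClosedEmbedding.tendsto_cocompact

theorem tendsto_centredParam_endFilter_neg_one :
    Tendsto (centredParam v p) (endFilter n (-1)) (𝓝 ((stereoChart n v).symm p)) := by
  have h := (continuous_centredParam (v := v) (p := p)).tendsto 0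
  rw [centredParam, add_zero] at h
  exact h.mono_left endFilter_neg_one_le_nhds

/-- The distance to the `j`-th truncation of an end, cut off at height one. -/
noncomputable def truncatedEndDist (n : ℕ) (u : USphere n → ℝ) (Ω : Set (USphere n))
    (v : USphere n) (p : EuclideanSpace ℝ (Fin n)) (ε : ℝ) (j : ℕ)
    (x : EuclideanSpace ℝ (Fin n)) : ℝ := (min (endDist n u Ω v p ε j x) 1).toReal

theorem truncatedEndDist_mem_Icc (j : ℕ) (x : EuclideanSpace ℝ (Fin n)) :
    truncatedEndDist n u Ω v p ε j x ∈ Icc (0 : ℝ) 1 := by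
  refine ⟨ENNReal.toReal_nonneg, ?_⟩
  have := ENNReal.toReal_mono ENNReal.one_ne_top (min_le_right (endDist n u Ω v p ε j x) 1)
  simpa [truncatedEndDist] using this

/-- The distance to a set is 1-Lipschitz for the Riemannian distance, and truncation at 1 preserves
this while keeping values finite. -/
theorem truncatedEndDist_le_add {j : ℕ} {y z : EuclideanSpace ℝ (Fin n)} {c : ℝ} (hc : 0 ≤ c)
    (h : metricDist n u Ω (centredParam v p y) (centredParam v p z) ≤ ENNReal.ofReal c) :
    truncatedEndDist n u Ω v p ε j y ≤ c + truncatedEndDist n u Ω v p ε j z := by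
  have hz : min (endDist n u Ω v p ε j z) 1 ≠ ⊤ := ne_top_of_le_ne_top ENNReal.one_ne_top
    (min_le_right _ _)
  have h1 : min (endDist n u Ω v p ε j y) 1 ≤ ENNReal.ofReal c + min (endDist n u Ω v p ε j z) 1 := by
    rw [← min_add_add_left]
    exact min_le_min ((endDist_le_add _ _ z).trans (add_le_add h le_rfl)) le_add_self
  have h2 := ENNReal.toReal_mono (ENNReal.add_ne_top.2 ⟨ENNReal.ofReal_ne_top, hz⟩) h1
  rwa [ENNReal.toReal_add ENNReal.ofReal_ne_top hz, ENNReal.toReal_ofReal hc] at h2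

/-- On a complete end with nonnegative scalar curvature the spherical averages of the conformal
factor cannot decay too fast. -/
theorem IsCompleteMetric.end_growth (hcomp : IsCompleteMetric n u Ω) (hΩ : IsOpen Ω)
    (hu : ContMDiffOn (𝓡 n) 𝓘(ℝ, ℝ) ∞ u Ω) (hn : 2 ≤ n) (hε : ε = 1 ∨ ε = -1)
    (hmem : ∀ y ∈ shell n {t | T < ε * t}, centredParam v p y ∈ Ω) (hq : q ∉ Ω)
    (hlim : Tendsto (centredParam v p) (endFilter n ε) (𝓝 q))
    (hineq : ∀ x ∈ shell n {t | T < ε * t}, 2 * Δ (fun y => flatFactor n u v (p + y)) x +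
      (n - 2) * ‖fderiv ℝ (fun y => flatFactor n u v (p + y)) x‖ ^ 2 ≤ 0) {l : ℝ}
    (hl : Tendsto (fun s => sphereInt (fun y => flatFactor n u v (p + y)) (ε * s) / s) atTop (𝓝 l)) :
    -ε * (sphereMeasure n).real univ ≤ l := by
  have hw : ∀ x ∈ shell n {t | T < ε * t}, ContDiffAt ℝ ∞ (fun y => flatFactor n u v (p + y)) x :=
    fun x hx => (contDiffAt_flatFactor hΩ hu (hmem x hx)).comp x (by fun_prop)
  rcases hn.lt_or_eq with h | rfl
  · refine end_growth_of_two_lt h hε hw hineq (fun θ T₁ hT₁ => ?_) hl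
    exact hcomp.lintegral_ray_eq_top hΩ hu.continuousOn hε hq
      (fun s hs => hmem _ (logPolar_mem_shell.2 (mul_mem_end hε (hT₁.lt.trans_le hs))))
      (hlim.comp (tendsto_logPolar_endFilter hε θ))
  · refine end_growth_two (ρ := truncatedEndDist 2 u Ω v p ε) hε hw (fun x hx => ?_)
      truncatedEndDist_mem_Icc ?_ ?_ ?_ hl
    · have := hineq x hx
      norm_num at this
      linarith
    · intro j x hx M hM
      obtain ⟨r, hr, hball⟩ := eventually_metricDist_centredParam_le hΩ (hmem x hx)
        (hw x hx).continuousAt hM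
      refine ⟨r, hr, fun y hy z hz => ?_⟩
      have h1 := truncatedEndDist_le_add (ε := ε) (j := j) (by positivity) (hball y hy z hz)
      have h2 := truncatedEndDist_le_add (ε := ε) (j := j) (by positivity) (hball z hz y hy)
      rw [norm_sub_rev] at h1
      rw [abs_le]
      constructor <;> linarith
    · intro j x hx hj
      rw [truncatedEndDist, endDist_eq_zero (hmem x hx) ⟨hx.1, hj⟩]
      simp
    · intro x hx
      -- The end is infinitely far away, so the truncated distance is exactly 1 from some index on.
      have htop := hcomp.iSup_endDist_eq_top hΩ hu.continuousOn hε hmem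
        (fun y hy => (hw y hy).continuousAt) hq
        (fun X hX => hlim.comp (tendsto_comap_iff.2 hX)) hx
      obtain ⟨j₀, hj₀⟩ := lt_iSup_iff.1 (htop ▸ ENNReal.one_lt_top :
        1 < ⨆ j : ℕ, endDist 2 u Ω v p ε j x)
      refine tendsto_const_nhds.congr' ?_
      filter_upwards [eventually_ge_atTop j₀] with j hj
      rw [truncatedEndDist, min_eq_right
        (hj₀.le.trans (endDist_mono (by exact_mod_cast hj) x))]
      simp

end EndGrowth

/-! ### Bounded oscillation of the spherical integrals -/

section EndFlux

variable {k : ℕ} {u : USphere (2 * k + 2) → ℝ} {Ω : Set (USphere (2 * k + 2))}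
  {v q : USphere (2 * k + 2)} {p : EuclideanSpace ℝ (Fin (2 * k + 2))} {ε T : ℝ}

/-- The normalizing constant of the flux of an end. -/
noncomputable def fluxConst (k : ℕ) : ℝ :=
  (((2 * k + 2 - 2)‼ : ℕ) : ℝ) ^ 2 * (sphereMeasure (2 * k + 2)).real univ

theorem fluxConst_pos : 0 < fluxConst k := by
  have h1 := Nat.doubleFactorial_pos (2 * k + 2 - 2)
  have h2 := sphereMeasure_real_univ_pos (n := 2 * k + 2) (by omega)
  unfold fluxConst
  positivity

/-- The radial derivative is bounded for different reasons in the two cases: the curvature sign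
through the Riccati inequality if `k > 0`, integrability of the Laplacian if `k = 0`. -/
theorem sphereInt_osc_of_end (hε : ε = 1 ∨ ε = -1) {w : EuclideanSpace ℝ (Fin (2 * k + 2)) → ℝ}
    (hw : ∀ x ∈ shell (2 * k + 2) {t | T < ε * t}, ContDiffAt ℝ ∞ w x)
    (hf : IntegrableOn (negLap^[k + 1] w) (shell (2 * k + 2) {t | T < ε * t}))
    (hineq : ∀ x ∈ shell (2 * k + 2) {t | T < ε * t},
      2 * Δ w x + (((2 * k + 2 : ℕ) : ℝ) - 2) * ‖fderiv ℝ w x‖ ^ 2 ≤ 0)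
    {T' : ℝ} (hT' : T < T') (hT'0 : 0 < T') :
    ∃ C, ∀ s ≥ T', ∀ τ ∈ Icc (0 : ℝ) 1,
      |sphereInt w (ε * (s + τ)) - sphereInt w (ε * s)| ≤ C := by
  obtain ⟨M, hM⟩ : ∃ M, ∀ s ≥ T', |sphereInt (radialD w) (ε * s)| ≤ M := by
    rcases Nat.eq_zero_or_pos k with rfl | hk
    · refine sphereInt_radialD_bound_two hε hw ?_ hT'
      refine hf.neg.congr (ae_of_all _ fun x => ?_)
      simp [negLap]
    · exact (sphereInt_radialD_bound_of_two_lt (by omega) hε hw hineq hT' hT'0).1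
  have hM0 : 0 ≤ M := (abs_nonneg _).trans (hM T' le_rfl)
  refine ⟨M, fun s hs τ hτ => ?_⟩
  refine (sphereInt_osc_le hε hw hT' hM hs (show T' ≤ s + τ by linarith [hτ.1])).trans ?_
  rw [add_sub_cancel_left, abs_of_nonneg hτ.1]
  exact mul_le_of_le_one_right hM0 hτ.2

end EndFlux

/-! ### Curvatures in the chart from the north pole -/

section Curvature

variable {n : ℕ} {u : USphere n → ℝ}

theorem chartPole_stereoChart_symm (y : EuclideanSpace ℝ (Fin n)) :
    chartPole n ((stereoChart n (northPole n)).symm y) = northPole n := by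
  rw [chartPole, if_neg (stereoChart_symm_ne y)]

/-- In the conformal formula for the scalar curvature the exponential and `n - 1` are positive, so
the sign passes to the bracket. -/
theorem laplacian_add_le_of_scalarCurvature_nonneg (hn : 1 < n) {y : EuclideanSpace ℝ (Fin n)}
    (hw : ContDiffAt ℝ ∞ (flatFactor n u (northPole n)) y)
    (h : 0 ≤ scalarCurvature n u ((stereoChart n (northPole n)).symm y)) :
    2 * Δ (flatFactor n u (northPole n)) y +
      (n - 2) * ‖fderiv ℝ (flatFactor n u (northPole n)) y‖ ^ 2 ≤ 0 := by
  have hm : metricCoord n u (northPole n) = fun z =>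
      Real.exp (2 * flatFactor n u (northPole n) z) • (1 : Matrix (Fin n) (Fin n) ℝ) :=
    funext (metricCoord_eq n u _)
  rw [scalarCurvature, chartPole_stereoChart_symm, stereoChart_apply_symm, hm,
    scalarCurvatureCoord_conformal (hw.of_le two_le_infty), neg_nonneg] at h
  have hn' : (1 : ℝ) < n := by exact_mod_cast hn
  by_contra! hpos
  have := mul_pos (Real.exp_pos (-(2 * flatFactor n u (northPole n) y)))
    (mul_pos (sub_pos.2 hn') hpos)
  linarith

theorem qCurvature_stereoChart_symm (y : EuclideanSpace ℝ (Fin n)) :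
    qCurvature n u ((stereoChart n (northPole n)).symm y) =
      Real.exp (-(n * flatFactor n u (northPole n) y)) *
        negLap^[n / 2] (flatFactor n u (northPole n)) y := by
  rw [qCurvature, chartPole_stereoChart_symm, stereoChart_apply_symm]
  rfl

end Curvature

/-! ### Upper bounds for the flux of each type of end -/

section Flux

variable {k : ℕ} {u : USphere (2 * k + 2) → ℝ} {Ω : Set (USphere (2 * k + 2))}
  {p : EuclideanSpace ℝ (Fin (2 * k + 2))} {ε : ℝ}

/-- `a` is the flux of `w` through the end described by the cutoffs with parameter `T`. -/
def HasEndFlux (k : ℕ) (ε T : ℝ) (w : EuclideanSpace ℝ (Fin (2 * k + 2)) → ℝ) (a : ℝ) : Prop :=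
  (∀ L : ℝ, 1 ≤ L → Integrable fun x => w x * negLap^[k + 1] (endCutoff k ε T L) x) ∧
    Tendsto (fun L => cutoffPairing k ε T (centreValue ε) L w) atTop (𝓝 a)

theorem exists_forall_of_eventually_endFilter {n : ℕ} {P : EuclideanSpace ℝ (Fin n) → Prop}
    (h : ∀ᶠ y in endFilter n ε, P y) : ∃ T : ℝ, ∀ y, T < ε * Real.log ‖y‖ → P y := by
  obtain ⟨s, hs, hsub⟩ := mem_comap.1 h
  obtain ⟨T, hT⟩ := mem_atTop_sets.1 hs
  exact ⟨T, fun y hy => hsub (hT _ hy.le)⟩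

/-- The flux through a complete end with nonnegative scalar curvature. -/
theorem IsCompleteMetric.exists_hasEndFlux_le (hcomp : IsCompleteMetric (2 * k + 2) u Ω)
    {Λ : Finset (USphere (2 * k + 2))} (hΩ : Ω = (Λ : Set (USphere (2 * k + 2)))ᶜ)
    (hu : ContMDiffOn (𝓡 (2 * k + 2)) 𝓘(ℝ, ℝ) ∞ u Ω) (hε : ε = 1 ∨ ε = -1)
    {K : Set (USphere (2 * k + 2))} (hK : IsCompact K) (hKΩ : K ⊆ Ω)
    (hR : ∀ x ∈ Ω \ K, 0 ≤ scalarCurvature (2 * k + 2) u x)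
    (hf : Integrable (negLap^[k + 1] (flatFactor (2 * k + 2) u (northPole (2 * k + 2)))))
    {q : USphere (2 * k + 2)} (hq : q ∈ Λ)
    (hlim : Tendsto (centredParam (northPole (2 * k + 2)) p) (endFilter (2 * k + 2) ε) (𝓝 q))
    (hne : ∀ y ≠ 0, centredParam (northPole (2 * k + 2)) p y ≠ q) :
    ∃ T a, HasEndFlux k ε T (fun y => flatFactor (2 * k + 2) u (northPole (2 * k + 2)) (p + y)) a ∧
      a ≤ ε * fluxConst k ∧
      ∀ y ≠ 0, centredParam (northPole (2 * k + 2)) p y ∉ Ω → ε * Real.log ‖y‖ < T := by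
  have hn1 : 1 < 2 * k + 2 := by omega
  set N := northPole (2 * k + 2)
  set W := flatFactor (2 * k + 2) u N
  have hΩo : IsOpen Ω := by rw [hΩ]; exact Λ.finite_toSet.isClosed.isOpen_compl
  have hqΩ : q ∉ Ω := by rw [hΩ]; simpa using hq
  -- A neighbourhood of `q` avoiding the other punctures and the compact set off which the curvature
  -- is nonnegative.
  have hO : ((Λ : Set (USphere (2 * k + 2))) \ {q})ᶜ ∩ Kᶜ ∈ 𝓝 q :=
    inter_mem (((Λ.finite_toSet.subset sdiff_subset).isClosed.isOpen_compl).mem_nhds (by simp))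
      (hK.isClosed.isOpen_compl.mem_nhds fun h => hqΩ (hKΩ h))
  obtain ⟨T₁, hT₁⟩ := exists_forall_of_eventually_endFilter (hlim.eventually hO)
  set T₀ := max T₁ 0
  have hmem : ∀ y ∈ shell (2 * k + 2) {t | T₀ < ε * t},
      centredParam N p y ∈ Ω ∧ centredParam N p y ∉ K := by
    intro y hy
    have h := hT₁ y ((le_max_left _ _).trans_lt hy.2)
    refine ⟨?_, h.2⟩
    rw [hΩ]
    exact fun hmem => h.1 ⟨hmem, hne y hy.1⟩
  have hw : ∀ x ∈ shell (2 * k + 2) {t | T₀ < ε * t}, ContDiffAt ℝ ∞ (fun y => W (p + y)) x :=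
    fun x hx => (contDiffAt_flatFactor hΩo hu (hmem x hx).1).comp x (by fun_prop)
  have hineq : ∀ x ∈ shell (2 * k + 2) {t | T₀ < ε * t}, 2 * Δ (fun y => W (p + y)) x +
      (((2 * k + 2 : ℕ) : ℝ) - 2) * ‖fderiv ℝ (fun y => W (p + y)) x‖ ^ 2 ≤ 0 := by
    intro x hx
    have h1 := laplacian_add_le_of_scalarCurvature_nonneg hn1
      (contDiffAt_flatFactor hΩo hu (hmem x hx).1) (hR _ (hmem x hx))
    have h2 := laplacian_comp_sub W (-p) x
    simp only [sub_neg_eq_add, add_comm x] at h2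
    have h3 : (fun z => W (z + p)) = fun z => W (p + z) := by funext z; rw [add_comm]
    rw [h3] at h2
    rw [h2, fderiv_comp_add_left]
    exact h1
  have hfe : negLap^[k + 1] (fun y => W (p + y)) = fun y => negLap^[k + 1] W (p + y) := by
    funext x
    have h := negLap_iterate_comp_sub W (-p) x (k + 1)
    simp only [sub_neg_eq_add, add_comm _ p] at h
    exact h
  have hfp : Integrable (negLap^[k + 1] fun y => W (p + y)) := by
    rw [hfe]; exact hf.comp_add_left p
  have hT0 : T₀ < T₀ + 1 := lt_add_one _
  obtain ⟨C, hC⟩ := sphereInt_osc_of_end hε hw hfp.integrableOn hineq hT0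
    (by have : 0 ≤ T₀ := le_max_right _ _; linarith)
  obtain ⟨a, ha, hl⟩ := exists_tendsto_cutoffPairing hε hT0 hw hfp.integrableOn hC
  have hgrow := hcomp.end_growth hΩo hu (by omega) hε (fun y hy => (hmem y hy).1) hqΩ hlim hineq hl
  refine ⟨T₀ + 1, a, ⟨fun L hL => integrable_mul_negLap_iterate_endCutoff hε hT0 (by linarith)
    fun x hx => (hw x hx).continuousAt.continuousWithinAt, ha⟩, ?_, ?_⟩
  · have hc0 : (0 : ℝ) < (((2 * k + 2 - 2)‼ : ℕ) : ℝ) ^ 2 := by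
      have := Nat.doubleFactorial_pos (2 * k + 2 - 2)
      positivity
    rw [le_div_iff₀ hc0] at hgrow
    rw [fluxConst]
    linarith
  · intro y hy hyΩ
    by_contra! h
    exact hyΩ (hmem y ⟨hy, hT0.trans_le h⟩).1

/-- The quotient `4 r² / (r² + 4)` lies between 1 and 4 for `r ≥ 2`: the round metric decays like
`r⁻²` in the chart, the source of the coefficient 2 at a smooth north pole. -/
theorem abs_log_chart_factor_le {r : ℝ} (hr : 2 ≤ r) :
    |Real.log (4 / (r ^ 2 + 4)) + 2 * Real.log r| ≤ Real.log 4 := by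
  have hr0 : 0 < r := by linarith
  have e : Real.log (4 / (r ^ 2 + 4)) + 2 * Real.log r = Real.log (4 * r ^ 2 / (r ^ 2 + 4)) := by
    have h2 : 2 * Real.log r = Real.log (r ^ 2) := by rw [Real.log_pow]; norm_num
    rw [h2, ← Real.log_mul (by positivity) (by positivity)]
    congr 1; ring
  have h1 : 1 ≤ 4 * r ^ 2 / (r ^ 2 + 4) := by
    rw [le_div_iff₀ (by positivity)]; nlinarith
  have h2 : 4 * r ^ 2 / (r ^ 2 + 4) ≤ 4 := by
    rw [div_le_iff₀ (by positivity)]; nlinarith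
  rw [e, abs_of_nonneg (Real.log_nonneg h1)]
  exact Real.log_le_log (by linarith) h2

/-- The flux through infinity when the metric extends smoothly across the north pole. -/
theorem exists_hasEndFlux_of_mem (hΩ : IsOpen Ω)
    (hu : ContMDiffOn (𝓡 (2 * k + 2)) 𝓘(ℝ, ℝ) ∞ u Ω)
    (hf : Integrable (negLap^[k + 1] (flatFactor (2 * k + 2) u (northPole (2 * k + 2)))))
    (hN : northPole (2 * k + 2) ∈ Ω) :
    ∃ T a, HasEndFlux k 1 T (flatFactor (2 * k + 2) u (northPole (2 * k + 2))) a ∧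
      a ≤ 2 * fluxConst k ∧
      ∀ y ≠ 0, (stereoChart (2 * k + 2) (northPole (2 * k + 2))).symm y ∉ Ω →
        1 * Real.log ‖y‖ < T := by
  set N := northPole (2 * k + 2)
  set W := flatFactor (2 * k + 2) u N
  set S := (sphereMeasure (2 * k + 2)).real univ with hSdef
  have huN : ContinuousAt u N := (hu.continuousOn.continuousAt (hΩ.mem_nhds hN))
  have hev : ∀ᶠ x in 𝓝 N, x ∈ Ω ∧ |u x| < |u N| + 1 :=
    (hΩ.eventually_mem hN).and (huN.abs.eventually (gt_mem_nhds (lt_add_one _)))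
  have hlim : Tendsto (stereoChart (2 * k + 2) N).symm (endFilter (2 * k + 2) 1) (𝓝 N) :=
    tendsto_stereoChart_symm_cocompact.mono_left endFilter_one_le_cocompact
  obtain ⟨T₁, hT₁⟩ := exists_forall_of_eventually_endFilter (hlim.eventually hev)
  set T₀ := max T₁ 1
  have hT01 : 1 ≤ T₀ := le_max_right _ _
  have hmem : ∀ y ∈ shell (2 * k + 2) {t | T₀ < 1 * t},
      (stereoChart (2 * k + 2) N).symm y ∈ Ω ∧ |W y + 2 * Real.log ‖y‖| ≤ |u N| + 1 + Real.log 4 := by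
    intro y hy
    have hlog : T₀ < 1 * Real.log ‖y‖ := hy.2
    have h := hT₁ y ((le_max_left _ _).trans_lt hlog)
    refine ⟨h.1, ?_⟩
    have hy0 := norm_pos_iff.2 hy.1
    have h2 : 2 ≤ ‖y‖ := by
      have h3 := Real.log_le_sub_one_of_pos hy0
      linarith
    have e : W y + 2 * Real.log ‖y‖ = u ((stereoChart (2 * k + 2) N).symm y) +
        (Real.log (4 / (‖y‖ ^ 2 + 4)) + 2 * Real.log ‖y‖) := by
      simp only [W, flatFactor]; ring
    rw [e]
    exact (abs_add_le _ _).trans (add_le_add h.2.le (abs_log_chart_factor_le h2))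
  have hw : ∀ x ∈ shell (2 * k + 2) {t | T₀ < 1 * t}, ContDiffAt ℝ ∞ W x :=
    fun x hx => contDiffAt_flatFactor hΩ hu (hmem x hx).1
  have hwc : ContinuousOn W (shell (2 * k + 2) {t | T₀ < 1 * t}) := fun x hx =>
    (hw x hx).continuousAt.continuousWithinAt
  set C := |u N| + 1 + Real.log 4
  -- Across a smooth north pole `W = -2 log ‖y‖ + O(1)`, so no curvature hypothesis is needed for
  -- the oscillation bound or for the slope `-2 S`.
  have hb : ∀ t, T₀ < t → |sphereInt W t + 2 * t * S| ≤ C * S := by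
    intro t ht
    have ht' : t ∈ {t | T₀ < 1 * t} := by change T₀ < 1 * t; linarith
    have hi := integrable_comp_logPolar hwc ht'
    have e : sphereInt W t + 2 * t * S =
        ∫ θ, (W (logPolar (t, θ)) + 2 * t) ∂(sphereMeasure (2 * k + 2)) := by
      rw [integral_add hi (integrable_const _), integral_const, smul_eq_mul, ← hSdef, sphereInt]
      ring
    rw [e, ← Real.norm_eq_abs]
    refine (norm_integral_le_of_norm_le_const (ae_of_all _ fun θ => ?_))
    have h := (hmem _ ((logPolar_mem_shell (p := (t, θ))).2 ht')).2
    rwa [log_norm_logPolar] at h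
  have hT0 : T₀ < T₀ + 1 := lt_add_one _
  have hosc : ∀ s ≥ T₀ + 1, ∀ τ ∈ Icc (0 : ℝ) 1,
      |sphereInt W (1 * (s + τ)) - sphereInt W (1 * s)| ≤ 2 * (C * S) + 2 * S := by
    intro s hs τ hτ
    rw [one_mul, one_mul]
    have h1 := abs_le.1 (hb (s + τ) (by linarith [hτ.1]))
    have h2 := abs_le.1 (hb s (by linarith))
    have hS : 0 ≤ S := measureReal_nonneg
    have h3 : 0 ≤ S * τ := mul_nonneg hS hτ.1
    have h4 : S * τ ≤ S := mul_le_of_le_one_right hS hτ.2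
    rw [abs_le]
    constructor <;> nlinarith
  obtain ⟨a, ha, hl⟩ := exists_tendsto_cutoffPairing (Or.inl rfl) hT0 hw hf.integrableOn hosc
  refine ⟨T₀ + 1, a, ⟨fun L hL => integrable_mul_negLap_iterate_endCutoff (Or.inl rfl) hT0
    (by linarith) hwc, ha⟩, ?_, ?_⟩
  · have hl2 : Tendsto (fun s => sphereInt W (1 * s) / s) atTop (𝓝 (-(2 * S))) := by
      have h0 : Tendsto (fun s : ℝ => C * S / s) atTop (𝓝 0) :=
        tendsto_const_nhds.div_atTop tendsto_id
      rw [tendsto_iff_norm_sub_tendsto_zero]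
      refine squeeze_zero' (Eventually.of_forall fun s => norm_nonneg _) ?_ h0
      filter_upwards [eventually_gt_atTop T₀] with s hs
      have hs0 : 0 < s := by linarith
      have e : sphereInt W (1 * s) / s - -(2 * S) = (sphereInt W s + 2 * s * S) / s := by
        rw [one_mul]; field_simp; ring
      rw [e, norm_div, Real.norm_eq_abs, Real.norm_eq_abs, abs_of_pos hs0]
      exact div_le_div_of_nonneg_right (hb s hs) hs0.le
    have hc0 : (0 : ℝ) < (((2 * k + 2 - 2)‼ : ℕ) : ℝ) ^ 2 := by
      have := Nat.doubleFactorial_pos (2 * k + 2 - 2)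
      positivity
    have heq := tendsto_nhds_unique hl hl2
    rw [div_eq_iff hc0.ne'] at heq
    rw [fluxConst]
    linarith
  · intro y hy hyΩ
    by_contra! h
    exact hyΩ (hmem y ⟨hy, hT0.trans_le h⟩).1

end Flux

/-! ### The total integral as a sum of fluxes -/

section FluxIdentity

variable {k : ℕ}

theorem endCutoff_eventuallyEq_one_of_ne {ε T L : ℝ} (hL : 0 < L)
    {x : EuclideanSpace ℝ (Fin (2 * k + 2))} (hx : x ≠ 0) (h : ε * Real.log ‖x‖ < T) :
    ∀ᶠ y in 𝓝 x, endCutoff k ε T L y = 1 := by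
  have hc : ContinuousAt (fun y : EuclideanSpace ℝ (Fin (2 * k + 2)) => ε * Real.log ‖y‖) x :=
    continuousAt_const.mul (continuous_norm.continuousAt.log (norm_ne_zero_iff.2 hx))
  filter_upwards [hc.eventually (gt_mem_nhds h), isOpen_ne.mem_nhds hx] with y hy hy0
  rw [endCutoff, radialFn_of_ne hy0]
  exact cutoffProfile_eq_one hL.le hy.le

theorem endCutoff_eventuallyEq_centreValue {ε T L : ℝ} (hε : ε = 1 ∨ ε = -1) (hL : 0 < L) :
    ∀ᶠ y in 𝓝 (0 : EuclideanSpace ℝ (Fin (2 * k + 2))), endCutoff k ε T L y = centreValue ε := by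
  obtain ⟨a, ha⟩ := cutoffProfile_eq_centreValue hε (T := T) hL
  filter_upwards [Metric.ball_mem_nhds (0 : EuclideanSpace ℝ (Fin (2 * k + 2)))
    (Real.exp_pos a)] with z hz
  exact radialFn_eq_const ha (mem_ball_zero_iff.1 hz).le

/-- The total integral is the sum of the fluxes through the ends. -/
theorem integral_negLap_iterate_eq_sum_flux
    {W : EuclideanSpace ℝ (Fin (2 * k + 2)) → ℝ} {P : Finset (EuclideanSpace ℝ (Fin (2 * k + 2)))}
    (hW : ∀ x ∉ P, ContDiffAt ℝ ∞ W x) (hf : Integrable (negLap^[k + 1] W)) {T₀ a₀ : ℝ}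
    (hinf : HasEndFlux k 1 T₀ W a₀) (hPinf : ∀ p ∈ P, p ≠ 0 → 1 * Real.log ‖p‖ < T₀)
    {T a : EuclideanSpace ℝ (Fin (2 * k + 2)) → ℝ}
    (hflux : ∀ p ∈ P, HasEndFlux k (-1) (T p) (fun y => W (p + y)) (a p))
    (hPP : ∀ p ∈ P, ∀ p' ∈ P, p' ≠ p → -1 * Real.log ‖p' - p‖ < T p) :
    ∫ x, negLap^[k + 1] W x = a₀ + ∑ p ∈ P, a p := by
  have h1ε : (1 : ℝ) = 1 ∨ (1 : ℝ) = -1 := Or.inl rfl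
  have hmε : (-1 : ℝ) = 1 ∨ (-1 : ℝ) = -1 := Or.inr rfl
  have hc1 : centreValue 1 = 1 := by norm_num [centreValue]
  have hcm : centreValue (-1) = 0 := by norm_num [centreValue]
  set f := negLap^[k + 1] W
  -- Near a puncture its own term is `0 - 1`, the cutoff at infinity is 1 and the other terms are `1
  -- - 1`; near infinity every summand is 0. A sum instead of a product lets the operator act on
  -- each end separately.
  set η := fun (L : ℝ) x => endCutoff k 1 T₀ L x +
    ∑ p ∈ P, (endCutoff k (-1) (T p) L (x - p) - 1) with hη
  have hsm1 : ∀ {L : ℝ}, 0 < L → ∀ p, ContDiff ℝ ∞ fun x => endCutoff k (-1) (T p) L (x - p) :=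
    fun hL p => (contDiff_endCutoff hmε hL).comp (by fun_prop)
  have hsm : ∀ {L : ℝ}, 0 < L → ContDiff ℝ ∞ (η L) := fun hL =>
    (contDiff_endCutoff h1ε hL).add (ContDiff.sum fun p _ => (hsm1 hL p).sub contDiff_const)
  have hcs : ∀ {L : ℝ}, 0 < L → HasCompactSupport (η L) := by
    intro L hL
    have h1 := hasCompactSupport_endCutoff_sub (k := k) h1ε (T := T₀) hL
    rw [hc1, sub_self] at h1
    simp only [sub_zero] at h1
    have h2 : ∀ p ∈ P, HasCompactSupport fun x => endCutoff k (-1) (T p) L (x - p) - 1 := by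
      intro p _
      have h2 := hasCompactSupport_endCutoff_sub (k := k) hmε (T := T p) hL
      rw [hcm, sub_zero] at h2
      exact h2.comp_homeomorph (Homeomorph.subRight p)
    have h3 := HasCompactSupport.finset_sum h2
    rw [show (∑ p ∈ P, fun x => endCutoff k (-1) (T p) L (x - p) - 1) =
      fun x => ∑ p ∈ P, (endCutoff k (-1) (T p) L (x - p) - 1) from
        funext fun x => Finset.sum_apply x P _] at h3
    exact h1.add h3
  have hvan : ∀ {L : ℝ}, 0 < L → tsupport (η L) ⊆ ((P : Set (EuclideanSpace ℝ _))ᶜ) := by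
    intro L hL q hq hqP
    have hqP : q ∈ P := hqP
    refine notMem_tsupport_iff_eventuallyEq.2 ?_ hq
    have e1 : ∀ᶠ x in 𝓝 q, endCutoff k 1 T₀ L x = 1 := by
      by_cases hq0 : q = 0
      · rw [hq0]
        filter_upwards [endCutoff_eventuallyEq_centreValue h1ε hL] with x hx
        rw [hx, hc1]
      · exact endCutoff_eventuallyEq_one_of_ne hL hq0 (hPinf q hqP hq0)
    have e2 : ∀ᶠ x in 𝓝 q, ∀ p ∈ P,
        endCutoff k (-1) (T p) L (x - p) - 1 = if p = q then -1 else 0 := by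
      refine (Finset.eventually_all P).2 fun p hp => ?_
      have ht : Tendsto (fun x => x - p) (𝓝 q) (𝓝 (q - p)) := tendsto_id.sub_const p
      by_cases hpq : p = q
      · rw [if_pos hpq]
        rw [hpq, sub_self] at ht
        rw [hpq]
        filter_upwards [ht.eventually (endCutoff_eventuallyEq_centreValue hmε hL)] with x hx
        rw [hx, hcm]; ring
      · rw [if_neg hpq]
        filter_upwards [ht.eventually (endCutoff_eventuallyEq_one_of_ne hL
          (sub_ne_zero.2 (Ne.symm hpq)) (hPP p hp q hqP (Ne.symm hpq)))] with x hx
        rw [hx, sub_self]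
    filter_upwards [e1, e2] with x h1 h2
    simp only [hη]
    rw [h1, Finset.sum_congr rfl h2, Finset.sum_ite_eq' P q, if_pos hqP]
    simp
  have hibp : ∀ {L : ℝ}, 1 ≤ L → ∫ x, f x * η L x = cutoffPairing k 1 T₀ (centreValue 1) L W +
      ∑ p ∈ P, cutoffPairing k (-1) (T p) (centreValue (-1)) L fun y => W (p + y) := by
    intro L hL
    have hL0 : 0 < L := by linarith
    have h1 := integral_negLap_iterate_mul_of_tsupport
      (P.finite_toSet.isClosed.isOpen_compl) (fun x hx => hW x hx) (hsm hL0) (hcs hL0)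
      (hvan hL0) (k + 1)
    have h2 : ∀ x, W x * negLap^[k + 1] (η L) x =
        W x * negLap^[k + 1] (endCutoff k 1 T₀ L) x +
          ∑ p ∈ P, W x * negLap^[k + 1] (endCutoff k (-1) (T p) L) (x - p) := by
      intro x
      simp only [hη]
      rw [negLap_iterate_add (contDiff_endCutoff h1ε hL0)
        (ContDiff.sum fun p _ => (hsm1 hL0 p).sub contDiff_const),
        negLap_iterate_sum P fun p _ => (hsm1 hL0 p).sub contDiff_const, mul_add, Finset.mul_sum]
      congr 1
      refine Finset.sum_congr rfl fun p _ => ?_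
      rw [negLap_iterate_succ_sub_const (hsm1 hL0 p), negLap_iterate_comp_sub]
    have h3 : ∀ p ∈ P, Integrable fun x =>
        W x * negLap^[k + 1] (endCutoff k (-1) (T p) L) (x - p) := by
      intro p hp
      have h := ((hflux p hp).1 L hL).comp_sub_right p
      simpa only [add_sub_cancel] using h
    rw [h1, integral_congr_ae (ae_of_all _ h2), integral_add (hinf.1 L hL)
      (integrable_finsetSum P h3), integral_finsetSum P h3]
    congr 1
    refine Finset.sum_congr rfl fun p _ => ?_
    rw [← integral_add_left_eq_self _ p]
    simp only [add_sub_cancel_left]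
    rfl
  have hlim1 : Tendsto (fun L => ∫ x, f x * η L x) atTop (𝓝 (a₀ + ∑ p ∈ P, a p)) := by
    refine (hinf.2.add (tendsto_finsetSum P fun p hp => (hflux p hp).2)).congr' ?_
    filter_upwards [eventually_ge_atTop 1] with L hL using (hibp hL).symm
  -- Each cutoff is bounded by 2, so the punctures contribute at most `2 + 1` each; pointwise every
  -- cutoff tends to 1 off the punctures and the origin.
  have hlim2 : Tendsto (fun L => ∫ x, f x * η L x) atTop (𝓝 (∫ x, f x * 1)) := by
    refine tendsto_integral_filter_of_dominated_convergence
      (fun x => |f x| * (2 + P.card * 3)) ?_ ?_ (hf.abs.mul_const _) ?_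
    · filter_upwards [eventually_gt_atTop 0] with L hL
      exact hf.aestronglyMeasurable.mul (hsm hL).continuous.aestronglyMeasurable
    · filter_upwards [eventually_ge_atTop 1] with L hL
      refine ae_of_all _ fun x => ?_
      rw [norm_mul, Real.norm_eq_abs, Real.norm_eq_abs]
      refine mul_le_mul_of_nonneg_left ?_ (abs_nonneg _)
      refine (abs_add_le _ _).trans (add_le_add (abs_endCutoff_le h1ε hL x) ?_)
      refine (Finset.abs_sum_le_sum_abs _ _).trans ?_
      rw [← nsmul_eq_mul]
      refine Finset.sum_le_card_nsmul _ _ _ fun p _ => ?_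
      have h1 := abs_endCutoff_le (k := k) (T := T p) hmε hL (x - p)
      have h2 := abs_sub (endCutoff k (-1) (T p) L (x - p)) 1
      rw [abs_one] at h2
      linarith
    · have hnull : ∀ᵐ x : EuclideanSpace ℝ (Fin (2 * k + 2)), x ∉ insert 0 P :=
        measure_eq_zero_iff_ae_notMem.1 ((Finset.finite_toSet (insert 0 P)).measure_zero volume)
      filter_upwards [hnull] with x hx
      rw [Finset.mem_insert, not_or] at hx
      refine Tendsto.const_mul _ ?_
      have h1 := (tendsto_endCutoff (ε := 1) T₀ hx.1).add (tendsto_finsetSum P fun p hp =>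
        (tendsto_endCutoff (ε := -1) (T p)
          (sub_ne_zero.2 fun h => hx.2 (h ▸ hp) : x - p ≠ 0)).sub_const 1)
      simpa only [sub_self, Finset.sum_const_zero, add_zero] using h1
  have := tendsto_nhds_unique hlim2 hlim1
  simpa using this

end FluxIdentity

/-! ### Total `Q`-curvature in the stereographic chart -/

section Transfer

variable {n : ℕ} {u : USphere n → ℝ} {Ω : Set (USphere n)}

theorem sqrt_det_metricCoord (v : USphere n) (y : EuclideanSpace ℝ (Fin n)) :
    Real.sqrt (metricCoord n u v y).det = Real.exp (n * flatFactor n u v y) := by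
  rw [metricCoord_eq, Matrix.det_smul, Matrix.det_one, mul_one, Fintype.card_fin, ← Real.exp_nat_mul,
    Real.sqrt_eq_iff_mul_self_eq_of_pos (Real.exp_pos _), ← Real.exp_add]
  congr 1; ring

theorem measurableEmbedding_stereoChart_symm (v : USphere n) :
    MeasurableEmbedding (stereoChart n v).symm :=
  continuous_stereoChart_symm.measurableEmbedding injective_stereoChart_symm

/-- The total `Q`-curvature in the stereographic chart. -/
theorem integrableOn_qCurvature_iff_and_integral_eq (hn : 0 < n) {Λ : Finset (USphere n)}
    (hΩ : Ω = (Λ : Set (USphere n))ᶜ) (hu : ContinuousOn u Ω) :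
    (IntegrableOn (qCurvature n u) Ω (volumeMeasure n u) ↔
      Integrable (negLap^[n / 2] (flatFactor n u (northPole n)))) ∧
    ∫ x in Ω, qCurvature n u x ∂(volumeMeasure n u) =
      ∫ y, negLap^[n / 2] (flatFactor n u (northPole n)) y := by
  have : Nonempty (Fin n) := ⟨⟨0, hn⟩⟩
  set W := flatFactor n u (northPole n)
  set σ := (stereoChart n (northPole n)).symm
  have hemb : MeasurableEmbedding σ := measurableEmbedding_stereoChart_symm _
  have hfin : (σ ⁻¹' (Λ : Set (USphere n))).Finite :=
    Λ.finite_toSet.preimage injective_stereoChart_symm.injOn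
  have hnull : ∀ᵐ y, y ∈ σ ⁻¹' Ω := by
    rw [hΩ]
    have h := hfin.measure_zero (volume : Measure (EuclideanSpace ℝ (Fin n)))
    filter_upwards [measure_eq_zero_iff_ae_notMem.1 h] with y hy using hy
  have hWc : ContinuousOn W (σ ⁻¹' Ω) := by
    refine (hu.comp continuous_stereoChart_symm.continuousOn fun y hy => hy).add
      (Continuous.continuousOn (Continuous.log (by fun_prop (disch := intro; positivity))
        fun y => by positivity))
  have hopen : IsOpen (σ ⁻¹' Ω) := by
    rw [hΩ]; exact (Λ.finite_toSet.isClosed.isOpen_compl).preimage continuous_stereoChart_symm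
  have hWm : AEMeasurable W := by
    have h := hWc.aemeasurable (μ := volume) hopen.measurableSet
    rwa [Measure.restrict_eq_self_of_ae_mem hnull] at h
  set D := fun y => ENNReal.ofReal (Real.sqrt (metricCoord n u (northPole n) y).det) with hD
  have hDe : D = fun y => ENNReal.ofReal (Real.exp (n * W y)) := by
    funext y; simp only [hD, sqrt_det_metricCoord, W]
  have hDm : AEMeasurable D := by
    rw [hDe]; exact (Real.measurable_exp.comp_aemeasurable (hWm.const_mul _)).ennreal_ofReal
  have hDt : ∀ᵐ y, D y < ⊤ := ae_of_all _ fun y => ENNReal.ofReal_lt_top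
  have hres : (volume.withDensity D).restrict (σ ⁻¹' Ω) = volume.withDensity D :=
    Measure.restrict_eq_self_of_ae_mem ((withDensity_absolutelyContinuous _ _).ae_le hnull)
  -- The volume density `e^{nW}` cancels the factor `e^{-nW}` of the `Q`-curvature.
  have hpt : ∀ y, (D y).toReal • qCurvature n u (σ y) = negLap^[n / 2] W y := by
    intro y
    rw [hDe, ENNReal.toReal_ofReal (Real.exp_pos _).le, qCurvature_stereoChart_symm, smul_eq_mul,
      ← mul_assoc, ← Real.exp_add, add_neg_cancel, Real.exp_zero, one_mul]
  constructor
  · rw [volumeMeasure, IntegrableOn, hemb.restrict_map, hemb.integrable_map_iff, hres,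
      integrable_withDensity_iff_integrable_smul₀' hDm hDt]
    simp only [Function.comp, hpt]
  · rw [volumeMeasure, hemb.setIntegral_map, hres,
      integral_withDensity_eq_integral_toReal_smul₀ hDm hDt]
    simp only [hpt]

end Transfer

/-! ### Summation over the ends -/

/-- The total `Q`-curvature inequality in dimension `2k + 2`. -/
theorem gaussBonnetConst_mul_integral_qCurvature_le {k : ℕ} {Λ : Finset (USphere (2 * k + 2))}
    {Ω : Set (USphere (2 * k + 2))} (hΩ : Ω = (Λ : Set (USphere (2 * k + 2)))ᶜ)
    {u : USphere (2 * k + 2) → ℝ} (hu : ContMDiffOn (𝓡 (2 * k + 2)) 𝓘(ℝ, ℝ) ∞ u Ω)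
    (hcomp : IsCompleteMetric (2 * k + 2) u Ω)
    {K : Set (USphere (2 * k + 2))} (hK : IsCompact K) (hKΩ : K ⊆ Ω)
    (hR : ∀ x ∈ Ω \ K, 0 ≤ scalarCurvature (2 * k + 2) u x)
    (hint : IntegrableOn (qCurvature (2 * k + 2) u) Ω (volumeMeasure (2 * k + 2) u)) :
    gaussBonnetConst (2 * k + 2) *
      ∫ x in Ω, qCurvature (2 * k + 2) u x ∂(volumeMeasure (2 * k + 2) u) ≤ 2 - (Λ.card : ℝ) := by
  classical
  have hn2 : (2 * k + 2) / 2 = k + 1 := by omega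
  obtain ⟨h1, h2⟩ := integrableOn_qCurvature_iff_and_integral_eq (n := 2 * k + 2) (by omega) hΩ
    hu.continuousOn
  rw [hn2] at h1 h2
  have hf := h1.1 hint
  rw [h2]
  set N := northPole (2 * k + 2)
  set W := flatFactor (2 * k + 2) u N
  set σ := (stereoChart (2 * k + 2) N).symm with hσ
  have hΩo : IsOpen Ω := by rw [hΩ]; exact Λ.finite_toSet.isClosed.isOpen_compl
  -- The finite punctures; the north pole, if removed, is the end at infinity.
  set P := (Λ.erase N).image (stereoChart (2 * k + 2) N) with hP
  have hmemP : ∀ y, y ∈ P ↔ σ y ∈ Λ := by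
    intro y
    rw [hP, Finset.mem_image]
    constructor
    · rintro ⟨x, hx, rfl⟩
      rw [Finset.mem_erase] at hx
      rw [hσ, stereoChart_symm_apply hx.1]
      exact hx.2
    · intro hy
      exact ⟨σ y, Finset.mem_erase.2 ⟨stereoChart_symm_ne y, hy⟩, stereoChart_apply_symm y⟩
  have hcardP : P.card = (Λ.erase N).card := by
    refine Finset.card_image_of_injOn fun x hx y hy hxy => ?_
    have hx' := (Finset.mem_erase.1 hx).1
    have hy' := (Finset.mem_erase.1 hy).1
    rw [← stereoChart_symm_apply hx', hxy, stereoChart_symm_apply hy']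
  have hnotΩ : ∀ y ∈ P, σ y ∉ Ω := fun y hy => by rw [hΩ]; simpa using (hmemP y).1 hy
  have hW : ∀ x ∉ P, ContDiffAt ℝ ∞ W x := fun x hx => contDiffAt_flatFactor hΩo hu (by
    rw [hΩ]; exact fun h => hx ((hmemP x).2 h))
  have hends : ∀ p : EuclideanSpace ℝ (Fin (2 * k + 2)), ∃ T a, p ∈ P →
      HasEndFlux k (-1) T (fun y => W (p + y)) a ∧ a ≤ -1 * fluxConst k ∧
      ∀ y ≠ 0, centredParam N p y ∉ Ω → -1 * Real.log ‖y‖ < T := by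
    intro p
    by_cases hp : p ∈ P
    · obtain ⟨T, a, h⟩ := hcomp.exists_hasEndFlux_le hΩ hu (Or.inr rfl) hK hKΩ hR hf
        ((hmemP p).1 hp) tendsto_centredParam_endFilter_neg_one (fun y hy he => hy (by
          have := injective_stereoChart_symm he
          simpa using this))
      exact ⟨T, a, fun _ => h⟩
    · exact ⟨0, 0, fun h => absurd h hp⟩
  choose T a hTa using hends
  -- The normalized bound `b` at infinity is 1 if the north pole is a puncture and 2 otherwise. In
  -- the first case `P` has one element fewer than `Λ`, so `b - P.card` is the same in both.
  obtain ⟨T₀, a₀, b, hinf, hb, hT₀, hbk⟩ : ∃ T₀ a₀ b : ℝ, HasEndFlux k 1 T₀ W a₀ ∧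
      a₀ ≤ b * fluxConst k ∧ (∀ y ≠ 0, σ y ∉ Ω → 1 * Real.log ‖y‖ < T₀) ∧
      b - P.card = 2 - (Λ.card : ℝ) := by
    by_cases hN : N ∈ Λ
    · obtain ⟨T', a', h⟩ := hcomp.exists_hasEndFlux_le (p := 0) hΩ hu (Or.inl rfl) hK hKΩ hR hf hN
        tendsto_centredParam_endFilter_one (fun y _ => stereoChart_symm_ne _)
      simp only [zero_add, centredParam] at h
      refine ⟨T', a', 1, h.1, h.2.1, h.2.2, ?_⟩
      rw [hcardP, ← Finset.card_erase_add_one hN]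
      push_cast; ring
    · obtain ⟨T', a', h⟩ := exists_hasEndFlux_of_mem hΩo hu hf (by rw [hΩ]; exact hN)
      refine ⟨T', a', 2, h.1, h.2.1, h.2.2, ?_⟩
      rw [hcardP, Finset.erase_eq_of_notMem hN]
  have hsum := integral_negLap_iterate_eq_sum_flux hW hf hinf
    (fun p hp hp0 => hT₀ p hp0 (hnotΩ p hp)) (fun p hp => (hTa p hp).1)
    (fun p hp p' hp' hne => (hTa p hp).2.2 (p' - p) (sub_ne_zero.2 hne) (by
      rw [centredParam, add_sub_cancel]; exact hnotΩ p' hp'))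
  have hle : ∑ p ∈ P, a p ≤ -(P.card * fluxConst k) := by
    refine (Finset.sum_le_card_nsmul P a _ fun p hp => (hTa p hp).2.1).trans (le_of_eq ?_)
    rw [nsmul_eq_mul]; ring
  have hG : gaussBonnetConst (2 * k + 2) = 1 / fluxConst k := rfl
  rw [hG, hsum, one_div, inv_mul_le_iff₀ fluxConst_pos, ← hbk]
  linarith

theorem mainTheorem6 (n : ℕ) (hn : Even n) (hn0 : 0 < n)
    (Λ : Finset (USphere n)) (Ω : Set (USphere n)) (hΩ : Ω = (Λ : Set (USphere n))ᶜ)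
    (u : USphere n → ℝ)
    (hu : ContMDiffOn (𝓡 n) 𝓘(ℝ, ℝ) ∞ u Ω)
    (hA1 : IsCompleteMetric n u Ω)
    (hA2 : ∃ K : Set (USphere n), IsCompact K ∧ K ⊆ Ω ∧
      ∀ x ∈ Ω \ K, 0 ≤ scalarCurvature n u x)
    (hA3 : IntegrableOn (qCurvature n u) Ω (volumeMeasure n u)) :
    gaussBonnetConst n * ∫ x in Ω, qCurvature n u x ∂(volumeMeasure n u) ≤
      2 - (Λ.card : ℝ) := by
  obtain ⟨m, rfl⟩ := hn
  -- Positivity rules out `m = 0`, so the natural subtraction in `m - 1` is genuine.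
  obtain ⟨k, hk⟩ : ∃ k, m + m = 2 * k + 2 := ⟨m - 1, by omega⟩
  obtain ⟨K, hK, hKΩ, hR⟩ := hA2
  generalize m + m = n at *
  subst hk
  exact gaussBonnetConst_mul_integral_qCurvature_le hΩ hu hA1 hK hKΩ hR hA3
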